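/- Notation. Points of $\mathbb R^{2d}$ are $z=(z_1,z_2)$; $\pi(z)f(t)=e^{2\pi i z_2\cdot t}f(t-z_1)$; $V_gf(z)=\langle f,\pi(z)g\rangle$, where $g$ is the $L^2$-normalized Gaussian and brackets are conjugate-linear in the second slot. An \emph{admissible weight} $v$ on $\mathbb R^{2d}$ is a continuous nonnegative function, even in each coordinate, with $v(0)=1$, $v(w+z)\le v(w)v(z)$ and $\lim_{n\to\infty} v(nz)^{1/n}=1$ for all $z$. For a weight $m$, $M^1_m(\mathbb R^d)=\{f\in L^2: V_gf\in L^1(m\,dz)\}$, $W(\mathcal FL^\infty,L^1_m)(\mathbb R^{2d})=\{\sigma\in\mathcal S'(\mathbb R^{2d}):\int\sup_y|V_g\sigma(x,y)|\,m(x)\,dx<\infty\}$, and $H\in L^1_v$ means $\int|H|v<\infty$. Let $$W_\tau(f,h)(x,\omega)=\int e^{-2\pi i y\cdot\omega}f(x+\tau y)\overline{h(x-(1-\tau)y)}\,dy,\qquad \langle \mathrm{Op}_\tau(\sigma)f,h\rangle=\langle\sigma,W_\tau(h,f)\rangle ,$$ where $\langle\sigma,\Psi\rangle$ is the duality of $M^\infty_{1/m}(\mathbb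 R^{2d})$ and $M^1_{m}(\mathbb R^{2d})$ for a weight $m=(1+|\cdot|)^N$, $N\ge 0$; the bracket is called defined if $\sigma\in M^\infty_{1/m}$ and $\Psi\in M^1_m$ for some such $N$ (always so when $\Psi$ is a Schwartz function), and each bound below includes that the bracket is defined. Finally put $$\mathcal B_\tau z=\Big(\tfrac{z_1}{1-\tau},\tfrac{z_2}{\tau}\Big),\quad \mathcal U_\tau z=-\Big(\tfrac{\tau}{1-\tau}z_1,\tfrac{1-\tau}{\tau}z_2\Big),\quad \mathcal D_\tau z=((1-\tau)z_1,\tau z_2),\quad \mathcal T_\tau(w,z)=\mathcal D_\tau w+\mathcal D_{1-\tau}z .$$ Theorem. Let $v$ be an admissible weight on $\mathbb R^{2d}$, $\varphi\in M^1_v(\mathbb R^d)\setminus\{0\}$ and $\sigma\in\mathcal S'(\mathbb R^{2d})$. (a) Let $\tau\in(0,1)$ and let also $\varphi\in M^1_{v\circ\mathcal U_\tau}$ (automatic if $\tau=1/2$, or if $v\circ\mathcal U_\tau\le Cv$, e.g. $v(z)=(1+|z|^2)^{s/2}$ with $s\ge0$). Then $\sigma\in W(\mathcal FL^\infty,L^1_{v\circ\mathcal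 B_\tau})(\mathbb R^{2d})$ if and only if there is $H_\tau\in L^1_v(\mathbb R^{2d})$ with $$|\langle \mathrm{Op}_\tau(\sigma)\pi(z)\varphi,\pi(w)\varphi\rangle|\le H_\tau(w-\mathcal U_\tau z)\qquad\text{for all } w,z\in\mathbb R^{2d}.$$ (b) Let $\tau\in[0,1]$ and let also $\varphi\in M^1_{v\circ\mathcal D_\tau}\cap M^1_{v\circ\mathcal D_{1-\tau}}$ (automatic if $v$ is nondecreasing in each $|z_j|$). Then $\sigma\in W(\mathcal FL^\infty,L^1_{v})(\mathbb R^{2d})$ if and only if there is $H_\tau\in L^1_v(\mathbb R^{2d})$ with $$|\langle \mathrm{Op}_\tau(\sigma)\pi(z)\varphi,\pi(w)\varphi\rangle|\le H_\tau(\mathcal T_\tau(w,z))\qquad\text{for all } w,z\in\mathbb R^{2d}.$$ (c) Let $\tau=1/2$ and let $\Lambda\subset\mathbb R^{2d}$ be a lattice such that $\{\pi(\lambda)\varphi:\lambda\in\Lambda\}$ is a Gabor frame for $L^2(\mathbb R^d)$. Then $\sigma\in W(\mathcal FL^\infty,L^1_{v\circ\mathcal B_{1/2}})(\mathbb R^{2d})$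 if and only if there is $h\in\ell^1_v(\Lambda)$ with $$|\langle \mathrm{Op}_{1/2}(\sigma)\pi(\mu)\varphi,\pi(\lambda)\varphi\rangle|\le h(\lambda+\mu)\qquad\text{for all }\lambda,\mu\in\Lambda.$$ -/

import Mathlib

open MeasureTheory Filter Topology
open scoped SchwartzMap ENNReal NNReal ComplexConjugate

noncomputable section

namespace TauPDO

section Window

variable {V : Type*} [NormedAddCommGroup V] [InnerProductSpace ℝ V]

theorem gaussian_contDiff : ContDiff ℝ ((⊤ : ℕ∞) : WithTop ℕ∞) (fun t : V => Real.exp (-Real.pi * ‖t‖ ^ 2)) :=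
  Real.contDiff_exp.comp (contDiff_const.mul (contDiff_norm_sq ℝ))

theorem pow_mul_exp_neg_le (m : ℕ) :
    ∃ C : ℝ, ∀ r : ℝ, 0 ≤ r → (1 + r) ^ m * Real.exp (-Real.pi * r ^ 2) ≤ C := by
  refine ⟨(m.factorial : ℝ) * Real.exp 2, fun r hr => ?_⟩
  have h1 : (1 + r) ^ m / (m.factorial : ℝ) ≤ Real.exp (1 + r) :=
    Real.pow_div_factorial_le_exp (1 + r) (by linarith) m
  have hm : (0 : ℝ) < (m.factorial : ℝ) := by exact_mod_cast Nat.factorial_pos m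
  have h2 : (1 + r) ^ m ≤ (m.factorial : ℝ) * Real.exp (1 + r) := by
    rw [div_le_iff₀ hm] at h1
    linarith
  have h3 : Real.exp (1 + r) * Real.exp (-Real.pi * r ^ 2) ≤ Real.exp 2 := by
    rw [← Real.exp_add]
    apply Real.exp_le_exp.mpr
    nlinarith [Real.pi_gt_three, sq_nonneg (r - 1), sq_nonneg r]
  calc (1 + r) ^ m * Real.exp (-Real.pi * r ^ 2)
      ≤ ((m.factorial : ℝ) * Real.exp (1 + r)) * Real.exp (-Real.pi * r ^ 2) := by gcongr
    _ = (m.factorial : ℝ) * (Real.exp (1 + r) * Real.exp (-Real.pi * r ^ 2)) := by ring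
    _ ≤ (m.factorial : ℝ) * Real.exp 2 := by gcongr

theorem gaussian_decay (k n : ℕ) : ∃ C : ℝ, ∀ x : V,
    ‖x‖ ^ k * ‖iteratedFDeriv ℝ n (fun t : V => Real.exp (-Real.pi * ‖t‖ ^ 2)) x‖ ≤ C := by
  have hf : (fun t : V => -Real.pi * ‖t‖ ^ 2).HasTemperateGrowth :=
    (Function.HasTemperateGrowth.const (-Real.pi)).mul
      (Function.hasTemperateGrowth_norm_sq V)
  obtain ⟨l, K, hK, hb⟩ := hf.norm_iteratedFDeriv_le_uniform n
  obtain ⟨C, hC⟩ := pow_mul_exp_neg_le (k + l * n)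
  refine ⟨(n.factorial : ℝ) * (1 + K) ^ n * C, fun x => ?_⟩
  have hx : (1 : ℝ) ≤ (1 + ‖x‖) ^ l := one_le_pow₀ (by linarith [norm_nonneg x])
  have key := norm_iteratedFDeriv_comp_le (𝕜 := ℝ) (g := Real.exp)
    (f := fun t : V => -Real.pi * ‖t‖ ^ 2) (n := n) (N := ((⊤ : ℕ∞) : WithTop ℕ∞))
    Real.contDiff_exp hf.1 (by exact_mod_cast le_top) x
    (C := Real.exp (-Real.pi * ‖x‖ ^ 2)) (D := (1 + K) * (1 + ‖x‖) ^ l)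
    (fun i _ => by
      rw [norm_iteratedFDeriv_eq_norm_iteratedDeriv, iteratedDeriv_eq_iterate,
        Real.iter_deriv_exp, Real.norm_of_nonneg (Real.exp_pos _).le])
    (fun i h1 hi => by
      calc ‖iteratedFDeriv ℝ i (fun t : V => -Real.pi * ‖t‖ ^ 2) x‖
          ≤ K * (1 + ‖x‖) ^ l := hb i hi x
        _ ≤ (1 + K) * (1 + ‖x‖) ^ l := by gcongr; linarith
        _ ≤ ((1 + K) * (1 + ‖x‖) ^ l) ^ i :=
          le_self_pow₀ (by nlinarith) (by omega))
  have hcomp : (Real.exp ∘ fun t : V => -Real.pi * ‖t‖ ^ 2) =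
      fun t : V => Real.exp (-Real.pi * ‖t‖ ^ 2) := rfl
  rw [hcomp] at key
  calc ‖x‖ ^ k * ‖iteratedFDeriv ℝ n (fun t : V => Real.exp (-Real.pi * ‖t‖ ^ 2)) x‖
      ≤ (1 + ‖x‖) ^ k *
        ((n.factorial : ℝ) * Real.exp (-Real.pi * ‖x‖ ^ 2) * ((1 + K) * (1 + ‖x‖) ^ l) ^ n) := by
        gcongr
        linarith
    _ = (n.factorial : ℝ) * (1 + K) ^ n *
        ((1 + ‖x‖) ^ (k + l * n) * Real.exp (-Real.pi * ‖x‖ ^ 2)) := by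
        rw [mul_pow, pow_add, pow_mul]; ring
    _ ≤ (n.factorial : ℝ) * (1 + K) ^ n * C := by
        gcongr
        exact hC _ (norm_nonneg x)

variable (V) in
/-- The Gaussian `2^{n/4} e^{-π |t|²}` on an `n`-dimensional Euclidean space `V`
(of `L²`-norm one), as a Schwartz function. -/
def gaussian : 𝓢(V, ℂ) :=
  ((2 : ℝ) ^ ((Module.finrank ℝ V : ℝ) / 4)) •
    SchwartzMap.postcompCLM Complex.ofRealCLM
      { toFun := fun t : V => Real.exp (-Real.pi * ‖t‖ ^ 2)
        smooth' := gaussian_contDiff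
        decay' := gaussian_decay }

theorem gaussian_apply (t : V) : gaussian V t =
    (((2 : ℝ) ^ ((Module.finrank ℝ V : ℝ) / 4) * Real.exp (-Real.pi * ‖t‖ ^ 2) : ℝ) : ℂ) := by
  rw [Complex.ofReal_mul, ← Complex.real_smul]
  rfl

/-- The character `t ↦ e^{2π i ξ·t}`. -/
def character (ξ t : V) : ℂ := Complex.exp (2 * Real.pi * Complex.I * (inner ℝ ξ t : ℝ))

theorem exp_mul_I_hasTemperateGrowth :
    (fun s : ℝ => Complex.exp (Complex.I * (s : ℂ))).HasTemperateGrowth := by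
  have hd : ∀ n : ℕ, iteratedDeriv n (fun s : ℝ => Complex.exp (Complex.I * (s : ℂ))) =
      fun s : ℝ => Complex.I ^ n * Complex.exp (Complex.I * (s : ℂ)) := by
    intro n
    induction n with
    | zero => simp
    | succ n ih =>
      rw [iteratedDeriv_succ, ih]
      funext s
      have h := (((Complex.ofRealCLM.hasDerivAt (x := s)).const_mul Complex.I).cexp).const_mul
        (Complex.I ^ n)
      simp only [Complex.ofRealCLM_apply] at h
      rw [h.deriv, pow_succ]
      simp
      ring
  refine ⟨Complex.contDiff_exp.comp (contDiff_const.mul Complex.ofRealCLM.contDiff),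
    fun n => ⟨0, 1, fun s => ?_⟩⟩
  rw [norm_iteratedFDeriv_eq_norm_iteratedDeriv, hd n]
  simp [Complex.norm_exp]

theorem character_hasTemperateGrowth (ξ : V) : (character ξ).HasTemperateGrowth := by
  have h : character ξ =
      (fun s : ℝ => Complex.exp (Complex.I * (s : ℂ))) ∘
        (fun t : V => inner ℝ ((2 * Real.pi) • ξ) t) := by
    funext t
    simp only [character, Function.comp_apply, real_inner_smul_left]
    push_cast
    ring_nf
  rw [h]
  exact exp_mul_I_hasTemperateGrowth.comp (Function.hasTemperateGrowth_inner_right _)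

/-- The complex conjugate of `π(x, ξ) g`, where `g` is the (real-valued) Gaussian:
`t ↦ e^{-2π i ξ·t} g(t - x)`, a Schwartz function. -/
def conjGaussianShift (x ξ : V) : 𝓢(V, ℂ) :=
  SchwartzMap.smulLeftCLM ℂ (character (-ξ))
    (SchwartzMap.compSubConstCLM ℂ x (gaussian V))

theorem conjGaussianShift_apply (x ξ t : V) :
    conjGaussianShift x ξ t = character (-ξ) t * gaussian V (t - x) := by
  simp [conjGaussianShift,
    SchwartzMap.smulLeftCLM_apply_apply (character_hasTemperateGrowth (-ξ))]

/-- Phase-space shift `π(x, ξ) f (t) = e^{2π i ξ·t} f(t - x)`. -/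
def shift (x ξ : V) (f : V → ℂ) (t : V) : ℂ := character ξ t * f (t - x)

/-- Short-time Fourier transform of a tempered distribution with Gaussian window:
`V_g σ (x, ξ) = ⟨σ, π(x, ξ) g⟩`, with brackets conjugate-linear in the second slot. -/
def distSTFT (σ : 𝓢'(V, ℂ)) (x ξ : V) : ℂ := σ (conjGaussianShift x ξ)

/-- The space `W(𝓕L^∞, L¹_m)` of tempered distributions `σ` with
`∫ sup_ξ |V_g σ (x, ξ)| m(x) dx < ∞`. -/
def MemAmalgam [FiniteDimensional ℝ V] [MeasurableSpace V] [BorelSpace V]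
    (m : V → ℝ) (σ : 𝓢'(V, ℂ)) : Prop :=
  ∫⁻ x : V, (⨆ ξ : V, ‖distSTFT σ x ξ‖ₑ) * ENNReal.ofReal (m x) < ∞

/-- `σ ∈ M^∞` with weight `(1 + |x| + |ξ|)^{-N}`. -/
def MemModInfty (N : ℕ) (σ : 𝓢'(V, ℂ)) : Prop :=
  ∃ C : ℝ, ∀ x ξ : V, ‖distSTFT σ x ξ‖ ≤ C * (1 + ‖x‖ + ‖ξ‖) ^ N

variable [FiniteDimensional ℝ V] [MeasurableSpace V] [BorelSpace V]

/-- Short-time Fourier transform of a function, `V_g f (x, ξ) = ∫ f(t) conj(π(x, ξ) g (t)) dt`. -/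
def stft (g f : V → ℂ) (x ξ : V) : ℂ := ∫ t : V, f t * conj (shift x ξ g t)

/-- The modulation space `M¹_m` for a weight `m ≥ 1` on `V × V`, as a subspace of `L²`. -/
def MemModOne (m : V → V → ℝ) (f : V → ℂ) : Prop :=
  MemLp f 2 ∧
    ∫⁻ p : V × V, ‖stft (gaussian V) f p.1 p.2‖ₑ * ENNReal.ofReal (m p.1 p.2) < ∞

/-- `⟨σ, Ψ⟩` is meaningful: `σ` lies in the dual `M^∞_{1/m}` of some `M¹_m ∋ Ψ`, with the weight
`m = (1 + |x| + |ξ|)^N`, `N ≥ 0`. Every tempered distribution belongs to such a dual for some `N`,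
and a Schwartz function `Ψ` belongs to `M¹_m` for all `N`. -/
def BracketDefined (σ : 𝓢'(V, ℂ)) (Ψ : V → ℂ) : Prop :=
  ∃ N : ℕ, MemModInfty N σ ∧ MemModOne (fun x ξ => (1 + ‖x‖ + ‖ξ‖) ^ N) Ψ

/-- The sesquilinear duality of `M^∞_{1/m}` and `M¹_m`, conjugate-linear in `Ψ`:
`⟨σ, Ψ⟩ = ∬ V_g σ conj(V_g Ψ)` with `‖g‖₂ = 1`.
For Schwartz `Ψ` it is the usual bracket `σ(conj Ψ)`. -/
def bracket (σ : 𝓢'(V, ℂ)) (Ψ : V → ℂ) : ℂ :=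
  ∫ p : V × V, distSTFT σ p.1 p.2 * conj (stft (gaussian V) Ψ p.1 p.2)

end Window

/-- The configuration space `ℝ^d`. -/
abbrev Conf (d : ℕ) : Type := EuclideanSpace ℝ (Fin d)

/-- The phase space `ℝ^{2d}`; the first block of coordinates is the position. -/
abbrev Phase (d : ℕ) : Type := EuclideanSpace ℝ (Fin d ⊕ Fin d)

variable {d : ℕ}

/-- `z₁`, for `z = (z₁, z₂)`. -/
def pos (z : Phase d) : Conf d := WithLp.toLp 2 fun i => z (Sum.inl i)

/-- `z₂`, for `z = (z₁, z₂)`. -/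
def freq (z : Phase d) : Conf d := WithLp.toLp 2 fun i => z (Sum.inr i)

/-- The point `(x, ξ)` of phase space. -/
def pt (x ξ : Conf d) : Phase d := WithLp.toLp 2 (Sum.elim (fun i => x i) (fun i => ξ i))

/-- Admissible weight functions on `ℝ^{2d}`. -/
structure IsAdmissible (v : Phase d → ℝ) : Prop where
  nonneg : ∀ z, 0 ≤ v z
  continuous : Continuous v
  zero : v 0 = 1
  even : ∀ z w : Phase d, (∀ i, |z i| = |w i|) → v z = v w
  submul : ∀ w z, v (w + z) ≤ v w * v z
  grs : ∀ z, Tendsto (fun n : ℕ => v ((n : ℝ) • z) ^ (1 / (n : ℝ))) atTop (𝓝 1)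

/-- `φ ∈ M¹_m(ℝ^d)`, for a weight `m` on `ℝ^{2d}`. -/
def MemM1 (m : Phase d → ℝ) (φ : Conf d → ℂ) : Prop := MemModOne (fun x ξ => m (pt x ξ)) φ

/-- `H ∈ L¹_v(ℝ^{2d})`. -/
def MemL1 (v : Phase d → ℝ) (H : Phase d → ℝ) : Prop := Integrable fun z => H z * v z

/-- `π(z) f` for `z ∈ ℝ^{2d}`. -/
def tfShift (z : Phase d) (f : Conf d → ℂ) : Conf d → ℂ := shift (pos z) (freq z) f

/-- The cross-`τ`-Wigner distribution
`W_τ(f, g)(x, ξ) = ∫ e^{-2π i y·ξ} f(x + τ y) conj(g(x - (1 - τ) y)) dy`. -/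
def tauWigner (τ : ℝ) (f g : Conf d → ℂ) (z : Phase d) : ℂ :=
  ∫ y : Conf d, character (-freq z) y * f (pos z + τ • y) * conj (g (pos z - (1 - τ) • y))

/-- `⟨Op_τ(σ) f, g⟩ = ⟨σ, W_τ(g, f)⟩`. -/
def opEntry (τ : ℝ) (σ : 𝓢'(Phase d, ℂ)) (f g : Conf d → ℂ) : ℂ := bracket σ (tauWigner τ g f)

/-- The pairing that defines `⟨Op_τ(σ) f, g⟩` is meaningful. -/
def OpEntryDefined (τ : ℝ) (σ : 𝓢'(Phase d, ℂ)) (f g : Conf d → ℂ) : Prop :=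
  BracketDefined σ (tauWigner τ g f)

/-- `⟨Op_τ(σ) π(z) φ, π(w) φ⟩` is meaningful and of modulus at most `b`. -/
def GaborEntryLE (τ : ℝ) (σ : 𝓢'(Phase d, ℂ)) (φ : Conf d → ℂ) (z w : Phase d) (b : ℝ) : Prop :=
  OpEntryDefined τ σ (tfShift z φ) (tfShift w φ) ∧
    ‖opEntry τ σ (tfShift z φ) (tfShift w φ)‖ ≤ b

/-- `𝓑_τ z = (z₁ / (1 - τ), z₂ / τ)`. -/
def matB (τ : ℝ) (z : Phase d) : Phase d := pt ((1 / (1 - τ)) • pos z) ((1 / τ) • freq z)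

/-- `𝓤_τ z = -(τ / (1 - τ) z₁, (1 - τ) / τ z₂)`. -/
def matU (τ : ℝ) (z : Phase d) : Phase d :=
  -pt ((τ / (1 - τ)) • pos z) (((1 - τ) / τ) • freq z)

/-- `𝓓_τ z = ((1 - τ) z₁, τ z₂)`. -/
def matD (τ : ℝ) (z : Phase d) : Phase d := pt ((1 - τ) • pos z) (τ • freq z)

/-- `𝓣_τ(z, w) = ((1 - τ) z₁ + τ w₁, τ z₂ + (1 - τ) w₂)`. -/
def mapT (τ : ℝ) (z w : Phase d) : Phase d :=
  pt ((1 - τ) • pos z + τ • pos w) (τ • freq z + (1 - τ) • freq w)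

/-- `{π(λ) φ : λ ∈ Λ}` is a Gabor frame for `L²(ℝ^d)`. -/
def IsGaborFrame (φ : Conf d → ℂ) (Λ : Submodule ℤ (Phase d)) : Prop :=
  ∃ a b : ℝ≥0, 0 < a ∧ 0 < b ∧ ∀ f : Lp ℂ 2 (volume : Measure (Conf d)),
    (a : ℝ≥0∞) * ‖f‖ₑ ^ 2 ≤ ∑' l : Λ, ‖stft φ f (pos (l : Phase d)) (freq (l : Phase d))‖ₑ ^ 2 ∧
    ∑' l : Λ, ‖stft φ f (pos (l : Phase d)) (freq (l : Phase d))‖ₑ ^ 2 ≤ (b : ℝ≥0∞) * ‖f‖ₑ ^ 2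

end TauPDO

end

set_option linter.unusedSectionVars false
set_option linter.unusedVariables false

noncomputable section

namespace TauPDO

/-! ### Plancherel for Fourier integrals and partial Fourier transforms -/

section FourierL2
open scoped FourierTransform RealInnerProductSpace

variable {V : Type*} [NormedAddCommGroup V] [InnerProductSpace ℝ V] [FiniteDimensional ℝ V]
  [MeasurableSpace V] [BorelSpace V]

/-! Phase-space shifts of the two arguments of the τ-Wigner distribution shift the distribution
itself: up to a unimodular factor, W_τ(π(w)φ, π(z)φ) is W_τ(φ, φ) moved by the point (T_τ(w,z),
J(w,z)) of ℝ^{4d}, where J(w,z) is a rotated copy of w - z (`tauWigner_tfShift`). The map (w,z) ↦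
(T_τ, J) is bijective for every τ, so the Gabor matrix of Op_τ(σ) lists, up to phases, all values of
the short-time Fourier transform of σ with window Ψ = W_τ(φ, φ). A bound by H(T_τ(w,z)) says that
this transform is at most H(x) at position x, whatever the frequency. Thus (b) expresses that the
amalgam space may be described with the window Ψ in place of the Gaussian G.

A change of window convolves with the marginal x ↦ ∫ |V_G Ψ(x,ξ)| dξ, which therefore has to lie in
L¹_v. Writing φ as a superposition of shifted Gaussians reduces this to V_G W_τ(g,g), an explicit
Gaussian integral with decay uniform in τ ∈ [0,1] (`exists_norm_stft_tauWigner_gaussian_le`).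
Submultiplicativity of v along T_τ(a,b) = D_τ a + D_{1-τ} b then calls for exactly the two
conditions on φ in (b) (`lintegral_wignerMajorant_lt_top`). One direction is
`exists_majorant_of_lintegral_ampl`; the other inverts p ↦ ⟨σ, π(p)Ψ⟩, with the constant ‖Ψ‖² = ‖φ‖⁴
≠ 0 (`distSTFT_eq_integral_bracket`, `lintegral_ampl_lt_top_of_opEntry_le`). Since B_τ T_τ(w,z) = w
- U_τ z, the case of the weight v∘B_τ is (a) after a linear change of variables.

In (c), the direct half samples the majorant on the lattice, which is harmless because it varies by
at most e^{α|q|} under translation by q. Conversely, every Gaussian π(w)g is expanded in the frame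
with coefficients bounded by K(l - w), K ∈ L¹_v (`IsGaborFrame.exists_expansion`). When two
expansions are inserted, the lattice bound, which depends on λ + μ only, becomes a bound H(w + z)
with H ∈ L¹_v for all Gaussian entries, and the continuous converse applies to g.

The coefficients come from S⁻¹π(w)g, S being the frame operator, so a Wiener lemma is needed:
weighted L¹ off-diagonal decay of the Gabor matrix passes from S to S⁻¹
(`exists_gaborNorm_preimage_atom_le`). The lower bound of S is localized with wide exponential
cutoffs. The commutators are small, which yields an inequality a(y) ≤ b(y) + ∫ κ(x) a(y + x) dx with
∫ κ < 1, and its iteration stays in the weighted space because the weight grows subexponentially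
(`IsSubexpWeight.exists_majorant_of_le_corr`). Exchanging σ with the lattice series needs polynomial
decay of φ as well; this is extracted from the fact that the entry at λ = μ = 0 is defined
(`lintegral_gaborNorm_mul_normWeight_lt_top`). -/

theorem fourier_toLp_ae_eq {u : V → ℂ} (h1 : Integrable u) (h2 : MemLp u 2) :
    ((𝓕 (h2.toLp u) : Lp ℂ 2 (volume : Measure V)) : V → ℂ) =ᵐ[volume] 𝓕 u := by
  have hc : Continuous (𝓕 u) := by
    exact VectorFourier.fourierIntegral_continuous Real.continuous_fourierChar
      (by exact continuous_inner) h1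
  -- Both sides are locally integrable, so test functions decide. On them the L² transform is the
  -- distributional one, and the multiplication formula moves the transform from the test function
  -- to u.
  apply ae_eq_of_integral_contDiff_smul_eq
  · exact (Lp.memLp _).locallyIntegrable one_le_two
  · exact hc.locallyIntegrable
  · intro g g_smooth g_cpt
    have hg₁ : HasCompactSupport (Complex.ofRealCLM ∘ g) := g_cpt.comp_left rfl
    have hg₂ : ContDiff ℝ ((⊤ : ℕ∞) : WithTop ℕ∞) (Complex.ofRealCLM ∘ g) := by fun_prop
    set θ : 𝓢(V, ℂ) := hg₁.toSchwartzMap hg₂ with hθ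
    have hθa : ∀ x, θ x = (g x : ℂ) := fun x => rfl
    have e1 := congrArg (fun T : 𝓢'(V, ℂ) => T θ) (Lp.fourier_toTemperedDistribution_eq (h2.toLp u))
    simp only [TemperedDistribution.fourier_apply, Lp.toTemperedDistribution_apply] at e1
    have e2 : ∫ x, g x • (𝓕 (h2.toLp u) : Lp ℂ 2 (volume : Measure V)) x
        = ∫ x, θ x • (𝓕 (h2.toLp u) : Lp ℂ 2 (volume : Measure V)) x := by
      congr 1
    rw [e2, ← e1]
    have e3 : ∫ x, 𝓕 (θ : V → ℂ) x • u x = ∫ x, θ x • 𝓕 u x := by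
      simpa using! VectorFourier.integral_bilin_fourierIntegral_eq_flip (ContinuousLinearMap.lsmul ℂ ℂ)
        (L := innerₗ V) Real.continuous_fourierChar continuous_inner θ.integrable h1
    have e4 : ∫ x, (𝓕 θ) x • (h2.toLp u) x = ∫ x, (𝓕 (θ : V → ℂ)) x • u x := by
      apply integral_congr_ae
      filter_upwards [h2.coeFn_toLp] with x hx
      rw [hx, SchwartzMap.fourier_coe]
    rw [e4, e3]
    congr 1

theorem eLpNorm_fourier {u : V → ℂ} (h1 : Integrable u) (h2 : MemLp u 2) :
    eLpNorm (𝓕 u) 2 = eLpNorm u 2 := by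
  rw [← eLpNorm_congr_ae (fourier_toLp_ae_eq h1 h2), ← eLpNorm_congr_ae h2.coeFn_toLp,
    ← Lp.enorm_def, ← Lp.enorm_def, ← ofReal_norm, ← ofReal_norm, Lp.norm_fourier_eq]

theorem lintegral_enorm_sq_eq_eLpNorm {α : Type*} [MeasurableSpace α] {μ : Measure α} (f : α → ℂ) :
    ∫⁻ x, ‖f x‖ₑ ^ 2 ∂μ = eLpNorm f 2 μ ^ 2 := by
  rw [eLpNorm_eq_lintegral_rpow_enorm_toReal (by norm_num) (by norm_num), ← ENNReal.rpow_natCast,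
    ← ENNReal.rpow_mul]
  simp

theorem lintegral_enorm_sq_fourier {u : V → ℂ} (h1 : Integrable u) (h2 : MemLp u 2) :
    ∫⁻ ξ, ‖𝓕 u ξ‖ₑ ^ 2 = ∫⁻ x, ‖u x‖ₑ ^ 2 := by
  rw [lintegral_enorm_sq_eq_eLpNorm, lintegral_enorm_sq_eq_eLpNorm, eLpNorm_fourier h1 h2]

theorem memLp_two_iff_lintegral {α : Type*} [MeasurableSpace α] {μ : Measure α} {f : α → ℂ} :
    MemLp f 2 μ ↔ AEStronglyMeasurable f μ ∧ ∫⁻ x, ‖f x‖ₑ ^ 2 ∂μ < ∞ := by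
  rw [lintegral_enorm_sq_eq_eLpNorm, MemLp]
  simp [ENNReal.pow_lt_top_iff]

theorem integral_conj_fourier_mul_fourier {u u' : V → ℂ} (h1 : Integrable u) (h2 : MemLp u 2)
    (h1' : Integrable u') (h2' : MemLp u' 2) :
    ∫ ξ, conj (𝓕 u' ξ) * 𝓕 u ξ = ∫ x, conj (u' x) * u x := by
  have h := Lp.inner_fourier_eq (h2'.toLp u') (h2.toLp u)
  rw [L2.inner_def, L2.inner_def] at h
  calc ∫ ξ, conj (𝓕 u' ξ) * 𝓕 u ξ = _ := ?_
    _ = _ := h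
    _ = ∫ x, conj (u' x) * u x := ?_
  · apply integral_congr_ae
    filter_upwards [fourier_toLp_ae_eq h1 h2, fourier_toLp_ae_eq h1' h2'] with x hx hx'
    rw [hx, hx', RCLike.inner_apply']
  · apply integral_congr_ae
    filter_upwards [h2.coeFn_toLp, h2'.coeFn_toLp] with x hx hx'
    rw [hx, hx', RCLike.inner_apply']

variable {W : Type*} [MeasurableSpace W] {μ : Measure W} [SFinite μ]

theorem aestronglyMeasurable_partialFourier {F : W × V → ℂ}
    (hF : AEStronglyMeasurable F (μ.prod volume)) :
    AEStronglyMeasurable (fun p : W × V => 𝓕 (fun y => F (p.1, y)) p.2) (μ.prod volume) := by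
  obtain ⟨F', hF', hFF'⟩ := hF
  refine ⟨fun p : W × V => 𝓕 (fun y => F' (p.1, y)) p.2, ?_, ?_⟩
  · simp only [Real.fourier_eq]
    refine StronglyMeasurable.integral_prod_right (f := fun (p : W × V) (y : V) =>
      Real.fourierChar (-inner ℝ y p.2) • F' (p.1, y)) ?_
    have hc : Continuous fun q : V × V => Real.fourierChar (-inner ℝ q.1 q.2) :=
      Real.continuous_fourierChar.comp (by fun_prop)
    have hc' : Measurable fun q : V × V => ((Real.fourierChar (-inner ℝ q.1 q.2) : Circle) : ℂ) :=
      (continuous_subtype_val.comp hc).measurable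
    have hg : Measurable fun q : (W × V) × V => (q.2, q.1.2) := by fun_prop
    have hg' : Measurable fun q : (W × V) × V => (q.1.1, q.2) := by fun_prop
    exact (hc'.comp hg).stronglyMeasurable.mul (hF'.comp_measurable hg')
  · have h := Measure.ae_ae_of_ae_prod hFF'
    have h2 : ∀ᵐ x ∂μ, ∀ ω, 𝓕 (fun y => F (x, y)) ω = 𝓕 (fun y => F' (x, y)) ω := by
      filter_upwards [h] with x hx ω
      rw [Real.fourier_eq, Real.fourier_eq]
      refine integral_congr_ae ?_
      filter_upwards [hx] with y hy
      rw [hy]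
    have h3 := Measure.quasiMeasurePreserving_fst (μ := μ) (ν := (volume : Measure V)) |>.ae h2
    filter_upwards [h3] with p hp using hp _

theorem ae_memLp_prod_right {F : W × V → ℂ} (hF : MemLp F 2 (μ.prod volume)) :
    ∀ᵐ x ∂μ, MemLp (fun y => F (x, y)) 2 := by
  rw [memLp_two_iff_lintegral] at hF
  have h := hF.2
  rw [lintegral_prod _ (hF.1.enorm.pow_const 2)] at h
  have h2 := ae_lt_top' (by
    exact (hF.1.enorm.pow_const 2).lintegral_prod_right') h.ne
  filter_upwards [h2, hF.1.prodMk_left] with x hx hx'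
  exact memLp_two_iff_lintegral.2 ⟨hx', hx⟩

/-- Plancherel on each fibre, then Tonelli. Integrability of the fibres is a separate hypothesis
because the transform is the pointwise integral. -/
theorem memLp_partialFourier {F : W × V → ℂ} (hF : MemLp F 2 (μ.prod volume))
    (h1 : ∀ᵐ x ∂μ, Integrable fun y => F (x, y)) :
    MemLp (fun p : W × V => 𝓕 (fun y => F (p.1, y)) p.2) 2 (μ.prod volume) := by
  have hm := aestronglyMeasurable_partialFourier (μ := μ) hF.1
  refine memLp_two_iff_lintegral.2 ⟨hm, ?_⟩
  have hF' := memLp_two_iff_lintegral.1 hF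
  rw [lintegral_prod _ (hm.enorm.pow_const 2)]
  calc ∫⁻ x, (∫⁻ ω, ‖𝓕 (fun y => F (x, y)) ω‖ₑ ^ 2) ∂μ = ∫⁻ x, (∫⁻ y, ‖F (x, y)‖ₑ ^ 2) ∂μ := by
        refine lintegral_congr_ae ?_
        filter_upwards [h1, ae_memLp_prod_right hF] with x hx hx2
        exact lintegral_enorm_sq_fourier hx hx2
    _ = ∫⁻ p, ‖F p‖ₑ ^ 2 ∂(μ.prod volume) := (lintegral_prod _ (hF.1.enorm.pow_const 2)).symm
    _ < ∞ := hF'.2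

theorem integrable_conj_mul {α : Type*} [MeasurableSpace α] {ν : Measure α} {f f' : α → ℂ}
    (hf : MemLp f 2 ν) (hf' : MemLp f' 2 ν) : Integrable (fun x => conj (f' x) * f x) ν := by
  have : MemLp (fun x => conj (f' x)) 2 ν := hf'.star
  exact MemLp.integrable_mul this hf

/-- Parseval on each fibre. Composed with a measure-preserving shear it gives both the orthogonality
relations of the short-time Fourier transform and Moyal's identity for W_τ. -/
theorem integral_conj_partialFourier_mul {F F' : W × V → ℂ} (hF : MemLp F 2 (μ.prod volume))
    (h1 : ∀ᵐ x ∂μ, Integrable fun y => F (x, y)) (hF' : MemLp F' 2 (μ.prod volume))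
    (h1' : ∀ᵐ x ∂μ, Integrable fun y => F' (x, y)) :
    ∫ p : W × V, conj (𝓕 (fun y => F' (p.1, y)) p.2) * 𝓕 (fun y => F (p.1, y)) p.2 ∂(μ.prod volume)
      = ∫ p : W × V, conj (F' p) * F p ∂(μ.prod volume) := by
  rw [integral_prod _ (integrable_conj_mul (memLp_partialFourier hF h1)
    (memLp_partialFourier hF' h1')), integral_prod _ (integrable_conj_mul hF hF')]
  refine integral_congr_ae ?_
  filter_upwards [h1, h1', ae_memLp_prod_right hF, ae_memLp_prod_right hF'] with x a b c e
  exact integral_conj_fourier_mul_fourier a c b e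

end FourierL2

/-! ### Characters -/

section Character
variable {V : Type*} [NormedAddCommGroup V] [InnerProductSpace ℝ V]

@[simp] theorem norm_character (ξ t : V) : ‖character ξ t‖ = 1 := by
  rw [character, show (2 * Real.pi * Complex.I * ((inner ℝ ξ t : ℝ) : ℂ) : ℂ) =
    ((2 * Real.pi * inner ℝ ξ t : ℝ) : ℂ) * Complex.I by push_cast; ring, Complex.norm_exp_ofReal_mul_I]

@[simp] theorem enorm_character (ξ t : V) : ‖character ξ t‖ₑ = 1 := by
  rw [← ofReal_norm, norm_character, ENNReal.ofReal_one]

theorem character_add_left (ξ η t : V) : character (ξ + η) t = character ξ t * character η t := by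
  rw [character, character, character, ← Complex.exp_add, inner_add_left]; push_cast; ring_nf

theorem character_add_right (ξ s t : V) : character ξ (s + t) = character ξ s * character ξ t := by
  rw [character, character, character, ← Complex.exp_add, inner_add_right]; push_cast; ring_nf

theorem conj_character (ξ t : V) : conj (character ξ t) = character (-ξ) t := by
  rw [character, character, ← Complex.exp_conj]; simp [map_ofNat]

theorem character_neg_right (ξ t : V) : character ξ (-t) = character (-ξ) t := by
  simp [character]

theorem character_comm (ξ t : V) : character ξ t = character t ξ := by
  rw [character, character, real_inner_comm]

@[simp] theorem character_zero_left (t : V) : character 0 t = 1 := by simp [character]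
@[simp] theorem character_zero_right (t : V) : character t 0 = 1 := by simp [character]

theorem character_smul_left (r : ℝ) (ξ t : V) : character (r • ξ) t = character ξ (r • t) := by
  simp [character, real_inner_smul_left, real_inner_smul_right]

theorem continuous_character : Continuous fun p : V × V => character p.1 p.2 := by
  unfold character; fun_prop

end Character

/-! ### Product measures and superpositions -/

section Prod
variable {α β : Type*} [MeasurableSpace α] [MeasurableSpace β] {μ : Measure α} {ν : Measure β}
  [SFinite μ] [SFinite ν]

theorem memLp_two_mul_prod {f : α → ℂ} {h : β → ℂ} (hf : MemLp f 2 μ) (hh : MemLp h 2 ν) :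
    MemLp (fun p : α × β => f p.1 * h p.2) 2 (μ.prod ν) := by
  rw [memLp_two_iff_lintegral] at *
  refine ⟨hf.1.comp_fst.mul hh.1.comp_snd, ?_⟩
  have := lintegral_prod_mul (hf.1.enorm.pow_const 2) (hh.1.enorm.pow_const 2)
  simp only [enorm_mul, mul_pow]
  rw [this]
  exact ENNReal.mul_lt_top hf.2 hh.2

/-- Fubini on sets of finite measure. It turns a weak reconstruction formula, tested against
indicators only, into an almost everywhere identity; Gaussian inversion and the frame expansion both
end this way. -/
theorem ae_eq_of_setIntegral_superposition {k : α × β → ℂ} {f : β → ℂ} [SigmaFinite ν]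
    (hk : Integrable k (μ.prod ν)) (hf : MemLp f 2 ν)
    (h : ∀ s, MeasurableSet s → ν s < ∞ → ∫ t in s, f t ∂ν = ∫ a, ∫ t in s, k (a, t) ∂ν ∂μ) :
    f =ᵐ[ν] fun t => ∫ a, k (a, t) ∂μ := by
  refine ae_eq_of_forall_setIntegral_eq_of_sigmaFinite (fun s _ hs' => ?_)
    (fun s _ _ => (hk.integral_prod_right).integrableOn) (fun s hs hs' => ?_)
  · have : IsFiniteMeasure (ν.restrict s) := ⟨by simpa using hs'⟩
    exact (hf.restrict s).integrable (by norm_num)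
  · rw [h s hs hs']
    refine integral_integral_swap (f := fun a t => k (a, t)) ?_
    refine hk.mono_measure ?_
    conv_lhs => rw [← Measure.restrict_univ (μ := μ), Measure.prod_restrict]
    exact Measure.restrict_le_self

end Prod

/-! ### Short-time Fourier transform: orthogonality and covariance -/

section STFT
open scoped FourierTransform RealInnerProductSpace
variable {V : Type*} [NormedAddCommGroup V] [InnerProductSpace ℝ V] [FiniteDimensional ℝ V]
  [MeasurableSpace V] [BorelSpace V]

theorem stft_eq_fourier (γ f : V → ℂ) (x ξ : V) :
    stft γ f x ξ = 𝓕 (fun t => f t * conj (γ (t - x))) ξ := by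
  rw [stft, Real.fourier_eq']
  congr 1 with t
  rw [shift, map_mul, conj_character, character, smul_eq_mul]
  simp only [inner_neg_left, real_inner_comm t ξ]
  push_cast
  ring_nf

theorem measurePreserving_sub_shear :
    MeasurePreserving (fun p : V × V => (p.2, p.2 - p.1)) (volume.prod volume)
      (volume.prod volume) := by
  have h : MeasurePreserving (fun p : V × V => (p.1, p.1 - p.2)) (volume.prod volume)
      (volume.prod volume) :=
    (MeasurePreserving.id volume).skew_product (g := fun a b => a - b) (by fun_prop)
      (.of_forall fun a => (Measure.measurePreserving_sub_left volume a).map_eq)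
  exact h.comp Measure.measurePreserving_swap

theorem memLp_stftKernel {γ f : V → ℂ} (hγ : MemLp γ 2) (hf : MemLp f 2) :
    MemLp (fun p : V × V => f p.2 * conj (γ (p.2 - p.1))) 2 (volume.prod volume) :=
  (memLp_two_mul_prod hf hγ.star).comp_measurePreserving measurePreserving_sub_shear

theorem memLp_conj_comp_sub {γ : V → ℂ} (hγ : MemLp γ 2) (x : V) :
    MemLp (fun t => conj (γ (t - x))) 2 :=
  (hγ.comp_measurePreserving (measurePreserving_sub_right volume x)).star

theorem integrable_stftKernel {γ f : V → ℂ} (hγ : MemLp γ 2) (hf : MemLp f 2) (x : V) :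
    Integrable fun t : V => f t * conj (γ (t - x)) :=
  MemLp.integrable_mul hf (memLp_conj_comp_sub hγ x)

theorem memLp_stft {γ f : V → ℂ} (hγ : MemLp γ 2) (hf : MemLp f 2) :
    MemLp (fun p : V × V => stft γ f p.1 p.2) 2 := by
  simp only [stft_eq_fourier]
  exact memLp_partialFourier (memLp_stftKernel hγ hf) (.of_forall (integrable_stftKernel hγ hf))

/-- Parseval in the frequency variable leaves the integral of products f(t) γ(t - x), which the
shear (x, t) ↦ (t, t - x) factorizes. -/
theorem integral_conj_stft_mul_stft {γ γ' f f' : V → ℂ} (hγ : MemLp γ 2) (hγ' : MemLp γ' 2)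
    (hf : MemLp f 2) (hf' : MemLp f' 2) :
    ∫ p : V × V, conj (stft γ' f' p.1 p.2) * stft γ f p.1 p.2 =
      (∫ t, conj (f' t) * f t) * ∫ t, γ' t * conj (γ t) := by
  simp only [stft_eq_fourier]
  have h := integral_conj_partialFourier_mul (memLp_stftKernel hγ hf)
    (.of_forall (integrable_stftKernel hγ hf)) (memLp_stftKernel hγ' hf')
    (.of_forall (integrable_stftKernel hγ' hf'))
  refine Eq.trans h ?_
  have hm : AEStronglyMeasurable (fun z : V × V => conj (f' z.1) * f z.1 *
      (γ' z.2 * conj (γ z.2))) (volume.prod volume) :=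
    (integrable_conj_mul hf hf').1.comp_fst.mul
      ((by simpa using integrable_conj_mul hγ.star hγ'.star :
        Integrable (fun t => γ' t * conj (γ t)) volume)).1.comp_snd
  rw [← measurePreserving_sub_shear.map_eq] at hm
  have h2 := integral_map measurePreserving_sub_shear.measurable.aemeasurable hm
  rw [measurePreserving_sub_shear.map_eq] at h2
  rw [← integral_prod_mul, h2]
  refine integral_congr_ae (.of_forall fun p => ?_)
  simp only [map_mul, Complex.conj_conj]
  ring

theorem stft_shift (γ f : V → ℂ) (a b x ξ : V) :
    stft γ (shift a b f) x ξ = character (b - ξ) a * stft γ f (x - a) (ξ - b) := by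
  rw [stft, stft, ← integral_const_mul, ← integral_add_right_eq_self _ a]
  congr 1 with t
  simp only [shift, map_mul, conj_character, add_sub_cancel_right, neg_sub, character_add_right,
    sub_eq_add_neg b ξ, character_add_left]
  rw [show t + a - x = t - (x - a) by abel]
  ring

theorem stft_shift_window (γ f : V → ℂ) (x ξ : V) :
    stft γ f x ξ = ∫ t, conj (shift x ξ γ t) * f t := by
  rw [stft]; congr 1 with t; ring

theorem conj_stft (γ f : V → ℂ) (x ξ : V) :
    conj (stft γ f x ξ) = ∫ t, shift x ξ γ t * conj (f t) := by
  rw [stft, ← integral_conj]; congr 1 with t; simp [mul_comm]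

theorem measurable_character (ξ : V) : Measurable fun t : V => character ξ t :=
  (continuous_character.comp (by fun_prop : Continuous fun t : V => (ξ, t))).measurable

theorem aestronglyMeasurable_shift {f : V → ℂ} (hf : AEStronglyMeasurable f) (x ξ : V) :
    AEStronglyMeasurable (shift x ξ f) :=
  (measurable_character ξ).aestronglyMeasurable.mul
    (hf.comp_measurePreserving (measurePreserving_sub_right volume x))

theorem memLp_shift {f : V → ℂ} {p : ℝ≥0∞} (hf : MemLp f p) (x ξ : V) : MemLp (shift x ξ f) p := by
  refine (hf.comp_measurePreserving (measurePreserving_sub_right volume x)).of_le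
    (aestronglyMeasurable_shift hf.1 x ξ) (.of_forall fun t => ?_)
  simp [shift]

theorem integrable_shift {f : V → ℂ} (hf : Integrable f) (x ξ : V) : Integrable (shift x ξ f) := by
  rw [← memLp_one_iff_integrable] at *
  exact memLp_shift hf x ξ

end STFT

/-! ### Gaussian windows and the inversion formula -/

section Gaussian
open scoped FourierTransform RealInnerProductSpace
variable {V : Type*} [NormedAddCommGroup V] [InnerProductSpace ℝ V] [FiniteDimensional ℝ V]
  [MeasurableSpace V] [BorelSpace V]

/-- Fourier integral of a shifted Gaussian `e^{-πA|t-c|²}`. -/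
theorem integral_gaussian_character {A : ℝ} (hA : 0 < A) (c ξ : V) :
    ∫ t : V, (Real.exp (-Real.pi * A * ‖t - c‖ ^ 2) : ℂ) * character ξ t =
      ((A⁻¹ ^ (Module.finrank ℝ V / 2 : ℝ) : ℝ) : ℂ) *
        (Real.exp (-Real.pi * ‖ξ‖ ^ 2 / A) : ℂ) * character ξ c := by
  have hpi := Real.pi_pos
  have h := GaussianFourier.integral_cexp_neg_mul_sq_norm_add (V := V) (b := (Real.pi * A : ℝ))
    (by simpa using mul_pos hpi hA) (2 * Real.pi * Complex.I) ξ
  rw [← integral_add_right_eq_self _ c]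
  simp only [add_sub_cancel_right, character_add_right, ← mul_assoc]
  rw [integral_mul_const]
  congr 1
  have e : ∀ t : V, ((Real.exp (-Real.pi * A * ‖t‖ ^ 2) : ℝ) : ℂ) * character ξ t =
      Complex.exp (-((Real.pi * A : ℝ) : ℂ) * ‖t‖ ^ 2 + 2 * Real.pi * Complex.I * (inner ℝ ξ t : ℝ)) := by
    intro t
    rw [character, Complex.ofReal_exp, ← Complex.exp_add]
    push_cast
    ring_nf
  simp only [e]
  rw [h, Complex.ofReal_exp]
  have hA' : (A : ℂ) ≠ 0 := by exact_mod_cast hA.ne'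
  have hpi' : (Real.pi : ℂ) ≠ 0 := by exact_mod_cast hpi.ne'
  congr 1
  · rw [Complex.ofReal_cpow (by positivity)]
    push_cast
    congr 1
    field_simp
  · congr 1
    push_cast
    rw [mul_pow, mul_pow, Complex.I_sq]
    field_simp
    ring

theorem gaussian_mul_gaussian_shift (x y t : V) :
    gaussian V (t - x) * gaussian V (t - y) =
      ((2 ^ ((Module.finrank ℝ V : ℝ) / 2) * Real.exp (-Real.pi / 2 * ‖x - y‖ ^ 2) : ℝ) : ℂ) *
        (Real.exp (-Real.pi * 2 * ‖t - (2⁻¹ : ℝ) • (x + y)‖ ^ 2) : ℂ) := by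
  rw [gaussian_apply, gaussian_apply, ← Complex.ofReal_mul, ← Complex.ofReal_mul]
  congr 1
  have e1 : (2 : ℝ) ^ ((Module.finrank ℝ V : ℝ) / 2) =
      2 ^ ((Module.finrank ℝ V : ℝ) / 4) * 2 ^ ((Module.finrank ℝ V : ℝ) / 4) := by
    rw [← Real.rpow_add two_pos]; ring_nf
  have e2 : Real.exp (-Real.pi * ‖t - x‖ ^ 2) * Real.exp (-Real.pi * ‖t - y‖ ^ 2) =
      Real.exp (-Real.pi / 2 * ‖x - y‖ ^ 2) * Real.exp (-Real.pi * 2 * ‖t - (2⁻¹ : ℝ) • (x + y)‖ ^ 2) := by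
    rw [← Real.exp_add, ← Real.exp_add]
    congr 1
    -- The exponents combine by the parallelogram law for t - x and t - y, whose sum is twice the
    -- distance vector to the midpoint.
    have p := parallelogram_law_with_norm ℝ (t - x) (t - y)
    have p1 : t - x + (t - y) = (2 : ℝ) • (t - (2⁻¹ : ℝ) • (x + y)) := by module
    have p2 : t - x - (t - y) = -(x - y) := by abel
    rw [p1, p2, norm_neg, norm_smul] at p
    simp only [Real.norm_ofNat] at p
    linear_combination Real.pi / 2 * p
  rw [e1]
  linear_combination 2 ^ ((Module.finrank ℝ V : ℝ) / 4) * 2 ^ ((Module.finrank ℝ V : ℝ) / 4) * e2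

theorem conj_gaussian (t : V) : conj (gaussian V t) = gaussian V t := by
  rw [gaussian_apply, Complex.conj_ofReal]

theorem gaussian_neg (t : V) : gaussian V (-t) = gaussian V t := by
  rw [gaussian_apply, gaussian_apply, norm_neg]

theorem memLp_gaussian : MemLp (gaussian V) 2 := (gaussian V).memLp 2

theorem stft_gaussian_gaussian (x ξ : V) :
    stft (gaussian V) (gaussian V) x ξ =
      ((Real.exp (-Real.pi / 2 * (‖x‖ ^ 2 + ‖ξ‖ ^ 2)) : ℝ) : ℂ) * character (-ξ) ((2⁻¹ : ℝ) • x) := by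
  have e : ∀ t, gaussian V t * conj (shift x ξ (gaussian V) t) =
      ((2 ^ ((Module.finrank ℝ V : ℝ) / 2) * Real.exp (-Real.pi / 2 * ‖x‖ ^ 2) : ℝ) : ℂ) *
       ((Real.exp (-Real.pi * 2 * ‖t - (2⁻¹ : ℝ) • x‖ ^ 2) : ℂ) * character (-ξ) t) := by
    intro t
    have := gaussian_mul_gaussian_shift 0 x t
    simp only [sub_zero, zero_add, zero_sub, norm_neg] at this
    rw [shift, map_mul, conj_character, conj_gaussian, ← mul_assoc _ (Complex.ofReal _) (character _ _),
      ← this]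
    ring
  simp only [stft, e]
  rw [integral_const_mul, integral_gaussian_character two_pos, ← mul_assoc, ← mul_assoc]
  congr 1
  rw [← Complex.ofReal_mul, ← Complex.ofReal_mul]
  congr 1
  rw [norm_neg]
  have e1 : (2 : ℝ) ^ ((Module.finrank ℝ V : ℝ) / 2) * 2⁻¹ ^ ((Module.finrank ℝ V : ℝ) / 2) = 1 := by
    rw [← Real.mul_rpow (by norm_num) (by norm_num)]; norm_num
  rw [mul_add, Real.exp_add, show -Real.pi * ‖ξ‖ ^ 2 / 2 = -Real.pi / 2 * ‖ξ‖ ^ 2 by ring]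
  linear_combination (Real.exp (-Real.pi / 2 * ‖x‖ ^ 2) * Real.exp (-Real.pi / 2 * ‖ξ‖ ^ 2)) * e1

theorem integral_gaussian_mul_conj : ∫ t : V, gaussian V t * conj (gaussian V t) = 1 := by
  have := stft_gaussian_gaussian (0 : V) 0
  simpa [stft, shift] using this

theorem norm_stft_gaussian_shift_gaussian (a b x ξ : V) :
    ‖stft (gaussian V) (shift a b (gaussian V)) x ξ‖ =
      Real.exp (-Real.pi / 2 * (‖x - a‖ ^ 2 + ‖ξ - b‖ ^ 2)) := by
  rw [stft_shift, stft_gaussian_gaussian, norm_mul, norm_mul, norm_character, norm_character,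
    Complex.norm_real, Real.norm_of_nonneg (Real.exp_pos _).le]
  ring

theorem integrable_superposition_gaussian {f : V → ℂ} (hf : MemLp f 2)
    (h1 : Integrable fun p : V × V => stft (gaussian V) f p.1 p.2) :
    Integrable (fun q : (V × V) × V => stft (gaussian V) f q.1.1 q.1.2 *
      shift q.1.1 q.1.2 (gaussian V) q.2) (volume.prod volume) := by
  have hm : AEStronglyMeasurable (fun q : (V × V) × V => stft (gaussian V) f q.1.1 q.1.2 *
      shift q.1.1 q.1.2 (gaussian V) q.2) (volume.prod volume) := by
    refine h1.1.comp_fst.mul (Continuous.aestronglyMeasurable ?_)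
    unfold shift
    exact (continuous_character.comp (by fun_prop : Continuous fun q : (V × V) × V => (q.1.2, q.2))).mul
      ((gaussian V).continuous.comp (by fun_prop))
  refine (integrable_prod_iff hm).2 ⟨.of_forall fun p => ?_, ?_⟩
  · exact (integrable_shift (gaussian V).integrable p.1 p.2).const_mul (stft (gaussian V) f p.1 p.2)
  · simp only [norm_mul, shift, norm_character, one_mul]
    simp_rw [integral_const_mul]
    have : ∀ p : V × V, ∫ t, ‖gaussian V (t - p.1)‖ = ∫ t, ‖gaussian V t‖ := fun p =>
      integral_sub_right_eq_self (fun t => ‖gaussian V t‖) p.1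
    simp only [this]
    exact h1.norm.mul_const _

/-- The orthogonality relations with both windows equal to the normalized Gaussian, tested against
indicators of sets of finite measure. -/
theorem ae_eq_superposition_gaussian {f : V → ℂ} (hf : MemLp f 2)
    (h1 : Integrable fun p : V × V => stft (gaussian V) f p.1 p.2) :
    f =ᵐ[volume] fun t => ∫ p : V × V, stft (gaussian V) f p.1 p.2 * shift p.1 p.2 (gaussian V) t := by
  refine ae_eq_of_setIntegral_superposition (integrable_superposition_gaussian hf h1) hf
    fun s hs hs' => ?_
  have hi : MemLp (s.indicator fun _ => (1 : ℂ)) 2 (volume : Measure V) :=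
    memLp_indicator_const 2 hs 1 (Or.inr hs'.ne)
  have h := integral_conj_stft_mul_stft memLp_gaussian memLp_gaussian hf hi
  rw [integral_gaussian_mul_conj, mul_one] at h
  have e1 : ∫ t, conj (s.indicator (fun _ => (1 : ℂ)) t) * f t = ∫ t in s, f t := by
    rw [← integral_indicator hs]
    congr 1 with t
    by_cases ht : t ∈ s <;> simp [ht]
  rw [← e1, ← h]
  congr 1 with p
  simp only
  rw [integral_const_mul, mul_comm, conj_stft, ← integral_indicator hs]
  congr 2 with t
  by_cases ht : t ∈ s <;> simp [ht]

/-- The inversion formula is an absolutely convergent superposition of functions of equal L¹ norm,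
so M¹ embeds in L¹. This makes the Wigner integrals below absolutely convergent. -/
theorem integrable_of_integrable_stft {f : V → ℂ} (hf : MemLp f 2)
    (h1 : Integrable fun p : V × V => stft (gaussian V) f p.1 p.2) : Integrable f :=
  ((integrable_superposition_gaussian hf h1).integral_prod_right).congr
    (ae_eq_superposition_gaussian hf h1).symm

end Gaussian

/-! ### Translations of Schwartz functions and their polynomial bounds -/

section SchwartzTranslate
open scoped FourierTransform RealInnerProductSpace
variable {V : Type*} [NormedAddCommGroup V] [NormedSpace ℝ V]

theorem pow_le_two_pow_mul {a b c : ℝ} (ha : 0 ≤ a) (hb : 0 ≤ b) (hc : 0 ≤ c) (h : a ≤ b + c) (k : ℕ) :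
    a ^ k ≤ 2 ^ k * (b ^ k + c ^ k) := by
  calc a ^ k ≤ (2 * max b c) ^ k := by
        refine pow_le_pow_left₀ ha (h.trans ?_) k
        linarith [le_max_left b c, le_max_right b c]
    _ = 2 ^ k * (max b c) ^ k := mul_pow ..
    _ ≤ 2 ^ k * (b ^ k + c ^ k) := by
        gcongr
        rcases max_cases b c with h | h <;> rw [h.1] <;> linarith [pow_nonneg hb k, pow_nonneg hc k]

theorem seminorm_translate_le (k n : ℕ) (a : V) (f : 𝓢(V, ℂ)) :
    SchwartzMap.seminorm ℝ k n (SchwartzMap.compSubConstCLM ℂ a f) ≤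
      2 ^ k * (SchwartzMap.seminorm ℝ k n f + ‖a‖ ^ k * SchwartzMap.seminorm ℝ 0 n f) := by
  refine SchwartzMap.seminorm_le_bound ℝ k n _ (by positivity) fun x => ?_
  have e : iteratedFDeriv ℝ n (SchwartzMap.compSubConstCLM ℂ a f) x = iteratedFDeriv ℝ n f (x - a) := by
    change iteratedFDeriv ℝ n (fun x => f (x - a)) x = _
    rw [iteratedFDeriv_comp_sub']
  rw [e]
  have h1 := SchwartzMap.le_seminorm ℝ k n f (x - a)
  have h2 := SchwartzMap.le_seminorm ℝ 0 n f (x - a)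
  rw [pow_zero, one_mul] at h2
  have h3 := pow_le_two_pow_mul (norm_nonneg x) (norm_nonneg (x - a)) (norm_nonneg a)
    (by simpa using norm_add_le (x - a) a) k
  calc ‖x‖ ^ k * ‖iteratedFDeriv ℝ n f (x - a)‖
      ≤ 2 ^ k * (‖x - a‖ ^ k + ‖a‖ ^ k) * ‖iteratedFDeriv ℝ n f (x - a)‖ := by gcongr
    _ = 2 ^ k * (‖x - a‖ ^ k * ‖iteratedFDeriv ℝ n f (x - a)‖ +
          ‖a‖ ^ k * ‖iteratedFDeriv ℝ n f (x - a)‖) := by ring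
    _ ≤ _ := by gcongr

/-- The mean value inequality for the n-th derivative on the segment from x to x - a, along which
‖x‖ exceeds the norm of the running point by at most ‖a‖. -/
theorem seminorm_translate_sub_le (k n : ℕ) (a : V) (f : 𝓢(V, ℂ)) :
    SchwartzMap.seminorm ℝ k n (SchwartzMap.compSubConstCLM ℂ a f - f) ≤
      ‖a‖ * (2 ^ k * (SchwartzMap.seminorm ℝ k (n + 1) f +
        ‖a‖ ^ k * SchwartzMap.seminorm ℝ 0 (n + 1) f)) := by
  refine SchwartzMap.seminorm_le_bound ℝ k n _ (by positivity) fun x => ?_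
  have e : iteratedFDeriv ℝ n (SchwartzMap.compSubConstCLM ℂ a f - f) x =
      iteratedFDeriv ℝ n f (x - a) - iteratedFDeriv ℝ n f x := by
    change iteratedFDeriv ℝ n ((fun x => f (x - a)) - (f : V → ℂ)) x = _
    rw [iteratedFDeriv_sub_apply, iteratedFDeriv_comp_sub']
    · exact ((f.smooth n).comp (by fun_prop : ContDiff ℝ n fun x : V => x - a)).contDiffAt
    · exact (f.smooth n).contDiffAt
  rw [e, mul_comm (‖x‖ ^ k)]
  have hd : Differentiable ℝ (iteratedFDeriv ℝ n f) :=
    (f.smooth (n + 1 : ℕ)).differentiable_iteratedFDeriv (by exact_mod_cast Nat.lt_succ_self n)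
  have hb : ∀ y ∈ segment ℝ x (x - a), ‖x‖ ^ k * ‖fderiv ℝ (iteratedFDeriv ℝ n f) y‖ ≤
      2 ^ k * (SchwartzMap.seminorm ℝ k (n + 1) f + ‖a‖ ^ k * SchwartzMap.seminorm ℝ 0 (n + 1) f) := by
    intro y hy
    rw [norm_fderiv_iteratedFDeriv]
    have h1 := SchwartzMap.le_seminorm ℝ k (n + 1) f y
    have h2 := SchwartzMap.le_seminorm ℝ 0 (n + 1) f y
    rw [pow_zero, one_mul] at h2
    have hxy : ‖x - y‖ ≤ ‖a‖ := by
      rw [segment_eq_image'] at hy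
      obtain ⟨θ, hθ, rfl⟩ := hy
      have : x - (x + θ • (x - a - x)) = θ • a := by module
      rw [this, norm_smul, Real.norm_of_nonneg hθ.1]
      nlinarith [hθ.2, norm_nonneg a]
    have h3 := pow_le_two_pow_mul (norm_nonneg x) (norm_nonneg y) (norm_nonneg a)
      (by
        calc ‖x‖ = ‖y + (x - y)‖ := by congr 1; abel
          _ ≤ ‖y‖ + ‖x - y‖ := norm_add_le _ _
          _ ≤ _ := by gcongr) k
    calc ‖x‖ ^ k * ‖iteratedFDeriv ℝ (n + 1) f y‖
        ≤ 2 ^ k * (‖y‖ ^ k + ‖a‖ ^ k) * ‖iteratedFDeriv ℝ (n + 1) f y‖ := by gcongr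
      _ = 2 ^ k * (‖y‖ ^ k * ‖iteratedFDeriv ℝ (n + 1) f y‖ +
            ‖a‖ ^ k * ‖iteratedFDeriv ℝ (n + 1) f y‖) := by ring
      _ ≤ _ := by gcongr
  rcases eq_or_ne (‖x‖ ^ k) 0 with h0 | h0
  · rw [h0, mul_zero]; positivity
  have hpos : 0 < ‖x‖ ^ k := lt_of_le_of_ne (by positivity) h0.symm
  have := (convex_segment x (x - a)).norm_image_sub_le_of_norm_fderiv_le (𝕜 := ℝ)
    (f := iteratedFDeriv ℝ n f) (fun y _ => hd y)
    (fun y hy => (le_div_iff₀' hpos).2 (hb y hy)) (left_mem_segment ℝ _ _) (right_mem_segment ℝ _ _)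
  rw [sub_sub_cancel_left, norm_neg] at this
  rw [div_mul_eq_mul_div, le_div_iff₀ hpos] at this
  linarith

/-- Translation of Schwartz functions is jointly continuous. -/
theorem continuous_translate :
    Continuous fun q : V × 𝓢(V, ℂ) => SchwartzMap.compSubConstCLM ℂ q.1 q.2 := by
  rw [continuous_iff_continuousAt]
  rintro ⟨a₀, f₀⟩
  refine ((schwartz_withSeminorms ℝ V ℂ).tendsto_nhds _ _).2 ?_
  rintro ⟨k, n⟩ ε hε
  have hc : ∀ k n, Continuous fun f : 𝓢(V, ℂ) => SchwartzMap.seminorm ℝ k n f := fun k n =>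
    (schwartz_withSeminorms ℝ V ℂ).continuous_seminorm (k, n)
  -- An explicit continuous majorant of the seminorm of T_a f - T_{a₀} f₀ that vanishes at (a₀, f₀).
  -- It comes from the splitting T_a(f - f₀) + T_{a₀}(T_{a - a₀} f₀ - f₀).
  let B : V × 𝓢(V, ℂ) → ℝ := fun q =>
    2 ^ k * (SchwartzMap.seminorm ℝ k n (q.2 - f₀) + ‖q.1‖ ^ k * SchwartzMap.seminorm ℝ 0 n (q.2 - f₀)) +
    2 ^ k * (‖q.1 - a₀‖ * (2 ^ k * (SchwartzMap.seminorm ℝ k (n + 1) f₀ +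
        ‖q.1 - a₀‖ ^ k * SchwartzMap.seminorm ℝ 0 (n + 1) f₀)) +
      ‖a₀‖ ^ k * (‖q.1 - a₀‖ * (2 ^ 0 * (SchwartzMap.seminorm ℝ 0 (n + 1) f₀ +
        ‖q.1 - a₀‖ ^ 0 * SchwartzMap.seminorm ℝ 0 (n + 1) f₀))))
  have hB : Continuous B := by
    have h1 := fun k n => (hc k n).comp (by fun_prop : Continuous fun q : V × 𝓢(V, ℂ) => q.2 - f₀)
    have h2 : Continuous fun q : V × 𝓢(V, ℂ) => ‖q.1‖ := by fun_prop
    have h3 : Continuous fun q : V × 𝓢(V, ℂ) => ‖q.1 - a₀‖ := by fun_prop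
    have h4 := h1 k n
    have h5 := h1 0 n
    simp only [Function.comp_def] at h4 h5
    fun_prop
  have hB0 : B (a₀, f₀) = 0 := by simp [B]
  have hev : ∀ᶠ q in 𝓝 (a₀, f₀), B q < ε := by
    have := hB.tendsto (a₀, f₀)
    rw [hB0] at this
    exact this.eventually (gt_mem_nhds hε)
  filter_upwards [hev] with q hq
  refine lt_of_le_of_lt ?_ hq
  have e : SchwartzMap.compSubConstCLM ℂ q.1 q.2 - SchwartzMap.compSubConstCLM ℂ a₀ f₀ =
      SchwartzMap.compSubConstCLM ℂ q.1 (q.2 - f₀) +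
      SchwartzMap.compSubConstCLM ℂ a₀ (SchwartzMap.compSubConstCLM ℂ (q.1 - a₀) f₀ - f₀) := by
    ext x
    simp
  change SchwartzMap.seminorm ℝ k n (SchwartzMap.compSubConstCLM ℂ q.1 q.2 -
    SchwartzMap.compSubConstCLM ℂ a₀ f₀) ≤ _
  rw [e]
  refine (map_add_le_add _ _ _).trans ?_
  refine add_le_add (seminorm_translate_le _ _ _ _) ((seminorm_translate_le _ _ _ _).trans ?_)
  gcongr
  · exact seminorm_translate_sub_le _ _ _ _
  · exact seminorm_translate_sub_le _ _ _ _

/-- A family of Schwartz functions whose seminorms grow at most polynomially in the parameter. -/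
def SchwartzPolyBounded {A : Type*} [NormedAddCommGroup A] (u : A → 𝓢(V, ℂ)) : Prop :=
  ∀ k n : ℕ, ∃ (C : ℝ) (N : ℕ), 0 ≤ C ∧ ∀ a, SchwartzMap.seminorm ℝ k n (u a) ≤ C * (1 + ‖a‖) ^ N

theorem SchwartzPolyBounded.seminorm {A : Type*} [NormedAddCommGroup A] {u : A → 𝓢(V, ℂ)}
    (hu : SchwartzPolyBounded u) {q : Seminorm ℝ 𝓢(V, ℂ)} (hq : Continuous q) :
    ∃ (C : ℝ) (N : ℕ), 0 ≤ C ∧ ∀ a, q (u a) ≤ C * (1 + ‖a‖) ^ N := by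
  obtain ⟨s, C, -, hC⟩ := Seminorm.bound_of_continuous (schwartz_withSeminorms ℝ V ℂ) q hq
  choose c N hc0 hc using fun i : ℕ × ℕ => hu i.1 i.2
  refine ⟨C * ∑ i ∈ s, c i, ∑ i ∈ s, N i, by have := Finset.sum_nonneg fun i (_ : i ∈ s) => hc0 i; positivity,
    fun a => ?_⟩
  have h1 : q (u a) ≤ C * (s.sup (schwartzSeminormFamily ℝ V ℂ)) (u a) := hC (u a)
  have h2 := Seminorm.finset_sup_le_sum (schwartzSeminormFamily ℝ V ℂ) s (u a)
  calc q (u a) ≤ C * (s.sup (schwartzSeminormFamily ℝ V ℂ)) (u a) := h1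
    _ ≤ C * ∑ i ∈ s, c i * (1 + ‖a‖) ^ N i := by
      gcongr
      refine h2.trans ?_
      rw [← FunLike.coeAddMonoidHom_apply, map_sum, Finset.sum_apply]
      exact Finset.sum_le_sum fun i _ => hc i a
    _ ≤ C * ∑ i ∈ s, c i * (1 + ‖a‖) ^ (∑ i ∈ s, N i) := by
      gcongr with i hi
      · exact hc0 i
      · linarith [norm_nonneg a]
      · exact Finset.single_le_sum (f := N) (fun _ _ => Nat.zero_le _) hi
    _ = _ := by rw [← Finset.sum_mul]; ring

theorem SchwartzPolyBounded.clm {A : Type*} [NormedAddCommGroup A] {u : A → 𝓢(V, ℂ)}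
    (hu : SchwartzPolyBounded u) (T : 𝓢(V, ℂ) →L[ℝ] 𝓢(V, ℂ)) :
    SchwartzPolyBounded fun a => T (u a) := by
  intro k n
  let q : Seminorm ℝ 𝓢(V, ℂ) := (SchwartzMap.seminorm ℝ k n).comp T.toLinearMap
  have hq : Continuous q :=
    ((schwartz_withSeminorms ℝ V ℂ).continuous_seminorm (k, n)).comp T.continuous
  exact hu.seminorm hq

theorem SchwartzPolyBounded.translate {A : Type*} [NormedAddCommGroup A] {u : A → 𝓢(V, ℂ)}
    (hu : SchwartzPolyBounded u) {x : A → V} (hx : ∀ a, ‖x a‖ ≤ ‖a‖) :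
    SchwartzPolyBounded fun a => SchwartzMap.compSubConstCLM ℂ (x a) (u a) := by
  intro k n
  obtain ⟨C, N, hC0, hC⟩ := hu k n
  obtain ⟨C', N', hC0', hC'⟩ := hu 0 n
  refine ⟨2 ^ k * (C + C'), N + (k + N'), by positivity, fun a => ?_⟩
  have h1 : 1 ≤ 1 + ‖a‖ := by linarith [norm_nonneg a]
  calc _ ≤ _ := seminorm_translate_le k n (x a) (u a)
    _ ≤ 2 ^ k * (C * (1 + ‖a‖) ^ N + (1 + ‖a‖) ^ k * (C' * (1 + ‖a‖) ^ N')) := by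
      gcongr
      · exact hC a
      · linarith [hx a]
      · exact hC' a
    _ = 2 ^ k * (C * (1 + ‖a‖) ^ N + C' * (1 + ‖a‖) ^ (k + N')) := by rw [pow_add]; ring
    _ ≤ 2 ^ k * (C * (1 + ‖a‖) ^ (N + (k + N')) + C' * (1 + ‖a‖) ^ (N + (k + N'))) := by
      have h2 := pow_le_pow_right₀ h1 (show N ≤ N + (k + N') by omega)
      have h3 := pow_le_pow_right₀ h1 (show k + N' ≤ N + (k + N') by omega)
      gcongr
    _ = _ := by ring

end SchwartzTranslate

/-! ### Derivatives of integrals of Schwartz functions -/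

section SchwartzIntegral
variable {A : Type*} [TopologicalSpace A] [SecondCountableTopology A] [MeasurableSpace A] [BorelSpace A]
  {ν : Measure A}

/-- Differentiation under the integral sign, with the Schwartz seminorms as dominating functions.
The induction has to quantify over the target space, since the derivative takes values in V →L[ℝ] F.
-/
theorem iteratedFDeriv_superposition {V : Type} [NormedAddCommGroup V] [NormedSpace ℝ V] (n : ℕ) :
    ∀ {F : Type} [NormedAddCommGroup F] [NormedSpace ℝ F] [CompleteSpace F] {u : A → 𝓢(V, F)} {f : 𝓢(V, F)},
    Continuous u → (∀ k n, Integrable (fun a => SchwartzMap.seminorm ℝ k n (u a)) ν) →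
    (∀ t, f t = ∫ a, u a t ∂ν) → ∀ t, iteratedFDeriv ℝ n f t = ∫ a, iteratedFDeriv ℝ n (u a) t ∂ν := by
  induction n with
  | zero =>
    intro F _ _ _ u f hu hint hf t
    have e : ∀ g : V → F, iteratedFDeriv ℝ 0 g t = (continuousMultilinearCurryFin0 ℝ V F).symm (g t) :=
      fun g => by rw [iteratedFDeriv_zero_eq_comp]; rfl
    simp only [e]
    rw [hf]
    exact ((continuousMultilinearCurryFin0 ℝ V F).symm.toContinuousLinearEquiv.integral_comp_comm _).symm
  | succ n ih =>
    intro F _ _ _ u f hu hint hf t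
    have hev : ∀ {G : Type} [NormedAddCommGroup G] [NormedSpace ℝ G] (w : A → 𝓢(V, G)),
        Continuous w → ∀ x, Continuous fun a => w a x := by
      intro G _ _ w hw x
      exact (BoundedContinuousFunction.evalCLM ℝ x).continuous.comp
        ((SchwartzMap.toBoundedContinuousFunctionCLM ℝ V G).continuous.comp hw)
    have hu' : Continuous fun a => SchwartzMap.fderivCLM ℝ V F (u a) :=
      (SchwartzMap.fderivCLM ℝ V F).continuous.comp hu
    have hle : ∀ k n a, SchwartzMap.seminorm ℝ k n (SchwartzMap.fderivCLM ℝ V F (u a)) ≤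
        SchwartzMap.seminorm ℝ k (n + 1) (u a) := fun k n a =>
      SchwartzMap.seminorm_le_bound ℝ k n _ (by positivity) fun x => by
        have := SchwartzMap.le_seminorm ℝ k (n + 1) (u a) x
        rwa [← norm_iteratedFDeriv_fderiv] at this
    have hf' : ∀ t, SchwartzMap.fderivCLM ℝ V F f t = ∫ a, SchwartzMap.fderivCLM ℝ V F (u a) t ∂ν := by
      intro t
      have hd : HasFDerivAt (fun t => ∫ a, u a t ∂ν) (∫ a, SchwartzMap.fderivCLM ℝ V F (u a) t ∂ν) t := by
        refine hasFDerivAt_integral_of_dominated_of_fderiv_le (𝕜 := ℝ) (s := Set.univ) (x₀ := t)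
          (F := fun t a => u a t)
          (F' := fun t a => SchwartzMap.fderivCLM ℝ V F (u a) t)
          (bound := fun a => SchwartzMap.seminorm ℝ 0 1 (u a)) univ_mem
          (.of_forall fun x => (hev u hu x).aestronglyMeasurable) ?_
          (hev _ hu' t).aestronglyMeasurable (.of_forall fun a x _ => ?_) (hint 0 1)
          (.of_forall fun a x _ => (u a).hasFDerivAt x)
        · refine (hint 0 0).mono' (hev u hu t).aestronglyMeasurable (.of_forall fun a => ?_)
          exact SchwartzMap.norm_le_seminorm ℝ (u a) t
        · exact (SchwartzMap.norm_le_seminorm ℝ _ x).trans (hle 0 0 a)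
      rw [SchwartzMap.fderivCLM_apply]
      rw [show (f : V → F) = fun t => ∫ a, u a t ∂ν from funext hf]
      exact hd.fderiv
    have h := ih hu' (fun k n => (hint k (n + 1)).mono'
      (((schwartz_withSeminorms ℝ V (V →L[ℝ] F)).continuous_seminorm (k, n)).comp hu').aestronglyMeasurable
      (.of_forall fun a => by
        change ‖SchwartzMap.seminorm ℝ k n _‖ ≤ _
        rw [Real.norm_of_nonneg (apply_nonneg _ _)]; exact hle k n a)) hf' t
    have e : ∀ g : 𝓢(V, F), iteratedFDeriv ℝ (n + 1) g t =
        (continuousMultilinearCurryRightEquiv' ℝ n V F).symm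
          (iteratedFDeriv ℝ n (SchwartzMap.fderivCLM ℝ V F g) t) := fun g => by
      rw [iteratedFDeriv_succ_eq_comp_right]; rfl
    simp only [e]
    rw [h]
    exact (ContinuousLinearEquiv.integral_comp_comm (𝕜 := ℝ) (E := V [×n]→L[ℝ] V →L[ℝ] F)
      (F := V [×(n + 1)]→L[ℝ] F)
      (continuousMultilinearCurryRightEquiv' ℝ n V F).symm.toContinuousLinearEquiv
      (μ := ν) (fun a => iteratedFDeriv ℝ n (SchwartzMap.fderivCLM ℝ V F (u a)) t)).symm

end SchwartzIntegral

/-! ### Factorization of tempered distributions through Banach spaces of jets -/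

section SchwartzJets
variable {V : Type} [NormedAddCommGroup V] [InnerProductSpace ℝ V]

/-- The weighted derivative `x ↦ ‖x‖^k Dⁿf(x)` of a Schwartz function. -/
def weightedJet (k n : ℕ) (f : 𝓢(V, ℂ)) : BoundedContinuousFunction V (V [×n]→L[ℝ] ℂ) :=
  BoundedContinuousFunction.ofNormedAddCommGroup (fun x => ‖x‖ ^ k • iteratedFDeriv ℝ n f x)
    ((continuous_norm.pow k).smul ((f.smooth n).continuous_iteratedFDeriv le_rfl))
    (SchwartzMap.seminorm ℝ k n f) fun x => by
      rw [norm_smul, norm_pow, norm_norm]; exact SchwartzMap.le_seminorm ℝ k n f x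

variable (V) in
/-- The Banach space of tuples of bounded continuous jets with orders listed in `s`. -/
def JetSpace (s : Finset (ℕ × ℕ)) : Type :=
  (i : s) → BoundedContinuousFunction V (V [×i.1.2]→L[ℝ] ℂ)

instance (s : Finset (ℕ × ℕ)) : NormedAddCommGroup (JetSpace V s) :=
  inferInstanceAs (NormedAddCommGroup ((i : s) → BoundedContinuousFunction V (V [×i.1.2]→L[ℝ] ℂ)))

instance (s : Finset (ℕ × ℕ)) : NormedSpace ℂ (JetSpace V s) :=
  inferInstanceAs (NormedSpace ℂ ((i : s) → BoundedContinuousFunction V (V [×i.1.2]→L[ℝ] ℂ)))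

instance (s : Finset (ℕ × ℕ)) : CompleteSpace (JetSpace V s) :=
  inferInstanceAs (CompleteSpace ((i : s) → BoundedContinuousFunction V (V [×i.1.2]→L[ℝ] ℂ)))

/-- Evaluation of a jet at a point. -/
def jetEval (s : Finset (ℕ × ℕ)) (i : s) (x : V) : JetSpace V s →L[ℂ] (V [×i.1.2]→L[ℝ] ℂ) :=
  (BoundedContinuousFunction.evalCLM ℂ x).comp
      (ContinuousLinearMap.proj (R := ℂ)
        (φ := fun i : s => BoundedContinuousFunction V (V [×i.1.2]→L[ℝ] ℂ)) i)

/-- The jets of a Schwartz function listed in `s`, as an element of a Banach space. -/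
def jetMap (s : Finset (ℕ × ℕ)) :
    𝓢(V, ℂ) →ₗ[ℂ] JetSpace V s where
  toFun f i := weightedJet i.1.1 i.1.2 f
  map_add' f g := by
    refine funext fun i => BoundedContinuousFunction.ext fun x => ?_
    change ‖x‖ ^ i.1.1 • iteratedFDeriv ℝ i.1.2 ((f : V → ℂ) + (g : V → ℂ)) x =
      ‖x‖ ^ i.1.1 • iteratedFDeriv ℝ i.1.2 f x + ‖x‖ ^ i.1.1 • iteratedFDeriv ℝ i.1.2 g x
    rw [iteratedFDeriv_add_apply (f.smooth _).contDiffAt (g.smooth _).contDiffAt, smul_add]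
  map_smul' c f := by
    refine funext fun i => BoundedContinuousFunction.ext fun x => ?_
    change ‖x‖ ^ i.1.1 • iteratedFDeriv ℝ i.1.2 (c • (f : V → ℂ)) x =
      c • ‖x‖ ^ i.1.1 • iteratedFDeriv ℝ i.1.2 f x
    rw [iteratedFDeriv_const_smul_apply (f.smooth _).contDiffAt, smul_comm]

theorem norm_jetMap_le (s : Finset (ℕ × ℕ)) (f : 𝓢(V, ℂ)) :
    ‖jetMap s f‖ ≤ ∑ i ∈ s, SchwartzMap.seminorm ℝ i.1 i.2 f := by
  refine (pi_norm_le_iff_of_nonneg (Finset.sum_nonneg fun _ _ => apply_nonneg _ _)).2 fun i => ?_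
  refine (BoundedContinuousFunction.norm_le (Finset.sum_nonneg fun _ _ => apply_nonneg _ _)).2 fun x => ?_
  change ‖‖x‖ ^ i.1.1 • iteratedFDeriv ℝ i.1.2 f x‖ ≤ _
  rw [norm_smul, norm_pow, norm_norm]
  exact (SchwartzMap.le_seminorm ℝ _ _ f x).trans
    (Finset.single_le_sum (f := fun j : ℕ × ℕ => SchwartzMap.seminorm ℝ j.1 j.2 f)
      (fun _ _ => apply_nonneg _ _) i.2)

theorem seminorm_le_norm_jetMap (s : Finset (ℕ × ℕ)) (f : 𝓢(V, ℂ)) {i : ℕ × ℕ} (hi : i ∈ s) :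
    SchwartzMap.seminorm ℂ i.1 i.2 f ≤ ‖jetMap s f‖ := by
  refine SchwartzMap.seminorm_le_bound ℂ _ _ _ (norm_nonneg _) fun x => ?_
  have h1 := norm_le_pi_norm (ι := s) (G := fun i : s => BoundedContinuousFunction V (V [×i.1.2]→L[ℝ] ℂ)) (jetMap s f) ⟨i, hi⟩
  have h2 := (jetMap s f ⟨i, hi⟩).norm_coe_le_norm x
  have h3 : ‖jetMap s f ⟨i, hi⟩ x‖ = ‖x‖ ^ i.1 * ‖iteratedFDeriv ℝ i.2 f x‖ := by
    change ‖‖x‖ ^ i.1 • iteratedFDeriv ℝ i.2 f x‖ = _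
    rw [norm_smul, norm_pow, norm_norm]
  exact h3.symm.le.trans (h2.trans h1)

theorem continuous_jetMap (s : Finset (ℕ × ℕ)) : Continuous (jetMap (V := V) s) := by
  have hc : Continuous fun f : 𝓢(V, ℂ) => ∑ i ∈ s, SchwartzMap.seminorm ℝ i.1 i.2 f :=
    continuous_finsetSum _ fun i _ => (schwartz_withSeminorms ℝ V ℂ).continuous_seminorm i
  refine continuous_of_continuousAt_zero (jetMap s) ?_
  rw [ContinuousAt, map_zero]
  refine squeeze_zero_norm (norm_jetMap_le s) ?_
  have := hc.tendsto 0
  simpa using this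

/-- A tempered distribution factors through finitely many weighted jets. -/
theorem exists_factor_jetMap (σ : 𝓢'(V, ℂ)) : ∃ (s : Finset (ℕ × ℕ))
    (g : StrongDual ℂ (JetSpace V s)),
    ∀ f, σ f = g (jetMap s f) := by
  let σ' : 𝓢(V, ℂ) →L[ℂ] ℂ := σ
  let q : Seminorm ℂ 𝓢(V, ℂ) := (normSeminorm ℂ ℂ).comp σ'.toLinearMap
  have hq : Continuous q := continuous_norm.comp σ'.continuous
  obtain ⟨s, C, -, hC⟩ := Seminorm.bound_of_continuous (schwartz_withSeminorms ℂ V ℂ) q hq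
  have hb : ∀ f, ‖σ' f‖ ≤ C * ‖jetMap s f‖ := by
    intro f
    have h1 : ‖σ' f‖ ≤ C * (s.sup (schwartzSeminormFamily ℂ V ℂ)) f := hC f
    refine h1.trans ?_
    gcongr
    exact Seminorm.finset_sup_apply_le (norm_nonneg _) fun i hi => seminorm_le_norm_jetMap s f hi
  -- A purely algebraic section of the jet map. The composite of σ with it is bounded on the range
  -- by the seminorm estimate, so Hahn–Banach extends it.
  obtain ⟨r, hr⟩ := (jetMap s).rangeRestrict.exists_rightInverse_of_surjective
    (jetMap (V := V) s).range_rangeRestrict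
  have hr' : ∀ y : (jetMap (V := V) s).range, jetMap s (r y) = y := fun y =>
    congrArg Subtype.val (LinearMap.congr_fun hr y)
  let g₀ : StrongDual ℂ (jetMap (V := V) s).range :=
    (σ'.toLinearMap ∘ₗ r).mkContinuous C fun y => by
      have := hb (r y)
      rw [hr'] at this
      exact this
  obtain ⟨g, hg, -⟩ := exists_extension_norm_eq _ g₀
  refine ⟨s, g, fun f => ?_⟩
  have h1 := hg ⟨jetMap s f, f, rfl⟩
  rw [h1]
  have h2 : g₀ ⟨jetMap s f, f, rfl⟩ = σ' (r ⟨jetMap s f, f, rfl⟩) := rfl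
  rw [h2]
  -- The choice of section is immaterial: σ vanishes on every function whose listed jets vanish.
  have h3 := hb (f - r ⟨jetMap s f, f, rfl⟩)
  rw [map_sub, map_sub, hr', sub_self, norm_zero, mul_zero] at h3
  exact sub_eq_zero.1 (norm_le_zero_iff.1 h3)

variable {A : Type*} [TopologicalSpace A] [SecondCountableTopology A] [MeasurableSpace A] [BorelSpace A]
  {ν : Measure A}

/-- A tempered distribution commutes with integrals of families of Schwartz functions. -/
theorem tempered_apply_superposition (σ : 𝓢'(V, ℂ)) {u : A → 𝓢(V, ℂ)} {f : 𝓢(V, ℂ)} (hu : Continuous u)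
    (hint : ∀ k n, Integrable (fun a => SchwartzMap.seminorm ℝ k n (u a)) ν)
    (hf : ∀ t, f t = ∫ a, u a t ∂ν) : σ f = ∫ a, σ (u a) ∂ν := by
  obtain ⟨s, g, hg⟩ := exists_factor_jetMap σ
  have hi : Integrable (fun a => jetMap s (u a)) ν :=
    (integrable_finsetSum s fun i _ => hint i.1 i.2).mono'
      ((continuous_jetMap s).comp hu).aestronglyMeasurable (.of_forall fun a => norm_jetMap_le s (u a))
  simp only [hg]
  rw [g.integral_comp_comm hi]
  congr 1
  -- The jets of f are the Bochner integral of the jets of u(a): point evaluations separate jets,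
  -- and each of them commutes with the integral.
  refine funext fun i => BoundedContinuousFunction.ext fun x => ?_
  change jetEval s i x (jetMap s f) = jetEval s i x (∫ a, jetMap s (u a) ∂ν)
  have h2 : ∀ h : 𝓢(V, ℂ), jetEval s i x (jetMap s h) =
    ‖x‖ ^ i.1.1 • iteratedFDeriv ℝ i.1.2 h x := fun h => rfl
  rw [← (jetEval s i x).integral_comp_comm hi]
  simp only [h2]
  rw [integral_smul, iteratedFDeriv_superposition i.1.2 hu hint hf]

end SchwartzJets

/-! ### Short-time Fourier transform of tempered distributions -/

section DistSTFT
open scoped FourierTransform RealInnerProductSpace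
variable {V : Type} [NormedAddCommGroup V] [InnerProductSpace ℝ V] [FiniteDimensional ℝ V]
  [MeasurableSpace V] [BorelSpace V]

/-- Modulation is translation conjugated by the Fourier transform, so its continuity and polynomial
bounds are inherited from those of translation. -/
theorem smulLeftCLM_character_eq (ξ : V) (f : 𝓢(V, ℂ)) :
    SchwartzMap.smulLeftCLM ℂ (character ξ) f = 𝓕⁻ (SchwartzMap.compSubConstCLM ℂ ξ (𝓕 f)) := by
  have h : 𝓕 (SchwartzMap.smulLeftCLM ℂ (character ξ) f) = SchwartzMap.compSubConstCLM ℂ ξ (𝓕 f) := by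
    ext w
    rw [SchwartzMap.compSubConstCLM_apply, SchwartzMap.fourier_coe, SchwartzMap.fourier_coe,
      Real.fourier_eq', Real.fourier_eq']
    congr 1 with t
    rw [SchwartzMap.smulLeftCLM_apply_apply (character_hasTemperateGrowth ξ), character, smul_eq_mul,
      smul_eq_mul, smul_eq_mul, ← mul_assoc, ← Complex.exp_add]
    congr 2
    rw [inner_sub_right, real_inner_comm t ξ]
    push_cast
    ring
  rw [← h, FourierTransform.fourierInv_fourier_eq]

theorem conjGaussianShift_eq (x ξ : V) : conjGaussianShift x ξ =
    𝓕⁻ (SchwartzMap.compSubConstCLM ℂ (-ξ) (𝓕 (SchwartzMap.compSubConstCLM ℂ x (gaussian V)))) :=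
  smulLeftCLM_character_eq _ _

theorem continuous_conjGaussianShift : Continuous fun p : V × V => conjGaussianShift p.1 p.2 := by
  simp only [conjGaussianShift_eq]
  have h1 : Continuous fun p : V × V => SchwartzMap.compSubConstCLM ℂ p.1 (gaussian V) :=
    continuous_translate.comp (by fun_prop : Continuous fun p : V × V => (p.1, gaussian V))
  have h2 : Continuous fun p : V × V => 𝓕 (SchwartzMap.compSubConstCLM ℂ p.1 (gaussian V)) :=
    (FourierTransform.fourierCLM ℂ 𝓢(V, ℂ)).continuous.comp h1
  have h3 := continuous_translate.comp
    ((continuous_snd.neg : Continuous fun p : V × V => -p.2).prodMk h2)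
  exact (FourierTransform.fourierInvCLM ℂ 𝓢(V, ℂ)).continuous.comp h3

theorem schwartzPolyBounded_conjGaussianShift :
    SchwartzPolyBounded fun p : V × V => conjGaussianShift p.1 p.2 := by
  simp only [conjGaussianShift_eq]
  have h0 : SchwartzPolyBounded fun p : V × V => gaussian V := fun k n =>
    ⟨SchwartzMap.seminorm ℝ k n (gaussian V), 0, apply_nonneg _ _, fun a => by simp⟩
  have h1 := h0.translate (x := fun p : V × V => p.1) fun a => norm_fst_le a
  have h2 := h1.clm ((FourierTransform.fourierCLM ℂ 𝓢(V, ℂ)).restrictScalars ℝ)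
  have h3 := h2.translate (x := fun p : V × V => -p.2) fun a => by rw [norm_neg]; exact norm_snd_le a
  exact h3.clm ((FourierTransform.fourierInvCLM ℂ 𝓢(V, ℂ)).restrictScalars ℝ)

theorem continuous_distSTFT (σ : 𝓢'(V, ℂ)) : Continuous fun p : V × V => distSTFT σ p.1 p.2 :=
  (show Continuous (σ : 𝓢(V, ℂ) →L[ℂ] ℂ) from ContinuousLinearMap.continuous _).comp
    continuous_conjGaussianShift

theorem continuous_stft_shift_gaussian (a b : V) :
    Continuous fun p : V × V => stft (gaussian V) (shift a b (gaussian V)) p.1 p.2 := by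
  simp only [stft_shift, stft_gaussian_gaussian]
  refine (continuous_character.comp (by fun_prop : Continuous fun p : V × V => (b - p.2, a))).mul
    ((Complex.continuous_ofReal.comp (by fun_prop)).mul (continuous_character.comp
      (by fun_prop : Continuous fun p : V × V => (-(p.2 - b), (2⁻¹ : ℝ) • (p.1 - a)))))

/-- Completing the square, -(π/2)r² ≤ α²/(2π) - αr. Exponentials are the working decay profile
because, unlike Gaussians, they change only by a bounded factor under a bounded translation. -/
theorem norm_stft_gaussian_shift_gaussian_le (α : ℝ) (a p : V × V) :
    ‖stft (gaussian V) (shift a.1 a.2 (gaussian V)) p.1 p.2‖ ≤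
      Real.exp (α ^ 2 / (2 * Real.pi)) * Real.exp (-α * ‖p - a‖) := by
  rw [norm_stft_gaussian_shift_gaussian, ← Real.exp_add]
  apply Real.exp_le_exp.2
  have hpi := Real.pi_pos
  have h1 : ‖p - a‖ ^ 2 ≤ ‖p.1 - a.1‖ ^ 2 + ‖p.2 - a.2‖ ^ 2 := by
    rw [Prod.norm_def]
    rcases max_cases ‖(p - a).1‖ ‖(p - a).2‖ with h | h <;> rw [h.1] <;>
      simp only [Prod.fst_sub, Prod.snd_sub] <;> nlinarith [norm_nonneg (p.1 - a.1), norm_nonneg (p.2 - a.2),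
        sq_nonneg ‖p.1 - a.1‖, sq_nonneg ‖p.2 - a.2‖]
  have h2 : 0 ≤ Real.pi / 2 * (‖p - a‖ - α / Real.pi) ^ 2 := by positivity
  have h3 : Real.pi / 2 * (‖p - a‖ - α / Real.pi) ^ 2 =
      Real.pi / 2 * ‖p - a‖ ^ 2 - α * ‖p - a‖ + α ^ 2 / (2 * Real.pi) := by
    field_simp
    ring
  nlinarith


theorem exists_pow_mul_exp_le {α : ℝ} (hα : 0 < α) (M : ℕ) :
    ∃ C : ℝ, 0 ≤ C ∧ ∀ r : ℝ, 0 ≤ r → (1 + r) ^ M * Real.exp (-α * r) ≤ C := by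
  refine ⟨M.factorial / α ^ M * Real.exp α, by positivity, fun r hr => ?_⟩
  have h1 : (α * (1 + r)) ^ M / (M.factorial : ℝ) ≤ Real.exp (α * (1 + r)) :=
    Real.pow_div_factorial_le_exp _ (by positivity) M
  have hM : (0 : ℝ) < M.factorial := by exact_mod_cast M.factorial_pos
  rw [div_le_iff₀ hM, mul_pow] at h1
  have h2 : (1 + r) ^ M ≤ Real.exp (α * (1 + r)) * M.factorial / α ^ M := by
    rw [le_div_iff₀ (by positivity)]; linarith
  calc (1 + r) ^ M * Real.exp (-α * r) ≤ Real.exp (α * (1 + r)) * M.factorial / α ^ M * Real.exp (-α * r) := by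
        gcongr
    _ = M.factorial / α ^ M * (Real.exp (α * (1 + r)) * Real.exp (-α * r)) := by ring
    _ = _ := by rw [← Real.exp_add]; ring_nf

theorem integrable_pow_mul_exp {X : Type*} [NormedAddCommGroup X] [NormedSpace ℝ X] [FiniteDimensional ℝ X]
    [MeasurableSpace X] [BorelSpace X] (μ : Measure X) [μ.IsAddHaarMeasure] {α : ℝ} (hα : 0 < α) (N : ℕ) :
    Integrable (fun x : X => (1 + ‖x‖) ^ N * Real.exp (-α * ‖x‖)) μ := by
  obtain ⟨C, hC0, hC⟩ := exists_pow_mul_exp_le hα (N + (Module.finrank ℝ X + 1))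
  have h := (integrable_one_add_norm (E := X) (μ := μ) (r := (Module.finrank ℝ X + 1 : ℕ))
    (by push_cast; linarith)).const_mul C
  refine h.mono' (by fun_prop) (.of_forall fun x => ?_)
  have h1 := hC ‖x‖ (norm_nonneg x)
  have h0 : (0 : ℝ) < 1 + ‖x‖ := by linarith [norm_nonneg x]
  rw [Real.norm_of_nonneg (by positivity), Real.rpow_neg h0.le, Real.rpow_natCast, ← div_eq_mul_inv,
    le_div_iff₀ (by positivity)]
  rw [pow_add] at h1
  linarith

theorem one_add_norm_pow_le {X : Type*} [NormedAddCommGroup X] (N : ℕ) (x y : X) :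
    (1 + ‖x + y‖) ^ N ≤ (1 + ‖x‖) ^ N * (1 + ‖y‖) ^ N := by
  rw [← mul_pow]
  gcongr
  nlinarith [norm_add_le x y, norm_nonneg x, norm_nonneg y, mul_nonneg (norm_nonneg x) (norm_nonneg y)]

theorem integrable_pow_mul_exp_sub {X : Type*} [NormedAddCommGroup X] [NormedSpace ℝ X]
    [FiniteDimensional ℝ X] [MeasurableSpace X] [BorelSpace X] (μ : Measure X) [μ.IsAddHaarMeasure]
    {α : ℝ} (hα : 0 < α) (N : ℕ) (a : X) :
    Integrable (fun x : X => (1 + ‖x‖) ^ N * Real.exp (-α * ‖x - a‖)) μ := by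
  have h := ((integrable_pow_mul_exp μ hα N).comp_sub_right a).const_mul ((1 + ‖a‖) ^ N)
  refine h.mono' (by fun_prop) (.of_forall fun x => ?_)
  have := one_add_norm_pow_le N a (x - a)
  rw [add_sub_cancel] at this
  rw [Real.norm_of_nonneg (by positivity), ← mul_assoc]
  gcongr

instance instIsAddHaarMeasureVolumeProd :
    (volume : Measure (V × V)).IsAddHaarMeasure :=
  inferInstanceAs ((volume : Measure V).prod (volume : Measure V)).IsAddHaarMeasure

/-- Coefficient function of the reproducing formula. -/
theorem integrable_stft_shift_gaussian_mul_pow (a : V × V) (N : ℕ) :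
    Integrable fun p : V × V =>
      ‖stft (gaussian V) (shift a.1 a.2 (gaussian V)) p.1 p.2‖ * (1 + ‖p‖) ^ N := by
  have h := (integrable_pow_mul_exp_sub (volume : Measure (V × V)) one_pos N a).const_mul
    (Real.exp (1 ^ 2 / (2 * Real.pi)))
  refine h.mono' ?_ (.of_forall fun p => ?_)
  · exact ((continuous_stft_shift_gaussian a.1 a.2).norm.mul (by fun_prop)).aestronglyMeasurable
  · have := norm_stft_gaussian_shift_gaussian_le 1 a p
    rw [Real.norm_of_nonneg (by positivity)]
    calc _ ≤ (Real.exp (1 ^ 2 / (2 * Real.pi)) * Real.exp (-1 * ‖p - a‖)) * (1 + ‖p‖) ^ N := by gcongr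
      _ = _ := by ring

theorem conjGaussianShift_eq_conj (x ξ t : V) :
    conjGaussianShift x ξ t = conj (shift x ξ (gaussian V) t) := by
  rw [conjGaussianShift_apply, shift, map_mul, conj_character, conj_gaussian]

theorem integrable_stft_shift_gaussian (a : V × V) :
    Integrable fun p : V × V => stft (gaussian V) (shift a.1 a.2 (gaussian V)) p.1 p.2 := by
  have h := integrable_stft_shift_gaussian_mul_pow a 0
  simp only [pow_zero, mul_one] at h
  exact (integrable_norm_iff (continuous_stft_shift_gaussian a.1 a.2).aestronglyMeasurable).1 h

/-- The inversion formula holds almost everywhere, and both sides are continuous in t. Equality at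
every t is required before σ can be applied. -/
theorem conjGaussianShift_superposition (a b t : V) : conjGaussianShift a b t =
    ∫ p : V × V, conj (stft (gaussian V) (shift a b (gaussian V)) p.1 p.2) * conjGaussianShift p.1 p.2 t := by
  have hc := (Complex.continuous_conj.comp (continuous_stft_shift_gaussian a b))
  have hcg : Continuous fun q : (V × V) × V => conjGaussianShift q.1.1 q.1.2 q.2 := by
    simp only [conjGaussianShift_apply]
    exact (continuous_character.comp (by fun_prop : Continuous fun q : (V × V) × V => (-q.1.2, q.2))).mul
      ((gaussian V).continuous.comp (by fun_prop))
  have hb : ∀ (p : V × V) t, ‖conjGaussianShift p.1 p.2 t‖ ≤ SchwartzMap.seminorm ℝ 0 0 (gaussian V) := by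
    intro p t
    rw [conjGaussianShift_apply, norm_mul, norm_character, one_mul]
    exact SchwartzMap.norm_le_seminorm ℝ _ _
  have hR : Continuous fun t => ∫ p : V × V,
      conj (stft (gaussian V) (shift a b (gaussian V)) p.1 p.2) * conjGaussianShift p.1 p.2 t := by
    refine continuous_of_dominated (bound := fun p => ‖stft (gaussian V) (shift a b (gaussian V)) p.1 p.2‖ *
      SchwartzMap.seminorm ℝ 0 0 (gaussian V)) (fun t => ?_) (fun t => .of_forall fun p => ?_) ?_
      (.of_forall fun p => ?_)
    · exact (hc.mul (hcg.comp (by fun_prop : Continuous fun p : V × V => (p, t)))).aestronglyMeasurable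
    · rw [norm_mul, RCLike.norm_conj]
      gcongr
      exact hb p t
    · exact (integrable_stft_shift_gaussian (a, b)).norm.mul_const _
    · exact continuous_const.mul (conjGaussianShift p.1 p.2).continuous
  have hae := ae_eq_superposition_gaussian (memLp_shift (memLp_gaussian (V := V)) a b)
    (integrable_stft_shift_gaussian (a, b))
  refine congrFun ((conjGaussianShift a b).continuous.ae_eq_iff_eq volume hR |>.1 ?_) t
  filter_upwards [hae] with t ht
  rw [conjGaussianShift_eq_conj, ht, ← integral_conj]
  congr 1 with p
  rw [map_mul, conjGaussianShift_eq_conj]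

/-- Reproducing formula for the short-time Fourier transform of a tempered distribution. -/
theorem distSTFT_reproducing (σ : 𝓢'(V, ℂ)) (a b : V) : distSTFT σ a b =
    ∫ p : V × V, conj (stft (gaussian V) (shift a b (gaussian V)) p.1 p.2) * distSTFT σ p.1 p.2 := by
  have hc := (Complex.continuous_conj.comp (continuous_stft_shift_gaussian a b))
  have := tempered_apply_superposition (ν := (volume : Measure (V × V))) σ (f := conjGaussianShift a b)
    (u := fun p : V × V => conj (stft (gaussian V) (shift a b (gaussian V)) p.1 p.2) •
      conjGaussianShift p.1 p.2) (hc.smul continuous_conjGaussianShift) ?_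
    (fun t => conjGaussianShift_superposition a b t)
  · rw [distSTFT, this]
    congr 1 with p
    exact (σ : 𝓢(V, ℂ) →L[ℂ] ℂ).map_smul _ _
  · intro k n
    obtain ⟨C, N, hC0, hC⟩ := schwartzPolyBounded_conjGaussianShift (V := V) k n
    refine ((integrable_stft_shift_gaussian_mul_pow (a, b) N).const_mul C).mono' ?_ (.of_forall fun p => ?_)
    · exact (((schwartz_withSeminorms ℝ V ℂ).continuous_seminorm (k, n)).comp
        (hc.smul continuous_conjGaussianShift)).aestronglyMeasurable
    · rw [Real.norm_of_nonneg (apply_nonneg _ _)]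
      have e : SchwartzMap.seminorm ℝ k n (conj (stft (gaussian V) (shift a b (gaussian V)) p.1 p.2) •
          conjGaussianShift p.1 p.2) = ‖stft (gaussian V) (shift a b (gaussian V)) p.1 p.2‖ *
          SchwartzMap.seminorm ℝ k n (conjGaussianShift p.1 p.2) := by
        have := map_smul_eq_mul (SchwartzMap.seminorm ℂ k n)
          (conj (stft (gaussian V) (shift a b (gaussian V)) p.1 p.2)) (conjGaussianShift p.1 p.2)
        rw [RCLike.norm_conj] at this
        exact this
      rw [e]
      calc _ ≤ ‖stft (gaussian V) (shift a b (gaussian V)) p.1 p.2‖ * (C * (1 + ‖p‖) ^ N) := by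
            gcongr; exact hC p
        _ = _ := by ring

end DistSTFT

/-! ### Phase space as a product of position and frequency -/

section PhaseSpace
variable {d : ℕ}

@[simp] theorem pos_pt (x ξ : Conf d) : pos (pt x ξ) = x := rfl
@[simp] theorem freq_pt (x ξ : Conf d) : freq (pt x ξ) = ξ := rfl
@[simp] theorem pt_pos_freq (z : Phase d) : pt (pos z) (freq z) = z := by
  ext i; cases i <;> rfl

theorem pos_sub (z w : Phase d) : pos (z - w) = pos z - pos w := rfl
theorem freq_sub (z w : Phase d) : freq (z - w) = freq z - freq w := rfl
theorem pos_add (z w : Phase d) : pos (z + w) = pos z + pos w := rfl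
theorem freq_add (z w : Phase d) : freq (z + w) = freq z + freq w := rfl
theorem pos_smul (c : ℝ) (z : Phase d) : pos (c • z) = c • pos z := rfl
theorem freq_smul (c : ℝ) (z : Phase d) : freq (c • z) = c • freq z := rfl

theorem pt_add (x ξ y η : Conf d) : pt (x + y) (ξ + η) = pt x ξ + pt y η := by
  ext i; cases i <;> rfl
theorem pt_smul (c : ℝ) (x ξ : Conf d) : pt (c • x) (c • ξ) = c • pt x ξ := by
  ext i; cases i <;> rfl

theorem phase_ext {z w : Phase d} (h1 : pos z = pos w) (h2 : freq z = freq w) : z = w := by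
  rw [← pt_pos_freq z, ← pt_pos_freq w, h1, h2]

theorem inner_phase (z w : Phase d) :
    inner ℝ z w = inner ℝ (pos z) (pos w) + inner ℝ (freq z) (freq w) := by
  simp only [PiLp.inner_apply, Fintype.sum_sum_type]
  rfl

theorem norm_sq_phase (z : Phase d) : ‖z‖ ^ 2 = ‖pos z‖ ^ 2 + ‖freq z‖ ^ 2 := by
  rw [← real_inner_self_eq_norm_sq, ← real_inner_self_eq_norm_sq, ← real_inner_self_eq_norm_sq,
    inner_phase]

theorem character_phase (z w : Phase d) :
    character z w = character (pos z) (pos w) * character (freq z) (freq w) := by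
  simp only [character, inner_phase, ← Complex.exp_add]
  push_cast
  ring_nf

theorem finrank_phase : Module.finrank ℝ (Phase d) = Module.finrank ℝ (Conf d) + Module.finrank ℝ (Conf d) := by
  simp

theorem gaussian_phase (z : Phase d) :
    gaussian (Phase d) z = gaussian (Conf d) (pos z) * gaussian (Conf d) (freq z) := by
  simp only [gaussian_apply, finrank_phase, norm_sq_phase]
  rw [← Complex.ofReal_mul]
  congr 1
  rw [mul_add, Real.exp_add]
  push_cast
  rw [add_div, Real.rpow_add two_pos]
  ring

/-- The identification of `ℝ^d × ℝ^d` with phase space. -/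
def ptHomeomorph : Conf d × Conf d ≃ₜ Phase d where
  toFun p := pt p.1 p.2
  invFun z := (pos z, freq z)
  left_inv p := rfl
  right_inv z := pt_pos_freq z
  continuous_toFun := by
    refine (PiLp.continuous_toLp 2 _).comp (continuous_pi fun i => ?_)
    cases i <;> simp <;> fun_prop
  continuous_invFun := by
    refine .prodMk ((PiLp.continuous_toLp 2 _).comp (continuous_pi fun i => ?_))
      ((PiLp.continuous_toLp 2 _).comp (continuous_pi fun i => ?_)) <;> fun_prop

theorem continuous_pos : Continuous (pos : Phase d → Conf d) :=
  (ptHomeomorph (d := d)).symm.continuous.fst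
theorem continuous_freq : Continuous (freq : Phase d → Conf d) :=
  (ptHomeomorph (d := d)).symm.continuous.snd
theorem continuous_pt : Continuous fun p : Conf d × Conf d => pt p.1 p.2 :=
  (ptHomeomorph (d := d)).continuous

theorem measurePreserving_pt :
    MeasurePreserving (fun p : Conf d × Conf d => pt p.1 p.2) (volume.prod volume) volume := by
  have h1 := (PiLp.volume_preserving_ofLp (Fin d)).prod (PiLp.volume_preserving_ofLp (Fin d))
  have h2 := measurePreserving_sumPiEquivProdPi_symm (X := fun _ : Fin d ⊕ Fin d => ℝ) (fun _ => volume)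
  have h3 := PiLp.volume_preserving_toLp (Fin d ⊕ Fin d)
  have := h3.comp (h2.comp h1)
  refine (show (fun p : Conf d × Conf d => pt p.1 p.2) = _ from ?_) ▸ this
  funext p
  ext i
  cases i <;> rfl

theorem measurableEmbedding_pt : MeasurableEmbedding fun p : Conf d × Conf d => pt p.1 p.2 :=
  (ptHomeomorph (d := d)).measurableEmbedding

theorem integral_phase (F : Phase d → ℂ) :
    ∫ z, F z = ∫ p : Conf d × Conf d, F (pt p.1 p.2) ∂(volume.prod volume) :=
  (measurePreserving_pt.integral_comp measurableEmbedding_pt F).symm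

theorem memLp_phase_iff {F : Phase d → ℂ} {q : ℝ≥0∞} :
    MemLp F q ↔ MemLp (fun p : Conf d × Conf d => F (pt p.1 p.2)) q (volume.prod volume) := by
  rw [← measurePreserving_pt.map_eq, measurableEmbedding_pt.memLp_map_measure_iff]
  rfl

end PhaseSpace

/-! ### The shear underlying the Wigner distribution -/

section Wigner
variable {V : Type*} [NormedAddCommGroup V] [InnerProductSpace ℝ V] [FiniteDimensional ℝ V]
  [MeasurableSpace V] [BorelSpace V]

/-- The map factors, up to swaps, into (a, b) ↦ (a, b + τa) and (a, b) ↦ (a, a - b), each of which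
preserves measure on every fibre. -/
theorem measurePreserving_wignerShear (τ : ℝ) :
    MeasurePreserving (fun p : V × V => (p.1 + τ • p.2, p.1 - (1 - τ) • p.2)) (volume.prod volume)
      (volume.prod volume) := by
  have h1 : MeasurePreserving (fun p : V × V => (p.1, p.2 + τ • p.1)) (volume.prod volume)
      (volume.prod volume) :=
    (MeasurePreserving.id volume).skew_product (g := fun a b => b + τ • a) (by fun_prop)
      (.of_forall fun a => (measurePreserving_add_right volume (τ • a)).map_eq)
  have h2 : MeasurePreserving (fun p : V × V => (p.1, p.1 - p.2)) (volume.prod volume)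
      (volume.prod volume) :=
    (MeasurePreserving.id volume).skew_product (g := fun a b => a - b) (by fun_prop)
      (.of_forall fun a => (Measure.measurePreserving_sub_left volume a).map_eq)
  have h3 := h2.comp (Measure.measurePreserving_swap.comp (h1.comp Measure.measurePreserving_swap))
  convert h3 using 1
  funext p
  simp only [Function.comp_apply, Prod.swap, Prod.mk.injEq, true_and]
  module

theorem measurableEmbedding_wignerShear (τ : ℝ) :
    MeasurableEmbedding (fun p : V × V => (p.1 + τ • p.2, p.1 - (1 - τ) • p.2)) := by
  let e : V × V ≃ₜ V × V :=
    { toFun := fun p => (p.1 + τ • p.2, p.1 - (1 - τ) • p.2)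
      invFun := fun q => ((1 - τ) • q.1 + τ • q.2, q.1 - q.2)
      left_inv := fun p => by ext : 1 <;> simp <;> module
      right_inv := fun p => by ext : 1 <;> (simp; module)
      continuous_toFun := by fun_prop
      continuous_invFun := by fun_prop }
  exact e.measurableEmbedding

/-- The function whose partial Fourier transform is the cross-`τ`-Wigner distribution. -/
def wignerIntegrand (τ : ℝ) (f h : V → ℂ) (p : V × V) : ℂ :=
  f (p.1 + τ • p.2) * conj (h (p.1 - (1 - τ) • p.2))

theorem memLp_wignerIntegrand (τ : ℝ) {f h : V → ℂ} (hf : MemLp f 2) (hh : MemLp h 2) :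
    MemLp (wignerIntegrand τ f h) 2 (volume.prod volume) :=
  (memLp_two_mul_prod hf hh.star).comp_measurePreserving (measurePreserving_wignerShear τ)

theorem integrable_wignerIntegrand (τ : ℝ) {f h : V → ℂ} (hf : Integrable f) (hh : Integrable h) :
    Integrable (wignerIntegrand τ f h) (volume.prod volume) := by
  have h1 : Integrable (fun t => conj (h t)) := (memLp_one_iff_integrable.1 (memLp_one_iff_integrable.2 hh).star)
  exact (measurePreserving_wignerShear τ).integrable_comp_of_integrable (hf.mul_prod h1)

end Wigner

/-! ### The τ-Wigner distribution: Moyal identity, covariance, kernel -/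

section TauWigner
variable {d : ℕ}
open scoped FourierTransform

theorem tauWigner_eq_fourier (τ : ℝ) (f h : Conf d → ℂ) (z : Phase d) :
    tauWigner τ f h z = 𝓕 (fun y => wignerIntegrand τ f h (pos z, y)) (freq z) := by
  rw [Real.fourier_eq', tauWigner]
  congr 1 with y
  rw [wignerIntegrand, character, smul_eq_mul, mul_assoc, inner_neg_left, real_inner_comm]
  congr 2
  push_cast
  ring

theorem memLp_tauWigner (τ : ℝ) {f h : Conf d → ℂ} (hf : MemLp f 2) (hf1 : Integrable f)
    (hh : MemLp h 2) (hh1 : Integrable h) : MemLp (tauWigner τ f h) 2 := by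
  rw [memLp_phase_iff]
  simp only [tauWigner_eq_fourier, pos_pt, freq_pt]
  exact memLp_partialFourier (memLp_wignerIntegrand τ hf hh)
    (integrable_wignerIntegrand τ hf1 hh1).prod_right_ae

/-- Moyal's identity: Parseval in y, after which the shear separates the two arguments. -/
theorem integral_conj_tauWigner_mul (τ : ℝ) {f h f' h' : Conf d → ℂ} (hf : MemLp f 2)
    (hf1 : Integrable f) (hh : MemLp h 2) (hh1 : Integrable h) (hf' : MemLp f' 2)
    (hf1' : Integrable f') (hh' : MemLp h' 2) (hh1' : Integrable h') :
    ∫ z, conj (tauWigner τ f' h' z) * tauWigner τ f h z =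
      (∫ t, conj (f' t) * f t) * ∫ t, h' t * conj (h t) := by
  rw [integral_phase]
  simp only [tauWigner_eq_fourier, pos_pt, freq_pt]
  rw [integral_conj_partialFourier_mul (memLp_wignerIntegrand τ hf hh)
    (integrable_wignerIntegrand τ hf1 hh1).prod_right_ae (memLp_wignerIntegrand τ hf' hh')
    (integrable_wignerIntegrand τ hf1' hh1').prod_right_ae, ← integral_prod_mul]
  refine Eq.trans ?_ ((measurePreserving_wignerShear τ).integral_comp (measurableEmbedding_wignerShear τ)
    fun q : Conf d × Conf d => conj (f' q.1) * f q.1 * (h' q.2 * conj (h q.2)))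
  refine integral_congr_ae (.of_forall fun p => ?_)
  simp only [wignerIntegrand, map_mul, Complex.conj_conj]
  ring

/-- The frequency shift that accompanies `mapT` in the covariance of the Wigner distribution. -/
def mapJ (w z : Phase d) : Phase d := pt (freq w - freq z) (pos z - pos w)

/-- The substitution y ↦ y + (pos w - pos z) brings both arguments back to f and h, and the
remaining phases are a constant, a character in q and a change of the frequency of the y-integral.
Consequently all Gabor matrix entries are brackets of σ with shifts of one single window. -/
theorem tauWigner_tfShift (τ : ℝ) (f h : Conf d → ℂ) (w z : Phase d) : ∃ c : ℂ, ‖c‖ = 1 ∧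
    ∀ q, tauWigner τ (tfShift w f) (tfShift z h) q =
      c * shift (mapT τ w z) (mapJ w z) (tauWigner τ f h) q := by
  refine ⟨character (τ • freq w + (1 - τ) • freq z) (pos w - pos z), norm_character _ _, fun q => ?_⟩
  simp only [tauWigner, shift, tfShift]
  rw [← integral_add_right_eq_self _ (pos w - pos z), ← integral_const_mul, ← integral_const_mul]
  congr 1 with y
  simp only [map_mul, conj_character, pos_sub, freq_sub, mapT, mapJ, character_phase, pos_pt, freq_pt]
  have e1 : pos q + τ • (y + (pos w - pos z)) - pos w =
      pos q - ((1 - τ) • pos w + τ • pos z) + τ • y := by module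
  have e2 : pos q - (1 - τ) • (y + (pos w - pos z)) - pos z =
      pos q - ((1 - τ) • pos w + τ • pos z) - (1 - τ) • y := by module
  rw [e1, e2]
  have key : character (-freq q) (y + (pos w - pos z)) *
      character (freq w) (pos q + τ • (y + (pos w - pos z))) *
      character (-freq z) (pos q - (1 - τ) • (y + (pos w - pos z))) =
      character (τ • freq w + (1 - τ) • freq z) (pos w - pos z) *
      (character (freq w - freq z) (pos q) * character (pos z - pos w) (freq q)) *
      character (-(freq q - (τ • freq w + (1 - τ) • freq z))) y := by
    simp only [character, ← Complex.exp_add]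
    congr 1
    simp only [inner_add_left, inner_sub_left, inner_add_right, inner_sub_right, inner_neg_left,
      real_inner_smul_left, real_inner_smul_right, real_inner_comm (freq q) (pos z),
      real_inner_comm (freq q) (pos w)]
    push_cast
    ring
  linear_combination (f (pos q - ((1 - τ) • pos w + τ • pos z) + τ • y)) *
    conj (h (pos q - ((1 - τ) • pos w + τ • pos z) - (1 - τ) • y)) * key

theorem continuous_gaussian {V : Type*} [NormedAddCommGroup V] [InnerProductSpace ℝ V] :
    Continuous (gaussian V) := (gaussian V).continuous

theorem continuous_character_left {V : Type*} [NormedAddCommGroup V] [InnerProductSpace ℝ V] (ξ : V) :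
    Continuous (character ξ) := continuous_character.comp (by fun_prop : Continuous fun t : V => (ξ, t))

theorem integral_gaussian_sub_mul_character {V : Type*} [NormedAddCommGroup V] [InnerProductSpace ℝ V]
    [FiniteDimensional ℝ V] [MeasurableSpace V] [BorelSpace V] (c ξ : V) :
    ∫ t, character ξ t * gaussian V (t - c) = gaussian V ξ * character ξ c := by
  have h := integral_gaussian_character (V := V) one_pos c ξ
  simp only [mul_one, inv_one, Real.one_rpow, Complex.ofReal_one, one_mul, div_one] at h
  simp only [gaussian_apply, Complex.ofReal_mul]
  rw [mul_assoc, ← h, ← integral_const_mul]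
  congr 1 with t
  ring

/-- The kernel of `V_G W_τ(f, h)(z, ζ)` as a sesquilinear form in `f` and `h`. -/
def wignerKernel (τ : ℝ) (p : Phase d × Phase d) (q : Conf d × Conf d) : ℂ :=
  character (-pos p.2) ((1 - τ) • q.1 + τ • q.2) *
    gaussian (Conf d) ((1 - τ) • q.1 + τ • q.2 - pos p.1) *
    (gaussian (Conf d) (q.1 - q.2 + freq p.2) * character (-(q.1 - q.2 + freq p.2)) (freq p.1))

theorem continuous_wignerKernel (τ : ℝ) :
    Continuous fun r : (Phase d × Phase d) × (Conf d × Conf d) => wignerKernel τ r.1 r.2 := by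
  have hp : Continuous (pos : Phase d → Conf d) := continuous_pos
  have hf : Continuous (freq : Phase d → Conf d) := continuous_freq
  have hg := continuous_gaussian (V := Conf d)
  unfold wignerKernel
  refine .mul (.mul ?_ (by fun_prop)) (.mul (by fun_prop) ?_)
  · exact continuous_character.comp
      (f := fun r : (Phase d × Phase d) × (Conf d × Conf d) =>
        (-pos r.1.2, (1 - τ) • r.2.1 + τ • r.2.2)) (by fun_prop)
  · exact continuous_character.comp
      (f := fun r : (Phase d × Phase d) × (Conf d × Conf d) =>
        (-(r.2.1 - r.2.2 + freq r.1.2), freq r.1.1)) (by fun_prop)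

theorem norm_gaussian_le {V : Type*} [NormedAddCommGroup V] [InnerProductSpace ℝ V] (t : V) :
    ‖gaussian V t‖ ≤ 2 ^ ((Module.finrank ℝ V : ℝ) / 4) := by
  rw [gaussian_apply, Complex.norm_real, Real.norm_of_nonneg (by positivity)]
  refine mul_le_of_le_one_right (by positivity) (Real.exp_le_one_iff.2 ?_)
  nlinarith [Real.pi_pos, sq_nonneg ‖t‖]

theorem exists_norm_wignerKernel_le (d : ℕ) :
    ∃ C : ℝ, ∀ (τ : ℝ) (p : Phase d × Phase d) (q : Conf d × Conf d), ‖wignerKernel τ p q‖ ≤ C := by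
  refine ⟨2 ^ ((Module.finrank ℝ (Conf d) : ℝ) / 4) * 2 ^ ((Module.finrank ℝ (Conf d) : ℝ) / 4), fun τ p q => ?_⟩
  simp only [wignerKernel, norm_mul, norm_character, one_mul, mul_one]
  gcongr <;> exact norm_gaussian_le _

/-- The integral over the frequency variable ω of the Wigner distribution is the Fourier integral of
a Gaussian and can be carried out; the shear then replaces (x, y) by the arguments (s, t) of f and
h. An absolutely convergent sesquilinear form with bounded kernel results, into which superpositions
of f and h may be inserted. -/
theorem stft_tauWigner_eq (τ : ℝ) {f h : Conf d → ℂ} (hf : Integrable f) (hh : Integrable h)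
    (p : Phase d × Phase d) :
    stft (gaussian (Phase d)) (tauWigner τ f h) p.1 p.2 =
      ∫ q : Conf d × Conf d, f q.1 * conj (h q.2) * wignerKernel τ p q ∂(volume.prod volume) := by
  have hgi : Integrable (fun ω : Conf d => gaussian (Conf d) (ω - freq p.1)) :=
    (gaussian (Conf d)).integrable.comp_sub_right _
  have hF := integrable_wignerIntegrand τ hf hh
  have hI := hF.mul_prod hgi
  have hI2 : Integrable (fun r : (Conf d × Conf d) × Conf d =>
      wignerIntegrand τ f h r.1 * gaussian (Conf d) (r.2 - freq p.1) *
        (character (-r.2) r.1.2 * (character (-pos p.2) r.1.1 * gaussian (Conf d) (r.1.1 - pos p.1)) *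
          character (-freq p.2) r.2)) ((volume.prod volume).prod volume) := by
    refine hI.mul_bdd (c := 2 ^ ((Module.finrank ℝ (Conf d) : ℝ) / 4)) ?_ (.of_forall fun r => ?_)
    · refine Continuous.aestronglyMeasurable (.mul (.mul ?_ (.mul ?_ ?_)) ?_)
      · exact continuous_character.comp
          (f := fun r : (Conf d × Conf d) × Conf d => (-r.2, r.1.2)) (by fun_prop)
      · exact (continuous_character_left _).comp (by fun_prop)
      · exact continuous_gaussian.comp (by fun_prop)
      · exact (continuous_character_left _).comp (by fun_prop)
    · simp only [norm_mul, norm_character, one_mul, mul_one]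
      exact norm_gaussian_le _
  have e1 : ∀ q : Conf d × Conf d, ∫ ω : Conf d, wignerIntegrand τ f h q * gaussian (Conf d) (ω - freq p.1) *
        (character (-ω) q.2 * (character (-pos p.2) q.1 * gaussian (Conf d) (q.1 - pos p.1)) *
          character (-freq p.2) ω) = wignerIntegrand τ f h q *
          (character (-pos p.2) q.1 * gaussian (Conf d) (q.1 - pos p.1) *
          (gaussian (Conf d) (q.2 + freq p.2) * character (-(q.2 + freq p.2)) (freq p.1))) := by
    intro q
    have := integral_gaussian_sub_mul_character (freq p.1) (-(q.2 + freq p.2))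
    rw [gaussian_neg] at this
    rw [← this, ← integral_const_mul, ← integral_const_mul]
    congr 1 with ω
    rw [neg_add, character_add_left, ← character_neg_right q.2, character_comm q.2]
    ring
  have e2 : stft (gaussian (Phase d)) (tauWigner τ f h) p.1 p.2 =
      ∫ x : Conf d, ∫ ω : Conf d, ∫ y : Conf d, wignerIntegrand τ f h (x, y) * gaussian (Conf d) (ω - freq p.1) *
        (character (-ω) y * (character (-pos p.2) x * gaussian (Conf d) (x - pos p.1)) *
          character (-freq p.2) ω) := by
    have hI3 : Integrable (fun r : Conf d × Conf d => ∫ y : Conf d, wignerIntegrand τ f h (r.1, y) * gaussian (Conf d) (r.2 - freq p.1) *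
        (character (-r.2) y * (character (-pos p.2) r.1 * gaussian (Conf d) (r.1 - pos p.1)) *
          character (-freq p.2) r.2)) (volume.prod volume) := by
      -- The variables come as ((x, y), ω), while the inner integral to be formed is the one over y;
      -- the reshuffle swaps y and ω.
      have hmp : MeasurePreserving (fun s : (Conf d × Conf d) × Conf d => ((s.1.1, s.2), s.1.2))
          ((volume.prod volume).prod volume) ((volume.prod volume).prod volume) := by
        have a1 := measurePreserving_prodAssoc (volume : Measure (Conf d)) (volume : Measure (Conf d)) (volume : Measure (Conf d))
        have a2 := (MeasurePreserving.id (volume : Measure (Conf d))).prod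
          (Measure.measurePreserving_swap (μ := (volume : Measure (Conf d))) (ν := (volume : Measure (Conf d))))
        exact ((a1.symm _).comp (a2.comp a1))
      exact (hmp.integrable_comp_of_integrable hI2).integral_prod_left
    rw [← integral_prod _ hI3, stft, integral_phase]
    refine integral_congr_ae (.of_forall fun r => ?_)
    simp only [tauWigner]
    rw [← integral_mul_const]
    congr 1 with y
    simp only [shift, map_mul, conj_character, conj_gaussian, pos_pt, freq_pt, character_phase, gaussian_phase,
      pos_sub, freq_sub, wignerIntegrand]
    ring
  have e3 : ∀ᵐ x : Conf d, (∫ ω : Conf d, ∫ y : Conf d, wignerIntegrand τ f h (x, y) * gaussian (Conf d) (ω - freq p.1) *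
        (character (-ω) y * (character (-pos p.2) x * gaussian (Conf d) (x - pos p.1)) *
          character (-freq p.2) ω)) = ∫ y : Conf d, wignerIntegrand τ f h (x, y) *
          (character (-pos p.2) x * gaussian (Conf d) (x - pos p.1) *
          (gaussian (Conf d) (y + freq p.2) * character (-(y + freq p.2)) (freq p.1))) := by
    have a1 := (measurePreserving_prodAssoc (volume : Measure (Conf d)) (volume : Measure (Conf d)) (volume : Measure (Conf d)))
    have a2 := (a1.symm (MeasurableEquiv.prodAssoc)).integrable_comp_of_integrable hI2
    filter_upwards [a2.prod_right_ae] with x hx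
    rw [integral_integral_swap]
    · congr 1 with y
      exact e1 (x, y)
    · exact hx.swap
  rw [e2, integral_congr_ae e3]
  have hI4 : Integrable (fun q : Conf d × Conf d => wignerIntegrand τ f h q *
          (character (-pos p.2) q.1 * gaussian (Conf d) (q.1 - pos p.1) *
          (gaussian (Conf d) (q.2 + freq p.2) * character (-(q.2 + freq p.2)) (freq p.1)))) (volume.prod volume) := by
    refine hI2.integral_prod_left.congr (.of_forall fun q => e1 q)
  rw [← integral_prod _ hI4]
  refine Eq.trans ?_ ((measurePreserving_wignerShear τ).integral_comp (measurableEmbedding_wignerShear τ)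
    fun q : Conf d × Conf d => f q.1 * conj (h q.2) * wignerKernel τ p q)
  refine integral_congr_ae (.of_forall fun q => ?_)
  simp only [wignerKernel, wignerIntegrand]
  rw [show (1 - τ) • (q.1 + τ • q.2) + τ • (q.1 - (1 - τ) • q.2) = q.1 by module,
    show q.1 + τ • q.2 - (q.1 - (1 - τ) • q.2) = q.2 by module]

end TauWigner

/-! ### Gaussian integrals with a quadratic form in two vectors -/

section GaussianForm
variable {V : Type*} [NormedAddCommGroup V] [InnerProductSpace ℝ V]

/-- Squares are completed first in t, then in s with the Schur complement (αγ - β²)/γ. -/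
theorem complete_square_two {α β γ : ℝ} (hγ : γ ≠ 0) (hΔ : α * γ - β ^ 2 ≠ 0) (s t p r : V) :
    α * ‖s‖ ^ 2 + 2 * β * inner ℝ s t + γ * ‖t‖ ^ 2 - 2 * inner ℝ s p - 2 * inner ℝ t r =
      γ * ‖t - γ⁻¹ • (r - β • s)‖ ^ 2 +
        ((α * γ - β ^ 2) / γ) * ‖s - (α * γ - β ^ 2)⁻¹ • (γ • p - β • r)‖ ^ 2 -
        ((α * γ - β ^ 2) / γ * ‖(α * γ - β ^ 2)⁻¹ • (γ • p - β • r)‖ ^ 2 + γ⁻¹ * ‖r‖ ^ 2) := by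
  set Δ := α * γ - β ^ 2 with hD
  have hα : α = (Δ + β ^ 2) / γ := by rw [hD]; field_simp; ring
  clear_value Δ
  subst hα
  simp only [← real_inner_self_eq_norm_sq, inner_sub_left, inner_sub_right, real_inner_smul_left,
    real_inner_smul_right, real_inner_comm s t, real_inner_comm s p, real_inner_comm s r, real_inner_comm t r,
    real_inner_comm p r]
  field_simp
  ring

/-- The quadratic form in the exponent of `V_G W_τ(g, g)`. -/
def wignerForm (τ : ℝ) (z ζ s t : V) : ℝ :=
  ‖s‖ ^ 2 + ‖t‖ ^ 2 + ‖(1 - τ) • s + τ • t - z‖ ^ 2 + ‖s - t + ζ‖ ^ 2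

theorem norm_sq_add_le (x y : V) : ‖x + y‖ ^ 2 ≤ 2 * ‖x‖ ^ 2 + 2 * ‖y‖ ^ 2 := by
  nlinarith [norm_add_le x y, norm_nonneg (x + y), norm_nonneg x, norm_nonneg y, sq_nonneg (‖x‖ - ‖y‖)]

theorem norm_sq_sub_le (x y : V) : ‖x - y‖ ^ 2 ≤ 2 * ‖x‖ ^ 2 + 2 * ‖y‖ ^ 2 := by
  simpa [sub_eq_add_neg] using norm_sq_add_le x (-y)

/-- z is the difference of (1 - τ)s + τt and the third vector of the form, ζ that of the fourth
vector and s - t. The first combination is convex, so its square is at most ‖s‖² + ‖t‖² for all τ ∈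
[0,1]; the constant is 6 = 2 + 4. -/
theorem le_wignerForm {τ : ℝ} (h0 : 0 ≤ τ) (h1 : τ ≤ 1) (z ζ s t : V) :
    ‖z‖ ^ 2 + ‖ζ‖ ^ 2 ≤ 6 * wignerForm τ z ζ s t := by
  have a := norm_sq_sub_le ((1 - τ) • s + τ • t) ((1 - τ) • s + τ • t - z)
  have b := norm_sq_sub_le (s - t + ζ) (s - t)
  have c := norm_sq_sub_le s t
  have e : ‖(1 - τ) • s + τ • t‖ ^ 2 ≤ ‖s‖ ^ 2 + ‖t‖ ^ 2 := by
    have h : ‖(1 - τ) • s + τ • t‖ ≤ (1 - τ) * ‖s‖ + τ * ‖t‖ := by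
      refine (norm_add_le _ _).trans ?_
      rw [norm_smul, norm_smul, Real.norm_of_nonneg (by linarith), Real.norm_of_nonneg h0]
    have h2 : ((1 - τ) * ‖s‖ + τ * ‖t‖) ^ 2 ≤ (1 - τ) * ‖s‖ ^ 2 + τ * ‖t‖ ^ 2 := by
      nlinarith [mul_nonneg (mul_nonneg h0 (by linarith : 0 ≤ 1 - τ)) (sq_nonneg (‖s‖ - ‖t‖))]
    have h3 := pow_le_pow_left₀ (norm_nonneg _) h 2
    nlinarith [sq_nonneg ‖s‖, sq_nonneg ‖t‖]
  rw [sub_sub_cancel] at a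
  rw [add_sub_cancel_left] at b
  unfold wignerForm
  nlinarith [sq_nonneg ‖s‖, sq_nonneg ‖t‖, sq_nonneg ‖(1 - τ) • s + τ • t - z‖, sq_nonneg ‖s - t + ζ‖]

/-- The left side is at most 4(‖ξ‖² + ‖η‖²), and |B/Γ|² ≤ 1/4 gives ‖ξ‖² ≤ 2‖ξ - (B/Γ)η‖² + ‖η‖²/2.
Hence 8 · 9/2 = 36 suffices for the first square and 6 · 3 for the second. -/
theorem norm_sq_frequencies_le {τ B Γ Q : ℝ} (h0 : 0 ≤ τ) (h1 : τ ≤ 1) (hG2 : 2 ≤ Γ) (hG3 : Γ ≤ 3)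
    (hB : B ^ 2 ≤ 1) (hQ : 0 < Q) (hQ9 : Q ≤ 9 / 2) (ξ η : V) :
    ‖ξ + η‖ ^ 2 + ‖(1 - τ) • η - τ • ξ‖ ^ 2 ≤ 36 * (‖η‖ ^ 2 / Γ + ‖ξ - (B / Γ) • η‖ ^ 2 / Q) := by
  have a1 : ‖η‖ ^ 2 / 3 ≤ ‖η‖ ^ 2 / Γ := by gcongr
  have a2 : ‖ξ - (B / Γ) • η‖ ^ 2 / (9 / 2) ≤ ‖ξ - (B / Γ) • η‖ ^ 2 / Q := by gcongr
  have a3 := norm_sq_add_le (ξ - (B / Γ) • η) ((B / Γ) • η)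
  rw [sub_add_cancel, norm_smul, mul_pow] at a3
  have a4 : ‖B / Γ‖ ^ 2 ≤ 1 / 4 := by
    rw [Real.norm_eq_abs, sq_abs, div_pow, div_le_iff₀ (by positivity)]
    nlinarith
  have a5 : ‖B / Γ‖ ^ 2 * ‖η‖ ^ 2 ≤ 1 / 4 * ‖η‖ ^ 2 := by gcongr
  have b3 := norm_sq_add_le ξ η
  have b4 : ‖(1 - τ) • η - τ • ξ‖ ^ 2 ≤ 2 * ‖η‖ ^ 2 + 2 * ‖ξ‖ ^ 2 := by
    refine (norm_sq_sub_le _ _).trans ?_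
    have c1 : ‖(1 - τ) • η‖ ≤ ‖η‖ := by
      rw [norm_smul, Real.norm_of_nonneg (by linarith)]
      exact mul_le_of_le_one_left (norm_nonneg _) (by linarith)
    have c2 : ‖τ • ξ‖ ≤ ‖ξ‖ := by
      rw [norm_smul, Real.norm_of_nonneg h0]
      exact mul_le_of_le_one_left (norm_nonneg _) h1
    gcongr
  linarith [sq_nonneg ‖η‖]

variable [FiniteDimensional ℝ V] [MeasurableSpace V] [BorelSpace V]

/-- After the squares are completed the integral over t is Gaussian. Its phase depends on s through
the centre (r - βs)/γ, which shifts the frequency of the s-integral from ξ to ξ - (β/γ)η. -/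
theorem norm_integral_gaussian_pair {α β γ : ℝ} (hγ : 0 < γ) (hΔ : 0 < α * γ - β ^ 2) (p r ξ η : V)
    (κ : ℝ) :
    ‖∫ s : V, ∫ t : V, (Real.exp (-Real.pi * (α * ‖s‖ ^ 2 + 2 * β * inner ℝ s t + γ * ‖t‖ ^ 2
        - 2 * inner ℝ s p - 2 * inner ℝ t r + κ)) : ℂ) * (character ξ s * character η t)‖ =
      γ⁻¹ ^ (Module.finrank ℝ V / 2 : ℝ) * ((α * γ - β ^ 2) / γ)⁻¹ ^ (Module.finrank ℝ V / 2 : ℝ) *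
      Real.exp (-Real.pi * (κ - ((α * γ - β ^ 2) / γ * ‖(α * γ - β ^ 2)⁻¹ • (γ • p - β • r)‖ ^ 2 +
        γ⁻¹ * ‖r‖ ^ 2))) *
      Real.exp (-Real.pi * (‖η‖ ^ 2 / γ + ‖ξ - (β / γ) • η‖ ^ 2 / ((α * γ - β ^ 2) / γ))) := by
  have h1 : ∀ s t : V, (Real.exp (-Real.pi * (α * ‖s‖ ^ 2 + 2 * β * inner ℝ s t + γ * ‖t‖ ^ 2
        - 2 * inner ℝ s p - 2 * inner ℝ t r + κ)) : ℂ) * (character ξ s * character η t) =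
      ((Real.exp (-Real.pi * (κ - ((α * γ - β ^ 2) / γ * ‖(α * γ - β ^ 2)⁻¹ • (γ • p - β • r)‖ ^ 2 +
        γ⁻¹ * ‖r‖ ^ 2))) : ℂ) * (Real.exp (-Real.pi * ((α * γ - β ^ 2) / γ) *
          ‖s - (α * γ - β ^ 2)⁻¹ • (γ • p - β • r)‖ ^ 2) : ℂ) * character ξ s) *
        ((Real.exp (-Real.pi * γ * ‖t - γ⁻¹ • (r - β • s)‖ ^ 2) : ℂ) * character η t) := by
    intro s t
    rw [complete_square_two hγ.ne' hΔ.ne']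
    set A := ‖s - (α * γ - β ^ 2)⁻¹ • (γ • p - β • r)‖ ^ 2
    set B := (α * γ - β ^ 2) / γ * ‖(α * γ - β ^ 2)⁻¹ • (γ • p - β • r)‖ ^ 2 + γ⁻¹ * ‖r‖ ^ 2
    set C := ‖t - γ⁻¹ • (r - β • s)‖ ^ 2
    rw [show -Real.pi * (γ * C + (α * γ - β ^ 2) / γ * A - B + κ) = -Real.pi * (κ - B) +
      -Real.pi * ((α * γ - β ^ 2) / γ) * A + -Real.pi * γ * C by ring, Real.exp_add, Real.exp_add]
    push_cast
    ring
  simp only [h1, integral_const_mul, integral_gaussian_character hγ]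
  have h2 : ∀ s : V, character η (γ⁻¹ • (r - β • s)) =
      character η (γ⁻¹ • r) * character (-((β / γ) • η)) s := by
    intro s
    rw [smul_sub, sub_eq_add_neg, character_add_right, character_neg_right, smul_smul,
      ← character_smul_left (γ⁻¹ * β) (-η), smul_neg, div_eq_inv_mul]
  have h3 : ∀ s : V, ((Real.exp (-Real.pi * (κ - ((α * γ - β ^ 2) / γ * ‖(α * γ - β ^ 2)⁻¹ • (γ • p - β • r)‖ ^ 2 +
        γ⁻¹ * ‖r‖ ^ 2))) : ℂ) * (Real.exp (-Real.pi * ((α * γ - β ^ 2) / γ) *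
          ‖s - (α * γ - β ^ 2)⁻¹ • (γ • p - β • r)‖ ^ 2) : ℂ) * character ξ s) *
        (((γ⁻¹ ^ (Module.finrank ℝ V / 2 : ℝ) : ℝ) : ℂ) *
        (Real.exp (-Real.pi * ‖η‖ ^ 2 / γ) : ℂ) * character η (γ⁻¹ • (r - β • s))) =
      ((Real.exp (-Real.pi * (κ - ((α * γ - β ^ 2) / γ * ‖(α * γ - β ^ 2)⁻¹ • (γ • p - β • r)‖ ^ 2 +
        γ⁻¹ * ‖r‖ ^ 2))) : ℂ) * ((γ⁻¹ ^ (Module.finrank ℝ V / 2 : ℝ) : ℝ) : ℂ) *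
        (Real.exp (-Real.pi * ‖η‖ ^ 2 / γ) : ℂ) * character η (γ⁻¹ • r)) *
        ((Real.exp (-Real.pi * ((α * γ - β ^ 2) / γ) *
          ‖s - (α * γ - β ^ 2)⁻¹ • (γ • p - β • r)‖ ^ 2) : ℂ) * character (ξ - (β / γ) • η) s) := by
    intro s
    rw [h2, sub_eq_add_neg ξ, character_add_left]
    ring
  simp only [h3, integral_const_mul, integral_gaussian_character (div_pos hΔ hγ)]
  simp only [norm_mul, norm_character, Complex.norm_real, Real.norm_eq_abs, Real.abs_exp, mul_one]
  rw [abs_of_nonneg (by positivity), abs_of_nonneg (by positivity), mul_add, Real.exp_add, mul_div, mul_div]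
  ring

end GaussianForm

/-! ### Decay of the Wigner distribution of the Gaussian -/

section GaussianWigner
variable {d : ℕ}

set_option maxHeartbeats 800000 in
-- The exponent is the sum of the minimum of the real quadratic form, which controls pos p.1 and
-- freq p.2, and of a quadratic form in the frequencies, which controls pos p.2 and freq p.1. The
-- bounds are uniform up to τ = 0 and τ = 1 because the diagonal coefficients A, Γ stay in [2, 3]
-- and the determinant AΓ - B² in [3, 9].
theorem exists_norm_stft_tauWigner_gaussian_le (d : ℕ) (α : ℝ) : ∃ C : ℝ, 0 ≤ C ∧ ∀ τ : ℝ, 0 ≤ τ → τ ≤ 1 →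
    ∀ p : Phase d × Phase d,
    ‖stft (gaussian (Phase d)) (tauWigner τ (gaussian (Conf d)) (gaussian (Conf d))) p.1 p.2‖ ≤
      C * Real.exp (-α * ‖p‖) := by
  set n : ℝ := (Module.finrank ℝ (Conf d) : ℝ) with hn
  have hn0 : 0 ≤ n := by positivity
  refine ⟨2 ^ n * Real.exp (36 * α ^ 2 / (4 * Real.pi)), by positivity, fun τ h0 h1 p => ?_⟩
  have hgi : Integrable (gaussian (Conf d)) := (gaussian (Conf d)).integrable
  rw [stft_tauWigner_eq τ hgi hgi]
  obtain ⟨M, hM⟩ := exists_norm_wignerKernel_le d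
  have hI : Integrable (fun q : Conf d × Conf d => gaussian (Conf d) q.1 * conj (gaussian (Conf d) q.2) *
      wignerKernel τ p q) (volume.prod volume) := by
    simp only [conj_gaussian]
    refine (hgi.mul_prod hgi).mul_bdd (c := M) ?_ (.of_forall fun q => hM τ p q)
    exact ((continuous_wignerKernel τ).comp (by fun_prop : Continuous fun q : Conf d × Conf d => (p, q))).aestronglyMeasurable
  rw [integral_prod _ hI]
  have hA : ∀ s t : Conf d, gaussian (Conf d) s * conj (gaussian (Conf d) t) * wignerKernel τ p (s, t) =
      (((2 : ℝ) ^ n : ℝ) * character (-freq p.2) (freq p.1)) *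
      ((Real.exp (-Real.pi * ((2 + (1 - τ) ^ 2) * ‖s‖ ^ 2 + 2 * (τ * (1 - τ) - 1) * inner ℝ s t +
        (2 + τ ^ 2) * ‖t‖ ^ 2 - 2 * inner ℝ s ((1 - τ) • pos p.1 - freq p.2) -
        2 * inner ℝ t (τ • pos p.1 + freq p.2) + (‖pos p.1‖ ^ 2 + ‖freq p.2‖ ^ 2))) : ℂ) *
      (character (-((1 - τ) • pos p.2 + freq p.1)) s * character (-(τ • pos p.2 - freq p.1)) t)) := by
    intro s t
    have e1 : character (-pos p.2) ((1 - τ) • s + τ • t) * character (-(s - t + freq p.2)) (freq p.1) =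
        character (-freq p.2) (freq p.1) *
        (character (-((1 - τ) • pos p.2 + freq p.1)) s * character (-(τ • pos p.2 - freq p.1)) t) := by
      simp only [character, ← Complex.exp_add]
      congr 1
      simp only [inner_add_left, inner_sub_left, inner_add_right, inner_neg_left,
        real_inner_smul_left, real_inner_smul_right, real_inner_comm s (freq p.1), real_inner_comm t (freq p.1)]
      push_cast
      ring
    have e2 : gaussian (Conf d) s * gaussian (Conf d) t * (gaussian (Conf d) ((1 - τ) • s + τ • t - pos p.1) *
        gaussian (Conf d) (s - t + freq p.2)) = (((2 : ℝ) ^ n : ℝ) : ℂ) *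
        ((Real.exp (-Real.pi * ((2 + (1 - τ) ^ 2) * ‖s‖ ^ 2 + 2 * (τ * (1 - τ) - 1) * inner ℝ s t +
        (2 + τ ^ 2) * ‖t‖ ^ 2 - 2 * inner ℝ s ((1 - τ) • pos p.1 - freq p.2) -
        2 * inner ℝ t (τ • pos p.1 + freq p.2) + (‖pos p.1‖ ^ 2 + ‖freq p.2‖ ^ 2)))) : ℂ) := by
      simp only [gaussian_apply, ← Complex.ofReal_mul, ← hn]
      congr 1
      have e3 : (2 : ℝ) ^ n = 2 ^ (n / 4) * 2 ^ (n / 4) * (2 ^ (n / 4) * 2 ^ (n / 4)) := by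
        rw [← Real.rpow_add two_pos, ← Real.rpow_add two_pos]
        congr 1
        ring
      have e4 : (2 + (1 - τ) ^ 2) * ‖s‖ ^ 2 + 2 * (τ * (1 - τ) - 1) * inner ℝ s t +
        (2 + τ ^ 2) * ‖t‖ ^ 2 - 2 * inner ℝ s ((1 - τ) • pos p.1 - freq p.2) -
        2 * inner ℝ t (τ • pos p.1 + freq p.2) + (‖pos p.1‖ ^ 2 + ‖freq p.2‖ ^ 2) =
        wignerForm τ (pos p.1) (freq p.2) s t := by
        unfold wignerForm
        simp only [← real_inner_self_eq_norm_sq, inner_add_left, inner_sub_left, inner_add_right, inner_sub_right,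
          real_inner_smul_left, real_inner_smul_right, real_inner_comm s (pos p.1), real_inner_comm t (pos p.1),
          real_inner_comm s (freq p.2), real_inner_comm t (freq p.2), real_inner_comm s t]
        ring
      rw [e3, e4, wignerForm, mul_add, mul_add, mul_add, Real.exp_add, Real.exp_add, Real.exp_add]
      ring
    rw [wignerKernel, conj_gaussian]
    linear_combination (character (-pos p.2) ((1 - τ) • s + τ • t) * character (-(s - t + freq p.2)) (freq p.1)) * e2 +
      (((2 : ℝ) ^ n : ℝ) : ℂ) * ((Real.exp (-Real.pi * ((2 + (1 - τ) ^ 2) * ‖s‖ ^ 2 + 2 * (τ * (1 - τ) - 1) * inner ℝ s t +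
        (2 + τ ^ 2) * ‖t‖ ^ 2 - 2 * inner ℝ s ((1 - τ) • pos p.1 - freq p.2) -
        2 * inner ℝ t (τ • pos p.1 + freq p.2) + (‖pos p.1‖ ^ 2 + ‖freq p.2‖ ^ 2)))) : ℂ) * e1
  simp only [hA, integral_const_mul]
  set A : ℝ := 2 + (1 - τ) ^ 2 with hAd
  set B : ℝ := τ * (1 - τ) - 1 with hBd
  set Γ : ℝ := 2 + τ ^ 2 with hGd
  have hA2 : 2 ≤ A := by rw [hAd]; nlinarith [sq_nonneg (1 - τ)]
  have hA3 : A ≤ 3 := by rw [hAd]; nlinarith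
  have hG2 : 2 ≤ Γ := by rw [hGd]; nlinarith [sq_nonneg τ]
  have hG3 : Γ ≤ 3 := by rw [hGd]; nlinarith
  have hB1 : B ≤ 0 := by rw [hBd]; nlinarith
  have hB2 : -1 ≤ B := by rw [hBd]; nlinarith
  have hBB : B ^ 2 ≤ 1 := by nlinarith
  have hΔ3 : 3 ≤ A * Γ - B ^ 2 := by nlinarith
  have hΔ9 : A * Γ - B ^ 2 ≤ 9 := by nlinarith
  have hQ1 : 1 ≤ (A * Γ - B ^ 2) / Γ := by rw [le_div_iff₀ (by linarith)]; linarith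
  have hQ9 : (A * Γ - B ^ 2) / Γ ≤ 9 / 2 := by rw [div_le_iff₀ (by linarith)]; nlinarith
  rw [norm_mul, norm_integral_gaussian_pair (by linarith) (by linarith)]
  set pp := (1 - τ) • pos p.1 - freq p.2
  set rr := τ • pos p.1 + freq p.2
  set ξ := -((1 - τ) • pos p.2 + freq p.1) with hξ
  set η := -(τ • pos p.2 - freq p.1) with hη
  set E0 := ‖pos p.1‖ ^ 2 + ‖freq p.2‖ ^ 2 - ((A * Γ - B ^ 2) / Γ *
    ‖(A * Γ - B ^ 2)⁻¹ • (Γ • pp - B • rr)‖ ^ 2 + Γ⁻¹ * ‖rr‖ ^ 2) with hE0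
  -- E0 is the value of the form at its critical point (s0, t0), where both completed squares
  -- vanish; the lower bound for the form is used there.
  have hE : ‖pos p.1‖ ^ 2 + ‖freq p.2‖ ^ 2 ≤ 6 * E0 := by
    set s0 := (A * Γ - B ^ 2)⁻¹ • (Γ • pp - B • rr) with hs0
    have key := complete_square_two (α := A) (β := B) (γ := Γ) (by linarith) (by linarith) s0
      (Γ⁻¹ • (rr - B • s0)) pp rr
    rw [← hs0, sub_self, sub_self, norm_zero] at key
    have := le_wignerForm h0 h1 (pos p.1) (freq p.2) s0 (Γ⁻¹ • (rr - B • s0))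
    set t0 := Γ⁻¹ • (rr - B • s0)
    have e4 : wignerForm τ (pos p.1) (freq p.2) s0 t0 = A * ‖s0‖ ^ 2 + 2 * B * inner ℝ s0 t0 +
        Γ * ‖t0‖ ^ 2 - 2 * inner ℝ s0 pp - 2 * inner ℝ t0 rr + (‖pos p.1‖ ^ 2 + ‖freq p.2‖ ^ 2) := by
      unfold wignerForm
      simp only [hAd, hBd, hGd, pp, rr]
      clear_value s0 t0
      simp only [← real_inner_self_eq_norm_sq, inner_add_left, inner_sub_left, inner_add_right, inner_sub_right,
        real_inner_smul_left, real_inner_smul_right, real_inner_comm s0 (pos p.1), real_inner_comm t0 (pos p.1),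
        real_inner_comm s0 (freq p.2), real_inner_comm t0 (freq p.2), real_inner_comm s0 t0]
      ring
    rw [e4, key] at this
    rw [hE0]
    linarith
  have hfreq : ‖pos p.2‖ ^ 2 + ‖freq p.1‖ ^ 2 ≤
      36 * (‖η‖ ^ 2 / Γ + ‖ξ - (B / Γ) • η‖ ^ 2 / ((A * Γ - B ^ 2) / Γ)) := by
    rw [show pos p.2 = -(ξ + η) by rw [hξ, hη]; module, norm_neg,
      show freq p.1 = (1 - τ) • η - τ • ξ by rw [hξ, hη]; module]
    exact norm_sq_frequencies_le h0 h1 hG2 hG3 hBB (by linarith) hQ9 ξ η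
  set Xx := ‖η‖ ^ 2 / Γ + ‖ξ - (B / Γ) • η‖ ^ 2 / ((A * Γ - B ^ 2) / Γ)
  have hp : ‖p‖ ^ 2 ≤ 36 * (E0 + Xx) := by
    have c1 := norm_sq_phase p.1
    have c2 := norm_sq_phase p.2
    have c0 : ‖p‖ ^ 2 ≤ ‖p.1‖ ^ 2 + ‖p.2‖ ^ 2 := by
      rcases max_cases ‖p.1‖ ‖p.2‖ with h | h <;> rw [Prod.norm_def, h.1] <;> nlinarith [sq_nonneg ‖p.1‖, sq_nonneg ‖p.2‖]
    have c3 : 0 ≤ E0 := by nlinarith [sq_nonneg ‖pos p.1‖, sq_nonneg ‖freq p.2‖]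
    linarith
  have f1 : Γ⁻¹ ^ (n / 2) ≤ 1 := Real.rpow_le_one (by positivity) (inv_le_one_of_one_le₀ (by linarith)) (by positivity)
  have f2 : ((A * Γ - B ^ 2) / Γ)⁻¹ ^ (n / 2) ≤ 1 :=
    Real.rpow_le_one (inv_nonneg.2 (by linarith)) (inv_le_one_of_one_le₀ hQ1) (by positivity)
  rw [norm_mul, norm_character, mul_one, Complex.norm_real, Real.norm_of_nonneg (by positivity),
    mul_assoc ((2 : ℝ) ^ n)]
  refine mul_le_mul_of_nonneg_left ?_ (by positivity)
  rw [mul_assoc, ← Real.exp_add, ← Real.exp_add]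
  have f3 : 0 ≤ ((A * Γ - B ^ 2) / Γ)⁻¹ ^ (n / 2) := Real.rpow_nonneg (inv_nonneg.2 (by linarith)) _
  have f4 : 0 ≤ Γ⁻¹ ^ (n / 2) := Real.rpow_nonneg (inv_nonneg.2 (by linarith)) _
  have f5 : Γ⁻¹ ^ (n / 2) * ((A * Γ - B ^ 2) / Γ)⁻¹ ^ (n / 2) ≤ 1 := by nlinarith
  refine (mul_le_of_le_one_left (Real.exp_pos _).le f5).trans ?_
  rw [Real.exp_le_exp]
  have hpi := Real.pi_pos
  -- The Gaussian rate π/36 is exchanged for e^{-α‖p‖} by completing the square, at the cost of the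
  -- factor e^{36α²/(4π)}.
  have g1 : Real.pi * ‖p‖ ^ 2 / 36 ≤ Real.pi * (E0 + Xx) := by
    rw [div_le_iff₀ (by norm_num)]; nlinarith
  have g2 : 0 ≤ (Real.pi / 36) * (‖p‖ - 36 * α / (2 * Real.pi)) ^ 2 := by positivity
  have g3 : (Real.pi / 36) * (‖p‖ - 36 * α / (2 * Real.pi)) ^ 2 = Real.pi * ‖p‖ ^ 2 / 36 - α * ‖p‖ +
      36 * α ^ 2 / (4 * Real.pi) := by field_simp; ring
  nlinarith

end GaussianWigner

/-! ### Wigner distributions of superpositions -/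

section Superposition

theorem measurePreserving_prodProdProdComm {A S B T : Type*} [MeasurableSpace A] [MeasurableSpace S]
    [MeasurableSpace B] [MeasurableSpace T] (μa : Measure A) (μs : Measure S) (μb : Measure B)
    (μt : Measure T) [SFinite μa] [SFinite μs] [SFinite μb] [SFinite μt] :
    MeasurePreserving (fun r : (A × B) × (S × T) => ((r.1.1, r.2.1), (r.1.2, r.2.2)))
      ((μa.prod μb).prod (μs.prod μt)) ((μa.prod μs).prod (μb.prod μt)) := by
  have h1 := measurePreserving_prodAssoc μa μb (μs.prod μt)
  have h2 := (MeasurePreserving.id μa).prod ((measurePreserving_prodAssoc μb μs μt).symm _)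
  have h3 := (MeasurePreserving.id μa).prod
    ((Measure.measurePreserving_swap (μ := μb) (ν := μs)).prod (MeasurePreserving.id μt))
  have h4 := (MeasurePreserving.id μa).prod (measurePreserving_prodAssoc μs μb μt)
  have h5 := (measurePreserving_prodAssoc μa μs (μb.prod μt)).symm
  exact h5.comp (h4.comp (h3.comp (h2.comp h1)))

variable {d : ℕ} {A B : Type*} [MeasurableSpace A] [MeasurableSpace B] {ν : Measure A} {ν' : Measure B}
  [SFinite ν] [SFinite ν']

/-- Fubini in the sesquilinear form with bounded kernel. The index spaces are arbitrary so that the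
same statement covers integrals of shifted Gaussians and series over a lattice. -/
theorem stft_tauWigner_superposition (τ : ℝ) {f h : Conf d → ℂ} {kf : A × Conf d → ℂ}
    {kh : B × Conf d → ℂ} (hkf : Integrable kf (ν.prod volume)) (hkh : Integrable kh (ν'.prod volume))
    (hf : f =ᵐ[volume] fun t => ∫ a, kf (a, t) ∂ν) (hh : h =ᵐ[volume] fun t => ∫ b, kh (b, t) ∂ν')
    (p : Phase d × Phase d) :
    AEStronglyMeasurable (fun r : A × B => stft (gaussian (Phase d))
      (tauWigner τ (fun s => kf (r.1, s)) (fun t => kh (r.2, t))) p.1 p.2) (ν.prod ν') ∧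
    stft (gaussian (Phase d)) (tauWigner τ f h) p.1 p.2 = ∫ r : A × B, stft (gaussian (Phase d))
      (tauWigner τ (fun s => kf (r.1, s)) (fun t => kh (r.2, t))) p.1 p.2 ∂(ν.prod ν') := by
  have hfi : Integrable f := hkf.integral_prod_right.congr hf.symm
  have hhi : Integrable h := hkh.integral_prod_right.congr hh.symm
  obtain ⟨M, hM⟩ := exists_norm_wignerKernel_le d
  have hw : Continuous fun q => wignerKernel τ p q := by
    have h1 : Continuous fun q : Conf d × Conf d => (p, q) := by fun_prop
    have h2 := (continuous_wignerKernel τ).comp h1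
    exact h2
  have hkh' : Integrable (fun r => conj (kh r)) (ν'.prod volume) :=
    memLp_one_iff_integrable.1 (memLp_one_iff_integrable.2 hkh).star
  have h0 : Integrable (fun r : (A × B) × (Conf d × Conf d) => kf (r.1.1, r.2.1) * conj (kh (r.1.2, r.2.2)))
      ((ν.prod ν').prod (volume.prod volume)) :=
    (measurePreserving_prodProdProdComm ν (volume : Measure (Conf d)) ν'
      (volume : Measure (Conf d))).integrable_comp_of_integrable (hkf.mul_prod hkh')
  have hJ : Integrable (fun r : (A × B) × (Conf d × Conf d) => kf (r.1.1, r.2.1) * conj (kh (r.1.2, r.2.2)) *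
      wignerKernel τ p r.2) ((ν.prod ν').prod (volume.prod volume)) := by
    have hw2 : AEStronglyMeasurable (fun r : (A × B) × (Conf d × Conf d) => wignerKernel τ p r.2)
        ((ν.prod ν').prod (volume.prod volume)) :=
      hw.aestronglyMeasurable.comp_snd
    have hw3 : ∀ᵐ r : (A × B) × (Conf d × Conf d) ∂((ν.prod ν').prod (volume.prod volume)),
        ‖wignerKernel τ p r.2‖ ≤ M := .of_forall fun r => hM τ p r.2
    exact h0.mul_bdd hw2 hw3
  have hae : ∀ᵐ q : Conf d × Conf d ∂(volume.prod volume), f q.1 = (∫ a, kf (a, q.1) ∂ν) ∧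
      h q.2 = ∫ b, kh (b, q.2) ∂ν' := by
    have a1 := Measure.quasiMeasurePreserving_fst (μ := (volume : Measure (Conf d))) (ν := (volume : Measure (Conf d))) |>.ae hf
    have a2 := Measure.quasiMeasurePreserving_snd (μ := (volume : Measure (Conf d))) (ν := (volume : Measure (Conf d))) |>.ae hh
    filter_upwards [a1, a2] with q h1 h2 using ⟨h1, h2⟩
  have e1 : stft (gaussian (Phase d)) (tauWigner τ f h) p.1 p.2 =
      ∫ r : A × B, ∫ q : Conf d × Conf d, kf (r.1, q.1) * conj (kh (r.2, q.2)) *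
      wignerKernel τ p q ∂(volume.prod volume) ∂(ν.prod ν') := by
    have e0 := integral_integral_swap (f := fun (r : A × B) (q : Conf d × Conf d) =>
      kf (r.1, q.1) * conj (kh (r.2, q.2)) * wignerKernel τ p q) hJ
    rw [stft_tauWigner_eq τ hfi hhi, e0]
    refine integral_congr_ae (hae.mono fun q hq => ?_)
    dsimp only
    rw [hq.1, hq.2, integral_mul_const, ← integral_conj,
      ← integral_prod_mul (fun a => kf (a, q.1)) (fun b => conj (kh (b, q.2)))]
  have hae2 : ∀ᵐ r : A × B ∂(ν.prod ν'), ∫ q : Conf d × Conf d, kf (r.1, q.1) * conj (kh (r.2, q.2)) *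
      wignerKernel τ p q ∂(volume.prod volume) =
      stft (gaussian (Phase d)) (tauWigner τ (fun s => kf (r.1, s)) (fun t => kh (r.2, t))) p.1 p.2 := by
    have a1 := Measure.quasiMeasurePreserving_fst (μ := ν) (ν := ν') |>.ae hkf.prod_right_ae
    have a2 := Measure.quasiMeasurePreserving_snd (μ := ν) (ν := ν') |>.ae hkh.prod_right_ae
    filter_upwards [a1, a2] with r h1 h2
    rw [stft_tauWigner_eq τ h1 h2]
  refine ⟨hJ.integral_prod_left.1.congr hae2, ?_⟩
  rw [e1, integral_congr_ae hae2]

theorem enorm_stft_tauWigner_superposition_le (τ : ℝ) {f h : Conf d → ℂ} {kf : A × Conf d → ℂ}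
    {kh : B × Conf d → ℂ} (hkf : Integrable kf (ν.prod volume)) (hkh : Integrable kh (ν'.prod volume))
    (hf : f =ᵐ[volume] fun t => ∫ a, kf (a, t) ∂ν) (hh : h =ᵐ[volume] fun t => ∫ b, kh (b, t) ∂ν')
    (p : Phase d × Phase d) :
    ‖stft (gaussian (Phase d)) (tauWigner τ f h) p.1 p.2‖ₑ ≤
      ∫⁻ a, ∫⁻ b, ‖stft (gaussian (Phase d)) (tauWigner τ (fun s => kf (a, s)) (fun t => kh (b, t)))
        p.1 p.2‖ₑ ∂ν' ∂ν := by
  obtain ⟨hm, he⟩ := stft_tauWigner_superposition τ hkf hkh hf hh p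
  rw [he]
  have h4 := enorm_integral_le_lintegral_enorm (μ := ν.prod ν') (fun r : A × B => stft (gaussian (Phase d))
      (tauWigner τ (fun s => kf (r.1, s)) (fun t => kh (r.2, t))) p.1 p.2)
  rw [lintegral_prod _ hm.enorm] at h4
  exact h4

end Superposition

/-! ### Continuity of the short-time Fourier transform -/

section Continuity
variable {V : Type} [NormedAddCommGroup V] [InnerProductSpace ℝ V] [FiniteDimensional ℝ V]
  [MeasurableSpace V] [BorelSpace V]

/-- The transform is an L² inner product with a fixed function, and the shifted Gaussians depend
continuously on the shift in the Schwartz topology, hence in L². -/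
theorem continuous_stft_gaussian {f : V → ℂ} (hf : MemLp f 2) :
    Continuous fun p : V × V => stft (gaussian V) f p.1 p.2 := by
  have h1 : Continuous fun p : V × V =>
      inner ℂ (hf.star.toLp _) ((conjGaussianShift p.1 p.2).toLp 2 (volume : Measure V)) :=
    continuous_const.inner ((SchwartzMap.toLpCLM ℂ ℂ 2 (volume : Measure V)).continuous.comp
      continuous_conjGaussianShift)
  refine h1.congr fun p => ?_
  rw [L2.inner_def, stft]
  refine integral_congr_ae ?_
  filter_upwards [hf.star.coeFn_toLp, (conjGaussianShift p.1 p.2).coeFn_toLp 2 (volume : Measure V)] with t h1 h2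
  rw [h1, h2, conjGaussianShift_eq_conj, RCLike.inner_apply]
  simp [mul_comm]

end Continuity

/-! ### Exponential decay profiles -/

section ExpDecay

/-- The function `x ↦ e^{-α |x|}` with values in `[0, ∞]`. -/
def expDecay {V : Type*} [NormedAddCommGroup V] (α : ℝ) (x : V) : ℝ≥0∞ :=
  ENNReal.ofReal (Real.exp (-α * ‖x‖))

variable {V : Type*} [NormedAddCommGroup V]

theorem continuous_expDecay (α : ℝ) : Continuous (expDecay α : V → ℝ≥0∞) := by
  exact ENNReal.continuous_ofReal.comp (by fun_prop)

@[fun_prop]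
theorem measurable_expDecay [MeasurableSpace V] [OpensMeasurableSpace V] (α : ℝ) :
    Measurable (expDecay α : V → ℝ≥0∞) :=
  (continuous_expDecay α).measurable

theorem expDecay_sub_comm (α : ℝ) (x y : V) : expDecay α (x - y) = expDecay α (y - x) := by
  simp [expDecay, norm_sub_rev]

theorem expDecay_le_one {α : ℝ} (hα : 0 ≤ α) (x : V) : expDecay α x ≤ 1 := by
  rw [expDecay, ENNReal.ofReal_le_one, Real.exp_le_one_iff]
  nlinarith [norm_nonneg x]

theorem expDecay_le {α : ℝ} (hα : 0 ≤ α) (x y : V) :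
    expDecay α x ≤ ENNReal.ofReal (Real.exp (α * ‖y‖)) * expDecay α (x + y) := by
  rw [expDecay, expDecay, ← ENNReal.ofReal_mul (Real.exp_pos _).le, ← Real.exp_add]
  refine ENNReal.ofReal_le_ofReal (Real.exp_le_exp.2 ?_)
  nlinarith [norm_add_le x y]

theorem expDecay_antitone {α β : ℝ} (h : α ≤ β) (x : V) : expDecay β x ≤ expDecay α x := by
  refine ENNReal.ofReal_le_ofReal (Real.exp_le_exp.2 ?_)
  nlinarith [norm_nonneg x]

theorem expDecay_add (α β : ℝ) (x : V) : expDecay (α + β) x = expDecay α x * expDecay β x := by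
  rw [expDecay, expDecay, expDecay, ← ENNReal.ofReal_mul (Real.exp_pos _).le, ← Real.exp_add]
  ring_nf

/-- The norm of a product is the maximum, so ‖p.1‖ + ‖p.2‖ ≤ 2‖p‖: half of the rate goes to each
factor. -/
theorem expDecay_prod_le {W : Type*} [NormedAddCommGroup W] {α : ℝ} (hα : 0 ≤ α) (p : V × W) :
    expDecay (2 * α) p ≤ expDecay α p.1 * expDecay α p.2 := by
  rw [expDecay, expDecay, expDecay, ← ENNReal.ofReal_mul (Real.exp_pos _).le, ← Real.exp_add]
  refine ENNReal.ofReal_le_ofReal (Real.exp_le_exp.2 ?_)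
  nlinarith [norm_fst_le p, norm_snd_le p]

theorem expDecay_mul_expDecay_le {α : ℝ} (hα : 0 ≤ α) (x y : V) :
    expDecay α x * expDecay α y ≤ expDecay α (x + y) := by
  rw [expDecay, expDecay, expDecay, ← ENNReal.ofReal_mul (Real.exp_pos _).le, ← Real.exp_add]
  refine ENNReal.ofReal_le_ofReal (Real.exp_le_exp.2 ?_)
  nlinarith [norm_add_le x y]

theorem lintegral_expDecay_lt_top [NormedSpace ℝ V] [FiniteDimensional ℝ V] [MeasurableSpace V]
    [BorelSpace V] (μ : Measure V) [μ.IsAddHaarMeasure] {α : ℝ} (hα : 0 < α) :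
    ∫⁻ x, expDecay α x ∂μ < ∞ := by
  have := (integrable_pow_mul_exp μ hα 0)
  simp only [pow_zero, one_mul] at this
  refine lt_of_eq_of_lt ?_ this.2
  refine lintegral_congr fun x => ?_
  rw [expDecay, ← ofReal_norm, Real.norm_of_nonneg (Real.exp_pos _).le]

end ExpDecay

/-! ### Gabor transform and pointwise bounds for Wigner distributions -/

section Gabor
variable {d : ℕ}

/-- The Gabor transform `V_g f` on phase space, for the Gaussian window `g`. -/
def gabor (f : Conf d → ℂ) (z : Phase d) : ℂ := stft (gaussian (Conf d)) f (pos z) (freq z)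

theorem gabor_pt (f : Conf d → ℂ) (x ξ : Conf d) : gabor f (pt x ξ) = stft (gaussian (Conf d)) f x ξ := rfl

theorem continuous_gabor {f : Conf d → ℂ} (hf : MemLp f 2) : Continuous (gabor f) := by
  have h1 := (continuous_stft_gaussian hf).comp ((continuous_pos (d := d)).prodMk continuous_freq)
  exact h1

theorem lintegral_phase (F : Phase d → ℝ≥0∞) :
    ∫⁻ z, F z = ∫⁻ p : Conf d × Conf d, F (pt p.1 p.2) ∂(volume.prod volume) :=
  (measurePreserving_pt.lintegral_comp_emb measurableEmbedding_pt F).symm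

theorem memM1_iff {m : Phase d → ℝ} {φ : Conf d → ℂ} :
    MemM1 m φ ↔ MemLp φ 2 ∧ ∫⁻ z, ‖gabor φ z‖ₑ * ENNReal.ofReal (m z) < ∞ := by
  rw [lintegral_phase]
  rfl

theorem integrable_stft_of_lintegral_gabor {f : Conf d → ℂ} (hf : MemLp f 2)
    (h1 : ∫⁻ z, ‖gabor f z‖ₑ < ∞) :
    Integrable fun p : Conf d × Conf d => stft (gaussian (Conf d)) f p.1 p.2 := by
  refine ⟨(continuous_stft_gaussian hf).aestronglyMeasurable, ?_⟩
  rw [lintegral_phase] at h1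
  exact h1

theorem integrable_of_lintegral_gabor {f : Conf d → ℂ} (hf : MemLp f 2)
    (h1 : ∫⁻ z, ‖gabor f z‖ₑ < ∞) : Integrable f :=
  integrable_of_integrable_stft hf (integrable_stft_of_lintegral_gabor hf h1)

theorem enorm_stft_shift {V : Type*} [NormedAddCommGroup V] [InnerProductSpace ℝ V] [FiniteDimensional ℝ V]
    [MeasurableSpace V] [BorelSpace V] (γ f : V → ℂ) (a b x ξ : V) :
    ‖stft γ (shift a b f) x ξ‖ₑ = ‖stft γ f (x - a) (ξ - b)‖ₑ := by
  rw [stft_shift, enorm_mul, enorm_character, one_mul]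

theorem stft_const_mul {V : Type*} [NormedAddCommGroup V] [InnerProductSpace ℝ V] [FiniteDimensional ℝ V]
    [MeasurableSpace V] [BorelSpace V] (γ f : V → ℂ) (c : ℂ) (x ξ : V) :
    stft γ (fun t => c * f t) x ξ = c * stft γ f x ξ := by
  simp only [stft, mul_assoc, integral_const_mul]

theorem tauWigner_const_mul (τ : ℝ) (c c' : ℂ) (f h : Conf d → ℂ) (q : Phase d) :
    tauWigner τ (fun t => c * f t) (fun t => c' * h t) q = c * conj c' * tauWigner τ f h q := by
  simp only [tauWigner, ← integral_const_mul]
  congr 1 with y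
  rw [map_mul]
  ring

theorem enorm_stft_tauWigner_tfShift (τ : ℝ) (f h : Conf d → ℂ) (w z : Phase d) (p : Phase d × Phase d) :
    ‖stft (gaussian (Phase d)) (tauWigner τ (tfShift w f) (tfShift z h)) p.1 p.2‖ₑ =
      ‖stft (gaussian (Phase d)) (tauWigner τ f h) (p.1 - mapT τ w z) (p.2 - mapJ w z)‖ₑ := by
  obtain ⟨c, hc, h1⟩ := tauWigner_tfShift τ f h w z
  rw [funext h1, stft_const_mul, enorm_mul, enorm_stft_shift, ← ofReal_norm c, hc, ENNReal.ofReal_one, one_mul]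

/-- With f and h written as superpositions of shifted Gaussians, covariance moves the transform of
W_τ(g, g) to (T_τ(a,b), J(a,b)), and the uniform exponential decay applies to each term. -/
theorem exists_enorm_stft_tauWigner_le (d : ℕ) (α : ℝ) : ∃ C : ℝ≥0, ∀ τ : ℝ, 0 ≤ τ → τ ≤ 1 →
    ∀ f h : Conf d → ℂ, MemLp f 2 → MemLp h 2 → ∫⁻ z, ‖gabor f z‖ₑ < ∞ → ∫⁻ z, ‖gabor h z‖ₑ < ∞ →
    ∀ p : Phase d × Phase d, ‖stft (gaussian (Phase d)) (tauWigner τ f h) p.1 p.2‖ₑ ≤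
      C * ∫⁻ a, ∫⁻ b, ‖gabor f a‖ₑ * ‖gabor h b‖ₑ * expDecay α (p - (mapT τ a b, mapJ a b)) := by
  obtain ⟨C, hC0, hC⟩ := exists_norm_stft_tauWigner_gaussian_le d α
  refine ⟨C.toNNReal, fun τ h0 h1 f h hf hh hf1 hh1 p => ?_⟩
  have hfi := integrable_stft_of_lintegral_gabor hf hf1
  have hhi := integrable_stft_of_lintegral_gabor hh hh1
  refine (enorm_stft_tauWigner_superposition_le τ (integrable_superposition_gaussian hf hfi)
    (integrable_superposition_gaussian hh hhi) (ae_eq_superposition_gaussian hf hfi)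
    (ae_eq_superposition_gaussian hh hhi) p).trans ?_
  rw [lintegral_phase]
  simp only [lintegral_phase (d := d) (F := fun b => _ * _ * _)]
  rw [← lintegral_const_mul' _ _ ENNReal.coe_ne_top]
  refine lintegral_mono fun a => ?_
  rw [← lintegral_const_mul' _ _ ENNReal.coe_ne_top]
  refine lintegral_mono fun b => ?_
  dsimp only
  rw [funext (tauWigner_const_mul τ _ _ (shift a.1 a.2 (gaussian (Conf d))) (shift b.1 b.2 (gaussian (Conf d)))),
    stft_const_mul, enorm_mul, enorm_mul, RCLike.enorm_conj, mul_left_comm]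
  have e := enorm_stft_tauWigner_tfShift τ (gaussian (Conf d)) (gaussian (Conf d)) (pt a.1 a.2) (pt b.1 b.2) p
  simp only [tfShift, pos_pt, freq_pt] at e
  rw [e, gabor_pt, gabor_pt]
  gcongr
  rw [← ofReal_norm]
  refine (ENNReal.ofReal_le_ofReal (hC τ h0 h1 (p - (mapT τ (pt a.1 a.2) (pt b.1 b.2), mapJ (pt a.1 a.2) (pt b.1 b.2))))).trans ?_
  rw [ENNReal.ofReal_mul hC0]
  exact le_rfl

end Gabor

/-! ### Weights on vector spaces -/

section Weight

/-- Symmetric submultiplicative weights of at most exponential growth, bounded below by one. -/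
structure IsWeight {V : Type*} [NormedAddCommGroup V] [MeasurableSpace V] (m : V → ℝ≥0∞) : Prop where
  measurable : Measurable m
  one_le : ∀ x, 1 ≤ m x
  neg : ∀ x, m (-x) = m x
  submul : ∀ x y, m (x + y) ≤ m x * m y
  exp_le : ∃ (α : ℝ) (C : ℝ≥0), 0 ≤ α ∧ ∀ x, m x ≤ C * ENNReal.ofReal (Real.exp (α * ‖x‖))

variable {V : Type*} [NormedAddCommGroup V] [NormedSpace ℝ V] [FiniteDimensional ℝ V]
  [MeasurableSpace V] [BorelSpace V] {m : V → ℝ≥0∞} {μ : Measure V} [μ.IsAddHaarMeasure]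

theorem IsWeight.ne_top (hm : IsWeight m) (x : V) : m x ≠ ∞ := by
  obtain ⟨α, C, -, h⟩ := hm.exp_le
  exact ne_top_of_le_ne_top (ENNReal.mul_ne_top ENNReal.coe_ne_top ENNReal.ofReal_ne_top) (h x)

theorem IsWeight.le_mul_sub (hm : IsWeight m) (x y : V) : m x ≤ m y * m (x - y) := by
  simpa using hm.submul y (x - y)

theorem IsWeight.le_mul_sub' (hm : IsWeight m) (x y : V) : m x ≤ m y * m (y - x) := by
  rw [← neg_sub, hm.neg]; exact hm.le_mul_sub x y

theorem IsWeight.lintegral_le (hm : IsWeight m) (f : V → ℝ≥0∞) : ∫⁻ x, f x ∂μ ≤ ∫⁻ x, f x * m x ∂μ :=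
  lintegral_mono fun x => le_mul_of_one_le_right' (hm.one_le x)

theorem IsWeight.comp {W : Type*} [NormedAddCommGroup W] [NormedSpace ℝ W] [FiniteDimensional ℝ W]
    [MeasurableSpace W] [BorelSpace W] (hm : IsWeight m) (L : W →L[ℝ] V) : IsWeight fun x => m (L x) where
  measurable := hm.measurable.comp L.continuous.measurable
  one_le x := hm.one_le _
  neg x := by rw [map_neg, hm.neg]
  submul x y := by rw [map_add]; exact hm.submul _ _
  exp_le := by
    obtain ⟨α, C, h0, h⟩ := hm.exp_le
    refine ⟨α * ‖L‖, C, by positivity, fun x => (h _).trans ?_⟩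
    rw [mul_assoc]
    gcongr
    exact L.le_opNorm x

/-- Young's inequality in weighted L¹, from m(x) ≤ m(y) m(x - y) and Tonelli. -/
theorem IsWeight.lintegral_conv_mul_le (hm : IsWeight m) {f g : V → ℝ≥0∞} (hf : Measurable f)
    (hg : Measurable g) :
    ∫⁻ x, (∫⁻ y, f y * g (x - y) ∂μ) * m x ∂μ ≤ (∫⁻ y, f y * m y ∂μ) * ∫⁻ y, g y * m y ∂μ := by
  have h0 := hm.measurable
  calc ∫⁻ x, (∫⁻ y, f y * g (x - y) ∂μ) * m x ∂μ
      ≤ ∫⁻ x, ∫⁻ y, (f y * m y) * (g (x - y) * m (x - y)) ∂μ ∂μ := by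
        refine lintegral_mono fun x => ?_
        rw [← lintegral_mul_const _ (by fun_prop)]
        refine lintegral_mono fun y => ?_
        calc f y * g (x - y) * m x ≤ f y * g (x - y) * (m y * m (x - y)) := by gcongr; exact hm.le_mul_sub x y
          _ = _ := by ring
    _ = ∫⁻ y, ∫⁻ x, (f y * m y) * (g (x - y) * m (x - y)) ∂μ ∂μ :=
        lintegral_lintegral_swap (Measurable.aemeasurable (by fun_prop))
    _ = ∫⁻ y, (f y * m y) * ∫⁻ x, g x * m x ∂μ ∂μ := by
        refine lintegral_congr fun y => ?_
        rw [lintegral_const_mul _ (by fun_prop), lintegral_sub_right_eq_self (fun x => g x * m x) y]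
    _ = _ := lintegral_mul_const _ (by fun_prop)

theorem IsWeight.lintegral_conv_neg_mul_le (hm : IsWeight m) {f g : V → ℝ≥0∞} (hf : Measurable f)
    (hg : Measurable g) :
    ∫⁻ x, (∫⁻ y, f y * g (y - x) ∂μ) * m x ∂μ ≤ (∫⁻ y, f y * m y ∂μ) * ∫⁻ y, g y * m y ∂μ := by
  have h := hm.lintegral_conv_mul_le (μ := μ) hf (hg.comp measurable_neg)
  simp only [Function.comp_apply, neg_sub] at h
  refine h.trans_eq ?_
  congr 1
  rw [← lintegral_neg_eq_self]
  simp only [neg_neg, hm.neg]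

theorem IsWeight.exists_lintegral_expDecay_lt_top (hm : IsWeight m) :
    ∃ α₀ : ℝ, 0 < α₀ ∧ ∀ α, α₀ ≤ α → ∫⁻ x, expDecay α x * m x ∂μ < ∞ := by
  obtain ⟨α, C, h0, h⟩ := hm.exp_le
  refine ⟨α + 1, by linarith, fun β hβ => ?_⟩
  calc ∫⁻ x, expDecay β x * m x ∂μ ≤ ∫⁻ x, C * expDecay 1 x ∂μ := by
        refine lintegral_mono fun x => ?_
        calc expDecay β x * m x ≤ expDecay (1 + α) x * (C * ENNReal.ofReal (Real.exp (α * ‖x‖))) := by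
              gcongr
              · exact expDecay_antitone (by linarith) x
              · exact h x
          _ = C * expDecay 1 x * (expDecay α x * ENNReal.ofReal (Real.exp (α * ‖x‖))) := by
              rw [expDecay_add]; ring
          _ = C * expDecay 1 x := by
              rw [expDecay, expDecay, ← ENNReal.ofReal_mul (Real.exp_pos _).le, ← Real.exp_add]
              simp
    _ = C * ∫⁻ x, expDecay 1 x ∂μ := lintegral_const_mul _ (by fun_prop)
    _ < ∞ := ENNReal.mul_lt_top ENNReal.coe_lt_top (lintegral_expDecay_lt_top μ one_pos)

end Weight

/-! ### Amalgam norms and change of window -/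

section Distribution
variable {V : Type} [NormedAddCommGroup V] [InnerProductSpace ℝ V] [FiniteDimensional ℝ V]
  [MeasurableSpace V] [BorelSpace V]

/-- The function `x ↦ sup_ξ |V_g σ(x, ξ)|`. -/
def ampl (σ : 𝓢'(V, ℂ)) (x : V) : ℝ≥0∞ := ⨆ ξ : V, ‖distSTFT σ x ξ‖ₑ

theorem measurable_ampl (σ : 𝓢'(V, ℂ)) : Measurable (ampl σ) := by
  refine LowerSemicontinuous.measurable (lowerSemicontinuous_iSup fun ξ => ?_)
  have h1 := (continuous_distSTFT σ).comp (by fun_prop : Continuous fun x : V => (x, ξ))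
  exact h1.enorm.lowerSemicontinuous

theorem enorm_distSTFT_le_ampl (σ : 𝓢'(V, ℂ)) (x ξ : V) : ‖distSTFT σ x ξ‖ₑ ≤ ampl σ x :=
  le_iSup (fun ξ => ‖distSTFT σ x ξ‖ₑ) ξ

/-- In the reproducing formula the position integral is controlled by the amplitude, so the decay of
the kernel in position may be discarded; its decay in frequency integrates to a constant. -/
theorem memModInfty_zero_of_lintegral_ampl {σ : 𝓢'(V, ℂ)} (h : ∫⁻ x, ampl σ x < ∞) : MemModInfty 0 σ := by
  set c := ENNReal.ofReal (Real.exp (2 ^ 2 / (2 * Real.pi)))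
  set M := c * ((∫⁻ x, ampl σ x) * ∫⁻ x : V, expDecay 1 x)
  have hA := measurable_ampl σ
  have hM : M < ∞ := ENNReal.mul_lt_top ENNReal.ofReal_lt_top
    (ENNReal.mul_lt_top h (lintegral_expDecay_lt_top volume one_pos))
  have key : ∀ a b : V, ‖distSTFT σ a b‖ₑ ≤ M := by
    intro a b
    rw [distSTFT_reproducing]
    refine (enorm_integral_le_lintegral_enorm _).trans ?_
    calc ∫⁻ p : V × V, ‖conj (stft (gaussian V) (shift a b (gaussian V)) p.1 p.2) * distSTFT σ p.1 p.2‖ₑ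
        ≤ ∫⁻ p : V × V, c * (ampl σ p.1 * expDecay 1 (p.2 - b)) := by
          refine lintegral_mono fun p => ?_
          have h1 := norm_stft_gaussian_shift_gaussian_le 2 (a, b) p
          have h2 : ‖stft (gaussian V) (shift a b (gaussian V)) p.1 p.2‖ₑ ≤ c * expDecay (2 * 1) (p - (a, b)) := by
            rw [← ofReal_norm]
            refine (ENNReal.ofReal_le_ofReal h1).trans ?_
            rw [ENNReal.ofReal_mul (Real.exp_pos _).le, expDecay, mul_one]
          have h3 : expDecay (2 * 1) (p - (a, b)) ≤ expDecay 1 (p.2 - b) :=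
            (expDecay_prod_le zero_le_one _).trans
              (mul_le_of_le_one_left' (expDecay_le_one zero_le_one _))
          rw [enorm_mul, RCLike.enorm_conj]
          calc _ ≤ (c * expDecay 1 (p.2 - b)) * ampl σ p.1 := by
                gcongr
                · exact h2.trans (by gcongr)
                · exact enorm_distSTFT_le_ampl σ _ _
            _ = _ := by ring
      _ = M := by
          have h4 : Measurable fun y : V => expDecay 1 (y - b) := by fun_prop
          rw [lintegral_const_mul _ (by fun_prop), Measure.volume_eq_prod,
            lintegral_prod_mul (f := ampl σ) (g := fun y => expDecay 1 (y - b)) hA.aemeasurable h4.aemeasurable,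
            lintegral_sub_right_eq_self (fun x => expDecay 1 x) b]
  refine ⟨M.toReal, fun x ξ => ?_⟩
  rw [pow_zero, mul_one, ← toReal_enorm]
  exact ENNReal.toReal_mono hM.ne (key x ξ)

/-- A single pairing of π(a,b)f with π(x,ξ)Ψ, read with either function as the window. This allows
the orthogonality relations to be used in the variable that shifts Ψ. -/
theorem stft_window_eq (Ψ f : V → ℂ) (a b x ξ : V) :
    stft Ψ (shift a b f) x ξ = conj (stft f (shift x ξ Ψ) a b) := by
  rw [conj_stft]
  rfl

theorem enorm_bracket_le (σ : 𝓢'(V, ℂ)) (Ψ : V → ℂ) :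
    ‖bracket σ Ψ‖ₑ ≤ ∫⁻ p : V × V, ‖distSTFT σ p.1 p.2‖ₑ * ‖stft (gaussian V) Ψ p.1 p.2‖ₑ := by
  refine (enorm_integral_le_lintegral_enorm _).trans_eq ?_
  simp only [enorm_mul, RCLike.enorm_conj]

/-- The polynomial weight of `BracketDefined`, as an `IsWeight` on `V × V`. -/
def polyWeight (N : ℕ) (p : V × V) : ℝ≥0∞ := ENNReal.ofReal ((1 + ‖p.1‖ + ‖p.2‖) ^ N)

theorem one_add_pow_le_exp (N : ℕ) {r : ℝ} (hr : 0 ≤ r) : (1 + r) ^ N ≤ Real.exp (N * r) := by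
  rw [Real.exp_nat_mul]
  gcongr
  linarith [Real.add_one_le_exp r]

theorem isWeight_polyWeight (N : ℕ) : IsWeight (polyWeight (V := V) N) where
  measurable := by unfold polyWeight; fun_prop
  one_le p := by
    rw [polyWeight, ENNReal.one_le_ofReal]
    exact one_le_pow₀ (by linarith [norm_nonneg p.1, norm_nonneg p.2])
  neg p := by simp [polyWeight]
  submul p q := by
    rw [polyWeight, polyWeight, polyWeight, ← ENNReal.ofReal_mul (by positivity), ← mul_pow]
    refine ENNReal.ofReal_le_ofReal (pow_le_pow_left₀ (by positivity) ?_ N)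
    have h1 := norm_add_le p.1 q.1
    have h2 := norm_add_le p.2 q.2
    simp only [Prod.fst_add, Prod.snd_add]
    nlinarith [mul_nonneg (norm_nonneg p.1) (norm_nonneg q.1), mul_nonneg (norm_nonneg p.1) (norm_nonneg q.2),
      mul_nonneg (norm_nonneg p.2) (norm_nonneg q.1), mul_nonneg (norm_nonneg p.2) (norm_nonneg q.2)]
  exp_le := by
    refine ⟨N * 2, 1, by positivity, fun p => ?_⟩
    rw [ENNReal.coe_one, one_mul, polyWeight]
    refine ENNReal.ofReal_le_ofReal ?_
    rw [add_assoc]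
    refine (one_add_pow_le_exp N (by positivity)).trans (Real.exp_le_exp.2 ?_)
    rw [mul_assoc]
    gcongr
    linarith [norm_fst_le p, norm_snd_le p]

theorem MemModInfty.enorm_le {N : ℕ} {σ : 𝓢'(V, ℂ)} (h : MemModInfty N σ) : ∃ C : ℝ≥0,
    ∀ p : V × V, ‖distSTFT σ p.1 p.2‖ₑ ≤ C * polyWeight N p := by
  obtain ⟨C, hC⟩ := h
  refine ⟨C.toNNReal, fun p => ?_⟩
  rw [← ofReal_norm, polyWeight]
  refine (ENNReal.ofReal_le_ofReal (hC p.1 p.2)).trans (ENNReal.ofReal_mul' (by positivity)).le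

/-- Inversion of `p ↦ ⟨σ, π(p) Ψ⟩`. -/
theorem distSTFT_eq_integral_bracket {σ : 𝓢'(V, ℂ)} {Ψ : V → ℂ} (h : BracketDefined σ Ψ) (a b : V) :
    (∫ t, Ψ t * conj (Ψ t)) * distSTFT σ a b =
      ∫ p : V × V, stft (gaussian V) (shift p.1 p.2 Ψ) a b * bracket σ (shift p.1 p.2 Ψ) := by
  obtain ⟨N, hσ, hΨ, hΨN⟩ := h
  obtain ⟨C, hC⟩ := hσ.enorm_le
  have hw := isWeight_polyWeight (V := V) N
  have hcK := continuous_stft_gaussian hΨ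
  have hcF := continuous_distSTFT σ
  have hK : Continuous fun r : (V × V) × (V × V) => stft (gaussian V) (shift r.1.1 r.1.2 Ψ) r.2.1 r.2.2 := by
    simp only [stft_shift]
    have h1 := continuous_character.comp (f := fun r : (V × V) × (V × V) => (r.1.2 - r.2.2, r.1.1)) (by fun_prop)
    have h2 := hcK.comp (by fun_prop : Continuous fun r : (V × V) × (V × V) => (r.2.1 - r.1.1, r.2.2 - r.1.2))
    exact h1.mul h2
  -- The growth of V_Gσ at r.1 is distributed by submultiplicativity over (a, b), (a, b) - r.2 and
  -- r.1 - r.2; the last two factors are absorbed by the weighted transform of Ψ.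
  have hint : Integrable (fun r : (V × V) × (V × V) => stft (gaussian V) (shift r.2.1 r.2.2 Ψ) a b *
      (distSTFT σ r.1.1 r.1.2 * conj (stft (gaussian V) (shift r.2.1 r.2.2 Ψ) r.1.1 r.1.2)))
      (volume.prod volume) := by
    refine ⟨Continuous.aestronglyMeasurable ?_, ?_⟩
    · have h1 := hK.comp (by fun_prop : Continuous fun r : (V × V) × (V × V) => (r.2, (a, b)))
      have h2 := hK.comp continuous_swap
      have h3 := hcF.comp (continuous_fst : Continuous (Prod.fst : (V × V) × (V × V) → V × V))
      exact h1.mul (h3.mul (Complex.continuous_conj.comp h2))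
    · set k : V × V → ℝ≥0∞ := fun p => ‖stft (gaussian V) Ψ p.1 p.2‖ₑ * polyWeight N p with hk
      have hkm : Measurable k := hcK.measurable.enorm.mul hw.measurable
      have hwm := hw.measurable
      have hb : ∀ r : (V × V) × (V × V), ‖stft (gaussian V) (shift r.2.1 r.2.2 Ψ) a b *
          (distSTFT σ r.1.1 r.1.2 * conj (stft (gaussian V) (shift r.2.1 r.2.2 Ψ) r.1.1 r.1.2))‖ₑ ≤
          C * polyWeight N (a, b) * (k ((a, b) - r.2) * k (r.1 - r.2)) := by
        intro r
        rw [enorm_mul, enorm_mul, RCLike.enorm_conj, enorm_stft_shift, enorm_stft_shift]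
        have h1 : polyWeight N r.1 ≤ polyWeight N (a, b) * polyWeight N ((a, b) - r.2) * polyWeight N (r.1 - r.2) := by
          refine (hw.le_mul_sub r.1 r.2).trans ?_
          gcongr
          exact hw.le_mul_sub' _ _
        calc _ ≤ ‖stft (gaussian V) Ψ (a - r.2.1) (b - r.2.2)‖ₑ * ((C * (polyWeight N (a, b) *
            polyWeight N ((a, b) - r.2) * polyWeight N (r.1 - r.2))) *
            ‖stft (gaussian V) Ψ (r.1.1 - r.2.1) (r.1.2 - r.2.2)‖ₑ) := by
              gcongr
              exact (hC r.1).trans (by gcongr)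
          _ = _ := by
              rw [hk]
              simp only [Prod.fst_sub, Prod.snd_sub]
              ring
      refine lt_of_le_of_lt (lintegral_mono hb) ?_
      rw [lintegral_const_mul _ (by fun_prop)]
      refine ENNReal.mul_lt_top (ENNReal.mul_lt_top ENNReal.coe_lt_top (hw.ne_top _).lt_top) ?_
      rw [lintegral_prod_symm _ (Measurable.aemeasurable (by fun_prop))]
      have h1 : ∀ y : V × V, ∫⁻ x : V × V, k ((a, b) - y) * k (x - y) = k ((a, b) - y) * ∫⁻ x, k x := by
        intro y
        rw [lintegral_const_mul _ (by fun_prop), lintegral_sub_right_eq_self (fun x => k x) y]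
      simp only [h1]
      rw [lintegral_mul_const _ (by fun_prop), lintegral_sub_left_eq_self (fun x => k x)]
      exact ENNReal.mul_lt_top hΨN hΨN
  -- The orthogonality relations with window Ψ on both sides show that the integral over the shifts
  -- of Ψ reproduces the Gaussian kernel, up to ‖Ψ‖².
  have h1 : ∀ q : V × V, (∫ t, Ψ t * conj (Ψ t)) * (conj (stft (gaussian V) (shift a b (gaussian V)) q.1 q.2) *
      distSTFT σ q.1 q.2) = ∫ p : V × V, stft (gaussian V) (shift p.1 p.2 Ψ) a b *
      (distSTFT σ q.1 q.2 * conj (stft (gaussian V) (shift p.1 p.2 Ψ) q.1 q.2)) := by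
    intro q
    have hM := integral_conj_stft_mul_stft hΨ hΨ (memLp_shift memLp_gaussian q.1 q.2)
      (memLp_shift (memLp_gaussian (V := V)) a b)
    have e1 : conj (stft (gaussian V) (shift a b (gaussian V)) q.1 q.2) =
        ∫ t, conj (shift a b (gaussian V) t) * shift q.1 q.2 (gaussian V) t := by
      rw [conj_stft]
      congr 1 with t
      ring
    rw [e1, ← mul_assoc, mul_comm (∫ t, Ψ t * conj (Ψ t)), ← hM, ← integral_mul_const]
    refine integral_congr_ae (.of_forall fun p => ?_)
    dsimp only
    rw [stft_window_eq Ψ (gaussian V) q.1 q.2 p.1 p.2, stft_window_eq Ψ (gaussian V) a b p.1 p.2,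
      Complex.conj_conj]
    ring
  rw [distSTFT_reproducing, ← integral_const_mul]
  simp only [h1]
  have h2 := integral_integral_swap (f := fun (q p : V × V) => stft (gaussian V) (shift p.1 p.2 Ψ) a b *
      (distSTFT σ q.1 q.2 * conj (stft (gaussian V) (shift p.1 p.2 Ψ) q.1 q.2))) hint
  rw [h2]
  refine integral_congr_ae (.of_forall fun p => ?_)
  exact integral_const_mul _ _

/-- Inversion gives |V_Gσ(x,ξ)| ≤ ‖Ψ‖⁻² ∫ H(y) Θ(x - y) dy with Θ the frequency marginal of |V_GΨ|.
The right side does not depend on ξ, so the supremum costs nothing, and Young's inequality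
concludes. An almost everywhere bound suffices, which permits a measurable modification of H. -/
theorem lintegral_ampl_lt_top_of_bracket_le {σ : 𝓢'(V, ℂ)} {Ψ : V → ℂ} (hd : BracketDefined σ Ψ)
    (h0 : (∫ t, Ψ t * conj (Ψ t)) ≠ 0) {m : V → ℝ≥0∞} (hm : IsWeight m) {H : V → ℝ≥0∞} (hH : Measurable H)
    (hHm : ∫⁻ x, H x * m x < ∞)
    (hb : ∀ᵐ p : V × V, ‖bracket σ (shift p.1 p.2 Ψ)‖ₑ ≤ H p.1)
    (hΨm : ∫⁻ x, (∫⁻ ξ, ‖stft (gaussian V) Ψ x ξ‖ₑ) * m x < ∞) :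
    ∫⁻ x, ampl σ x * m x < ∞ := by
  have hcK := continuous_stft_gaussian hd.choose_spec.2.1
  set Θ : V → ℝ≥0∞ := fun x => ∫⁻ ξ, ‖stft (gaussian V) Ψ x ξ‖ₑ with hΘ
  have hKm : Measurable fun p : V × V => ‖stft (gaussian V) Ψ p.1 p.2‖ₑ := hcK.enorm.measurable
  have hΘm : Measurable Θ := hKm.lintegral_prod_right'
  set c := ∫ t, Ψ t * conj (Ψ t)
  have hc0 : ‖c‖ₑ ≠ 0 := by simpa using h0
  have key : ∀ x, ampl σ x ≤ ‖c‖ₑ⁻¹ * ∫⁻ y, H y * Θ (x - y) := by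
    intro x
    refine iSup_le fun ξ => ?_
    have h1 : ‖c‖ₑ * ‖distSTFT σ x ξ‖ₑ ≤ ∫⁻ y, H y * Θ (x - y) := by
      rw [← enorm_mul, distSTFT_eq_integral_bracket hd]
      refine (enorm_integral_le_lintegral_enorm _).trans ?_
      calc ∫⁻ p : V × V, ‖stft (gaussian V) (shift p.1 p.2 Ψ) x ξ * bracket σ (shift p.1 p.2 Ψ)‖ₑ
          ≤ ∫⁻ p : V × V, H p.1 * ‖stft (gaussian V) Ψ (x - p.1) (ξ - p.2)‖ₑ := by
            refine lintegral_mono_ae (hb.mono fun p hp => ?_)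
            rw [enorm_mul, enorm_stft_shift, mul_comm]
            gcongr
        _ = ∫⁻ y, ∫⁻ η, H y * ‖stft (gaussian V) Ψ (x - y) (ξ - η)‖ₑ := by
            rw [Measure.volume_eq_prod, lintegral_prod]
            have h2 := hKm.comp (by fun_prop : Measurable fun p : V × V => (x - p.1, ξ - p.2))
            exact ((hH.comp measurable_fst).mul h2).aemeasurable
        _ = ∫⁻ y, H y * Θ (x - y) := by
            refine lintegral_congr fun y => ?_
            have h2 := hKm.comp (by fun_prop : Measurable fun η : V => (x - y, η))
            have h3 : Measurable fun η : V => ‖stft (gaussian V) Ψ (x - y) (ξ - η)‖ₑ :=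
              h2.comp (by fun_prop : Measurable fun η : V => ξ - η)
            rw [lintegral_const_mul _ h3,
              lintegral_sub_left_eq_self (fun η => ‖stft (gaussian V) Ψ (x - y) η‖ₑ) ξ]
    calc ‖distSTFT σ x ξ‖ₑ = ‖c‖ₑ⁻¹ * (‖c‖ₑ * ‖distSTFT σ x ξ‖ₑ) := by
          rw [← mul_assoc, ENNReal.inv_mul_cancel hc0 enorm_ne_top, one_mul]
      _ ≤ _ := by gcongr
  calc ∫⁻ x, ampl σ x * m x ≤ ∫⁻ x, ‖c‖ₑ⁻¹ * ((∫⁻ y, H y * Θ (x - y)) * m x) := by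
        refine lintegral_mono fun x => ?_
        rw [← mul_assoc]
        gcongr
        exact key x
    _ = ‖c‖ₑ⁻¹ * ∫⁻ x, (∫⁻ y, H y * Θ (x - y)) * m x :=
        lintegral_const_mul' _ _ (ENNReal.inv_ne_top.2 hc0)
    _ ≤ ‖c‖ₑ⁻¹ * ((∫⁻ x, H x * m x) * ∫⁻ x, Θ x * m x) := by
        gcongr
        exact hm.lintegral_conv_mul_le hH hΘm
    _ < ∞ := ENNReal.mul_lt_top (ENNReal.inv_lt_top.2 (pos_iff_ne_zero.2 hc0)) (ENNReal.mul_lt_top hHm hΨm)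

end Distribution

/-! ### A regular majorant of the marginal of V_G W_τ(φ, φ) -/

section Majorant
variable {d : ℕ}

theorem mapT_eq_add (τ : ℝ) (w z : Phase d) : mapT τ w z = matD τ w + matD (1 - τ) z := by
  rw [mapT, matD, matD, sub_sub_cancel, pt_add]

/-- `matD τ` as a continuous linear map. -/
def matDL (d : ℕ) (τ : ℝ) : Phase d →L[ℝ] Phase d where
  toFun := matD τ
  map_add' z w := by simp only [matD, pos_add, freq_add, smul_add, pt_add]
  map_smul' c z := by simp only [matD, pos_smul, freq_smul, smul_comm _ c, pt_smul]; rfl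
  cont := by
    have h1 : Continuous (pos : Phase d → Conf d) := continuous_pos
    have h2 : Continuous (freq : Phase d → Conf d) := continuous_freq
    have h3 := (continuous_pt (d := d)).comp (by fun_prop : Continuous fun z : Phase d => ((1 - τ) • pos z, τ • freq z))
    exact h3

theorem matDL_apply (τ : ℝ) (z : Phase d) : matDL d τ z = matD τ z := rfl

theorem continuous_mapT (τ : ℝ) : Continuous fun r : Phase d × Phase d => mapT τ r.1 r.2 := by
  have h1 := (matDL d τ).continuous.comp (continuous_fst (X := Phase d) (Y := Phase d))
  have h2 := (matDL d (1 - τ)).continuous.comp (continuous_snd (X := Phase d) (Y := Phase d))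
  refine (h1.add h2).congr fun r => ?_
  rw [mapT_eq_add]
  rfl

theorem continuous_mapJ : Continuous fun r : Phase d × Phase d => mapJ r.1 r.2 := by
  have h1 : Continuous (pos : Phase d → Conf d) := continuous_pos
  have h2 : Continuous (freq : Phase d → Conf d) := continuous_freq
  have h3 := (continuous_pt (d := d)).comp
    (by fun_prop : Continuous fun r : Phase d × Phase d => (freq r.1 - freq r.2, pos r.2 - pos r.1))
  exact h3

@[fun_prop]
theorem measurable_matD (τ : ℝ) : Measurable (matD τ : Phase d → Phase d) :=
  (matDL d τ).continuous.measurable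

@[fun_prop]
theorem measurable_mapT {X : Type*} [MeasurableSpace X] (τ : ℝ) {f g : X → Phase d} (hf : Measurable f)
    (hg : Measurable g) : Measurable fun x => mapT τ (f x) (g x) := by
  have h := (continuous_mapT (d := d) τ).measurable.comp (hf.prodMk hg)
  exact h

@[fun_prop]
theorem measurable_mapJ {X : Type*} [MeasurableSpace X] {f g : X → Phase d} (hf : Measurable f)
    (hg : Measurable g) : Measurable fun x => mapJ (f x) (g x) := by
  have h := (continuous_mapJ (d := d)).measurable.comp (hf.prodMk hg)
  exact h

/-- For `Φ = |V_g φ|`, a regular majorant of the marginal `x ↦ ∫ |V_G W_τ(φ, φ)(x, ξ)| dξ`. -/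
def wignerMajorant (α τ : ℝ) (Φ : Phase d → ℝ≥0∞) (x : Phase d) : ℝ≥0∞ :=
  ∫⁻ r : Phase d × Phase d, Φ r.1 * Φ r.2 * expDecay α (x - mapT τ r.1 r.2)

variable {Φ : Phase d → ℝ≥0∞}

theorem measurable_wignerMajorant (α τ : ℝ) (hΦ : Measurable Φ) : Measurable (wignerMajorant α τ Φ) :=
  Measurable.lintegral_prod_right' (f := fun q : Phase d × (Phase d × Phase d) =>
      Φ q.2.1 * Φ q.2.2 * expDecay α (q.1 - mapT τ q.2.1 q.2.2)) (by fun_prop)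

/-- The exponential factor alone provides the regularity, whatever Φ is. It makes the majorant
finite everywhere and, later, fit for sampling on a lattice. -/
theorem wignerMajorant_le {α : ℝ} (hα : 0 ≤ α) (τ : ℝ) (Φ : Phase d → ℝ≥0∞) (x y : Phase d) :
    wignerMajorant α τ Φ x ≤ ENNReal.ofReal (Real.exp (α * ‖y‖)) * wignerMajorant α τ Φ (x + y) := by
  rw [wignerMajorant, wignerMajorant, ← lintegral_const_mul' _ _ ENNReal.ofReal_ne_top]
  refine lintegral_mono fun r => ?_
  rw [mul_left_comm]
  gcongr
  refine (expDecay_le hα _ y).trans_eq ?_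
  rw [sub_add_eq_add_sub]

/-- The weight at x is at most m(x - T_τ(a,b)) m(D_τ a) m(D_{1-τ} b), because T_τ(a,b) = D_τ a +
D_{1-τ} b; the triple integral then factorizes. The two conditions imposed on φ in (b) are used
here. -/
theorem lintegral_wignerMajorant_lt_top {m : Phase d → ℝ≥0∞} (hm : IsWeight m) {α τ : ℝ}
    (hΦ : Measurable Φ) (hα : ∫⁻ x, expDecay α x * m x < ∞)
    (h1 : ∫⁻ z, Φ z * m (matD τ z) < ∞) (h2 : ∫⁻ z, Φ z * m (matD (1 - τ) z) < ∞) :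
    ∫⁻ x, wignerMajorant α τ Φ x * m x < ∞ := by
  have hm0 := hm.measurable
  set I := ∫⁻ x, expDecay α x * m x
  have e1 : ∀ x, wignerMajorant α τ Φ x * m x = ∫⁻ r : Phase d × Phase d, Φ r.1 * Φ r.2 *
      expDecay α (x - mapT τ r.1 r.2) * m x := fun x => by
    have h5 : Measurable fun r : Phase d × Phase d => Φ r.1 * Φ r.2 * expDecay α (x - mapT τ r.1 r.2) := by
      fun_prop
    rw [wignerMajorant]
    exact (lintegral_mul_const _ h5).symm
  have e2 : ∫⁻ x, ∫⁻ r : Phase d × Phase d, Φ r.1 * Φ r.2 * expDecay α (x - mapT τ r.1 r.2) * m x =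
      ∫⁻ r : Phase d × Phase d, ∫⁻ x, Φ r.1 * Φ r.2 * expDecay α (x - mapT τ r.1 r.2) * m x := by
    have h5 : Measurable fun q : Phase d × (Phase d × Phase d) =>
        Φ q.2.1 * Φ q.2.2 * expDecay α (q.1 - mapT τ q.2.1 q.2.2) * m q.1 := by fun_prop
    exact lintegral_lintegral_swap (f := fun (x : Phase d) (r : Phase d × Phase d) =>
      Φ r.1 * Φ r.2 * expDecay α (x - mapT τ r.1 r.2) * m x) h5.aemeasurable
  have e3 : ∀ r : Phase d × Phase d, ∫⁻ x, Φ r.1 * Φ r.2 * expDecay α (x - mapT τ r.1 r.2) * m x ≤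
      (Φ r.1 * m (matD τ r.1)) * (Φ r.2 * m (matD (1 - τ) r.2)) * I := by
    intro r
    calc ∫⁻ x, Φ r.1 * Φ r.2 * expDecay α (x - mapT τ r.1 r.2) * m x
        ≤ ∫⁻ x, (Φ r.1 * Φ r.2 * m (mapT τ r.1 r.2)) *
          (expDecay α (x - mapT τ r.1 r.2) * m (x - mapT τ r.1 r.2)) := by
          refine lintegral_mono fun x => ?_
          calc Φ r.1 * Φ r.2 * expDecay α (x - mapT τ r.1 r.2) * m x
              ≤ Φ r.1 * Φ r.2 * expDecay α (x - mapT τ r.1 r.2) *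
                (m (mapT τ r.1 r.2) * m (x - mapT τ r.1 r.2)) := by
                gcongr; exact hm.le_mul_sub x _
            _ = _ := by ring
      _ = (Φ r.1 * Φ r.2 * m (mapT τ r.1 r.2)) * I := by
          rw [lintegral_const_mul _ (by fun_prop), lintegral_sub_right_eq_self (fun x => expDecay α x * m x)]
      _ ≤ (Φ r.1 * Φ r.2 * (m (matD τ r.1) * m (matD (1 - τ) r.2))) * I := by
          gcongr
          rw [mapT_eq_add]
          exact hm.submul _ _
      _ = _ := by ring
  have e4 : ∫⁻ r : Phase d × Phase d, (Φ r.1 * m (matD τ r.1)) * (Φ r.2 * m (matD (1 - τ) r.2)) * I =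
      (∫⁻ z, Φ z * m (matD τ z)) * (∫⁻ z, Φ z * m (matD (1 - τ) z)) * I := by
    have a1 : Measurable fun z => Φ z * m (matD τ z) := by fun_prop
    have a2 : Measurable fun z => Φ z * m (matD (1 - τ) z) := by fun_prop
    have a3 : Measurable fun r : Phase d × Phase d => (Φ r.1 * m (matD τ r.1)) * (Φ r.2 * m (matD (1 - τ) r.2)) := by
      fun_prop
    rw [lintegral_mul_const _ a3, Measure.volume_eq_prod,
      lintegral_prod_mul (f := fun z => Φ z * m (matD τ z)) (g := fun z => Φ z * m (matD (1 - τ) z))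
      a1.aemeasurable a2.aemeasurable]
  rw [lintegral_congr e1, e2]
  refine (lintegral_mono e3).trans_lt ?_
  rw [e4]
  exact ENNReal.mul_lt_top (ENNReal.mul_lt_top h1 h2) hα

theorem lintegral_pair_expDecay {α : ℝ} (τ : ℝ) (hΦ : Measurable Φ) (x : Phase d) :
    ∫⁻ ξ : Phase d, ∫⁻ r : Phase d × Phase d, Φ r.1 * Φ r.2 *
      expDecay α (x - mapT τ r.1 r.2) * expDecay α (ξ - mapJ r.1 r.2) =
    wignerMajorant α τ Φ x * ∫⁻ ξ : Phase d, expDecay α ξ := by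
  have h5 : Measurable fun q : Phase d × (Phase d × Phase d) => Φ q.2.1 * Φ q.2.2 *
      expDecay α (x - mapT τ q.2.1 q.2.2) * expDecay α (q.1 - mapJ q.2.1 q.2.2) := by fun_prop
  have e := lintegral_lintegral_swap (μ := (volume : Measure (Phase d)))
    (ν := (volume : Measure (Phase d × Phase d))) (f := fun (ξ : Phase d) (r : Phase d × Phase d) =>
          Φ r.1 * Φ r.2 * expDecay α (x - mapT τ r.1 r.2) * expDecay α (ξ - mapJ r.1 r.2)) h5.aemeasurable
  have e2 : ∀ r : Phase d × Phase d, ∫⁻ ξ, Φ r.1 * Φ r.2 *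
      expDecay α (x - mapT τ r.1 r.2) * expDecay α (ξ - mapJ r.1 r.2) =
      Φ r.1 * Φ r.2 * expDecay α (x - mapT τ r.1 r.2) * ∫⁻ ξ : Phase d, expDecay α ξ := by
    intro r
    rw [lintegral_const_mul _ (by fun_prop), lintegral_sub_right_eq_self (fun ξ => expDecay α ξ)]
  have h6 : Measurable fun r : Phase d × Phase d => Φ r.1 * Φ r.2 * expDecay α (x - mapT τ r.1 r.2) := by
    fun_prop
  rw [e, lintegral_congr e2, lintegral_mul_const _ h6, wignerMajorant]

/-- The modulus of the Gabor transform. -/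
def gaborNorm (φ : Conf d → ℂ) (z : Phase d) : ℝ≥0∞ := ‖gabor φ z‖ₑ

theorem measurable_gaborNorm {φ : Conf d → ℂ} (hφ : MemLp φ 2) : Measurable (gaborNorm φ) :=
  (continuous_gabor hφ).enorm.measurable

/-- The pointwise bound at rate 2α splits into rate α in position and rate α in frequency; the
latter integrates to a constant. -/
theorem exists_lintegral_stft_tauWigner_le (d : ℕ) {α : ℝ} (hα : 0 < α) : ∃ C : ℝ≥0, ∀ τ : ℝ, 0 ≤ τ → τ ≤ 1 →
    ∀ φ : Conf d → ℂ, MemLp φ 2 → ∫⁻ z, gaborNorm φ z < ∞ → ∀ x : Phase d,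
    ∫⁻ ξ, ‖stft (gaussian (Phase d)) (tauWigner τ φ φ) x ξ‖ₑ ≤ C * wignerMajorant α τ (gaborNorm φ) x := by
  obtain ⟨C, hC⟩ := exists_enorm_stft_tauWigner_le d (2 * α)
  have hI := lintegral_expDecay_lt_top (volume : Measure (Phase d)) hα
  refine ⟨C * (∫⁻ x : Phase d, expDecay α x).toNNReal, fun τ h0 h1 φ hφ hφ1 x => ?_⟩
  have hg := measurable_gaborNorm hφ
  rw [ENNReal.coe_mul, ENNReal.coe_toNNReal hI.ne]
  calc ∫⁻ ξ, ‖stft (gaussian (Phase d)) (tauWigner τ φ φ) x ξ‖ₑ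
      ≤ ∫⁻ ξ, C * ∫⁻ r : Phase d × Phase d, gaborNorm φ r.1 * gaborNorm φ r.2 *
          expDecay α (x - mapT τ r.1 r.2) * expDecay α (ξ - mapJ r.1 r.2) := by
        refine lintegral_mono fun ξ => (hC τ h0 h1 φ φ hφ hφ hφ1 hφ1 (x, ξ)).trans ?_
        have h5 : Measurable fun r : Phase d × Phase d => gaborNorm φ r.1 * gaborNorm φ r.2 *
          expDecay α (x - mapT τ r.1 r.2) * expDecay α (ξ - mapJ r.1 r.2) := by fun_prop
        rw [Measure.volume_eq_prod, lintegral_prod _ h5.aemeasurable]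
        refine mul_le_mul_right (lintegral_mono fun a => lintegral_mono fun b => ?_) _
        rw [mul_assoc (gaborNorm φ a * gaborNorm φ b)]
        exact mul_le_mul_right (expDecay_prod_le hα.le _) _
    _ = C * (wignerMajorant α τ (gaborNorm φ) x * ∫⁻ ξ : Phase d, expDecay α ξ) := by
        rw [lintegral_const_mul' _ _ ENNReal.coe_ne_top, lintegral_pair_expDecay τ hg]
    _ = _ := by ring

end Majorant

/-! ### The equivalence between amalgam membership and Gabor matrix decay -/

section Core

theorem measurable_sub_sub_of_measurable {V W : Type*} [MeasurableSpace V] [AddGroup V] [MeasurableSub V]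
    [MeasurableSpace W] {F : V × V → W} (hF : Measurable F) (a b : V) :
    Measurable fun p : V × V => F (p.1 - a, p.2 - b) :=
  hF.comp (((measurable_sub_const a).comp measurable_fst).prodMk ((measurable_sub_const b).comp measurable_snd))

variable {d : ℕ} {φ : Conf d → ℂ}

theorem memLp_tfShift (hφ : MemLp φ 2) (z : Phase d) : MemLp (tfShift z φ) 2 := memLp_shift hφ _ _

theorem tfShift_zero (φ : Conf d → ℂ) : tfShift 0 φ = φ := by
  funext t
  have h1 : pos (0 : Phase d) = 0 := rfl
  have h2 : freq (0 : Phase d) = 0 := rfl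
  simp [tfShift, shift, h1, h2]

/-- Off-diagonal decay of the Gabor matrix, with a majorant of moderate variation. -/
theorem exists_majorant_of_lintegral_ampl {m : Phase d → ℝ≥0∞} (hm : IsWeight m) {τ : ℝ} (h0 : 0 ≤ τ)
    (h1 : τ ≤ 1) (hφ : MemLp φ 2) (hφ1 : ∫⁻ z, gaborNorm φ z * m (matD τ z) < ∞)
    (hφ2 : ∫⁻ z, gaborNorm φ z * m (matD (1 - τ) z) < ∞) {σ : 𝓢'(Phase d, ℂ)}
    (hσ : ∫⁻ x, ampl σ x * m x < ∞) :
    ∃ (α : ℝ) (H : Phase d → ℝ≥0∞), 0 ≤ α ∧ Measurable H ∧ ∫⁻ x, H x * m x < ∞ ∧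
      (∀ u q, H (u + q) ≤ ENNReal.ofReal (Real.exp (α * ‖q‖)) * H u) ∧
      ∀ w z, OpEntryDefined τ σ (tfShift z φ) (tfShift w φ) ∧
        ‖opEntry τ σ (tfShift z φ) (tfShift w φ)‖ₑ ≤ H (mapT τ w z) := by
  obtain ⟨α, hα, hαm⟩ := hm.exists_lintegral_expDecay_lt_top (μ := (volume : Measure (Phase d)))
  obtain ⟨C, hC⟩ := exists_lintegral_stft_tauWigner_le d hα
  have hφ0 : ∫⁻ z, gaborNorm φ z < ∞ :=
    lt_of_le_of_lt (lintegral_mono fun z => le_mul_of_one_le_right' (hm.one_le _)) hφ1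
  have hφi := integrable_of_lintegral_gabor hφ hφ0
  have hA := measurable_ampl σ
  have hW := measurable_wignerMajorant α τ (measurable_gaborNorm hφ)
  have hWm := lintegral_wignerMajorant_lt_top hm (measurable_gaborNorm hφ) (hαm α le_rfl) hφ1 hφ2
  have hK : Continuous fun p : Phase d × Phase d =>
      stft (gaussian (Phase d)) (tauWigner τ φ φ) p.1 p.2 :=
    continuous_stft_gaussian (memLp_tauWigner τ hφ hφi hφ hφi)
  have hK1 : ∫⁻ p : Phase d × Phase d, ‖stft (gaussian (Phase d)) (tauWigner τ φ φ) p.1 p.2‖ₑ < ∞ := by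
    rw [Measure.volume_eq_prod, lintegral_prod _ hK.enorm.measurable.aemeasurable]
    calc _ ≤ ∫⁻ x, C * wignerMajorant α τ (gaborNorm φ) x := lintegral_mono fun x => hC τ h0 h1 φ hφ hφ0 x
      _ = C * ∫⁻ x, wignerMajorant α τ (gaborNorm φ) x := lintegral_const_mul _ hW
      _ < ∞ := ENNReal.mul_lt_top ENNReal.coe_lt_top ((hm.lintegral_le _).trans_lt hWm)
  -- H is the correlation of the amplitude of σ with the majorant, and inherits its regularity. The
  -- brackets are defined with exponent 0, since the amalgam space lies in unweighted M^∞.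
  refine ⟨α, fun u => C * ∫⁻ x, ampl σ x * wignerMajorant α τ (gaborNorm φ) (x - u), hα.le, ?_, ?_, fun u q => ?_,
    fun w z => ⟨⟨0, ?_, ?_, ?_⟩, ?_⟩⟩
  · have h5 : Measurable fun r : Phase d × Phase d =>
        ampl σ r.2 * wignerMajorant α τ (gaborNorm φ) (r.2 - r.1) := by fun_prop
    exact h5.lintegral_prod_right'.const_mul _
  · simp only [mul_assoc]
    rw [lintegral_const_mul' _ _ ENNReal.coe_ne_top]
    exact ENNReal.mul_lt_top ENNReal.coe_lt_top
      ((hm.lintegral_conv_neg_mul_le hA hW).trans_lt (ENNReal.mul_lt_top hσ hWm))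
  · dsimp only
    rw [mul_left_comm]
    gcongr
    rw [← lintegral_const_mul' _ _ ENNReal.ofReal_ne_top]
    refine lintegral_mono fun x => ?_
    rw [mul_left_comm]
    gcongr
    refine (wignerMajorant_le hα.le τ (gaborNorm φ) _ q).trans_eq ?_
    rw [← sub_sub, sub_add_cancel]
  · exact memModInfty_zero_of_lintegral_ampl ((hm.lintegral_le _).trans_lt hσ)
  · exact memLp_tauWigner τ (memLp_tfShift hφ w) (integrable_shift hφi _ _) (memLp_tfShift hφ z)
      (integrable_shift hφi _ _)
  · simp only [pow_zero, ENNReal.ofReal_one, mul_one, enorm_stft_tauWigner_tfShift]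
    have h5 := lintegral_sub_right_eq_self (μ := (volume : Measure (Phase d × Phase d)))
      (fun p : Phase d × Phase d =>
        ‖stft (gaussian (Phase d)) (tauWigner τ φ φ) p.1 p.2‖ₑ) (mapT τ w z, mapJ w z)
    exact lt_of_eq_of_lt h5 hK1
  · have hKw : Measurable fun p : Phase d × Phase d => ‖stft (gaussian (Phase d)) (tauWigner τ φ φ)
        (p.1 - mapT τ w z) (p.2 - mapJ w z)‖ₑ :=
      measurable_sub_sub_of_measurable hK.enorm.measurable _ _
    calc ‖opEntry τ σ (tfShift z φ) (tfShift w φ)‖ₑ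
        ≤ ∫⁻ p : Phase d × Phase d, ampl σ p.1 * ‖stft (gaussian (Phase d)) (tauWigner τ φ φ)
            (p.1 - mapT τ w z) (p.2 - mapJ w z)‖ₑ := by
          refine (enorm_bracket_le σ _).trans (lintegral_mono fun p => ?_)
          rw [enorm_stft_tauWigner_tfShift]
          gcongr
          exact enorm_distSTFT_le_ampl σ _ _
      _ = ∫⁻ x, ∫⁻ ξ, ampl σ x * ‖stft (gaussian (Phase d)) (tauWigner τ φ φ)
            (x - mapT τ w z) (ξ - mapJ w z)‖ₑ := by
          rw [Measure.volume_eq_prod, lintegral_prod]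
          exact ((hA.comp measurable_fst).mul hKw).aemeasurable
      _ ≤ ∫⁻ x, C * (ampl σ x * wignerMajorant α τ (gaborNorm φ) (x - mapT τ w z)) := by
          refine lintegral_mono fun x => ?_
          have hKx : Measurable fun ξ : Phase d => ‖stft (gaussian (Phase d)) (tauWigner τ φ φ)
            (x - mapT τ w z) (ξ - mapJ w z)‖ₑ := by
            have h6 := hKw.comp (measurable_prodMk_left (x := x))
            exact h6
          dsimp only
          rw [lintegral_const_mul _ hKx, lintegral_sub_right_eq_self
            (fun ξ => ‖stft (gaussian (Phase d)) (tauWigner τ φ φ) (x - mapT τ w z) ξ‖ₑ), mul_left_comm]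
          gcongr
          exact hC τ h0 h1 φ hφ hφ0 _
      _ = _ := lintegral_const_mul' _ _ ENNReal.coe_ne_top

theorem bracket_const_mul {V : Type*} [NormedAddCommGroup V] [InnerProductSpace ℝ V] [FiniteDimensional ℝ V]
    [MeasurableSpace V] [BorelSpace V] (σ : 𝓢'(V, ℂ)) (c : ℂ) (Ψ : V → ℂ) :
    bracket σ (fun t => c * Ψ t) = conj c * bracket σ Ψ := by
  simp only [bracket, stft_const_mul, map_mul, ← integral_const_mul]
  congr 1 with p
  ring

/-- By Moyal's identity the integral is ‖φ‖⁴. -/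
theorem integral_tauWigner_mul_conj_ne_zero (τ : ℝ) (hφ : MemLp φ 2) (hφi : Integrable φ)
    (hφ0 : ¬ φ =ᵐ[volume] 0) : (∫ z, tauWigner τ φ φ z * conj (tauWigner τ φ φ z)) ≠ 0 := by
  have h := integral_conj_tauWigner_mul τ hφ hφi hφ hφi hφ hφi hφ hφi
  have e : (∫ z, tauWigner τ φ φ z * conj (tauWigner τ φ φ z)) =
      ∫ z, conj (tauWigner τ φ φ z) * tauWigner τ φ φ z := by congr 1 with z; ring
  have e2 : (∫ t, φ t * conj (φ t)) = ∫ t, conj (φ t) * φ t := by congr 1 with z; ring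
  rw [e, h, e2]
  refine mul_self_ne_zero.2 fun h1 => hφ0 ?_
  have h2 : ∀ t, conj (φ t) * φ t = ((‖φ t‖ ^ 2 : ℝ) : ℂ) := fun t => by
    rw [Complex.conj_mul']; norm_cast
  simp only [h2] at h1
  rw [integral_complex_ofReal, Complex.ofReal_eq_zero, integral_eq_zero_iff_of_nonneg (fun t => by positivity)
    ((memLp_two_iff_integrable_sq_norm hφ.1).1 hφ)] at h1
  filter_upwards [h1] with t ht
  simpa using ht

/-- Gabor matrix decay implies membership in the amalgam space. -/
theorem lintegral_ampl_lt_top_of_opEntry_le {m : Phase d → ℝ≥0∞} (hm : IsWeight m) {τ : ℝ} (h0 : 0 ≤ τ)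
    (h1 : τ ≤ 1) (hφ : MemLp φ 2) (hφ0 : ¬ φ =ᵐ[volume] 0)
    (hφ1 : ∫⁻ z, gaborNorm φ z * m (matD τ z) < ∞)
    (hφ2 : ∫⁻ z, gaborNorm φ z * m (matD (1 - τ) z) < ∞) {σ : 𝓢'(Phase d, ℂ)} {H : Phase d → ℝ≥0∞}
    (hH : AEMeasurable H) (hHm : ∫⁻ x, H x * m x < ∞)
    (hd : OpEntryDefined τ σ φ φ)
    (hb : ∀ w z, ‖opEntry τ σ (tfShift z φ) (tfShift w φ)‖ₑ ≤ H (mapT τ w z)) :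
    ∫⁻ x, ampl σ x * m x < ∞ := by
  obtain ⟨α, hα, hαm⟩ := hm.exists_lintegral_expDecay_lt_top (μ := (volume : Measure (Phase d)))
  obtain ⟨C, hC⟩ := exists_lintegral_stft_tauWigner_le d hα
  have hφs : ∫⁻ z, gaborNorm φ z < ∞ :=
    lt_of_le_of_lt (lintegral_mono fun z => le_mul_of_one_le_right' (hm.one_le _)) hφ1
  have hφi := integrable_of_lintegral_gabor hφ hφs
  have hWm := lintegral_wignerMajorant_lt_top hm (measurable_gaborNorm hφ) (hαm α le_rfl) hφ1 hφ2
  have hb2 : ∀ p : Phase d × Phase d, ‖bracket σ (shift p.1 p.2 (tauWigner τ φ φ))‖ₑ ≤ H p.1 := by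
    intro p
    -- The explicit inverse of (w, z) ↦ (T_τ(w,z), J(w,z)), valid for all τ: every shift of W_τ(φ,
    -- φ) occurs in the Gabor matrix.
    set w : Phase d := pt (pos p.1 - τ • freq p.2) (freq p.1 + (1 - τ) • pos p.2)
    set z : Phase d := pt (pos p.1 + (1 - τ) • freq p.2) (freq p.1 - τ • pos p.2)
    have hT : mapT τ w z = p.1 := by
      refine phase_ext ?_ ?_ <;> simp only [mapT, w, z, pos_pt, freq_pt] <;> module
    have hJ : mapJ w z = p.2 := by
      refine phase_ext ?_ ?_ <;> simp only [mapJ, w, z, pos_pt, freq_pt] <;> module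
    obtain ⟨c, hc, h2⟩ := tauWigner_tfShift τ φ φ w z
    have h3 := hb w z
    rw [opEntry, funext h2, bracket_const_mul, enorm_mul, RCLike.enorm_conj, ← ofReal_norm c, hc,
      ENNReal.ofReal_one, one_mul, hT, hJ] at h3
    exact h3
  refine lintegral_ampl_lt_top_of_bracket_le (H := hH.mk H) hd
    (integral_tauWigner_mul_conj_ne_zero τ hφ hφi hφ0) hm hH.measurable_mk ?_ ?_ ?_
  · refine lt_of_eq_of_lt (lintegral_congr_ae ?_) hHm
    filter_upwards [hH.ae_eq_mk] with x hx
    rw [hx]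
  · have h4 := Measure.quasiMeasurePreserving_fst (μ := (volume : Measure (Phase d)))
      (ν := (volume : Measure (Phase d))) |>.ae hH.ae_eq_mk
    rw [Measure.volume_eq_prod]
    filter_upwards [h4] with p hp
    rw [← hp]
    exact hb2 p
  · calc _ ≤ ∫⁻ x, C * (wignerMajorant α τ (gaborNorm φ) x * m x) := by
          refine lintegral_mono fun x => ?_
          rw [← mul_assoc]
          gcongr
          exact hC τ h0 h1 φ hφ hφs x
      _ = C * ∫⁻ x, wignerMajorant α τ (gaborNorm φ) x * m x := lintegral_const_mul' _ _ ENNReal.coe_ne_top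
      _ < ∞ := ENNReal.mul_lt_top ENNReal.coe_lt_top hWm

end Core

/-! ### Exponential bounds for admissible weights -/

section Admissible
variable {d : ℕ} {v : Phase d → ℝ}

theorem IsAdmissible.neg (hv : IsAdmissible v) (z : Phase d) : v (-z) = v z :=
  hv.even _ _ fun i => by simp

/-- 1 = v(0) ≤ v(z) v(-z) = v(z)². -/
theorem IsAdmissible.one_le (hv : IsAdmissible v) (z : Phase d) : 1 ≤ v z := by
  have h := hv.submul z (-z)
  rw [add_neg_cancel, hv.zero, hv.neg] at h
  nlinarith [hv.nonneg z]

theorem IsAdmissible.nsmul_le (hv : IsAdmissible v) (n : ℕ) (z : Phase d) : v (n • z) ≤ v z ^ n := by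
  induction n with
  | zero => simp [hv.zero]
  | succ n ih =>
    rw [succ_nsmul, pow_succ]
    exact (hv.submul _ _).trans (mul_le_mul_of_nonneg_right ih (hv.nonneg z))

theorem IsAdmissible.exists_exp_le (hv : IsAdmissible v) :
    ∃ α C : ℝ, 0 ≤ α ∧ 0 ≤ C ∧ ∀ z, v z ≤ C * Real.exp (α * ‖z‖) := by
  obtain ⟨M, hM⟩ := (isCompact_closedBall (0 : Phase d) 1).exists_bound_of_continuousOn hv.continuous.continuousOn
  have hM1 : 1 ≤ M := by
    have := hM 0 (by simp)
    rw [hv.zero, norm_one] at this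
    exact this
  refine ⟨Real.log M, M, Real.log_nonneg hM1, by linarith, fun z => ?_⟩
  -- z is covered in n equal steps, each inside the unit ball, where v ≤ M.
  set n : ℕ := ⌊‖z‖⌋₊ + 1 with hn
  have hn0 : (0 : ℝ) < n := by positivity
  have hzn : ‖z‖ ≤ n := by
    rw [hn]; push_cast; exact (Nat.lt_floor_add_one _).le
  have h1 : v z ≤ v ((n : ℝ)⁻¹ • z) ^ n := by
    have := hv.nsmul_le n ((n : ℝ)⁻¹ • z)
    rwa [← Nat.cast_smul_eq_nsmul ℝ, smul_inv_smul₀ hn0.ne'] at this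
  have h2 : v ((n : ℝ)⁻¹ • z) ≤ M := by
    refine (le_abs_self _).trans (hM _ ?_)
    rw [mem_closedBall_zero_iff, norm_smul, norm_inv, Real.norm_of_nonneg hn0.le, inv_mul_le_iff₀ hn0, mul_one]
    exact hzn
  have h3 : (n : ℝ) ≤ ‖z‖ + 1 := by
    rw [hn]; push_cast
    linarith [Nat.floor_le (norm_nonneg z)]
  calc v z ≤ M ^ n := h1.trans (pow_le_pow_left₀ (hv.nonneg _) h2 n)
    _ = Real.exp (Real.log M * n) := by
      rw [mul_comm, Real.exp_nat_mul, Real.exp_log (by linarith)]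
    _ ≤ Real.exp (Real.log M * (‖z‖ + 1)) := by
      refine Real.exp_le_exp.2 (mul_le_mul_of_nonneg_left h3 (Real.log_nonneg hM1))
    _ = M * Real.exp (Real.log M * ‖z‖) := by
      rw [mul_add, mul_one, Real.exp_add, Real.exp_log (by linarith), mul_comm]

theorem IsAdmissible.isWeight (hv : IsAdmissible v) : IsWeight fun z => ENNReal.ofReal (v z) where
  measurable := ENNReal.measurable_ofReal.comp hv.continuous.measurable
  one_le z := ENNReal.one_le_ofReal.2 (hv.one_le z)
  neg z := by rw [hv.neg]
  submul w z := by
    rw [← ENNReal.ofReal_mul (hv.nonneg w)]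
    exact ENNReal.ofReal_le_ofReal (hv.submul w z)
  exp_le := by
    obtain ⟨α, C, h0, hC, h⟩ := hv.exists_exp_le
    refine ⟨α, C.toNNReal, h0, fun z => ?_⟩
    exact (ENNReal.ofReal_le_ofReal (h z)).trans_eq (ENNReal.ofReal_mul hC)

end Admissible

/-! ### Statements (b) and (a) -/

section GaborMatrix
variable {d : ℕ} {v : Phase d → ℝ} {φ : Conf d → ℂ} {τ : ℝ} {σ : 𝓢'(Phase d, ℂ)}

/-- Integrability provides one point of finiteness, and the translation bound spreads it; a
real-valued H bounding every entry requires this. -/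
theorem lt_top_of_moderate {m : Phase d → ℝ≥0∞} (hm : IsWeight m) {H : Phase d → ℝ≥0∞} {α : ℝ}
    (hH : Measurable H) (hHm : ∫⁻ x, H x * m x < ∞)
    (hreg : ∀ u q, H (u + q) ≤ ENNReal.ofReal (Real.exp (α * ‖q‖)) * H u) (u : Phase d) : H u < ∞ := by
  have h1 := ae_lt_top hH ((hm.lintegral_le H).trans_lt hHm).ne
  obtain ⟨u0, hu0⟩ := h1.exists
  have := hreg u0 (u - u0)
  rw [add_sub_cancel] at this
  exact this.trans_lt (ENNReal.mul_lt_top ENNReal.ofReal_lt_top hu0)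

theorem memL1_toReal (hm : IsWeight fun z => ENNReal.ofReal (v z)) {H : Phase d → ℝ≥0∞} (hv : Measurable v)
    (hH : Measurable H) (hHm : ∫⁻ x, H x * ENNReal.ofReal (v x) < ∞) (hfin : ∀ u, H u < ∞) :
    MemL1 v fun u => (H u).toReal := by
  have h0 : ∀ z, 0 ≤ v z := fun z => by
    have := hm.one_le z
    rw [ENNReal.one_le_ofReal] at this
    linarith
  refine ⟨(hH.ennreal_toReal.mul hv).aestronglyMeasurable, ?_⟩
  refine lt_of_eq_of_lt (lintegral_congr fun z => ?_) hHm
  rw [← ofReal_norm, Real.norm_of_nonneg (mul_nonneg ENNReal.toReal_nonneg (h0 z)),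
    ENNReal.ofReal_mul ENNReal.toReal_nonneg, ENNReal.ofReal_toReal (hfin z).ne]

theorem MemL1.lintegral_lt_top {H : Phase d → ℝ} (h0 : ∀ z, 0 ≤ v z) (h : MemL1 v H) :
    ∫⁻ x, ENNReal.ofReal (H x) * ENNReal.ofReal (v x) < ∞ := by
  refine lt_of_le_of_lt (lintegral_mono fun z => ?_) h.2
  rw [← ENNReal.ofReal_mul' (h0 z), ← ofReal_norm]
  exact ENNReal.ofReal_le_ofReal (le_abs_self _)

theorem MemL1.aemeasurable {H : Phase d → ℝ} (hv : Measurable v) (h0 : ∀ z, v z ≠ 0) (h : MemL1 v H) :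
    AEMeasurable H := by
  have := h.1.aemeasurable.div hv.aemeasurable
  refine this.congr (.of_forall fun z => ?_)
  exact mul_div_cancel_right₀ _ (h0 z)

/-- Only the weight property is demanded of v, so that the weight v∘B_τ is covered too: v itself
gives (b), v∘B_τ gives (a). -/
theorem memAmalgam_iff_exists_gaborEntryLE (hm : IsWeight fun z => ENNReal.ofReal (v z)) (hv : Measurable v)
    (h0 : 0 ≤ τ) (h1 : τ ≤ 1) (hφ0 : ¬ φ =ᵐ[volume] 0)
    (hφ1 : MemM1 (fun z => v (matD τ z)) φ) (hφ2 : MemM1 (fun z => v (matD (1 - τ) z)) φ) :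
    MemAmalgam v σ ↔ ∃ H : Phase d → ℝ, MemL1 v H ∧ ∀ w z, GaborEntryLE τ σ φ z w (H (mapT τ w z)) := by
  rw [memM1_iff] at hφ1 hφ2
  have hv0 : ∀ z, 1 ≤ v z := fun z => ENNReal.one_le_ofReal.1 (hm.one_le z)
  constructor
  · intro h
    obtain ⟨α, H, hα, hH, hHm, hreg, hb⟩ := exists_majorant_of_lintegral_ampl hm h0 h1 hφ1.1 hφ1.2 hφ2.2 h
    have hfin := lt_top_of_moderate hm hH hHm hreg
    refine ⟨fun u => (H u).toReal, memL1_toReal hm hv hH hHm hfin, fun w z => ⟨(hb w z).1, ?_⟩⟩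
    rw [← toReal_enorm]
    exact ENNReal.toReal_mono (hfin _).ne (hb w z).2
  · rintro ⟨H, hH, hb⟩
    refine lintegral_ampl_lt_top_of_opEntry_le (H := fun u => ENNReal.ofReal (H u)) hm h0 h1 hφ1.1 hφ0 hφ1.2 hφ2.2
      (hH.aemeasurable hv fun z => by linarith [hv0 z]).ennreal_ofReal
      (hH.lintegral_lt_top fun z => by linarith [hv0 z]) ?_ fun w z => ?_
    · have := (hb 0 0).1
      rwa [tfShift_zero] at this
    · rw [← ofReal_norm]
      exact ENNReal.ofReal_le_ofReal (hb w z).2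

/-- `𝓑_τ` as a linear automorphism of phase space, for `0 < τ < 1`. -/
def matBE (d : ℕ) {τ : ℝ} (h0 : τ ≠ 0) (h1 : 1 - τ ≠ 0) : Phase d ≃L[ℝ] Phase d :=
  ContinuousLinearEquiv.equivOfInverse
    { toFun := matB τ
      map_add' := fun z w => by simp only [matB, pos_add, freq_add, smul_add, pt_add]
      map_smul' := fun c z => by
        simp only [matB, pos_smul, freq_smul, smul_comm _ c, pt_smul]; rfl
      cont := by
        have h1 : Continuous (pos : Phase d → Conf d) := continuous_pos
        have h2 : Continuous (freq : Phase d → Conf d) := continuous_freq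
        have h3 := (continuous_pt (d := d)).comp
          (by fun_prop : Continuous fun z : Phase d => ((1 / (1 - τ)) • pos z, (1 / τ) • freq z))
        exact h3 }
    (matDL d τ)
    (fun z => by
      change matD τ (matB τ z) = z
      simp only [matD, matB, pos_pt, freq_pt, smul_smul, mul_one_div_cancel h0, mul_one_div_cancel h1, one_smul,
        pt_pos_freq])
    (fun z => by
      change matB τ (matD τ z) = z
      simp only [matD, matB, pos_pt, freq_pt, smul_smul, one_div_mul_cancel h0, one_div_mul_cancel h1, one_smul,
        pt_pos_freq])

theorem matBE_apply (h0 : τ ≠ 0) (h1 : 1 - τ ≠ 0) (z : Phase d) : matBE d h0 h1 z = matB τ z := rfl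

theorem matB_matD (h0 : τ ≠ 0) (h1 : 1 - τ ≠ 0) (z : Phase d) : matB τ (matD τ z) = z :=
  (matBE d h0 h1).apply_symm_apply z

theorem matD_matB (h0 : τ ≠ 0) (h1 : 1 - τ ≠ 0) (z : Phase d) : matD τ (matB τ z) = z :=
  (matBE d h0 h1).symm_apply_apply z

theorem matB_matD_one_sub (z : Phase d) : matB τ (matD (1 - τ) z) = -matU τ z := by
  simp only [matB, matD, matU, neg_neg, pos_pt, freq_pt, smul_smul, sub_sub_cancel, div_eq_inv_mul, mul_one]

/-- B_τ D_τ is the identity and B_τ D_{1-τ} = -U_τ; this carries the matrix decay of (b) to that of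
(a). -/
theorem matB_mapT (h0 : τ ≠ 0) (h1 : 1 - τ ≠ 0) (w z : Phase d) : matB τ (mapT τ w z) = w - matU τ z := by
  rw [mapT_eq_add, ← matBE_apply h0 h1, map_add, matBE_apply, matBE_apply, matB_matD h0 h1, matB_matD_one_sub,
    sub_eq_add_neg]

theorem integrable_comp_continuousLinearEquiv {V : Type*} [NormedAddCommGroup V] [NormedSpace ℝ V]
    [FiniteDimensional ℝ V] [MeasurableSpace V] [BorelSpace V] {μ : Measure V} [μ.IsAddHaarMeasure]
    (L : V ≃L[ℝ] V) {f : V → ℝ} : Integrable (fun x => f (L x)) μ ↔ Integrable f μ := by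
  have hdet : LinearMap.det (L.toLinearEquiv : V →ₗ[ℝ] V) ≠ 0 := L.toLinearEquiv.isUnit_det'.ne_zero
  have h := Measure.map_linearMap_addHaar_eq_smul_addHaar μ hdet
  have h2 := L.toHomeomorph.measurableEmbedding.integrable_map_iff (μ := μ) (g := f)
  have h3 : Measure.map L.toHomeomorph μ = ENNReal.ofReal |(LinearMap.det (L.toLinearEquiv : V →ₗ[ℝ] V))⁻¹| • μ := h
  rw [h3, integrable_smul_measure (by simpa using hdet) ENNReal.ofReal_ne_top] at h2
  exact h2.symm

theorem memL1_comp_matB (h0 : τ ≠ 0) (h1 : 1 - τ ≠ 0) {H : Phase d → ℝ} :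
    MemL1 (fun z => v (matB τ z)) (fun z => H (matB τ z)) ↔ MemL1 v H :=
  integrable_comp_continuousLinearEquiv (matBE d h0 h1) (f := fun z => H z * v z)

theorem IsAdmissible.isWeight_comp_matB (hv : IsAdmissible v) (h0 : τ ≠ 0) (h1 : 1 - τ ≠ 0) :
    IsWeight fun z => ENNReal.ofReal (v (matB τ z)) :=
  hv.isWeight.comp (matBE d h0 h1 : Phase d →L[ℝ] Phase d)

/-- The preceding equivalence for the weight v∘B_τ. Its two conditions on φ involve v∘B_τ∘D_τ = v
and v∘B_τ∘D_{1-τ} = v∘U_τ, and H is transported by the linear automorphism B_τ. -/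
theorem memAmalgam_comp_matB_iff (hv : IsAdmissible v) (h0 : 0 < τ) (h1 : τ < 1) (hφ0 : ¬ φ =ᵐ[volume] 0)
    (hφ1 : MemM1 v φ) (hφ2 : MemM1 (fun z => v (matU τ z)) φ) :
    MemAmalgam (fun z => v (matB τ z)) σ ↔
      ∃ H : Phase d → ℝ, MemL1 v H ∧ ∀ w z, GaborEntryLE τ σ φ z w (H (w - matU τ z)) := by
  have h0' : τ ≠ 0 := h0.ne'
  have h1' : 1 - τ ≠ 0 := by linarith
  have e1 : ∀ z : Phase d, v (matB τ (matD τ z)) = v z := fun z => by rw [matB_matD h0' h1']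
  have e2 : ∀ z : Phase d, v (matB τ (matD (1 - τ) z)) = v (matU τ z) := fun z => by
    rw [matB_matD_one_sub, hv.neg]
  have hmB : Measurable fun z => v (matB τ z) :=
    hv.continuous.measurable.comp (matBE d h0' h1').continuous.measurable
  rw [memAmalgam_iff_exists_gaborEntryLE (hv.isWeight_comp_matB h0' h1') hmB h0.le h1.le hφ0
    (by simpa only [e1] using hφ1) (by simpa only [e2] using hφ2)]
  constructor
  · rintro ⟨H, hH, hb⟩
    refine ⟨fun u => H (matD τ u), ?_, fun w z => ?_⟩
    · rw [← memL1_comp_matB h0' h1']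
      simpa only [matD_matB h0' h1'] using hH
    · dsimp only
      rw [← matB_mapT h0' h1', matD_matB h0' h1']
      exact hb w z
  · rintro ⟨H, hH, hb⟩
    refine ⟨fun u => H (matB τ u), (memL1_comp_matB h0' h1').2 hH, fun w z => ?_⟩
    dsimp only
    rw [matB_mapT h0' h1']
    exact hb w z

end GaborMatrix

/-! ### Minkowski's integral inequality -/

section Minkowski
variable {A B : Type*} [MeasurableSpace A] [MeasurableSpace B] {μ : Measure A} {ν : Measure B}

theorem lintegral_mul_le_sqrt {f g : A → ℝ≥0∞} (hf : AEMeasurable f μ) (hg : AEMeasurable g μ) :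
    ∫⁻ a, f a * g a ∂μ ≤ (∫⁻ a, f a ^ 2 ∂μ) ^ (1 / 2 : ℝ) * (∫⁻ a, g a ^ 2 ∂μ) ^ (1 / 2 : ℝ) := by
  have h := ENNReal.lintegral_mul_le_Lp_mul_Lq μ Real.HolderConjugate.two_two hf hg
  simpa only [Pi.mul_apply, ENNReal.rpow_two] using h

theorem rpow_half_sq (x : ℝ≥0∞) : (x ^ 2) ^ (1 / 2 : ℝ) = x := by
  rw [← ENNReal.rpow_two, ← ENNReal.rpow_mul]; norm_num

/-- Minkowski's integral inequality in `L²`. -/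
theorem rpow_lintegral_sq_lintegral_le [SFinite μ] [SFinite ν] {G : A → B → ℝ≥0∞}
    (hG : Measurable (Function.uncurry G)) :
    (∫⁻ a, (∫⁻ b, G a b ∂ν) ^ 2 ∂μ) ^ (1 / 2 : ℝ) ≤ ∫⁻ b, (∫⁻ a, G a b ^ 2 ∂μ) ^ (1 / 2 : ℝ) ∂ν := by
  have hGa : ∀ a, Measurable (G a) := fun a => hG.comp measurable_prodMk_left
  have hGb : ∀ b, Measurable fun a => G a b := fun b => hG.comp measurable_prodMk_right
  have hN : Measurable fun b => (∫⁻ a, G a b ^ 2 ∂μ) ^ (1 / 2 : ℝ) := by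
    have h : Measurable fun b => ∫⁻ a, G a b ^ 2 ∂μ :=
      Measurable.lintegral_prod_left' (f := fun p : A × B => G p.1 p.2 ^ 2) (hG.pow_const 2)
    exact h.pow_const _
  rw [← rpow_half_sq (∫⁻ b, _ ∂ν)]
  refine ENNReal.rpow_le_rpow ?_ (by norm_num)
  -- The square is opened into a double integral; after Tonelli, Cauchy–Schwarz in a bounds each
  -- pair (b, b').
  have h1 : ∀ a, (∫⁻ b, G a b ∂ν) ^ 2 = ∫⁻ b, ∫⁻ b', G a b * G a b' ∂ν ∂ν := fun a => by
    simp_rw [lintegral_const_mul _ (hGa a), lintegral_mul_const _ (hGa a), sq]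
  have hm3 : Measurable fun p : A × B => ∫⁻ b', G p.1 p.2 * G p.1 b' ∂ν :=
    Measurable.lintegral_prod_right' (f := fun q : (A × B) × B => G q.1.1 q.1.2 * G q.1.1 q.2)
      ((hG.comp (by fun_prop : Measurable fun q : (A × B) × B => (q.1.1, q.1.2))).mul
        (hG.comp (by fun_prop : Measurable fun q : (A × B) × B => (q.1.1, q.2))))
  simp_rw [h1]
  rw [lintegral_lintegral_swap (μ := μ) (ν := ν) (f := fun a b => ∫⁻ b', G a b * G a b' ∂ν) hm3.aemeasurable]
  have h2 : ∀ b, ∫⁻ a, ∫⁻ b', G a b * G a b' ∂ν ∂μ = ∫⁻ b', ∫⁻ a, G a b * G a b' ∂μ ∂ν := fun b =>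
    lintegral_lintegral_swap (μ := μ) (ν := ν) (f := fun a b' => G a b * G a b')
      (((hGb b).comp measurable_fst).mul hG).aemeasurable
  simp_rw [h2]
  calc ∫⁻ b, ∫⁻ b', ∫⁻ a, G a b * G a b' ∂μ ∂ν ∂ν
      ≤ ∫⁻ b, ∫⁻ b', (∫⁻ a, G a b ^ 2 ∂μ) ^ (1 / 2 : ℝ) * (∫⁻ a, G a b' ^ 2 ∂μ) ^ (1 / 2 : ℝ) ∂ν ∂ν :=
        lintegral_mono fun b => lintegral_mono fun b' =>
          lintegral_mul_le_sqrt (hGb b).aemeasurable (hGb b').aemeasurable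
    _ = _ := by simp_rw [lintegral_const_mul _ hN, lintegral_mul_const _ hN, sq]

end Minkowski

/-! ### Neumann iteration in weighted L¹ -/

section Neumann
variable {V : Type*} [NormedAddCommGroup V] [NormedSpace ℝ V] [FiniteDimensional ℝ V]
  [MeasurableSpace V] [BorelSpace V] {μ : Measure V} [μ.IsAddHaarMeasure] {m κ b : V → ℝ≥0∞}

/-- Continuous weights of subexponential growth. -/
structure IsSubexpWeight (m : V → ℝ≥0∞) : Prop extends IsWeight m where
  continuous : Continuous m
  subexp : ∀ η : ℝ, 0 < η → ∃ C : ℝ≥0, ∀ x, m x * expDecay η x ≤ C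

/-- The iterates of `b` under `f ↦ ∫ κ(x) f(· + x) dx`. -/
def corrIter (μ : Measure V) (κ b : V → ℝ≥0∞) : ℕ → V → ℝ≥0∞
  | 0 => b
  | n + 1 => fun y => ∫⁻ x, κ x * corrIter μ κ b n (y + x) ∂μ

theorem measurable_corrIter (hκ : Measurable κ) (hb : Measurable b) (n : ℕ) :
    Measurable (corrIter μ κ b n) := by
  induction n with
  | zero => exact hb
  | succ n ih =>
    exact Measurable.lintegral_prod_right' (f := fun p : V × V => κ p.2 * corrIter μ κ b n (p.1 + p.2))
      (by fun_prop)

theorem corrIter_translate (w : V) (n : ℕ) (y : V) :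
    corrIter μ κ (fun x => b (x - w)) n y = corrIter μ κ b n (y - w) := by
  induction n generalizing y with
  | zero => rfl
  | succ n ih =>
    simp only [corrIter, ih]
    refine lintegral_congr fun x => ?_
    rw [add_sub_right_comm]

/-- Each use of the inequality extracts one more iterate of b, and after K uses the remainder is at
most (∫ κ)^K M, which tends to 0. -/
theorem le_tsum_corrIter (hκ : Measurable κ) (hb : Measurable b) (hκ1 : ∫⁻ x, κ x ∂μ < 1) {a : V → ℝ≥0∞}
    {M : ℝ≥0∞} (hM : M ≠ ∞) (haM : ∀ y, a y ≤ M) (hab : ∀ y, a y ≤ b y + ∫⁻ x, κ x * a (y + x) ∂μ) (y : V) :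
    a y ≤ ∑' n, corrIter μ κ b n y := by
  have hstep : ∀ K : ℕ, ∀ y, a y ≤ ∑ n ∈ Finset.range K, corrIter μ κ b n y + (∫⁻ x, κ x ∂μ) ^ K * M := by
    intro K
    induction K with
    | zero => simpa using haM
    | succ K ih =>
      intro y
      have hmeas : ∀ n, Measurable fun x => κ x * corrIter μ κ b n (y + x) := fun n =>
        hκ.mul ((measurable_corrIter hκ hb n).comp (measurable_const_add y))
      calc a y ≤ b y + ∫⁻ x, κ x * a (y + x) ∂μ := hab y
        _ ≤ b y + ∫⁻ x, (∑ n ∈ Finset.range K, κ x * corrIter μ κ b n (y + x)) +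
              κ x * ((∫⁻ x, κ x ∂μ) ^ K * M) ∂μ := by
            gcongr with x
            rw [← Finset.mul_sum, ← mul_add]
            gcongr
            exact ih _
        _ = _ := by
            rw [lintegral_add_left (Finset.measurable_fun_sum _ fun n _ => hmeas n),
              lintegral_finsetSum _ fun n _ => hmeas n, lintegral_mul_const _ hκ,
              Finset.sum_range_succ' _ K, pow_succ]
            simp only [corrIter]
            ring
  have hlim : Tendsto (fun K : ℕ => (∑' n, corrIter μ κ b n y) + (∫⁻ x, κ x ∂μ) ^ K * M) atTop
      (𝓝 ((∑' n, corrIter μ κ b n y) + 0 * M)) :=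
    (ENNReal.Tendsto.mul_const (ENNReal.tendsto_pow_atTop_nhds_zero_of_lt_one hκ1) (Or.inr hM)).const_add _
  rw [zero_mul, add_zero] at hlim
  exact ge_of_tendsto' hlim fun K => (hstep K y).trans (by gcongr; exact ENNReal.sum_le_tsum _)

/-- Since ω(y) ≤ p(x) ω(y + x), one iteration costs a factor ∫ κ p, by Tonelli and translation
invariance. -/
theorem lintegral_corrIter_mul_le (hκ : Measurable κ) (hb : Measurable b) {ω p : V → ℝ≥0∞}
    (hω : Measurable ω) (hp : Measurable p) (h : ∀ y x, ω y ≤ p x * ω (y + x)) (n : ℕ) :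
    ∫⁻ y, corrIter μ κ b n y * ω y ∂μ ≤ (∫⁻ x, κ x * p x ∂μ) ^ n * ∫⁻ y, b y * ω y ∂μ := by
  induction n with
  | zero => simp [corrIter]
  | succ n ih =>
    have hi := measurable_corrIter (μ := μ) hκ hb n
    calc ∫⁻ y, (∫⁻ x, κ x * corrIter μ κ b n (y + x) ∂μ) * ω y ∂μ
        = ∫⁻ y, ∫⁻ x, κ x * corrIter μ κ b n (y + x) * ω y ∂μ ∂μ := by
          refine lintegral_congr fun y => ?_
          rw [lintegral_mul_const]
          exact hκ.mul (hi.comp (measurable_const_add y))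
      _ = ∫⁻ x, ∫⁻ y, κ x * corrIter μ κ b n (y + x) * ω y ∂μ ∂μ :=
          lintegral_lintegral_swap (μ := μ) (ν := μ) (f := fun y x => κ x * corrIter μ κ b n (y + x) * ω y)
            (by unfold Function.uncurry; fun_prop)
      _ ≤ ∫⁻ x, ∫⁻ y, (κ x * p x) * (corrIter μ κ b n (y + x) * ω (y + x)) ∂μ ∂μ := by
          refine lintegral_mono fun x => lintegral_mono fun y => ?_
          calc κ x * corrIter μ κ b n (y + x) * ω y
              ≤ κ x * corrIter μ κ b n (y + x) * (p x * ω (y + x)) := by gcongr; exact h y x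
            _ = _ := by ring
      _ = (∫⁻ x, κ x * p x ∂μ) * ∫⁻ y, corrIter μ κ b n y * ω y ∂μ := by
          have hκp : Measurable fun x => κ x * p x := hκ.mul hp
          rw [← lintegral_mul_const _ hκp]
          refine lintegral_congr fun x => ?_
          have hiω : Measurable fun y => corrIter μ κ b n (y + x) * ω (y + x) := by fun_prop
          rw [lintegral_const_mul _ hiω]
          congr 1
          exact lintegral_add_right_eq_self (fun y => corrIter μ κ b n y * ω y) x
      _ ≤ _ := by
          rw [pow_succ', mul_assoc]
          gcongr

/-- The envelope of a subexponential weight, equivalent to it and growing at most like `e^{η|x|}`. -/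
def weightEnvelope (η : ℝ) (m : V → ℝ≥0∞) (x : V) : ℝ≥0∞ := ⨆ y, m (x + y) * expDecay η y

theorem IsSubexpWeight.measurable_envelope (hm : IsSubexpWeight m) (η : ℝ) :
    Measurable (weightEnvelope η m) :=
  (lowerSemicontinuous_iSup fun y =>
    ((ENNReal.continuous_mul_const (by simp [expDecay])).comp
      (hm.continuous.comp (continuous_add_const y))).lowerSemicontinuous).measurable

theorem le_weightEnvelope (η : ℝ) (m : V → ℝ≥0∞) (x : V) : m x ≤ weightEnvelope η m x := by
  refine le_trans ?_ (le_iSup _ (0 : V))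
  simp [expDecay]

theorem IsSubexpWeight.envelope_le (hm : IsSubexpWeight m) {η : ℝ} (hη : 0 < η) :
    ∃ C : ℝ≥0, ∀ x, weightEnvelope η m x ≤ C * m x := by
  obtain ⟨C, hC⟩ := hm.subexp η hη
  refine ⟨C, fun x => iSup_le fun y => ?_⟩
  calc m (x + y) * expDecay η y ≤ (m x * m y) * expDecay η y := by gcongr; exact hm.submul x y
    _ = (m y * expDecay η y) * m x := by ring
    _ ≤ C * m x := by gcongr; exact hC y

/-- Two competing bounds: moving the supremum variable by x costs e^{η|x|}, while
submultiplicativity of m costs m(x). Their minimum is integrable against κ thanks to m, and close to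
1 for small η. -/
theorem IsWeight.envelope_le_mul (hm : IsWeight m) {η : ℝ} (hη : 0 ≤ η) (y x : V) :
    weightEnvelope η m y ≤ min (ENNReal.ofReal (Real.exp (η * ‖x‖))) (m x) * weightEnvelope η m (y + x) := by
  rcases min_cases (ENNReal.ofReal (Real.exp (η * ‖x‖))) (m x) with h | h
  · rw [h.1]
    refine iSup_le fun t => ?_
    calc m (y + t) * expDecay η t
        ≤ m (y + x + (t - x)) * (ENNReal.ofReal (Real.exp (η * ‖x‖)) * expDecay η (t - x)) := by
          rw [show y + x + (t - x) = y + t by abel]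
          gcongr
          have := expDecay_le hη t (-x)
          rwa [norm_neg, ← sub_eq_add_neg] at this
      _ = ENNReal.ofReal (Real.exp (η * ‖x‖)) * (m (y + x + (t - x)) * expDecay η (t - x)) := by ring
      _ ≤ _ := by
        gcongr
        exact le_iSup (fun s => m (y + x + s) * expDecay η s) (t - x)
  · rw [h.1]
    refine iSup_le fun t => ?_
    calc m (y + t) * expDecay η t ≤ (m x * m (y + x + t)) * expDecay η t := by
          gcongr
          have := hm.submul (-x) (y + x + t)
          rwa [hm.neg, show -x + (y + x + t) = y + t by abel] at this
      _ = m x * (m (y + x + t) * expDecay η t) := by ring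
      _ ≤ _ := by
        gcongr
        exact le_iSup (fun s => m (y + x + s) * expDecay η s) t

/-- Dominated convergence with dominating function κ m as η → 0; the minimum tends to 1 because m ≥
1. -/
theorem IsWeight.exists_lintegral_mul_min_lt_one (hm : IsWeight m) (hκ : Measurable κ)
    (hκm : ∫⁻ x, κ x * m x ∂μ < ∞) (hκ1 : ∫⁻ x, κ x ∂μ < 1) :
    ∃ η : ℝ, 0 < η ∧ ∫⁻ x, κ x * min (ENNReal.ofReal (Real.exp (η * ‖x‖))) (m x) ∂μ < 1 := by
  have hκfin : ∀ᵐ x ∂μ, κ x < ∞ := ae_lt_top hκ (hκ1.trans ENNReal.one_lt_top).ne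
  have hlim : Tendsto (fun n : ℕ => ∫⁻ x, κ x *
      min (ENNReal.ofReal (Real.exp ((1 / ((n : ℝ) + 1)) * ‖x‖))) (m x) ∂μ) atTop (𝓝 (∫⁻ x, κ x ∂μ)) := by
    refine tendsto_lintegral_of_dominated_convergence (fun x => κ x * m x) (fun n => ?_) (fun n => ?_) hκm.ne ?_
    · exact hκ.mul (Measurable.min (by fun_prop) hm.measurable)
    · exact Eventually.of_forall fun x => mul_le_mul_right (min_le_right _ _) _
    · filter_upwards [hκfin] with x hx
      have h1 : Tendsto (fun n : ℕ => ENNReal.ofReal (Real.exp ((1 / ((n : ℝ) + 1)) * ‖x‖))) atTop (𝓝 1) := by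
        have h2 := (Real.continuous_exp.tendsto _).comp
          ((tendsto_one_div_add_atTop_nhds_zero_nat (𝕜 := ℝ)).mul_const ‖x‖)
        rw [zero_mul, Real.exp_zero] at h2
        simpa using ENNReal.tendsto_ofReal h2
      have h3 := ENNReal.Tendsto.const_mul (a := κ x) (h1.min (tendsto_const_nhds (x := m x))) (Or.inr hx.ne)
      rwa [min_eq_left (hm.one_le x), mul_one] at h3
  obtain ⟨n, hn⟩ := (hlim.eventually (gt_mem_nhds hκ1)).exists
  exact ⟨_, by positivity, hn⟩

/-- ∫ κ m may exceed 1, so the series need not converge geometrically for m itself. For the envelope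
of m, which is equivalent to m by subexponential growth, one iteration costs q = ∫ κ min(e^{η|x|},
m) < 1. The majorant R is chosen before a, w and M. -/
theorem IsSubexpWeight.exists_majorant_of_le_corr (hm : IsSubexpWeight m) (hκ : Measurable κ) (hb : Measurable b)
    (hκm : ∫⁻ x, κ x * m x ∂μ < ∞) (hκ1 : ∫⁻ x, κ x ∂μ < 1) (hbm : ∫⁻ x, b x * m x ∂μ < ∞) :
    ∃ R : V → ℝ≥0∞, Measurable R ∧ ∫⁻ x, R x * m x ∂μ < ∞ ∧ ∀ (a : V → ℝ≥0∞) (w : V) (M : ℝ≥0∞), M ≠ ∞ →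
      (∀ y, a y ≤ M) → (∀ y, a y ≤ b (y - w) + ∫⁻ x, κ x * a (y + x) ∂μ) → ∀ y, a y ≤ R (y - w) := by
  obtain ⟨η, hη, hη1⟩ := hm.exists_lintegral_mul_min_lt_one hκ hκm hκ1
  obtain ⟨C, hC⟩ := hm.envelope_le hη
  have hω := hm.measurable_envelope η
  refine ⟨fun y => ∑' n, corrIter μ κ b n y, Measurable.tsum fun n => measurable_corrIter hκ hb n, ?_,
    fun a w M hM haM hab y => ?_⟩
  · set q := ∫⁻ x, κ x * min (ENNReal.ofReal (Real.exp (η * ‖x‖))) (m x) ∂μ with hq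
    have hbω : ∫⁻ y, b y * weightEnvelope η m y ∂μ < ∞ := by
      calc ∫⁻ y, b y * weightEnvelope η m y ∂μ ≤ ∫⁻ y, C * (b y * m y) ∂μ := by
            refine lintegral_mono fun y => ?_
            calc b y * weightEnvelope η m y ≤ b y * (C * m y) := by gcongr; exact hC y
              _ = _ := by ring
        _ = C * ∫⁻ y, b y * m y ∂μ := lintegral_const_mul _ (hb.mul hm.measurable)
        _ < ∞ := ENNReal.mul_lt_top ENNReal.coe_lt_top hbm
    have hi : ∀ n, ∫⁻ y, corrIter μ κ b n y * weightEnvelope η m y ∂μ ≤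
        q ^ n * ∫⁻ y, b y * weightEnvelope η m y ∂μ := fun n =>
      lintegral_corrIter_mul_le hκ hb hω (Measurable.min (by fun_prop) hm.measurable)
        (hm.envelope_le_mul hη.le) n
    calc ∫⁻ x, (∑' n, corrIter μ κ b n x) * m x ∂μ
        ≤ ∫⁻ x, ∑' n, corrIter μ κ b n x * weightEnvelope η m x ∂μ := by
          refine lintegral_mono fun x => ?_
          rw [ENNReal.tsum_mul_right]
          gcongr
          exact le_weightEnvelope η m x
      _ = ∑' n, ∫⁻ x, corrIter μ κ b n x * weightEnvelope η m x ∂μ :=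
          lintegral_tsum fun n => ((measurable_corrIter hκ hb n).mul hω).aemeasurable
      _ ≤ ∑' n, q ^ n * ∫⁻ y, b y * weightEnvelope η m y ∂μ := ENNReal.tsum_le_tsum hi
      _ = (1 - q)⁻¹ * ∫⁻ y, b y * weightEnvelope η m y ∂μ := by
          rw [ENNReal.tsum_mul_right, ENNReal.tsum_geometric]
      _ < ∞ := ENNReal.mul_lt_top (by simpa using hη1) hbω
  · have h := le_tsum_corrIter (b := fun x => b (x - w)) hκ (hb.comp (measurable_sub_const w)) hκ1 hM haM hab y
    simpa only [corrIter_translate] using h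

end Neumann

/-! ### Subexponential growth of admissible weights -/

section Subexp
variable {d : ℕ} {v : Phase d → ℝ}

/-- The condition v(nz)^{1/n} → 1 bounds the values at large integers n; submultiplicativity and a
local bound fill the gaps between integers. -/
theorem IsAdmissible.exists_subexp_line (hv : IsAdmissible v) {η : ℝ} (hη : 0 < η) (e : Phase d) :
    ∃ C : ℝ, 0 ≤ C ∧ ∀ t : ℝ, 0 ≤ t → v (t • e) ≤ C * Real.exp (η * t) := by
  obtain ⟨M, hM⟩ := (isCompact_Icc (a := (0 : ℝ)) (b := 1)).exists_bound_of_continuousOn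
    (hv.continuous.comp (by fun_prop : Continuous fun t : ℝ => t • e)).continuousOn
  have hM' : ∀ s ∈ Set.Icc (0 : ℝ) 1, v (s • e) ≤ M := fun s hs => (le_abs_self _).trans (hM s hs)
  have hM0 : 0 ≤ M := (hv.nonneg _).trans (hM' 0 (by simp))
  have hev := (hv.grs e).eventually (gt_mem_nhds (Real.one_lt_exp_iff.2 hη))
  obtain ⟨N, hN⟩ := (hev.and (eventually_gt_atTop 0)).exists_forall_of_atTop
  have hbig : ∀ n : ℕ, N ≤ n → v ((n : ℝ) • e) ≤ Real.exp (η * n) := fun n hn => by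
    obtain ⟨h1, h2⟩ := hN n hn
    have hn0 : (0 : ℝ) < n := by exact_mod_cast h2
    have h3 := pow_le_pow_left₀ (Real.rpow_nonneg (hv.nonneg _) _) h1.le n
    rw [← Real.rpow_natCast, ← Real.rpow_mul (hv.nonneg _), one_div_mul_cancel hn0.ne', Real.rpow_one,
      ← Real.exp_nat_mul] at h3
    rwa [mul_comm]
  -- The sum covers the finitely many n < N, and the summand 1 makes C₀ ≥ 1 for the others.
  set C₀ := ∑ n ∈ Finset.range N, v ((n : ℝ) • e) + 1 with hC₀
  have hsum : 0 ≤ ∑ n ∈ Finset.range N, v ((n : ℝ) • e) := Finset.sum_nonneg fun n _ => hv.nonneg _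
  have hall : ∀ n : ℕ, v ((n : ℝ) • e) ≤ C₀ * Real.exp (η * n) := fun n => by
    have he : 1 ≤ Real.exp (η * n) := Real.one_le_exp (by positivity)
    rcases lt_or_ge n N with hn | hn
    · have h1 : v ((n : ℝ) • e) ≤ ∑ n ∈ Finset.range N, v ((n : ℝ) • e) :=
        Finset.single_le_sum (f := fun n : ℕ => v ((n : ℝ) • e)) (fun n _ => hv.nonneg _) (Finset.mem_range.2 hn)
      nlinarith
    · have := hbig n hn
      nlinarith
  refine ⟨C₀ * M, by positivity, fun t ht => ?_⟩
  have hfl := Nat.floor_le ht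
  have hfl' := Nat.lt_floor_add_one t
  calc v (t • e) = v ((⌊t⌋₊ : ℝ) • e + (t - ⌊t⌋₊) • e) := by rw [← add_smul]; congr 2; ring
    _ ≤ v ((⌊t⌋₊ : ℝ) • e) * v ((t - ⌊t⌋₊) • e) := hv.submul _ _
    _ ≤ (C₀ * Real.exp (η * ⌊t⌋₊)) * M := by
      gcongr
      · exact hv.nonneg _
      · exact hall _
      · exact hM' _ ⟨by linarith, by linarith⟩
    _ ≤ (C₀ * Real.exp (η * t)) * M := by gcongr
    _ = _ := by ring

theorem IsAdmissible.exists_subexp (hv : IsAdmissible v) {η : ℝ} (hη : 0 < η) :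
    ∃ C : ℝ, 0 ≤ C ∧ ∀ z, v z ≤ C * Real.exp (η * ‖z‖) := by
  set n : ℕ := Fintype.card (Fin d ⊕ Fin d)
  -- The rate η/(n + 1) on each of n coordinate axes adds up to at most η, and n = 0 is allowed.
  -- Evenness of v in each coordinate reduces every axis to a half-line.
  have hη' : 0 < η / (n + 1) := by positivity
  choose C hC0 hC using fun i : Fin d ⊕ Fin d =>
    hv.exists_subexp_line hη' (EuclideanSpace.single i (1 : ℝ))
  refine ⟨∏ i, C i, Finset.prod_nonneg fun i _ => hC0 i, fun z => ?_⟩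
  have hsum : z = ∑ i, z i • EuclideanSpace.single i (1 : ℝ) := by
    have h := (EuclideanSpace.basisFun (Fin d ⊕ Fin d) ℝ).sum_repr z
    simpa using h.symm
  have hprod : ∀ s : Finset (Fin d ⊕ Fin d), v (∑ i ∈ s, z i • EuclideanSpace.single i (1 : ℝ)) ≤
      ∏ i ∈ s, v (z i • EuclideanSpace.single i (1 : ℝ)) := by
    intro s
    induction s using Finset.induction_on with
    | empty => simp [hv.zero]
    | insert i s hi ih =>
      rw [Finset.sum_insert hi, Finset.prod_insert hi]
      exact (hv.submul _ _).trans (mul_le_mul_of_nonneg_left ih (hv.nonneg _))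
  have hone : ∀ i, v (z i • EuclideanSpace.single i (1 : ℝ)) ≤ C i * Real.exp (η / (n + 1) * ‖z‖) := fun i => by
    have h1 : v (z i • EuclideanSpace.single i (1 : ℝ)) = v (|z i| • EuclideanSpace.single i (1 : ℝ)) :=
      hv.even _ _ fun j => by by_cases hj : j = i <;> simp [hj]
    rw [h1]
    refine (hC i _ (abs_nonneg _)).trans ?_
    have h2 : |z i| ≤ ‖z‖ := EuclideanSpace.norm_eq z ▸ by
      rw [← Real.norm_eq_abs]
      exact (EuclideanSpace.norm_eq z).symm ▸ PiLp.norm_apply_le z i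
    have := hC0 i
    gcongr
  calc v z ≤ ∏ i, v (z i • EuclideanSpace.single i (1 : ℝ)) := by
        conv_lhs => rw [hsum]
        exact hprod _
    _ ≤ ∏ i, C i * Real.exp (η / (n + 1) * ‖z‖) :=
        Finset.prod_le_prod (fun i _ => hv.nonneg _) fun i _ => hone i
    _ = (∏ i, C i) * Real.exp (η * (n / (n + 1)) * ‖z‖) := by
        rw [Finset.prod_mul_distrib, Finset.prod_const, ← Real.exp_nat_mul, Finset.card_univ]
        congr 2
        field_simp
        try ring
    _ ≤ _ := by
        have : (n : ℝ) / (n + 1) ≤ 1 := by rw [div_le_one (by positivity)]; linarith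
        have hp : 0 ≤ ∏ i, C i := Finset.prod_nonneg fun i _ => hC0 i
        gcongr
        nlinarith

/-- The sum of an admissible weight and a polynomial weight. -/
def sumWeight (v : Phase d → ℝ) (N : ℕ) (z : Phase d) : ℝ≥0∞ := ENNReal.ofReal (v z + (1 + ‖z‖) ^ N)

/-- The polynomial summand keeps the frame coefficients decaying fast enough for a distribution of
polynomial growth, known before it is shown to lie in the amalgam space, to be paired with the
lattice series term by term. -/
theorem IsAdmissible.isSubexpWeight_sumWeight (hv : IsAdmissible v) (N : ℕ) :
    IsSubexpWeight (sumWeight v N) := by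
  have hcont : Continuous (sumWeight v N) := by
    have := hv.continuous
    exact ENNReal.continuous_ofReal.comp (by fun_prop)
  have hp : ∀ z : Phase d, 1 ≤ (1 + ‖z‖) ^ N := fun z => one_le_pow₀ (by linarith [norm_nonneg z])
  have hsub : ∀ η : ℝ, 0 < η → ∃ C : ℝ, 0 ≤ C ∧ ∀ z : Phase d, v z + (1 + ‖z‖) ^ N ≤ C * Real.exp (η * ‖z‖) := by
    intro η hη
    obtain ⟨C, hC0, hC⟩ := hv.exists_subexp hη
    obtain ⟨C', hC0', hC'⟩ := exists_pow_mul_exp_le hη N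
    refine ⟨C + C', by positivity, fun z => ?_⟩
    have h1 := hC' ‖z‖ (norm_nonneg z)
    rw [neg_mul, Real.exp_neg, ← div_eq_mul_inv, div_le_iff₀ (Real.exp_pos _)] at h1
    linarith [hC z]
  refine ⟨⟨hcont.measurable, fun z => ?_, fun z => ?_, fun w z => ?_, ?_⟩, hcont, fun η hη => ?_⟩
  · exact ENNReal.one_le_ofReal.2 (by linarith [hv.one_le z, hp z])
  · simp only [sumWeight, norm_neg, hv.neg]
  · rw [sumWeight, sumWeight, sumWeight, ← ENNReal.ofReal_mul (by linarith [hv.one_le w, hp w])]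
    refine ENNReal.ofReal_le_ofReal ?_
    have h1 := hv.submul w z
    have h2 := one_add_norm_pow_le N w z
    nlinarith [hv.one_le w, hv.one_le z, hp w, hp z]
  · obtain ⟨C, hC0, hC⟩ := hsub 1 one_pos
    refine ⟨1, C.toNNReal, zero_le_one, fun z => ?_⟩
    exact (ENNReal.ofReal_le_ofReal (hC z)).trans_eq (ENNReal.ofReal_mul hC0)
  · obtain ⟨C, hC0, hC⟩ := hsub η hη
    refine ⟨C.toNNReal, fun z => ?_⟩
    rw [sumWeight, expDecay, ← ENNReal.ofReal_mul (by linarith [hv.one_le z, hp z])]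
    refine ENNReal.ofReal_le_ofReal ?_
    rw [neg_mul, Real.exp_neg, ← div_eq_mul_inv, div_le_iff₀ (Real.exp_pos _)]
    exact hC z

theorem ofReal_le_sumWeight (N : ℕ) (z : Phase d) : ENNReal.ofReal (v z) ≤ sumWeight v N z :=
  ENNReal.ofReal_le_ofReal (by linarith [pow_nonneg (by positivity : 0 ≤ 1 + ‖z‖) N])

end Subexp

/-! ### Analysis operators of Bessel families -/

section AnalysisOperator
variable {d : ℕ} {X : Type*} [MeasurableSpace X] {ν : Measure X} {ψ : Conf d → ℂ} {ι : X → Phase d}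

/-- The Hilbert space `L²(ℝ^d)`. -/
abbrev ConfL2 (d : ℕ) : Type := Lp ℂ 2 (volume : Measure (Conf d))

/-- The coefficient `⟨f, π(z) ψ⟩`. -/
def coeff (ψ f : Conf d → ℂ) (z : Phase d) : ℂ := stft ψ f (pos z) (freq z)

theorem coeff_congr {f f' : Conf d → ℂ} (h : f =ᵐ[volume] f') (z : Phase d) : coeff ψ f z = coeff ψ f' z :=
  integral_congr_ae (by filter_upwards [h] with t ht; rw [ht])

theorem inner_eq_integral {α : Type*} [MeasurableSpace α] {μ : Measure α} (f h : Lp ℂ 2 μ) :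
    inner ℂ f h = ∫ x, conj (f x) * h x ∂μ := by
  rw [L2.inner_def]
  exact integral_congr_ae (Eventually.of_forall fun x => by simp only [RCLike.inner_apply]; ring)

theorem coeff_eq_inner (hψ : MemLp ψ 2) (f : ConfL2 d) (z : Phase d) :
    coeff ψ f z = inner ℂ ((memLp_tfShift hψ z).toLp _) f := by
  rw [inner_eq_integral]
  refine integral_congr_ae ?_
  filter_upwards [(memLp_tfShift hψ z).coeFn_toLp] with t ht
  rw [ht, mul_comm]
  rfl

/-- `{π(ι x) ψ}` is a Bessel family. -/
def IsBessel (ν : Measure X) (ψ : Conf d → ℂ) (ι : X → Phase d) (b : ℝ≥0) : Prop :=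
  ∀ f : ConfL2 d, MemLp (fun x => coeff ψ f (ι x)) 2 ν ∧
    ∫⁻ x, ‖coeff ψ f (ι x)‖ₑ ^ 2 ∂ν ≤ b * ‖f‖ₑ ^ 2

theorem eLpNorm_two_eq {α : Type*} [MeasurableSpace α] {μ : Measure α} (f : α → ℂ) :
    eLpNorm f 2 μ = (∫⁻ x, ‖f x‖ₑ ^ 2 ∂μ) ^ (1 / 2 : ℝ) := by
  rw [lintegral_enorm_sq_eq_eLpNorm, rpow_half_sq]

/-- The analysis operator of a Bessel family. -/
def analysisL {b : ℝ≥0} (hψ : MemLp ψ 2) (hb : IsBessel ν ψ ι b) : ConfL2 d →L[ℂ] Lp ℂ 2 ν :=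
  LinearMap.mkContinuous
    { toFun := fun f => (hb f).1.toLp _
      map_add' := fun f h => by
        rw [← MemLp.toLp_add]
        refine MemLp.toLp_congr _ _ (Eventually.of_forall fun x => ?_)
        simp only [Pi.add_apply, coeff_eq_inner hψ, inner_add_right]
      map_smul' := fun c f => by
        rw [← MemLp.toLp_const_smul]
        refine MemLp.toLp_congr _ _ (Eventually.of_forall fun x => ?_)
        simp only [Pi.smul_apply, coeff_eq_inner hψ, inner_smul_right, smul_eq_mul, RingHom.id_apply] }
    (NNReal.sqrt b) fun f => by
      have h := ENNReal.rpow_le_rpow (hb f).2 (by norm_num : (0 : ℝ) ≤ 1 / 2)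
      rw [ENNReal.mul_rpow_of_nonneg _ _ (by norm_num), rpow_half_sq, ← eLpNorm_two_eq] at h
      rw [LinearMap.coe_mk, AddHom.coe_mk, Lp.norm_toLp]
      have h2 : ((b : ℝ≥0∞) ^ (1 / 2 : ℝ)) * ‖f‖ₑ = ((NNReal.sqrt b * ‖f‖₊ : ℝ≥0) : ℝ≥0∞) := by
        rw [NNReal.sqrt_eq_rpow, ENNReal.coe_mul, ENNReal.coe_rpow_of_nonneg _ (by norm_num)]
        rfl
      rw [h2] at h
      exact ENNReal.toReal_mono ENNReal.coe_ne_top h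

theorem analysisL_coeFn {b : ℝ≥0} (hψ : MemLp ψ 2) (hb : IsBessel ν ψ ι b) (f : ConfL2 d) :
    analysisL hψ hb f =ᵐ[ν] fun x => coeff ψ f (ι x) := MemLp.coeFn_toLp (hb f).1

theorem inner_analysisL {b : ℝ≥0} (hψ : MemLp ψ 2) (hb : IsBessel ν ψ ι b) (f : ConfL2 d) (u : Lp ℂ 2 ν) :
    inner ℂ (analysisL hψ hb f) u = ∫ x, conj (coeff ψ f (ι x)) * u x ∂ν := by
  rw [inner_eq_integral]
  refine integral_congr_ae ?_
  filter_upwards [analysisL_coeFn hψ hb f] with x hx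
  rw [hx]

theorem inner_analysisL_analysisL {b : ℝ≥0} (hψ : MemLp ψ 2) (hb : IsBessel ν ψ ι b) (f h : ConfL2 d) :
    inner ℂ (analysisL hψ hb f) (analysisL hψ hb h) =
      ∫ x, conj (coeff ψ f (ι x)) * coeff ψ h (ι x) ∂ν := by
  rw [inner_analysisL]
  refine integral_congr_ae ?_
  filter_upwards [analysisL_coeFn hψ hb h] with x hx
  rw [hx]

end AnalysisOperator

/-! ### The Gabor transform as an isometry -/

section GaborTransform
variable {d : ℕ}

theorem memLp_gabor {f : Conf d → ℂ} (hf : MemLp f 2) : MemLp (gabor f) 2 :=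
  memLp_phase_iff.2 (memLp_stft memLp_gaussian hf)

theorem integral_conj_gabor_mul {f f' : Conf d → ℂ} (hf : MemLp f 2) (hf' : MemLp f' 2) :
    ∫ z, conj (gabor f' z) * gabor f z = ∫ t, conj (f' t) * f t := by
  rw [integral_phase]
  have h := integral_conj_stft_mul_stft (memLp_gaussian (V := Conf d)) memLp_gaussian hf hf'
  rw [integral_gaussian_mul_conj, mul_one] at h
  exact h

theorem isBessel_gaussian (d : ℕ) :
    IsBessel (volume : Measure (Phase d)) (gaussian (Conf d)) id 1 := by
  intro f
  have hf := Lp.memLp f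
  refine ⟨memLp_gabor hf, ?_⟩
  have h1 : (∫⁻ z, ‖gabor f z‖ₑ ^ 2) = ‖f‖ₑ ^ 2 := by
    have h2 := integral_conj_gabor_mul hf hf
    have h3 : ∀ {α : Type} [MeasurableSpace α] {μ : Measure α} {u : α → ℂ}, MemLp u 2 μ →
        ∫⁻ x, ‖u x‖ₑ ^ 2 ∂μ = ENNReal.ofReal (∫ x, conj (u x) * u x ∂μ).re := by
      intro α _ μ u hu
      have hi := integrable_conj_mul hu hu
      have h4 : ∀ x, conj (u x) * u x = ((‖u x‖ ^ 2 : ℝ) : ℂ) := fun x => by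
        rw [mul_comm, Complex.mul_conj, Complex.normSq_eq_norm_sq]
      simp_rw [h4] at hi ⊢
      rw [integral_complex_ofReal, Complex.ofReal_re, ofReal_integral_eq_lintegral_ofReal
        (by simpa only [RCLike.re_to_complex, Complex.ofReal_re] using hi.re) (Eventually.of_forall fun x => by positivity)]
      refine lintegral_congr fun x => ?_
      rw [ENNReal.ofReal_pow (norm_nonneg _), ofReal_norm]
    rw [h3 (memLp_gabor hf), h2, ← h3 hf, lintegral_enorm_sq_eq_eLpNorm, Lp.enorm_def]
  rw [ENNReal.coe_one, one_mul]
  exact h1.le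

/-- The short-time Fourier transform as an operator on `L²`. -/
def gaborL (d : ℕ) : ConfL2 d →L[ℂ] Lp ℂ 2 (volume : Measure (Phase d)) :=
  analysisL memLp_gaussian (isBessel_gaussian d)

theorem gaborL_coeFn (f : ConfL2 d) : gaborL d f =ᵐ[volume] gabor f := analysisL_coeFn _ _ f

theorem inner_gaborL (f h : ConfL2 d) : inner ℂ (gaborL d f) (gaborL d h) = inner ℂ f h := by
  rw [gaborL, inner_analysisL_analysisL, inner_eq_integral]
  exact integral_conj_gabor_mul (Lp.memLp h) (Lp.memLp f)

theorem adjoint_gaborL_gaborL (f : ConfL2 d) : (gaborL d).adjoint (gaborL d f) = f := by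
  refine ext_inner_left ℂ fun h => ?_
  rw [ContinuousLinearMap.adjoint_inner_right, inner_gaborL]

theorem enorm_gaborL (f : ConfL2 d) : ‖gaborL d f‖ₑ = ‖f‖ₑ := by
  have h : ‖gaborL d f‖ = ‖f‖ := by
    have h1 := inner_gaborL f f
    rw [inner_self_eq_norm_sq_to_K, inner_self_eq_norm_sq_to_K] at h1
    have h2 : ‖gaborL d f‖ ^ 2 = ‖f‖ ^ 2 := by exact_mod_cast h1
    exact (pow_left_inj₀ (norm_nonneg _) (norm_nonneg _) two_ne_zero).1 h2
  rw [← ofReal_norm, h, ofReal_norm]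

/-- The normalized Gaussian at the phase-space point `w`. -/
def atom (w : Phase d) : ConfL2 d := (memLp_tfShift memLp_gaussian w).toLp (tfShift w (gaussian (Conf d)))

theorem gabor_eq_inner (f : ConfL2 d) (z : Phase d) : gabor f z = inner ℂ (atom z) f :=
  coeff_eq_inner memLp_gaussian f z

theorem coeFn_atom (w : Phase d) : atom w =ᵐ[volume] tfShift w (gaussian (Conf d)) := MemLp.coeFn_toLp _

theorem enorm_gabor_tfShift (f : Conf d → ℂ) (w z : Phase d) :
    gaborNorm (tfShift w f) z = gaborNorm f (z - w) :=
  enorm_stft_shift _ _ _ _ _ _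

theorem gaborNorm_atom (w z : Phase d) : gaborNorm (atom w) z = gaborNorm (gaussian (Conf d)) (z - w) := by
  rw [← enorm_gabor_tfShift]
  exact congrArg _ (coeff_congr (coeFn_atom w) z)

theorem exists_gaborNorm_gaussian_le (d : ℕ) (α : ℝ) :
    ∃ C : ℝ≥0, ∀ z, gaborNorm (gaussian (Conf d)) z ≤ C * expDecay α z := by
  refine ⟨(Real.exp (α ^ 2 / (2 * Real.pi))).toNNReal, fun z => ?_⟩
  have h1 : ‖gabor (gaussian (Conf d)) z‖ = Real.exp (-Real.pi / 2 * ‖z‖ ^ 2) := by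
    have h := norm_stft_gaussian_shift_gaussian (V := Conf d) 0 0 (pos z) (freq z)
    rw [sub_zero, sub_zero, ← norm_sq_phase] at h
    rw [← h, gabor]
    congr 2
    funext t
    simp [shift]
  rw [gaborNorm, ← ofReal_norm, h1, expDecay, ENNReal.ofNNReal_toNNReal,
    ← ENNReal.ofReal_mul (Real.exp_pos _).le, ← Real.exp_add]
  refine ENNReal.ofReal_le_ofReal (Real.exp_le_exp.2 ?_)
  have hp := Real.pi_pos
  have h3 : α ^ 2 / (2 * Real.pi) + -α * ‖z‖ - -Real.pi / 2 * ‖z‖ ^ 2 =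
      (α - Real.pi * ‖z‖) ^ 2 / (2 * Real.pi) := by field_simp; ring
  have h4 : 0 ≤ (α - Real.pi * ‖z‖) ^ 2 / (2 * Real.pi) := by positivity
  linarith

theorem gabor_reproducing (f : ConfL2 d) (z : Phase d) :
    gabor f z = ∫ w, conj (gabor (atom z) w) * gabor f w := by
  rw [gabor_eq_inner, ← inner_gaborL, gaborL, inner_analysisL_analysisL]
  rfl

/-- The Gabor transform reproduces itself under the inner products of Gaussian atoms. -/
theorem gaborNorm_le_lintegral (f : ConfL2 d) (z : Phase d) :
    gaborNorm f z ≤ ∫⁻ w, gaborNorm (gaussian (Conf d)) (w - z) * gaborNorm f w := by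
  rw [gaborNorm, gabor_reproducing]
  refine (enorm_integral_le_lintegral_enorm _).trans_eq (lintegral_congr fun w => ?_)
  rw [enorm_mul, ← gaborNorm_atom, RCLike.enorm_conj]
  rfl

end GaborTransform

/-! ### Localized L² norms -/

section LocalNorm
variable {V : Type*} [NormedAddCommGroup V] [MeasureSpace V] [BorelSpace V]

/-- The `L²` norm of an extended nonnegative function. -/
def lnorm (F : V → ℝ≥0∞) : ℝ≥0∞ := (∫⁻ w, F w ^ 2) ^ (1 / 2 : ℝ)

theorem lnorm_mono {F G : V → ℝ≥0∞} (h : ∀ w, F w ≤ G w) : lnorm F ≤ lnorm G :=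
  ENNReal.rpow_le_rpow (lintegral_mono fun w => pow_le_pow_left₀ zero_le (h w) 2) (by norm_num)

theorem lnorm_add_le {F G : V → ℝ≥0∞} (hF : Measurable F) (hG : Measurable G) :
    lnorm (fun w => F w + G w) ≤ lnorm F + lnorm G := by
  have h := ENNReal.lintegral_Lp_add_le (p := 2) (μ := volume) hF.aemeasurable hG.aemeasurable (by norm_num)
  simpa only [Pi.add_apply, ENNReal.rpow_two, lnorm] using h

theorem lnorm_const_mul (c : ℝ≥0∞) {F : V → ℝ≥0∞} (hF : Measurable F) :
    lnorm (fun w => c * F w) = c * lnorm F := by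
  simp_rw [lnorm, mul_pow]
  rw [lintegral_const_mul _ (hF.pow_const 2), ENNReal.mul_rpow_of_nonneg _ _ (by norm_num), rpow_half_sq]

theorem lnorm_translate [(volume : Measure V).IsAddRightInvariant] (F : V → ℝ≥0∞) (x : V) :
    lnorm (fun w => F (w + x)) = lnorm F := by
  rw [lnorm, lnorm, lintegral_add_right_eq_self (fun w => F w ^ 2) x]

/-- The `L²` norm of `U` localized near `y`. -/
def locNorm (ε : ℝ) (U : V → ℝ≥0∞) (y : V) : ℝ≥0∞ := lnorm fun w => expDecay ε (w - y) * U w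

theorem measurable_locNorm [SecondCountableTopology V] [SFinite (volume : Measure V)] (ε : ℝ) {U : V → ℝ≥0∞}
    (hU : Measurable U) : Measurable (locNorm ε U) := by
  have h : Measurable fun y => ∫⁻ w, (expDecay ε (w - y) * U w) ^ 2 :=
    Measurable.lintegral_prod_right' (f := fun p : V × V => (expDecay ε (p.2 - p.1) * U p.2) ^ 2)
      ((((measurable_expDecay ε).comp (measurable_snd.sub measurable_fst)).mul
        (hU.comp measurable_snd)).pow_const 2)
  exact h.pow_const _

theorem locNorm_le_lnorm {ε : ℝ} (hε : 0 ≤ ε) (U : V → ℝ≥0∞) (y : V) : locNorm ε U y ≤ lnorm U :=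
  lnorm_mono fun w => by
    calc expDecay ε (w - y) * U w ≤ 1 * U w := by gcongr; exact expDecay_le_one hε _
      _ = U w := one_mul _

theorem locNorm_translate [(volume : Measure V).IsAddRightInvariant] (ε : ℝ) (U : V → ℝ≥0∞) (x y : V) :
    locNorm ε (fun w => U (w - x)) y = locNorm ε U (y - x) := by
  rw [locNorm, ← lnorm_translate _ x, locNorm]
  congr 1
  funext w
  rw [add_sub_cancel_right, sub_sub_eq_add_sub]

/-- The difference is at most the larger exponential, and at most r times it since 1 - e^{-r} ≤ r.
The factor min(1, r) is what becomes small for wide cutoffs. -/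
theorem enorm_exp_sub_exp_le {s t r : ℝ} (h : |s - t| ≤ r) :
    ‖Real.exp (-s) - Real.exp (-t)‖ₑ ≤
      min 1 (ENNReal.ofReal r) * (ENNReal.ofReal (Real.exp (-s)) + ENNReal.ofReal (Real.exp (-t))) := by
  have hs := Real.exp_pos (-s)
  have ht := Real.exp_pos (-t)
  rw [← ofReal_norm, Real.norm_eq_abs, ← ENNReal.ofReal_add hs.le ht.le, ← ENNReal.ofReal_one,
    ← ENNReal.ofReal_min, ← ENNReal.ofReal_mul (le_min zero_le_one ((abs_nonneg _).trans h))]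
  refine ENNReal.ofReal_le_ofReal ?_
  have key : ∀ {s t : ℝ}, s ≤ t → |s - t| ≤ r → |Real.exp (-s) - Real.exp (-t)| ≤ min 1 r * Real.exp (-s) := by
    intro s t hst hr
    have hs := Real.exp_pos (-s)
    have ht := Real.exp_pos (-t)
    have hle : Real.exp (-t) ≤ Real.exp (-s) := Real.exp_le_exp.2 (by linarith)
    rw [abs_of_nonneg (by linarith)]
    rw [abs_of_nonpos (by linarith)] at hr
    have h1 : Real.exp (-t) = Real.exp (-s) * Real.exp (s - t) := by rw [← Real.exp_add]; ring_nf
    have h2 := Real.add_one_le_exp (s - t)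
    rcases min_cases 1 r with ⟨h, _⟩ | ⟨h, _⟩ <;> rw [h] <;> nlinarith
  have hmin : 0 ≤ min 1 r := le_min zero_le_one ((abs_nonneg _).trans h)
  rcases le_total s t with hst | hst
  · have := key hst h
    nlinarith
  · have := key hst (by rwa [abs_sub_comm])
    rw [abs_sub_comm] at this
    nlinarith

end LocalNorm

/-! ### Commutators with exponential cutoffs -/

section Commutator
variable {d : ℕ} {T : ConfL2 d →L[ℂ] ConfL2 d} {h : Phase d → ℝ≥0∞}

theorem gabor_adjoint_gaborL (T : ConfL2 d →L[ℂ] ConfL2 d) (u : Lp ℂ 2 (volume : Measure (Phase d)))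
    (w : Phase d) : gabor (T ((gaborL d).adjoint u)) w = ∫ z, conj (gabor (T.adjoint (atom w)) z) * u z := by
  rw [gabor_eq_inner, ← ContinuousLinearMap.adjoint_inner_left, ContinuousLinearMap.adjoint_inner_right, gaborL,
    inner_analysisL]
  rfl

theorem gaborNorm_adjoint_atom (T : ConfL2 d →L[ℂ] ConfL2 d) (w z : Phase d) :
    gaborNorm (T.adjoint (atom w)) z = ‖inner ℂ (atom w) (T (atom z))‖ₑ := by
  rw [gaborNorm, gabor_eq_inner, ContinuousLinearMap.adjoint_inner_right, ← inner_conj_symm, RCLike.enorm_conj]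

theorem measurable_gaborNorm_Lp (f : ConfL2 d) : Measurable (gaborNorm f) := measurable_gaborNorm (Lp.memLp f)

theorem lnorm_gaborNorm (f : ConfL2 d) : lnorm (gaborNorm f) = ‖f‖ₑ := by
  rw [← enorm_gaborL, Lp.enorm_def, eLpNorm_congr_ae (gaborL_coeFn f), eLpNorm_two_eq]
  rfl

/-- The exponential cutoff centred at `y`. -/
def cutoff (ε : ℝ) (y z : Phase d) : ℝ := Real.exp (-(ε * ‖z - y‖))

theorem norm_cutoff (ε : ℝ) (y z : Phase d) : ‖cutoff ε y z‖ = Real.exp (-(ε * ‖z - y‖)) :=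
  Real.norm_of_nonneg (Real.exp_pos _).le

theorem enorm_cutoff (ε : ℝ) (y z : Phase d) : ‖((cutoff ε y z : ℝ) : ℂ)‖ₑ = expDecay ε (z - y) := by
  rw [← ofReal_norm, Complex.norm_real, norm_cutoff, expDecay, neg_mul]

theorem memLp_cutoff_mul {ε : ℝ} (hε : 0 ≤ ε) (y : Phase d) (f : ConfL2 d) :
    MemLp (fun z => ((cutoff ε y z : ℝ) : ℂ) * gabor f z) 2 := by
  have hc : Continuous fun z : Phase d => ((cutoff ε y z : ℝ) : ℂ) := by unfold cutoff; fun_prop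
  refine (memLp_gabor (Lp.memLp f)).mono (hc.mul (continuous_gabor (Lp.memLp f))).aestronglyMeasurable
    (Eventually.of_forall fun z => ?_)
  rw [norm_mul, Complex.norm_real, norm_cutoff]
  refine mul_le_of_le_one_left (norm_nonneg _) (Real.exp_le_one_iff.2 ?_)
  have := mul_nonneg hε (norm_nonneg (z - y))
  linarith

/-- The Gabor synthesis of the localization of `f` near `y`. -/
def localized {ε : ℝ} (hε : 0 ≤ ε) (y : Phase d) (f : ConfL2 d) : ConfL2 d :=
  (gaborL d).adjoint ((memLp_cutoff_mul hε y f).toLp _)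

/-- The left side is the commutator of the Gabor matrix of T with multiplication by the cutoff; its
kernel at (w, w + x) carries the difference of two cutoff values, which is Lipschitz in ε‖x‖. -/
theorem enorm_gabor_localized_sub_le (hT : ∀ w z, ‖inner ℂ (atom w) (T (atom z))‖ₑ ≤ h (z - w)) {ε : ℝ}
    (hε : 0 ≤ ε) (y : Phase d) (f : ConfL2 d) (w : Phase d) :
    ‖gabor (T (localized hε y f)) w - cutoff ε y w * gabor (T f) w‖ₑ ≤
      ∫⁻ x, h x * min 1 (ENNReal.ofReal (ε * ‖x‖)) *
        ((expDecay ε (w + x - y) + expDecay ε (w - y)) * gaborNorm f (w + x)) := by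
  have hA : MemLp (gabor (T.adjoint (atom w))) 2 := memLp_gabor (Lp.memLp _)
  have h1 : gabor (T (localized hε y f)) w =
      ∫ z, conj (gabor (T.adjoint (atom w)) z) * (cutoff ε y z * gabor f z) := by
    rw [localized, gabor_adjoint_gaborL]
    refine integral_congr_ae ?_
    filter_upwards [(memLp_cutoff_mul hε y f).coeFn_toLp] with z hz
    rw [hz]
  have h2 : gabor (T f) w = ∫ z, conj (gabor (T.adjoint (atom w)) z) * gabor f z := by
    conv_lhs => rw [← adjoint_gaborL_gaborL f]
    rw [gabor_adjoint_gaborL]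
    refine integral_congr_ae ?_
    filter_upwards [gaborL_coeFn f] with z hz
    rw [hz]
  have h3 : gabor (T (localized hε y f)) w - cutoff ε y w * gabor (T f) w =
      ∫ z, conj (gabor (T.adjoint (atom w)) z) * (((cutoff ε y z - cutoff ε y w : ℝ) : ℂ) * gabor f z) := by
    rw [h1, h2, ← integral_const_mul, ← integral_sub (integrable_conj_mul (memLp_cutoff_mul hε y f) hA)
      ((integrable_conj_mul (memLp_gabor (Lp.memLp f)) hA).const_mul _)]
    refine integral_congr_ae (Eventually.of_forall fun z => ?_)
    dsimp only
    push_cast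
    ring
  rw [h3]
  refine (enorm_integral_le_lintegral_enorm _).trans ?_
  rw [← lintegral_add_left_eq_self _ w]
  refine lintegral_mono fun x => ?_
  rw [enorm_mul, enorm_mul, RCLike.enorm_conj]
  have h4 : ‖gabor (T.adjoint (atom w)) (w + x)‖ₑ ≤ h x := by
    have := hT w (w + x)
    rw [add_sub_cancel_left, ← gaborNorm_adjoint_atom] at this
    exact this
  have h5 : ‖((cutoff ε y (w + x) - cutoff ε y w : ℝ) : ℂ)‖ₑ ≤
      min 1 (ENNReal.ofReal (ε * ‖x‖)) * (expDecay ε (w + x - y) + expDecay ε (w - y)) := by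
    have h6 : |ε * ‖w + x - y‖ - ε * ‖w - y‖| ≤ ε * ‖x‖ := by
      rw [← mul_sub, abs_mul, abs_of_nonneg hε]
      refine mul_le_mul_of_nonneg_left ((abs_norm_sub_norm_le _ _).trans_eq ?_) hε
      congr 1
      abel
    have h7 := enorm_exp_sub_exp_le h6
    rw [← ofReal_norm, Complex.norm_real, ofReal_norm]
    simpa only [expDecay, neg_mul, cutoff] using h7
  calc _ ≤ h x * ((min 1 (ENNReal.ofReal (ε * ‖x‖)) * (expDecay ε (w + x - y) + expDecay ε (w - y))) *
          ‖gabor f (w + x)‖ₑ) := mul_le_mul' h4 (mul_le_mul_left h5 _)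
    _ = _ := by rw [gaborNorm]; ring

/-- Minkowski's inequality takes the L² norm in w inside the integral over x. After translation by x
the two exponentials are centred at y and at y + x. -/
theorem lnorm_gabor_localized_sub_le (hh : Measurable h)
    (hT : ∀ w z, ‖inner ℂ (atom w) (T (atom z))‖ₑ ≤ h (z - w)) {ε : ℝ} (hε : 0 ≤ ε) (y : Phase d)
    (f : ConfL2 d) :
    lnorm (fun w => ‖gabor (T (localized hε y f)) w - cutoff ε y w * gabor (T f) w‖ₑ) ≤
      ∫⁻ x, h x * min 1 (ENNReal.ofReal (ε * ‖x‖)) *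
        (locNorm ε (gaborNorm f) y + locNorm ε (gaborNorm f) (y + x)) := by
  have hf := measurable_gaborNorm_Lp f
  generalize hU : gaborNorm f = U at hf
  have hE := measurable_expDecay (V := Phase d) ε
  refine (lnorm_mono (enorm_gabor_localized_sub_le hT hε y f)).trans ?_
  rw [hU]
  refine (rpow_lintegral_sq_lintegral_le (G := fun w x => h x * min 1 (ENNReal.ofReal (ε * ‖x‖)) *
    ((expDecay ε (w + x - y) + expDecay ε (w - y)) * U (w + x))) (by unfold Function.uncurry; fun_prop)).trans ?_
  refine lintegral_mono fun x => ?_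
  have m1 : Measurable fun w => expDecay ε (w + x - y) * U (w + x) := by fun_prop
  have m2 : Measurable fun w => expDecay ε (w - y) * U (w + x) := by fun_prop
  have h1 : lnorm (fun w => h x * min 1 (ENNReal.ofReal (ε * ‖x‖)) *
      (expDecay ε (w + x - y) * U (w + x) + expDecay ε (w - y) * U (w + x))) ≤
      h x * min 1 (ENNReal.ofReal (ε * ‖x‖)) * (locNorm ε U y + locNorm ε U (y + x)) := by
    have m3 : Measurable fun w => expDecay ε (w + x - y) * U (w + x) + expDecay ε (w - y) * U (w + x) := m1.add m2
    rw [lnorm_const_mul _ m3]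
    gcongr
    refine (lnorm_add_le m1 m2).trans_eq ?_
    rw [lnorm_translate (fun w => expDecay ε (w - y) * U w) x,
      ← lnorm_translate (fun w => expDecay ε (w - y) * U (w + x)) (-x)]
    simp only [locNorm, ← sub_eq_add_neg, sub_sub, add_comm x y, sub_add_cancel]
  refine le_trans (le_of_eq ?_) h1
  simp only [lnorm, add_mul]

end Commutator

/-! ### Wiener's lemma by localization of the lower bound -/

section Localization
variable {d : ℕ} {S : ConfL2 d →L[ℂ] ConfL2 d} {h h₁ : Phase d → ℝ≥0∞}

theorem continuous_gabor_Lp (f : ConfL2 d) : Continuous (gabor f) := continuous_gabor (Lp.memLp f)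

theorem continuous_cutoff (ε : ℝ) (y : Phase d) : Continuous fun z : Phase d => ((cutoff ε y z : ℝ) : ℂ) := by
  unfold cutoff; fun_prop

theorem lnorm_enorm_le_add {F G : Phase d → ℂ} (hF : Measurable F) (hG : Measurable G) :
    lnorm (fun w => ‖F w‖ₑ) ≤ lnorm (fun w => ‖G w‖ₑ) + lnorm (fun w => ‖G w - F w‖ₑ) := by
  refine (lnorm_mono fun w => ?_).trans (lnorm_add_le (by fun_prop) (by fun_prop))
  have h := enorm_sub_le (a := G w) (b := G w - F w)
  rwa [sub_sub_cancel] at h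

theorem locNorm_gaborNorm_eq (ε : ℝ) (f : ConfL2 d) (y : Phase d) :
    locNorm ε (gaborNorm f) y = lnorm fun w => ‖((cutoff ε y w : ℝ) : ℂ) * gabor f w‖ₑ := by
  simp only [locNorm, enorm_mul, enorm_cutoff, gaborNorm]

/-- The lower bound of S is applied to the synthesis of the cut-off transform of f. The error terms
are the commutators of the cutoff with S (kernel h) and with the Gabor projection (kernel h₁, the
case T = id). -/
theorem locNorm_le_add_lintegral {a : ℝ≥0} (ha : 0 < a) (hS : ∀ f, a * ‖f‖ₑ ≤ ‖S f‖ₑ) (hh : Measurable h)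
    (hk : ∀ w z, ‖inner ℂ (atom w) (S (atom z))‖ₑ ≤ h (z - w)) (hh₁ : Measurable h₁)
    (hk₁ : ∀ w z : Phase d, ‖inner ℂ (atom w) (atom z)‖ₑ ≤ h₁ (z - w)) {ε : ℝ} (hε : 0 ≤ ε) (f : ConfL2 d)
    (y : Phase d) :
    locNorm ε (gaborNorm f) y ≤ (a : ℝ≥0∞)⁻¹ * locNorm ε (gaborNorm (S f)) y +
      ∫⁻ x, (h₁ x + (a : ℝ≥0∞)⁻¹ * h x) * min 1 (ENNReal.ofReal (ε * ‖x‖)) *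
        (locNorm ε (gaborNorm f) y + locNorm ε (gaborNorm f) (y + x)) := by
  have ha0 : (a : ℝ≥0∞) ≠ 0 := by exact_mod_cast ha.ne'
  set fy := localized hε y f
  have e1 := lnorm_gabor_localized_sub_le (T := ContinuousLinearMap.id ℂ (ConfL2 d)) hh₁ hk₁ hε y f
  have e2 := lnorm_gabor_localized_sub_le hh hk hε y f
  have hmul : ∀ u : ConfL2 d, Measurable fun w => ((cutoff ε y w : ℝ) : ℂ) * gabor u w := fun u =>
    ((continuous_cutoff ε y).mul (continuous_gabor_Lp u)).measurable
  have s1 := lnorm_enorm_le_add (hmul f) (continuous_gabor_Lp fy).measurable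
  have s2 := lnorm_enorm_le_add (continuous_gabor_Lp (S fy)).measurable (hmul (S f))
  have s3 : lnorm (gaborNorm fy) ≤ (a : ℝ≥0∞)⁻¹ * lnorm (gaborNorm (S fy)) := by
    rw [lnorm_gaborNorm, lnorm_gaborNorm, ← ENNReal.mul_le_mul_iff_right ha0 ENNReal.coe_ne_top, ← mul_assoc,
      ENNReal.mul_inv_cancel ha0 ENNReal.coe_ne_top, one_mul]
    exact hS fy
  have s4 : ∀ w, ‖((cutoff ε y w : ℝ) : ℂ) * gabor (S f) w - gabor (S fy) w‖ₑ =
      ‖gabor (S fy) w - ((cutoff ε y w : ℝ) : ℂ) * gabor (S f) w‖ₑ := fun w => enorm_sub_rev _ _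
  simp only [s4] at s2
  rw [← locNorm_gaborNorm_eq] at s1 s2
  have hL := measurable_locNorm ε (measurable_gaborNorm_Lp f)
  calc locNorm ε (gaborNorm f) y
      ≤ (a : ℝ≥0∞)⁻¹ * (locNorm ε (gaborNorm (S f)) y +
          ∫⁻ x, h x * min 1 (ENNReal.ofReal (ε * ‖x‖)) *
            (locNorm ε (gaborNorm f) y + locNorm ε (gaborNorm f) (y + x))) +
          ∫⁻ x, h₁ x * min 1 (ENNReal.ofReal (ε * ‖x‖)) *
            (locNorm ε (gaborNorm f) y + locNorm ε (gaborNorm f) (y + x)) := by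
        refine s1.trans (add_le_add (s3.trans ?_) e1)
        gcongr
        exact s2.trans (by gcongr)
    _ = _ := by
        generalize locNorm ε (gaborNorm f) = L at hL
        rw [mul_add, add_assoc, ← lintegral_const_mul _ (by fun_prop), ← lintegral_add_left (by fun_prop)]
        congr 1
        refine lintegral_congr fun x => ?_
        ring

/-- Dominated convergence with dominating function ρ as ε → 0. -/
theorem exists_lintegral_mul_min_le {ρ : Phase d → ℝ≥0∞} (hρ : Measurable ρ) (hρ1 : ∫⁻ x, ρ x < ∞) {c : ℝ≥0∞}
    (hc : 0 < c) : ∃ ε : ℝ, 0 < ε ∧ ∫⁻ x, ρ x * min 1 (ENNReal.ofReal (ε * ‖x‖)) < c := by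
  have hfin : ∀ᵐ x, ρ x < ∞ := ae_lt_top hρ hρ1.ne
  have hlim : Tendsto (fun n : ℕ => ∫⁻ x, ρ x * min 1 (ENNReal.ofReal ((1 / ((n : ℝ) + 1)) * ‖x‖))) atTop
      (𝓝 (∫⁻ x : Phase d, 0)) := by
    refine tendsto_lintegral_of_dominated_convergence ρ (fun n => by fun_prop) (fun n => ?_) hρ1.ne ?_
    · refine Eventually.of_forall fun x => ?_
      exact mul_le_of_le_one_right zero_le (min_le_left _ _)
    · filter_upwards [hfin] with x hx
      have h1 : Tendsto (fun n : ℕ => ENNReal.ofReal ((1 / ((n : ℝ) + 1)) * ‖x‖)) atTop (𝓝 0) := by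
        have h2 := (tendsto_one_div_add_atTop_nhds_zero_nat (𝕜 := ℝ)).mul_const ‖x‖
        rw [zero_mul] at h2
        simpa using ENNReal.tendsto_ofReal h2
      have h3 := ENNReal.Tendsto.const_mul (a := ρ x) ((tendsto_const_nhds (x := (1 : ℝ≥0∞))).min h1) (Or.inr hx.ne)
      rwa [min_eq_right zero_le_one, mul_zero] at h3
  rw [lintegral_zero] at hlim
  obtain ⟨n, hn⟩ := (hlim.eventually (gt_mem_nhds hc)).exists
  exact ⟨_, by positivity, hn⟩

theorem le_two_mul_of_le_add_half {x A : ℝ≥0∞} (hx : x ≠ ∞) (h : x ≤ A + 2⁻¹ * x) : x ≤ 2 * A := by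
  have h1 : 2⁻¹ * x ≠ ∞ := ENNReal.mul_ne_top (by simp) hx
  have h2 : 2⁻¹ * x + 2⁻¹ * x = x := by rw [← add_mul, ENNReal.inv_two_add_inv_two, one_mul]
  have h3 : 2⁻¹ * x ≤ A := by
    refine (ENNReal.add_le_add_iff_right h1).1 ?_
    rwa [h2]
  calc x = 2⁻¹ * x + 2⁻¹ * x := h2.symm
    _ ≤ A + A := add_le_add h3 h3
    _ = 2 * A := (two_mul A).symm

theorem lnorm_expDecay_lt_top {α : ℝ} (hα : 0 < α) : lnorm (expDecay α : Phase d → ℝ≥0∞) < ∞ := by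
  refine ENNReal.rpow_lt_top_of_nonneg (by norm_num) (ne_of_lt ?_)
  have h : ∀ x : Phase d, expDecay α x ^ 2 = expDecay (α + α) x := fun x => by rw [sq, expDecay_add]
  simp_rw [h]
  exact lintegral_expDecay_lt_top _ (by linarith)

theorem gaborNorm_gaussian_neg (z : Phase d) :
    gaborNorm (gaussian (Conf d)) (-z) = gaborNorm (gaussian (Conf d)) z := by
  have h1 := gaborNorm_atom (0 : Phase d) (-z)
  have h2 := gaborNorm_atom (-z) (0 : Phase d)
  rw [gaborNorm, gabor_eq_inner, sub_zero] at h1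
  rw [gaborNorm, gabor_eq_inner, zero_sub, neg_neg] at h2
  rw [← h1, ← h2, ← inner_conj_symm, RCLike.enorm_conj]

/-- The reproducing formula and Cauchy–Schwarz: the Gaussian kernel has enough decay to leave e^{-|w
- z|} in L² beside the cutoff. -/
theorem exists_gaborNorm_le_locNorm (d : ℕ) {ε : ℝ} (hε : 0 < ε) :
    ∃ C : ℝ≥0, ∀ (f : ConfL2 d) z, gaborNorm f z ≤ C * locNorm ε (gaborNorm f) z := by
  obtain ⟨C, hC⟩ := exists_gaborNorm_gaussian_le d (1 + ε)
  have hfin := lnorm_expDecay_lt_top (d := d) one_pos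
  refine ⟨C * (lnorm (expDecay 1 : Phase d → ℝ≥0∞)).toNNReal, fun f z => ?_⟩
  have hf := measurable_gaborNorm_Lp f
  have hE := measurable_expDecay (V := Phase d)
  refine (gaborNorm_le_lintegral f z).trans ?_
  rw [ENNReal.coe_mul, ENNReal.coe_toNNReal hfin.ne, mul_assoc]
  calc ∫⁻ w, gaborNorm (gaussian (Conf d)) (w - z) * gaborNorm f w
      ≤ ∫⁻ w, C * (expDecay 1 (w - z) * (expDecay ε (w - z) * gaborNorm f w)) := by
        refine lintegral_mono fun w => ?_
        calc _ ≤ (C * expDecay (1 + ε) (w - z)) * gaborNorm f w := by gcongr; exact hC _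
          _ = _ := by rw [expDecay_add]; ring
    _ = C * ∫⁻ w, expDecay 1 (w - z) * (expDecay ε (w - z) * gaborNorm f w) := by
        generalize gaborNorm f = U at hf
        exact lintegral_const_mul _ (by fun_prop)
    _ ≤ C * (lnorm (fun w => expDecay 1 (w - z)) * locNorm ε (gaborNorm f) z) := by
        gcongr
        generalize gaborNorm f = U at hf
        exact lintegral_mul_le_sqrt (by fun_prop) (by fun_prop)
    _ = _ := by
        simp only [sub_eq_add_neg _ z, lnorm_translate (expDecay 1 : Phase d → ℝ≥0∞) (-z)]

theorem IsSubexpWeight.lintegral_expDecay_mul_lt_top {V : Type*} [NormedAddCommGroup V] [NormedSpace ℝ V]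
    [FiniteDimensional ℝ V] [MeasurableSpace V] [BorelSpace V] {μ : Measure V} [μ.IsAddHaarMeasure]
    {m : V → ℝ≥0∞} (hm : IsSubexpWeight m) {α : ℝ} (hα : 0 < α) : ∫⁻ x, expDecay α x * m x ∂μ < ∞ := by
  obtain ⟨C, hC⟩ := hm.subexp (α / 2) (by linarith)
  calc ∫⁻ x, expDecay α x * m x ∂μ ≤ ∫⁻ x, C * expDecay (α / 2) x ∂μ := by
        refine lintegral_mono fun x => ?_
        calc expDecay α x * m x = (m x * expDecay (α / 2) x) * expDecay (α / 2) x := by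
              rw [mul_assoc, ← expDecay_add, add_halves, mul_comm]
          _ ≤ _ := by gcongr; exact hC x
    _ = C * ∫⁻ x, expDecay (α / 2) x ∂μ := lintegral_const_mul _ (measurable_expDecay _)
    _ < ∞ := ENNReal.mul_lt_top ENNReal.coe_lt_top (lintegral_expDecay_lt_top μ (by linarith))

theorem exists_locNorm_gaussian_le (d : ℕ) {ε : ℝ} (hε : 0 < ε) :
    ∃ C : ℝ≥0, ∀ y, locNorm ε (gaborNorm (gaussian (Conf d))) y ≤ C * expDecay ε y := by
  obtain ⟨C, hC⟩ := exists_gaborNorm_gaussian_le d (1 + ε)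
  have hfin := lnorm_expDecay_lt_top (d := d) one_pos
  refine ⟨C * (lnorm (expDecay 1 : Phase d → ℝ≥0∞)).toNNReal, fun y => ?_⟩
  rw [ENNReal.coe_mul, ENNReal.coe_toNNReal hfin.ne]
  calc locNorm ε (gaborNorm (gaussian (Conf d))) y ≤ lnorm fun w => (C * expDecay ε y) * expDecay 1 w := by
        refine lnorm_mono fun w => ?_
        calc expDecay ε (w - y) * gaborNorm (gaussian (Conf d)) w
            ≤ expDecay ε (w - y) * (C * expDecay (1 + ε) w) := by gcongr; exact hC w
          _ = C * (expDecay ε (y - w) * expDecay ε w) * expDecay 1 w := by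
              rw [expDecay_add, expDecay_sub_comm]; ring
          _ ≤ C * expDecay ε y * expDecay 1 w := by
              gcongr
              have := expDecay_mul_expDecay_le hε.le (y - w) w
              rwa [sub_add_cancel] at this
    _ = _ := by rw [lnorm_const_mul _ (measurable_expDecay 1)]; ring

/-- Off-diagonal decay of the Gabor matrix of `S` carries over to the inverse of `S`. -/
theorem exists_gaborNorm_preimage_atom_le {m : Phase d → ℝ≥0∞} (hm : IsSubexpWeight m) {a : ℝ≥0} (ha : 0 < a)
    (hS : ∀ f, a * ‖f‖ₑ ≤ ‖S f‖ₑ) (hh : Measurable h) (hhm : ∫⁻ x, h x * m x < ∞)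
    (hk : ∀ w z, ‖inner ℂ (atom w) (S (atom z))‖ₑ ≤ h (z - w)) :
    ∃ B : Phase d → ℝ≥0∞, Measurable B ∧ ∫⁻ x, B x * m x < ∞ ∧
      ∀ (w : Phase d) (f : ConfL2 d), S f = atom w → ∀ z, gaborNorm f z ≤ B (z - w) := by
  have ha0 : (a : ℝ≥0∞) ≠ 0 := by exact_mod_cast ha.ne'
  have hai : (a : ℝ≥0∞)⁻¹ < ∞ := ENNReal.inv_lt_top.2 (pos_iff_ne_zero.2 ha0)
  obtain ⟨C₁, hC₁⟩ := exists_gaborNorm_gaussian_le d 1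
  set h₁ : Phase d → ℝ≥0∞ := fun x => C₁ * expDecay 1 x
  have hh₁ : Measurable h₁ := (measurable_expDecay 1).const_mul _
  have hk₁ : ∀ w z : Phase d, ‖inner ℂ (atom w) (atom z)‖ₑ ≤ h₁ (z - w) := fun w z => by
    rw [← gabor_eq_inner]
    calc ‖gabor (atom z) w‖ₑ = gaborNorm (gaussian (Conf d)) (z - w) := by
          rw [← neg_sub w z, gaborNorm_gaussian_neg]
          exact gaborNorm_atom z w
      _ ≤ _ := hC₁ _
  set ρ : Phase d → ℝ≥0∞ := fun x => h₁ x + (a : ℝ≥0∞)⁻¹ * h x with hρdef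
  have hρ : Measurable ρ := hh₁.add (hh.const_mul _)
  have hmm := hm.measurable
  have hρm : ∫⁻ x, ρ x * m x < ∞ := by
    have e : ∀ x, ρ x * m x = C₁ * (expDecay 1 x * m x) + (a : ℝ≥0∞)⁻¹ * (h x * m x) := fun x => by
      simp only [hρdef, h₁]; ring
    have hE := measurable_expDecay (V := Phase d) 1
    simp_rw [e]
    rw [lintegral_add_left (by fun_prop), lintegral_const_mul _ (by fun_prop), lintegral_const_mul _ (by fun_prop)]
    exact ENNReal.add_lt_top.2 ⟨ENNReal.mul_lt_top ENNReal.coe_lt_top (hm.lintegral_expDecay_mul_lt_top one_pos),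
      ENNReal.mul_lt_top hai hhm⟩
  have hρ1 : ∫⁻ x, ρ x < ∞ := (hm.toIsWeight.lintegral_le ρ).trans_lt hρm
  -- A quarter serves two purposes: the term κ(x)L(y) is absorbed into L(y) with factor 1/2, and the
  -- doubled kernel 2κ left by the absorption still has mass below 1.
  obtain ⟨ε, hε, hερ⟩ := exists_lintegral_mul_min_le hρ hρ1 (c := 2⁻¹ * 2⁻¹) (by simp)
  set κ : Phase d → ℝ≥0∞ := fun x => ρ x * min 1 (ENNReal.ofReal (ε * ‖x‖)) with hκdef
  have hκ : Measurable κ := by fun_prop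
  have hκ2 : ∫⁻ x, 2 * κ x < 1 := by
    rw [lintegral_const_mul _ hκ]
    calc 2 * ∫⁻ x, κ x ≤ 2 * (2⁻¹ * 2⁻¹) := by gcongr
      _ = 2⁻¹ := by rw [← mul_assoc, ENNReal.mul_inv_cancel two_ne_zero ENNReal.ofNat_ne_top, one_mul]
      _ < 1 := by rw [ENNReal.inv_lt_one]; exact ENNReal.one_lt_two
  have hκm : ∫⁻ x, (2 * κ x) * m x < ∞ := by
    calc ∫⁻ x, (2 * κ x) * m x ≤ ∫⁻ x, 2 * (ρ x * m x) := by
          refine lintegral_mono fun x => ?_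
          calc 2 * κ x * m x ≤ 2 * (ρ x * 1) * m x := by simp only [hκdef]; gcongr; exact min_le_left _ _
            _ = _ := by ring
      _ = 2 * ∫⁻ x, ρ x * m x := lintegral_const_mul _ (by fun_prop)
      _ < ∞ := ENNReal.mul_lt_top ENNReal.ofNat_lt_top hρm
  obtain ⟨C₂, hC₂⟩ := exists_locNorm_gaussian_le d hε
  obtain ⟨C₃, hC₃⟩ := exists_gaborNorm_le_locNorm d hε
  set b : Phase d → ℝ≥0∞ := fun y => (2 * ((a : ℝ≥0∞)⁻¹ * C₂)) * expDecay ε y with hbdef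
  have hb : Measurable b := (measurable_expDecay ε).const_mul _
  have hbm : ∫⁻ x, b x * m x < ∞ := by
    have hE := measurable_expDecay (V := Phase d) ε
    simp only [hbdef, mul_assoc _ (expDecay ε _)]
    rw [lintegral_const_mul _ (by fun_prop)]
    exact ENNReal.mul_lt_top (ENNReal.mul_lt_top ENNReal.ofNat_lt_top (ENNReal.mul_lt_top hai ENNReal.coe_lt_top))
      (hm.lintegral_expDecay_mul_lt_top hε)
  obtain ⟨R, hR, hRm, hRle⟩ := hm.exists_majorant_of_le_corr (μ := volume) (hκ.const_mul 2) hb hκm hκ2 hbm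
  refine ⟨fun x => C₃ * R x, hR.const_mul _, ?_, fun w f hf z => (hC₃ f z).trans ?_⟩
  · simp_rw [mul_assoc]
    rw [lintegral_const_mul _ (by fun_prop)]
    exact ENNReal.mul_lt_top ENNReal.coe_lt_top hRm
  refine mul_le_mul_right ?_ _
  -- The a priori bound that legitimizes the absorption and starts the iteration; its size does not
  -- enter the majorant.
  have hle : ∀ y, locNorm ε (gaborNorm f) y ≤ ‖f‖ₑ := fun y =>
    (locNorm_le_lnorm hε.le _ y).trans_eq (lnorm_gaborNorm f)
  have hmain := locNorm_le_add_lintegral ha hS hh hk hh₁ hk₁ hε.le f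
  have hL := measurable_locNorm ε (measurable_gaborNorm_Lp f)
  have hatom : ∀ y, locNorm ε (gaborNorm (S f)) y ≤ C₂ * expDecay ε (y - w) := fun y => by
    have e : gaborNorm (S f) = fun z => gaborNorm (gaussian (Conf d)) (z - w) := by
      rw [hf]; funext z; exact gaborNorm_atom w z
    rw [e, locNorm_translate]
    exact hC₂ _
  refine hRle (locNorm ε (gaborNorm f)) w ‖f‖ₑ enorm_ne_top hle (fun y => ?_) z
  generalize locNorm ε (gaborNorm f) = L at hle hmain hL
  have h2 : L y ≤ ((a : ℝ≥0∞)⁻¹ * (C₂ * expDecay ε (y - w)) + ∫⁻ x, κ x * L (y + x)) + 2⁻¹ * L y := by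
    have e0 : L y ≤ (a : ℝ≥0∞)⁻¹ * locNorm ε (gaborNorm (S f)) y +
        ∫⁻ x, ρ x * min 1 (ENNReal.ofReal (ε * ‖x‖)) * (L y + L (y + x)) := hmain y
    refine e0.trans ?_
    have e : ∀ x, ρ x * min 1 (ENNReal.ofReal (ε * ‖x‖)) * (L y + L (y + x)) = κ x * L y + κ x * L (y + x) :=
      fun x => mul_add _ _ _
    have e2 : ∫⁻ x, κ x * L y ≤ 2⁻¹ * L y := by
      rw [lintegral_mul_const _ hκ]
      gcongr
      refine hερ.le.trans ?_
      calc (2⁻¹ : ℝ≥0∞) * 2⁻¹ ≤ 2⁻¹ * 1 := by gcongr; rw [ENNReal.inv_le_one]; exact one_le_two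
        _ = 2⁻¹ := mul_one _
    simp only [e]
    rw [lintegral_add_left (by fun_prop), add_assoc, add_comm _ (2⁻¹ * L y)]
    gcongr
    exact hatom y
  refine (le_two_mul_of_le_add_half (ne_top_of_le_ne_top enorm_ne_top (hle y)) h2).trans_eq ?_
  simp_rw [mul_assoc 2 (κ _)]
  rw [lintegral_const_mul _ (by fun_prop), mul_add]
  simp only [hbdef]
  ring

end Localization

/-! ### Moderate functions and lattice sums -/

section Moderate
variable {V : Type*} [NormedAddCommGroup V] [NormedSpace ℝ V] [FiniteDimensional ℝ V]
  [MeasurableSpace V] [BorelSpace V] {μ : Measure V} [μ.IsAddHaarMeasure] {F U m : V → ℝ≥0∞} {α β : ℝ}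

/-- `F` varies by at most a factor `e^{α|q|}` under translation by `q`. -/
def Moderate (α : ℝ) (F : V → ℝ≥0∞) : Prop := ∀ x q, F (x + q) ≤ ENNReal.ofReal (Real.exp (α * ‖q‖)) * F x

theorem moderate_expDecay (hα : 0 ≤ α) : Moderate α (expDecay α : V → ℝ≥0∞) := fun x q => by
  have h := expDecay_le hα (x + q) (-q)
  rwa [norm_neg, add_neg_cancel_right] at h

theorem Moderate.mul {G : V → ℝ≥0∞} (hF : Moderate α F) (hG : Moderate β G) :
    Moderate (α + β) fun x => F x * G x := fun x q => by
  calc F (x + q) * G (x + q) ≤ (ENNReal.ofReal (Real.exp (α * ‖q‖)) * F x) *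
        (ENNReal.ofReal (Real.exp (β * ‖q‖)) * G x) := mul_le_mul' (hF x q) (hG x q)
    _ = _ := by rw [add_mul, Real.exp_add, ENNReal.ofReal_mul (Real.exp_pos _).le]; ring

theorem Moderate.comp_const_sub (hF : Moderate α F) (a : V) : Moderate α fun x => F (a - x) := fun x q => by
  have h := hF (a - x) (-q)
  rwa [norm_neg, ← sub_eq_add_neg, sub_sub] at h

theorem Moderate.comp_sub_const (hF : Moderate α F) (a : V) : Moderate α fun x => F (x - a) := fun x q => by
  have h := hF (x - a) q
  rwa [sub_add_eq_add_sub] at h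

theorem Moderate.lintegral_right {X : Type*} [MeasurableSpace X] {ν : Measure X} {k : X → ℝ≥0∞}
    {K : X → V → ℝ≥0∞} (hK : ∀ s, Moderate α (K s)) : Moderate α fun x => ∫⁻ s, k s * K s x ∂ν := fun x q => by
  dsimp only
  rw [← lintegral_const_mul' _ _ ENNReal.ofReal_ne_top]
  refine lintegral_mono fun s => ?_
  calc k s * K s (x + q) ≤ k s * (ENNReal.ofReal (Real.exp (α * ‖q‖)) * K s x) := mul_le_mul_right (hK s x q) _
    _ = _ := by ring

/-- Sums over a lattice of moderate functions are controlled by integrals. -/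
theorem exists_tsum_lattice_le (μ : Measure V) [μ.IsAddHaarMeasure] (Λ : Submodule ℤ V) [DiscreteTopology Λ]
    [IsZLattice ℝ Λ] (α : ℝ) :
    ∃ C : ℝ≥0, ∀ F : V → ℝ≥0∞, Moderate α F → ∑' l : Λ, F l ≤ C * ∫⁻ x, F x ∂μ := by
  have : VAddInvariantMeasure Λ V μ :=
    ⟨fun l s _ => measure_preimage_add μ (l : V) s⟩
  set b := Module.Free.chooseBasis ℤ Λ
  have hD := ZLattice.isAddFundamentalDomain b μ
  set D := ZSpan.fundamentalDomain (b.ofZLatticeBasis ℝ) with hDdef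
  have hDb : Bornology.IsBounded D := ZSpan.fundamentalDomain_isBounded _
  have hD0 : μ D ≠ 0 := ZSpan.measure_fundamentalDomain_ne_zero _
  have hDt : μ D ≠ ∞ := hDb.measure_lt_top.ne
  obtain ⟨r, hr⟩ := hDb.exists_norm_le
  set E := ENNReal.ofReal (Real.exp (|α| * r))
  have hfin : (μ D)⁻¹ * E ≠ ∞ := ENNReal.mul_ne_top (ENNReal.inv_ne_top.2 hD0) ENNReal.ofReal_ne_top
  refine ⟨((μ D)⁻¹ * E).toNNReal, fun F hF => ?_⟩
  rw [ENNReal.coe_toNNReal hfin, mul_assoc, ← ENNReal.mul_le_mul_iff_right hD0 hDt, ← mul_assoc,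
    ENNReal.mul_inv_cancel hD0 hDt, one_mul, ← ENNReal.tsum_mul_left, hD.lintegral_eq_tsum'' F,
    ← ENNReal.tsum_mul_left]
  -- F(l) is compared with F on the cell l + D: the points of the fundamental domain D have norm at
  -- most r, so the values differ by a factor at most e^{|α| r}.
  refine ENNReal.tsum_le_tsum fun l => ?_
  rw [mul_comm, ← setLIntegral_const, ← lintegral_const_mul' _ _ ENNReal.ofReal_ne_top]
  refine setLIntegral_mono' (ZSpan.fundamentalDomain_measurableSet _) fun x hx => ?_
  have h := hF ((l : V) + x) (-x)
  rw [add_neg_cancel_right, norm_neg] at h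
  refine h.trans ?_
  refine mul_le_mul_left (ENNReal.ofReal_le_ofReal (Real.exp_le_exp.2 ?_)) _
  exact mul_le_mul (le_abs_self _) (hr x hx) (norm_nonneg _) (abs_nonneg _)

/-- Smoothing of `U` by an exponential. -/
def smear (μ : Measure V) (α : ℝ) (U : V → ℝ≥0∞) (x : V) : ℝ≥0∞ := ∫⁻ s, U s * expDecay α (x - s) ∂μ

theorem measurable_smear (α : ℝ) (hU : Measurable U) : Measurable (smear μ α U) := by
  have hE := measurable_expDecay (V := V) α
  exact Measurable.lintegral_prod_right' (f := fun p : V × V => U p.2 * expDecay α (p.1 - p.2)) (by fun_prop)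

theorem moderate_smear (hα : 0 ≤ α) (U : V → ℝ≥0∞) : Moderate α (smear μ α U) :=
  Moderate.lintegral_right fun s => (moderate_expDecay hα).comp_sub_const s

theorem lintegral_smear_mul_lt_top (hm : IsSubexpWeight m) (hα : 0 < α) (hU : Measurable U)
    (hUm : ∫⁻ x, U x * m x ∂μ < ∞) : ∫⁻ x, smear μ α U x * m x ∂μ < ∞ :=
  (hm.toIsWeight.lintegral_conv_mul_le hU (measurable_expDecay α)).trans_lt
    (ENNReal.mul_lt_top hUm (hm.lintegral_expDecay_mul_lt_top hα))

end Moderate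

/-! ### A moderate majorant of the Gabor transform -/

section GaborSmear
variable {d : ℕ}

/-- |V_g f| need not be moderate, so it cannot be sampled on a lattice directly; its exponential
smoothing can, and keeps weighted integrability. -/
theorem exists_gaborNorm_le_smear (d : ℕ) (α : ℝ) :
    ∃ C : ℝ≥0, ∀ (f : ConfL2 d) z, gaborNorm f z ≤ C * smear volume α (gaborNorm f) z := by
  obtain ⟨C, hC⟩ := exists_gaborNorm_gaussian_le d α
  refine ⟨C, fun f z => (gaborNorm_le_lintegral f z).trans ?_⟩
  have hf := measurable_gaborNorm_Lp f
  have hE := measurable_expDecay (V := Phase d) α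
  rw [smear, ← lintegral_const_mul _ (by fun_prop)]
  refine lintegral_mono fun w => ?_
  calc gaborNorm (gaussian (Conf d)) (w - z) * gaborNorm f w ≤ (C * expDecay α (w - z)) * gaborNorm f w := by
        gcongr; exact hC _
    _ = _ := by rw [expDecay_sub_comm]; ring

end GaborSmear

/-! ### Gabor frames and the frame operator -/

section Frame
variable {d : ℕ} {Λ : Submodule ℤ (Phase d)} {φ : ConfL2 d} {m : Phase d → ℝ≥0∞}

/-- The function `φ` shifted to the phase-space point `l`, as an element of `L²`. -/
def shiftLp (φ : ConfL2 d) (l : Phase d) : ConfL2 d := (memLp_tfShift (Lp.memLp φ) l).toLp (tfShift l φ)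

theorem coeFn_shiftLp (φ : ConfL2 d) (l : Phase d) : shiftLp φ l =ᵐ[volume] tfShift l φ := MemLp.coeFn_toLp _

theorem coeff_eq_inner_shiftLp (φ f : ConfL2 d) (l : Phase d) : coeff φ f l = inner ℂ (shiftLp φ l) f :=
  coeff_eq_inner (Lp.memLp φ) f l

theorem gaborNorm_shiftLp (φ : ConfL2 d) (l z : Phase d) : gaborNorm (shiftLp φ l) z = gaborNorm φ (z - l) := by
  rw [← enorm_gabor_tfShift]
  exact congrArg _ (coeff_congr (coeFn_shiftLp φ l) z)

theorem enorm_coeff_atom (φ : ConfL2 d) (z l : Phase d) : ‖coeff φ (atom z) l‖ₑ = gaborNorm φ (z - l) := by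
  rw [coeff_eq_inner_shiftLp, ← inner_conj_symm, RCLike.enorm_conj, ← gabor_eq_inner]
  exact gaborNorm_shiftLp φ l z

theorem enorm_coeff_le (φ f : ConfL2 d) (l : Phase d) :
    ‖coeff φ f l‖ₑ ≤ ∫⁻ z, gaborNorm f z * gaborNorm φ (z - l) := by
  rw [coeff_eq_inner_shiftLp, ← inner_gaborL, gaborL, inner_analysisL_analysisL]
  refine (enorm_integral_le_lintegral_enorm _).trans_eq (lintegral_congr fun z => ?_)
  rw [enorm_mul, RCLike.enorm_conj, ← gaborNorm_shiftLp, mul_comm]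
  rfl

theorem IsGaborFrame.isBessel [DiscreteTopology Λ] [IsZLattice ℝ Λ] (hΛ : IsGaborFrame φ Λ) :
    ∃ a b : ℝ≥0, 0 < a ∧ IsBessel (Measure.count : Measure Λ) φ (fun l => (l : Phase d)) b ∧
      ∀ f : ConfL2 d, a * ‖f‖ₑ ^ 2 ≤ ∫⁻ l : Λ, ‖coeff φ f l‖ₑ ^ 2 ∂Measure.count := by
  obtain ⟨a, b, ha, hb, h⟩ := hΛ
  refine ⟨a, b, ha, fun f => ?_, fun f => ?_⟩
  · have h1 : ∫⁻ l : Λ, ‖coeff φ f l‖ₑ ^ 2 ∂Measure.count ≤ b * ‖f‖ₑ ^ 2 := by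
      rw [lintegral_count]; exact (h f).2
    refine ⟨memLp_two_iff_lintegral.2 ⟨(measurable_of_countable _).aestronglyMeasurable, h1.trans_lt ?_⟩, h1⟩
    exact ENNReal.mul_lt_top ENNReal.coe_lt_top (ENNReal.pow_lt_top enorm_lt_top)
  · rw [lintegral_count]; exact (h f).1

/-- The frame operator, through its quadratic form. -/
theorem IsGaborFrame.exists_frameOperator [DiscreteTopology Λ] [IsZLattice ℝ Λ] (hΛ : IsGaborFrame φ Λ) :
    ∃ (a : ℝ≥0) (S : ConfL2 d →L[ℂ] ConfL2 d), 0 < a ∧ (∀ f, a * ‖f‖ₑ ≤ ‖S f‖ₑ) ∧ Function.Surjective S ∧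
      (∀ f u : ConfL2 d, inner ℂ f (S u) = ∫ l : Λ, conj (coeff φ f l) * coeff φ u l ∂Measure.count) := by
  obtain ⟨a, b, ha, hB, hlow⟩ := hΛ.isBessel
  set C := analysisL (Lp.memLp φ) hB
  set S := C.adjoint ∘L C with hS
  have hin : ∀ f u, inner ℂ f (S u) = inner ℂ (C f) (C u) := fun f u => by
    rw [hS, ContinuousLinearMap.comp_apply, ContinuousLinearMap.adjoint_inner_right]
  have hC : ∀ f, (a : ℝ) * ‖f‖ ^ 2 ≤ ‖C f‖ ^ 2 := fun f => by
    have h1 : (a : ℝ≥0∞) * ‖f‖ₑ ^ 2 ≤ ‖C f‖ₑ ^ 2 := by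
      refine (hlow f).trans_eq ?_
      rw [lintegral_enorm_sq_eq_eLpNorm, ← eLpNorm_congr_ae (analysisL_coeFn (Lp.memLp φ) hB f), Lp.enorm_def]
    have h2 := ENNReal.toReal_mono (ENNReal.pow_ne_top enorm_ne_top) h1
    simpa using h2
  have hlow2 : ∀ f, ‖f‖ ^ 2 * (a : ℝ) ≤ ‖inner ℂ (S f) f‖ := fun f => by
    rw [norm_inner_symm, hin, inner_self_eq_norm_sq_to_K, mul_comm]
    refine (hC f).trans_eq ?_
    simp
  refine ⟨a, S, ha, fun f => ?_, ?_, fun f u => by rw [hin]; exact inner_analysisL_analysisL _ hB f u⟩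
  · have h1 : (a : ℝ) * ‖f‖ ≤ ‖S f‖ := by
      rcases eq_or_ne f 0 with rfl | hf
      · simp
      · have hf0 := norm_pos_iff.2 hf
        have h2 := (hlow2 f).trans (norm_inner_le_norm (𝕜 := ℂ) _ _)
        refine le_of_mul_le_mul_right ?_ hf0
        linarith [sq ‖f‖]
    have h2 : (a * ‖f‖₊ : ℝ≥0) ≤ ‖S f‖₊ := by exact_mod_cast h1
    have h3 : ((a * ‖f‖₊ : ℝ≥0) : ℝ≥0∞) ≤ (‖S f‖₊ : ℝ≥0∞) := ENNReal.coe_le_coe.2 h2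
    rwa [ENNReal.coe_mul] at h3
  -- Coercivity |⟨Sf, f⟩| ≥ a‖f‖² makes S invertible, as in the Lax–Milgram theorem.
  · exact ((ContinuousLinearMap.isUnit_iff_bijective).1
      (S.isUnit_of_forall_le_norm_inner_map ha hlow2)).2

end Frame

/-! ### Localized frame expansions of shifted Gaussians -/

section Expansion
variable {d : ℕ} {Λ : Submodule ℤ (Phase d)} {φ : ConfL2 d} {m : Phase d → ℝ≥0∞}

theorem lintegral_enorm_tfShift (f : Conf d → ℂ) (w : Phase d) : ∫⁻ t, ‖tfShift w f t‖ₑ = ∫⁻ t, ‖f t‖ₑ := by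
  simp only [tfShift, shift, enorm_mul, enorm_character, one_mul]
  exact lintegral_sub_right_eq_self (fun t => ‖f t‖ₑ) (pos w)

theorem measurable_tfShift {f : Conf d → ℂ} (hf : Measurable f) (w : Phase d) : Measurable (tfShift w f) :=
  (measurable_character _).mul (hf.comp (measurable_sub_const _))

theorem measurable_coeFn_Lp (φ : ConfL2 d) : Measurable φ := (Lp.stronglyMeasurable φ).measurable

theorem setIntegral_eq_inner {s : Set (Conf d)} (hs : MeasurableSet s) (hs' : volume s ≠ ∞) (f : ConfL2 d) :
    ∫ t in s, f t = inner ℂ (indicatorConstLp 2 hs hs' (1 : ℂ)) f :=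
  (L2.inner_indicatorConstLp_one hs hs' f).symm

/-- Every shifted Gaussian is a superposition of the atoms of a Gabor frame, with coefficients that
are concentrated near the centre of the Gaussian, uniformly in the centre. -/
theorem IsGaborFrame.exists_expansion [DiscreteTopology Λ] [IsZLattice ℝ Λ] (hΛ : IsGaborFrame φ Λ)
    (hm : IsSubexpWeight m) (hφ : ∫⁻ z, gaborNorm φ z * m z < ∞) :
    ∃ K : Phase d → ℝ≥0∞, Measurable K ∧ Moderate 1 K ∧ ∫⁻ x, K x * m x < ∞ ∧
      ∀ w : Phase d, ∃ c : Λ → ℂ, (∀ l : Λ, ‖c l‖ₑ ≤ K (l - w)) ∧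
        Integrable (fun p : Λ × Conf d => c p.1 * tfShift (p.1 : Phase d) φ p.2)
          ((Measure.count : Measure Λ).prod volume) ∧
        tfShift w (gaussian (Conf d)) =ᵐ[volume]
          fun t => ∫ l : Λ, c l * tfShift (l : Phase d) φ t ∂Measure.count := by
  obtain ⟨a, S, ha, hlow, hsurj, hform⟩ := hΛ.exists_frameOperator
  obtain ⟨C, hC⟩ := exists_gaborNorm_le_smear d 1
  have hΦ := measurable_gaborNorm_Lp φ
  obtain ⟨C', hC'⟩ := exists_tsum_lattice_le (volume : Measure (Phase d)) Λ (1 + 1)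
  obtain ⟨C'', hC''⟩ := exists_tsum_lattice_le (volume : Measure (Phase d)) Λ 1
  set P : Phase d → ℝ≥0∞ := smear volume 1 (gaborNorm φ) with hP
  have hPm : Measurable P := measurable_smear 1 hΦ
  have hPmod : Moderate 1 P := moderate_smear zero_le_one _
  have hPw : ∫⁻ x, P x * m x < ∞ := lintegral_smear_mul_lt_top hm one_pos hΦ hφ
  -- This bounds the Gabor matrix of S: the lattice sum of |V_gφ(w - l)| |V_gφ(z - l)| is compared
  -- with an integral of the moderate majorants P, and that integral depends on z - w only.
  set h : Phase d → ℝ≥0∞ := fun x => (C * C * C' : ℝ≥0) * ∫⁻ y, P y * P (y - x) with hh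
  have hconv : Measurable fun x => ∫⁻ y, P y * P (y - x) :=
    Measurable.lintegral_prod_right' (f := fun p : Phase d × Phase d => P p.2 * P (p.2 - p.1)) (by fun_prop)
  have hhm : Measurable h := hconv.const_mul _
  have hmm := hm.measurable
  have hhw : ∫⁻ x, h x * m x < ∞ := by
    simp only [hh, mul_assoc _ _ (m _)]
    rw [lintegral_const_mul _ (by fun_prop)]
    exact ENNReal.mul_lt_top ENNReal.coe_lt_top
      ((hm.toIsWeight.lintegral_conv_neg_mul_le hPm hPm).trans_lt (ENNReal.mul_lt_top hPw hPw))
  have hk : ∀ w z, ‖inner ℂ (atom w) (S (atom z))‖ₑ ≤ h (z - w) := by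
    intro w z
    rw [hform]
    calc ‖∫ l : Λ, conj (coeff φ (atom w) l) * coeff φ (atom z) l ∂Measure.count‖ₑ
        ≤ ∑' l : Λ, gaborNorm φ (w - l) * gaborNorm φ (z - l) := by
          refine (enorm_integral_le_lintegral_enorm _).trans_eq ?_
          rw [lintegral_count]
          simp only [enorm_mul, RCLike.enorm_conj, enorm_coeff_atom]
      _ ≤ ∑' l : Λ, (C * C : ℝ≥0∞) * (P (w - l) * P (z - l)) := by
          refine ENNReal.tsum_le_tsum fun l => ?_
          calc _ ≤ (C * P (w - l)) * (C * P (z - l)) := mul_le_mul' (hC _ _) (hC _ _)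
            _ = _ := by ring
      _ ≤ (C * C : ℝ≥0∞) * (C' * ∫⁻ t, P (w - t) * P (z - t)) := by
          rw [ENNReal.tsum_mul_left]
          gcongr
          exact hC' _ ((hPmod.comp_const_sub w).mul (hPmod.comp_const_sub z))
      _ = h (z - w) := by
          have e := lintegral_sub_left_eq_self (fun y => P y * P (y - (z - w))) z (μ := volume)
          simp only [hh]
          rw [← e, ENNReal.coe_mul, ENNReal.coe_mul,
            mul_assoc (C * C : ℝ≥0∞)]
          congr 3
          funext t
          rw [show z - t - (z - w) = w - t by abel, mul_comm]
  obtain ⟨B, hB, hBm, hBle⟩ := exists_gaborNorm_preimage_atom_le hm ha hlow hhm hhw hk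
  have hBP : Measurable fun x => ∫⁻ y, B y * P (y - x) :=
    Measurable.lintegral_prod_right' (f := fun p : Phase d × Phase d => B p.2 * P (p.2 - p.1)) (by fun_prop)
  set K : Phase d → ℝ≥0∞ := fun x => ∫⁻ y, (C * B y) * P (y - x) with hK
  have hKeq : ∀ x, K x = C * ∫⁻ y, B y * P (y - x) := fun x => by
    simp only [hK, mul_assoc]
    exact lintegral_const_mul _ (by fun_prop)
  have hKmod : Moderate 1 K := Moderate.lintegral_right fun y => hPmod.comp_const_sub y
  have hKw : ∫⁻ x, K x * m x < ∞ := by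
    simp only [hKeq, mul_assoc _ _ (m _)]
    rw [lintegral_const_mul _ (by fun_prop)]
    exact ENNReal.mul_lt_top ENNReal.coe_lt_top
      ((hm.toIsWeight.lintegral_conv_neg_mul_le hB hPm).trans_lt (ENNReal.mul_lt_top hBm hPw))
  have hKmeas : Measurable K := by
    rw [funext hKeq]; exact hBP.const_mul _
  have hφ1 : Integrable φ := integrable_of_lintegral_gabor (Lp.memLp φ) ((hm.toIsWeight.lintegral_le _).trans_lt hφ)
  refine ⟨K, hKmeas, hKmod, hKw, fun w => ?_⟩
  -- With γ = S⁻¹π(w)g the numbers ⟨γ, π(l)φ⟩ are the canonical frame coefficients of π(w)g. They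
  -- decay in l - w because V_gγ is concentrated near w.
  obtain ⟨γ, hγ⟩ := hsurj (atom w)
  have hc : ∀ l : Λ, ‖coeff φ γ l‖ₑ ≤ K (l - w) := fun l => by
    refine (enorm_coeff_le φ γ l).trans ?_
    rw [← lintegral_add_right_eq_self _ w]
    refine lintegral_mono fun y => ?_
    calc gaborNorm γ (y + w) * gaborNorm φ (y + w - l) ≤ B (y + w - w) * (C * P (y + w - l)) :=
          mul_le_mul' (hBle w γ hγ _) (hC _ _)
      _ = _ := by rw [add_sub_cancel_right, show y + w - (l : Phase d) = y - (l - w) by abel]; ring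
  have hint : Integrable (fun p : Λ × Conf d => coeff φ γ p.1 * tfShift (p.1 : Phase d) φ p.2)
      ((Measure.count : Measure Λ).prod volume) := by
    have hmeas : Measurable fun p : Λ × Conf d => coeff φ γ p.1 * tfShift (p.1 : Phase d) φ p.2 :=
      measurable_from_prod_countable_right fun l => by
        have h1 := measurable_tfShift (measurable_coeFn_Lp φ) (l : Phase d)
        have h2 := h1.const_mul (coeff φ γ l)
        exact h2
    refine ⟨hmeas.aestronglyMeasurable, ?_⟩
    rw [hasFiniteIntegral_iff_enorm, lintegral_prod _ hmeas.enorm.aemeasurable, lintegral_count]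
    have e : ∀ l : Λ, ∫⁻ t, ‖coeff φ γ l * tfShift (l : Phase d) φ t‖ₑ = ‖coeff φ γ l‖ₑ * ∫⁻ t, ‖φ t‖ₑ := fun l => by
      simp only [enorm_mul]
      rw [lintegral_const_mul' _ _ enorm_ne_top, lintegral_enorm_tfShift]
    simp only [e]
    rw [ENNReal.tsum_mul_right]
    refine ENNReal.mul_lt_top ?_ (hasFiniteIntegral_iff_enorm.1 hφ1.2)
    calc ∑' l : Λ, ‖coeff φ γ l‖ₑ ≤ ∑' l : Λ, K (l - w) := ENNReal.tsum_le_tsum hc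
      _ ≤ C'' * ∫⁻ x, K (x - w) := hC'' _ (hKmod.comp_sub_const w)
      _ = C'' * ∫⁻ x, K x := by rw [lintegral_sub_right_eq_self K w]
      _ < ∞ := ENNReal.mul_lt_top ENNReal.coe_lt_top ((hm.toIsWeight.lintegral_le K).trans_lt hKw)
  refine ⟨fun l => coeff φ γ l, hc, hint, ?_⟩
  -- Tested against the indicator of s, the expansion is the formula for ⟨1_s, Sγ⟩ as a sum over the
  -- lattice.
  refine ae_eq_of_setIntegral_superposition (k := fun p : Λ × Conf d => coeff φ γ p.1 * tfShift (p.1 : Phase d) φ p.2)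
    hint (memLp_tfShift memLp_gaussian w) fun s hs hs' => ?_
  calc ∫ t in s, tfShift w (gaussian (Conf d)) t = ∫ t in s, (atom w : ConfL2 d) t :=
        setIntegral_congr_ae hs (by filter_upwards [coeFn_atom w] with t ht _ using ht.symm)
    _ = ∫ l : Λ, conj (coeff φ (indicatorConstLp 2 hs hs'.ne (1 : ℂ)) l) * coeff φ γ l ∂Measure.count := by
        rw [setIntegral_eq_inner hs hs'.ne, ← hγ, hform]
    _ = _ := by
        refine integral_congr_ae (Eventually.of_forall fun l => ?_)
        dsimp only
        rw [coeff_eq_inner_shiftLp φ (indicatorConstLp 2 hs hs'.ne (1 : ℂ)), inner_conj_symm,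
          ← setIntegral_eq_inner hs hs'.ne, integral_const_mul, mul_comm]
        congr 1
        exact setIntegral_congr_ae hs (by filter_upwards [coeFn_shiftLp φ l] with t ht _ using ht)

end Expansion

/-! ### Polynomial weights -/

section PolynomialWeight
variable {V : Type*} [NormedAddCommGroup V] [NormedSpace ℝ V] [FiniteDimensional ℝ V]
  [MeasurableSpace V] [BorelSpace V]

/-- The polynomial weight `(1 + |x|)^N`. -/
def normWeight (N : ℕ) (x : V) : ℝ≥0∞ := ENNReal.ofReal ((1 + ‖x‖) ^ N)

theorem isWeight_normWeight (N : ℕ) : IsWeight (normWeight (V := V) N) where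
  measurable := by unfold normWeight; fun_prop
  one_le x := ENNReal.one_le_ofReal.2 (one_le_pow₀ (by linarith [norm_nonneg x]))
  neg x := by simp only [normWeight, norm_neg]
  submul x y := by
    rw [normWeight, normWeight, normWeight, ← ENNReal.ofReal_mul (by positivity)]
    exact ENNReal.ofReal_le_ofReal (one_add_norm_pow_le N x y)
  exp_le := ⟨N, 1, by positivity, fun x => by
    rw [ENNReal.coe_one, one_mul]
    exact ENNReal.ofReal_le_ofReal (one_add_pow_le_exp N (norm_nonneg x))⟩

theorem moderate_normWeight (N : ℕ) : Moderate N (normWeight (V := V) N) := fun x q => by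
  rw [mul_comm]
  refine ((isWeight_normWeight N).submul x q).trans (mul_le_mul_right ?_ _)
  exact ENNReal.ofReal_le_ofReal (one_add_pow_le_exp N (norm_nonneg q))

theorem lintegral_expDecay_mul_normWeight_lt_top (μ : Measure V) [μ.IsAddHaarMeasure] {α : ℝ} (hα : 0 < α) (N : ℕ) :
    ∫⁻ x, expDecay α x * normWeight N x ∂μ < ∞ := by
  have h := (integrable_pow_mul_exp μ hα N).2
  rw [hasFiniteIntegral_iff_enorm] at h
  refine lt_of_le_of_lt (lintegral_mono fun x => ?_) h
  rw [expDecay, normWeight, ← ENNReal.ofReal_mul (Real.exp_pos _).le, mul_comm]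
  exact Real.ofReal_le_enorm _

end PolynomialWeight

/-! ### Polynomial localization of φ from that of its Wigner distribution -/

section WignerWindow
variable {d : ℕ} {φ : ConfL2 d} {N : ℕ}

theorem integrable_gaussian (V : Type) [NormedAddCommGroup V] [InnerProductSpace ℝ V] [FiniteDimensional ℝ V]
    [MeasurableSpace V] [BorelSpace V] : Integrable (gaussian V) := (gaussian V).integrable

theorem memLp_tauWigner_gaussian (τ : ℝ) : MemLp (tauWigner τ (gaussian (Conf d)) (gaussian (Conf d))) 2 :=
  memLp_tauWigner τ memLp_gaussian (integrable_gaussian _) memLp_gaussian (integrable_gaussian _)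

/-- Change of window. -/
theorem integral_mul_conj_eq_stft {V : Type} [NormedAddCommGroup V] [InnerProductSpace ℝ V] [FiniteDimensional ℝ V]
    [MeasurableSpace V] [BorelSpace V] {f f' : V → ℂ} (hf : MemLp f 2) (hf' : MemLp f' 2) :
    ∫ t, conj (f' t) * f t = ∫ p : V × V, conj (stft (gaussian V) f' p.1 p.2) * stft (gaussian V) f p.1 p.2 := by
  rw [integral_conj_stft_mul_stft memLp_gaussian memLp_gaussian hf hf', integral_gaussian_mul_conj, mul_one]

theorem enorm_integral_conj_tfShift_mul (φ : ConfL2 d) (a : Phase d) :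
    ‖∫ t, conj (tfShift a (gaussian (Conf d)) t) * φ t‖ₑ = gaborNorm φ a := by
  rw [gaborNorm, gabor, stft_shift_window]
  rfl

/-- By Moyal's identity the product is |⟨W_τ(φ,φ), W_τ(π(a)g, π(b)g)⟩|; the orthogonality relations
rewrite this pairing in terms of transforms, and covariance turns the second one into a shift of V_G
W_τ(g,g). -/
theorem gaborNorm_mul_gaborNorm_le (τ : ℝ) (hφ1 : Integrable φ) (a b : Phase d) :
    gaborNorm φ a * gaborNorm φ b ≤ ∫⁻ q : Phase d × Phase d,
      ‖stft (gaussian (Phase d)) (tauWigner τ (gaussian (Conf d)) (gaussian (Conf d)))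
        (q.1 - mapT τ a b) (q.2 - mapJ a b)‖ₑ * ‖stft (gaussian (Phase d)) (tauWigner τ φ φ) q.1 q.2‖ₑ := by
  have hg : ∀ w : Phase d, MemLp (tfShift w (gaussian (Conf d))) 2 := memLp_tfShift memLp_gaussian
  have hg1 : ∀ w : Phase d, Integrable (tfShift w (gaussian (Conf d))) := fun w =>
    integrable_shift (integrable_gaussian _) _ _
  have h1 := integral_conj_tauWigner_mul τ (Lp.memLp φ) hφ1 (Lp.memLp φ) hφ1 (hg a) (hg1 a) (hg b) (hg1 b)
  have h2 : ‖∫ t, tfShift b (gaussian (Conf d)) t * conj (φ t)‖ₑ = gaborNorm φ b := by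
    rw [← enorm_integral_conj_tfShift_mul, ← RCLike.enorm_conj, ← integral_conj]
    simp only [map_mul, Complex.conj_conj]
  have h3 : gaborNorm φ a * gaborNorm φ b = ‖∫ z, conj (tauWigner τ (tfShift a (gaussian (Conf d)))
      (tfShift b (gaussian (Conf d))) z) * tauWigner τ φ φ z‖ₑ := by
    rw [h1, enorm_mul, enorm_integral_conj_tfShift_mul, h2]
  rw [h3, integral_mul_conj_eq_stft (memLp_tauWigner τ (Lp.memLp φ) hφ1 (Lp.memLp φ) hφ1)
    (memLp_tauWigner τ (hg a) (hg1 a) (hg b) (hg1 b))]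
  refine (enorm_integral_le_lintegral_enorm _).trans_eq (lintegral_congr fun q => ?_)
  rw [enorm_mul, RCLike.enorm_conj, enorm_stft_tauWigner_tfShift]

/-- J(a,b) is a - b rotated by an isometry, so decay in the frequency of the Wigner distribution is
decay of a around a point determined by b and that frequency. -/
theorem norm_sub_mapJ (a b q : Phase d) : ‖q - mapJ a b‖ = ‖a - (b + pt (-freq q) (pos q))‖ := by
  rw [← sq_eq_sq₀ (norm_nonneg _) (norm_nonneg _), norm_sq_phase, norm_sq_phase]
  have h1 : pos (q - mapJ a b) = -freq (a - (b + pt (-freq q) (pos q))) := by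
    rw [pos_sub, freq_sub, freq_add, mapJ, pos_pt, freq_pt]; abel
  have h2 : freq (q - mapJ a b) = pos (a - (b + pt (-freq q) (pos q))) := by
    rw [pos_sub, freq_sub, pos_add, mapJ, pos_pt, freq_pt]; abel
  rw [h1, h2, norm_neg, add_comm]

theorem norm_mapJ (a b : Phase d) : ‖mapJ a b‖ = ‖a - b‖ := by
  have h := norm_sub_mapJ a b 0
  have e : pt (-freq (0 : Phase d)) (pos 0) = 0 := by
    refine phase_ext ?_ ?_
    · rw [pos_pt]; ext i; simp [freq, pos]
    · rw [freq_pt]; rfl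
  rwa [zero_sub, norm_neg, e, add_zero] at h

theorem exists_enorm_stft_tauWigner_gaussian_le (d : ℕ) (α : ℝ) : ∃ C : ℝ≥0, ∀ τ : ℝ, 0 ≤ τ → τ ≤ 1 →
    ∀ x ξ : Phase d, ‖stft (gaussian (Phase d)) (tauWigner τ (gaussian (Conf d)) (gaussian (Conf d))) x ξ‖ₑ ≤
      C * expDecay α (x, ξ) := by
  obtain ⟨C, hC0, hC⟩ := exists_norm_stft_tauWigner_gaussian_le d α
  refine ⟨C.toNNReal, fun τ h0 h1 x ξ => ?_⟩
  rw [← ofReal_norm]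
  refine (ENNReal.ofReal_le_ofReal (hC τ h0 h1 (x, ξ))).trans_eq ?_
  rw [ENNReal.ofReal_mul hC0]
  rfl

/-- If the Wigner distribution of `φ` is polynomially localized then so is `φ`. -/
theorem lintegral_gaborNorm_mul_normWeight_lt_top {τ : ℝ} (h0 : 0 ≤ τ) (h1 : τ ≤ 1) (hφ1 : Integrable φ)
    {b : Phase d} (hb : gaborNorm φ b ≠ 0)
    (hW : ∫⁻ q : Phase d × Phase d, ‖stft (gaussian (Phase d)) (tauWigner τ φ φ) q.1 q.2‖ₑ * polyWeight N q < ∞) :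
    ∫⁻ a, gaborNorm φ a * normWeight N a < ∞ := by
  obtain ⟨C, hC⟩ := exists_enorm_stft_tauWigner_gaussian_le d 1
  have hWc : Continuous fun q : Phase d × Phase d => stft (gaussian (Phase d)) (tauWigner τ φ φ) q.1 q.2 :=
    continuous_stft_gaussian (memLp_tauWigner τ (Lp.memLp φ) hφ1 (Lp.memLp φ) hφ1)
  have hWm : Measurable fun q : Phase d × Phase d =>
      ‖stft (gaussian (Phase d)) (tauWigner τ φ φ) q.1 q.2‖ₑ := hWc.measurable.enorm
  set Y : Phase d × Phase d → ℝ≥0∞ := fun q => ‖stft (gaussian (Phase d)) (tauWigner τ φ φ) q.1 q.2‖ₑ with hY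
  set p : Phase d → ℝ≥0∞ := normWeight N with hp
  have hpw : IsWeight p := isWeight_normWeight N
  have hpm := hpw.measurable
  have hE := measurable_expDecay (V := Phase d) 1
  have hΦ := measurable_gaborNorm_Lp φ
  -- For fixed b the kernel concentrates a near this point, whose weight is at most that of b times
  -- that of q. Only the frequency half of the kernel's decay is used.
  set J : Phase d → Phase d := fun q => b + pt (-freq q) (pos q) with hJ
  have hJm : Measurable J := by
    have : Continuous J := continuous_const.add
      (continuous_pt.comp ((continuous_freq.neg).prodMk continuous_pos))
    exact this.measurable
  have hJn : ∀ q, p (J q) ≤ p b * p q := fun q => by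
    refine (hpw.submul _ _).trans_eq ?_
    congr 1
    have hn : ‖pt (-freq q) (pos q)‖ = ‖q‖ := by
      rw [← sq_eq_sq₀ (norm_nonneg _) (norm_nonneg _), norm_sq_phase, norm_sq_phase q, pos_pt, freq_pt, norm_neg,
        add_comm]
    simp only [hp, normWeight, hn]
  set M := ∫⁻ a : Phase d, expDecay 1 a * p a with hM
  have hMfin : M < ∞ := lintegral_expDecay_mul_normWeight_lt_top _ one_pos N
  have key : ∀ a, gaborNorm φ a * gaborNorm φ b ≤ ∫⁻ q, (C * expDecay 1 (a - J q.2)) * Y q := fun a => by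
    refine (gaborNorm_mul_gaborNorm_le τ hφ1 a b).trans (lintegral_mono fun q => ?_)
    refine mul_le_mul_left ((hC τ h0 h1 _ _).trans ?_) _
    refine mul_le_mul_right (ENNReal.ofReal_le_ofReal (Real.exp_le_exp.2 ?_)) _
    have e1 : ‖a - J q.2‖ = ‖q.2 - mapJ a b‖ := (norm_sub_mapJ a b q.2).symm
    have e2 : ‖q.2 - mapJ a b‖ ≤ ‖((q.1 - mapT τ a b, q.2 - mapJ a b) : Phase d × Phase d)‖ :=
      norm_snd_le (q.1 - mapT τ a b, q.2 - mapJ a b)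
    rw [e1]
    linarith
  have hfin : gaborNorm φ b * ∫⁻ a, gaborNorm φ a * p a < ∞ := by
    calc gaborNorm φ b * ∫⁻ a, gaborNorm φ a * p a = ∫⁻ a, (gaborNorm φ a * gaborNorm φ b) * p a := by
          rw [← lintegral_const_mul _ (by fun_prop)]
          refine lintegral_congr fun a => ?_
          ring
      _ ≤ ∫⁻ a, ∫⁻ q, (C * expDecay 1 (a - J q.2)) * Y q * p a := by
          refine lintegral_mono fun a => ?_
          rw [lintegral_mul_const _ (by fun_prop)]
          exact mul_le_mul_left (key a) _
      _ = ∫⁻ q, ∫⁻ a, (C * expDecay 1 (a - J q.2)) * Y q * p a :=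
          lintegral_lintegral_swap (f := fun (a : Phase d) (q : Phase d × Phase d) =>
            (C * expDecay 1 (a - J q.2)) * Y q * p a) (by unfold Function.uncurry; fun_prop)
      _ ≤ ∫⁻ q, (C * p b * M) * (Y q * polyWeight N q) := by
          refine lintegral_mono fun q => ?_
          have hq : p q.2 ≤ polyWeight N q := by
            refine ENNReal.ofReal_le_ofReal (pow_le_pow_left₀ (by positivity) ?_ N)
            linarith [norm_nonneg q.1]
          calc ∫⁻ a, (C * expDecay 1 (a - J q.2)) * Y q * p a
              ≤ ∫⁻ a, (C * Y q * (p b * p q.2)) * (expDecay 1 (a - J q.2) * p (a - J q.2)) := by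
                refine lintegral_mono fun a => ?_
                calc C * expDecay 1 (a - J q.2) * Y q * p a
                    ≤ C * expDecay 1 (a - J q.2) * Y q * ((p b * p q.2) * p (a - J q.2)) := by
                      gcongr
                      exact (hpw.le_mul_sub a (J q.2)).trans (mul_le_mul_left (hJn _) _)
                  _ = _ := by ring
            _ = (C * Y q * (p b * p q.2)) * M := by
                rw [lintegral_const_mul _ (by fun_prop), hM]
                congr 1
                exact lintegral_sub_right_eq_self (fun a => expDecay 1 a * p a) (J q.2)
            _ ≤ (C * Y q * (p b * polyWeight N q)) * M := by gcongr
            _ = _ := by ring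
      _ = (C * p b * M) * ∫⁻ q, Y q * polyWeight N q := by
          have := (isWeight_polyWeight (V := Phase d) N).measurable
          exact lintegral_const_mul _ (by fun_prop)
      _ < ∞ := ENNReal.mul_lt_top (ENNReal.mul_lt_top (ENNReal.mul_lt_top ENNReal.coe_lt_top
          (lt_top_iff_ne_top.2 (hpw.ne_top b))) hMfin) hW
  -- The finite quantity is the integral times |V_gφ(b)|, and this factor is not zero.
  by_contra hcon
  rw [not_lt, top_le_iff] at hcon
  rw [hcon, ENNReal.mul_top hb] at hfin
  exact lt_irrefl _ hfin

theorem exists_gaborNorm_ne_zero (hφ : φ ≠ 0) : ∃ b, gaborNorm φ b ≠ 0 := by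
  by_contra! hcon
  have h := lnorm_gaborNorm φ
  have h2 : lnorm (gaborNorm φ) = 0 := by
    simp only [lnorm, hcon]
    simp
  rw [h2] at h
  exact hφ (enorm_eq_zero.1 h.symm)

end WignerWindow

/-! ### Pairing a distribution with double series of Wigner distributions -/

section DoubleSum
variable {d : ℕ} {φ : ConfL2 d} {A : Type*} [MeasurableSpace A] [Countable A] [MeasurableSingletonClass A]
  {ζ : A → Phase d} {c c' : A → ℂ} {τ : ℝ} {σ : 𝓢'(Phase d, ℂ)}

theorem lintegral_count_prod_count (F : A × A → ℝ≥0∞) :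
    ∫⁻ r, F r ∂((Measure.count : Measure A).prod Measure.count) = ∑' l, ∑' k, F (l, k) := by
  rw [lintegral_prod _ (measurable_of_countable F).aemeasurable, lintegral_count]
  simp only [lintegral_count]

theorem enorm_bracket_tauWigner_const_mul (σ : 𝓢'(Phase d, ℂ)) (τ : ℝ) (a b : ℂ) (f h : Conf d → ℂ) :
    ‖bracket σ (tauWigner τ (fun t => a * f t) (fun t => b * h t))‖ₑ = ‖a‖ₑ * ‖b‖ₑ * ‖bracket σ (tauWigner τ f h)‖ₑ := by
  rw [funext (tauWigner_const_mul τ a b f h), bracket_const_mul, enorm_mul, RCLike.enorm_conj, enorm_mul,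
    RCLike.enorm_conj]

/-- The bracket with the Wigner distribution of two superpositions is dominated by the double series. -/
theorem enorm_bracket_le_tsum {f h : Conf d → ℂ} (hφ1 : Integrable φ)
    (hkf : Integrable (fun p : A × Conf d => c p.1 * tfShift (ζ p.1) φ p.2) (Measure.count.prod volume))
    (hkh : Integrable (fun p : A × Conf d => c' p.1 * tfShift (ζ p.1) φ p.2) (Measure.count.prod volume))
    (hf : f =ᵐ[volume] fun t => ∫ l, c l * tfShift (ζ l) φ t ∂Measure.count)
    (hh : h =ᵐ[volume] fun t => ∫ l, c' l * tfShift (ζ l) φ t ∂Measure.count)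
    (hfin : ∑' l, ∑' k, ‖c l‖ₑ * ‖c' k‖ₑ * ∫⁻ p : Phase d × Phase d, ‖distSTFT σ p.1 p.2‖ₑ *
      ‖stft (gaussian (Phase d)) (tauWigner τ (tfShift (ζ l) φ) (tfShift (ζ k) φ)) p.1 p.2‖ₑ < ∞) :
    ‖bracket σ (tauWigner τ f h)‖ₑ ≤
      ∑' l, ∑' k, ‖c l‖ₑ * ‖c' k‖ₑ * ‖bracket σ (tauWigner τ (tfShift (ζ l) φ) (tfShift (ζ k) φ))‖ₑ := by
  set X : A × A → Phase d × Phase d → ℂ := fun r p => stft (gaussian (Phase d))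
    (tauWigner τ (fun s => c r.1 * tfShift (ζ r.1) φ s) (fun t => c' r.2 * tfShift (ζ r.2) φ t)) p.1 p.2 with hX
  have hXeq : ∀ r p, X r p = (c r.1 * conj (c' r.2)) *
      stft (gaussian (Phase d)) (tauWigner τ (tfShift (ζ r.1) φ) (tfShift (ζ r.2) φ)) p.1 p.2 := fun r p => by
    simp only [hX]
    rw [funext (tauWigner_const_mul τ (c r.1) (c' r.2) (tfShift (ζ r.1) φ) (tfShift (ζ r.2) φ)), stft_const_mul]
  have hsh : ∀ w : Phase d, MemLp (tfShift w φ) 2 := memLp_tfShift (Lp.memLp φ)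
  have hsh1 : ∀ w : Phase d, Integrable (tfShift w φ) := fun w => integrable_shift hφ1 _ _
  have hXc : ∀ r, Continuous (X r) := fun r => by
    have h1 : Continuous fun p : Phase d × Phase d => stft (gaussian (Phase d))
        (tauWigner τ (tfShift (ζ r.1) φ) (tfShift (ζ r.2) φ)) p.1 p.2 :=
      continuous_stft_gaussian (memLp_tauWigner τ (hsh _) (hsh1 _) (hsh _) (hsh1 _))
    have h2 := h1.const_mul (c r.1 * conj (c' r.2))
    rw [funext (hXeq r)]
    exact h2
  set ρ := (Measure.count : Measure A).prod (Measure.count : Measure A)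
  have hstft : ∀ p : Phase d × Phase d, stft (gaussian (Phase d)) (tauWigner τ f h) p.1 p.2 = ∫ r, X r p ∂ρ :=
    fun p => (stft_tauWigner_superposition τ hkf hkh hf hh p).2
  have hmeas : Measurable fun q : (Phase d × Phase d) × (A × A) => distSTFT σ q.1.1 q.1.2 * conj (X q.2 q.1) :=
    measurable_from_prod_countable_left fun r =>
      ((continuous_distSTFT σ).mul (Complex.continuous_conj.comp (hXc r))).measurable
  -- Absolute convergence, which is `hfin` after Tonelli, exchanges the pairing with σ and the
  -- double series.
  have hint : Integrable (fun q : (Phase d × Phase d) × (A × A) => distSTFT σ q.1.1 q.1.2 * conj (X q.2 q.1))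
      (volume.prod ρ) := by
    refine ⟨hmeas.aestronglyMeasurable, ?_⟩
    rw [hasFiniteIntegral_iff_enorm, lintegral_prod_symm _ hmeas.enorm.aemeasurable, lintegral_count_prod_count]
    refine lt_of_eq_of_lt ?_ hfin
    refine tsum_congr fun l => tsum_congr fun k => ?_
    rw [← lintegral_const_mul' _ _ (ENNReal.mul_ne_top enorm_ne_top enorm_ne_top)]
    refine lintegral_congr fun p => ?_
    rw [hXeq, enorm_mul, RCLike.enorm_conj, enorm_mul, enorm_mul, RCLike.enorm_conj]
    ring
  have hb : bracket σ (tauWigner τ f h) = ∫ r, bracket σ (tauWigner τ (fun s => c r.1 * tfShift (ζ r.1) φ s)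
      (fun t => c' r.2 * tfShift (ζ r.2) φ t)) ∂ρ := by
    have hsw := integral_integral_swap (f := fun (p : Phase d × Phase d) (r : A × A) =>
      distSTFT σ p.1 p.2 * conj (X r p)) hint
    calc bracket σ (tauWigner τ f h) = ∫ p : Phase d × Phase d, ∫ r, distSTFT σ p.1 p.2 * conj (X r p) ∂ρ := by
          refine integral_congr_ae (Eventually.of_forall fun p => ?_)
          dsimp only
          rw [hstft, integral_const_mul, integral_conj]
      _ = _ := hsw
  rw [hb]
  refine (enorm_integral_le_lintegral_enorm _).trans_eq ?_
  rw [lintegral_count_prod_count]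
  exact tsum_congr fun l => tsum_congr fun k => enorm_bracket_tauWigner_const_mul _ _ _ _ _ _

/-- Moving W_{1/2}(φ, φ) by (T, J) multiplies its polynomially weighted norm by at most the weight
of (T, J), which grows polynomially in l and k. -/
theorem lintegral_enorm_mul_stft_tfShift_le {N : ℕ} {C : ℝ≥0}
    (hC : ∀ p : Phase d × Phase d, ‖distSTFT σ p.1 p.2‖ₑ ≤ C * polyWeight N p) (l k : Phase d) :
    ∫⁻ p : Phase d × Phase d, ‖distSTFT σ p.1 p.2‖ₑ *
      ‖stft (gaussian (Phase d)) (tauWigner (1 / 2) (tfShift l φ) (tfShift k φ)) p.1 p.2‖ₑ ≤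
    (C * 2 ^ N * ∫⁻ p : Phase d × Phase d,
      ‖stft (gaussian (Phase d)) (tauWigner (1 / 2) φ φ) p.1 p.2‖ₑ * polyWeight N p) *
      (normWeight N l * normWeight N k) := by
  set t : Phase d × Phase d := (mapT (1 / 2) l k, mapJ l k) with ht
  have hT : mapT (1 / 2) l k = (1 / 2 : ℝ) • (l + k) := by
    rw [mapT_eq_add]
    refine phase_ext ?_ ?_
    · simp only [matD, pos_add, pos_smul, pos_pt, smul_add]; norm_num
    · simp only [matD, freq_add, freq_smul, freq_pt, smul_add]; norm_num
  -- 1 + ‖T‖ + ‖J‖ ≤ 1 + (3/2)(‖l‖ + ‖k‖) ≤ 2(1 + ‖l‖)(1 + ‖k‖).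
  have htw : polyWeight N t ≤ 2 ^ N * (normWeight N l * normWeight N k) := by
    have e : (2 : ℝ≥0∞) ^ N = ENNReal.ofReal (2 ^ N) := by
      rw [ENNReal.ofReal_pow (by norm_num), ENNReal.ofReal_ofNat]
    rw [e, normWeight, normWeight, ← ENNReal.ofReal_mul (by positivity), ← ENNReal.ofReal_mul (by positivity),
      ← mul_pow, ← mul_pow]
    refine ENNReal.ofReal_le_ofReal (pow_le_pow_left₀ (by positivity) ?_ N)
    have h1 : ‖mapT (1 / 2) l k‖ ≤ (‖l‖ + ‖k‖) / 2 := by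
      rw [hT, norm_smul, Real.norm_of_nonneg (by norm_num)]
      linarith [norm_add_le l k]
    have h2 : ‖mapJ l k‖ ≤ ‖l‖ + ‖k‖ := by rw [norm_mapJ]; exact norm_sub_le l k
    have h3 := mul_nonneg (norm_nonneg l) (norm_nonneg k)
    have h4 := norm_nonneg l
    have h5 := norm_nonneg k
    simp only [ht]
    nlinarith
  have hpw := isWeight_polyWeight (V := Phase d) N
  set Y : Phase d × Phase d → ℝ≥0∞ := fun p => ‖stft (gaussian (Phase d)) (tauWigner (1 / 2) φ φ) p.1 p.2‖ₑ with hY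
  have hI : ∫⁻ p, Y (p - t) * polyWeight N (p - t) = ∫⁻ p, Y p * polyWeight N p :=
    lintegral_sub_right_eq_self (fun p => Y p * polyWeight N p) t
  have hfin : (C : ℝ≥0∞) * polyWeight N t ≠ ∞ := ENNReal.mul_ne_top ENNReal.coe_ne_top (hpw.ne_top t)
  calc _ ≤ ∫⁻ p, (C * polyWeight N t) * (Y (p - t) * polyWeight N (p - t)) := by
        refine lintegral_mono fun p => ?_
        rw [enorm_stft_tauWigner_tfShift]
        calc ‖distSTFT σ p.1 p.2‖ₑ * Y (p - t) ≤ (C * (polyWeight N t * polyWeight N (p - t))) * Y (p - t) := by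
              gcongr
              exact (hC p).trans (mul_le_mul_right (hpw.le_mul_sub p t) _)
          _ = _ := by ring
    _ = (C * polyWeight N t) * ∫⁻ p, Y p * polyWeight N p := by
        rw [lintegral_const_mul' _ _ hfin, hI]
    _ ≤ (C * (2 ^ N * (normWeight N l * normWeight N k))) * ∫⁻ p, Y p * polyWeight N p := by gcongr
    _ = _ := by ring

end DoubleSum

/-! ### Statement (c) -/

section LatticeEntries
variable {d : ℕ} {v : Phase d → ℝ} {φ : ConfL2 d} {Λ : Submodule ℤ (Phase d)} {σ : 𝓢'(Phase d, ℂ)}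

theorem lintegral_comp_continuousLinearEquiv_lt_top {V : Type*} [NormedAddCommGroup V] [NormedSpace ℝ V]
    [FiniteDimensional ℝ V] [MeasurableSpace V] [BorelSpace V] {μ : Measure V} [μ.IsAddHaarMeasure]
    (L : V ≃L[ℝ] V) {F : V → ℝ≥0∞} (hF : ∫⁻ x, F x ∂μ < ∞) : ∫⁻ x, F (L x) ∂μ < ∞ := by
  have hdet : LinearMap.det (L.toLinearEquiv : V →ₗ[ℝ] V) ≠ 0 := L.toLinearEquiv.isUnit_det'.ne_zero
  have h := Measure.map_linearMap_addHaar_eq_smul_addHaar μ hdet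
  have h2 := L.toHomeomorph.measurableEmbedding.lintegral_map (μ := μ) F
  have h3 : Measure.map L.toHomeomorph μ = ENNReal.ofReal |(LinearMap.det (L.toLinearEquiv : V →ₗ[ℝ] V))⁻¹| • μ := h
  rw [h3, lintegral_smul_measure] at h2
  exact lt_of_eq_of_lt h2.symm (ENNReal.mul_lt_top ENNReal.ofReal_lt_top hF)

theorem matU_half (z : Phase d) : matU (1 / 2) z = -z := by
  rw [matU]
  norm_num [pt_pos_freq]

theorem sumWeight_eq (hv : IsAdmissible v) (N : ℕ) (z : Phase d) :
    sumWeight v N z = ENNReal.ofReal (v z) + normWeight N z :=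
  ENNReal.ofReal_add (hv.nonneg z) (by positivity)

theorem normWeight_le_sumWeight (hv : IsAdmissible v) (N : ℕ) (z : Phase d) : normWeight N z ≤ sumWeight v N z := by
  rw [sumWeight_eq hv]
  exact le_add_self

theorem lintegral_gaborNorm_gaussian_mul_lt_top (hv : IsAdmissible v) :
    ∫⁻ z, gaborNorm (gaussian (Conf d)) z * ENNReal.ofReal (v z) < ∞ := by
  obtain ⟨C, hC⟩ := exists_gaborNorm_gaussian_le d 1
  have hm := hv.isSubexpWeight_sumWeight 0
  have hE := measurable_expDecay (V := Phase d) 1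
  have hmm := hm.measurable
  calc _ ≤ ∫⁻ z : Phase d, C * (expDecay 1 z * sumWeight v 0 z) := by
        refine lintegral_mono fun z => ?_
        rw [← mul_assoc]
        exact mul_le_mul' (hC z) (ofReal_le_sumWeight 0 z)
    _ = C * ∫⁻ z : Phase d, expDecay 1 z * sumWeight v 0 z := lintegral_const_mul _ (by fun_prop)
    _ < ∞ := ENNReal.mul_lt_top ENNReal.coe_lt_top (hm.lintegral_expDecay_mul_lt_top one_pos)

theorem opEntryDefined_gaussian {τ : ℝ} (h0 : 0 ≤ τ) (h1 : τ ≤ 1) {N : ℕ} (hσ : MemModInfty N σ) :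
    OpEntryDefined τ σ (gaussian (Conf d)) (gaussian (Conf d)) := by
  refine ⟨N, hσ, memLp_tauWigner_gaussian τ, ?_⟩
  obtain ⟨α, hα0, hα⟩ := (isWeight_polyWeight (V := Phase d) N).exists_lintegral_expDecay_lt_top
    (μ := (volume : Measure (Phase d × Phase d)))
  obtain ⟨C, hC⟩ := exists_enorm_stft_tauWigner_gaussian_le d α
  have hE := measurable_expDecay (V := Phase d × Phase d) α
  have hp := (isWeight_polyWeight (V := Phase d) N).measurable
  calc _ ≤ ∫⁻ p : Phase d × Phase d, C * (expDecay α p * polyWeight N p) := by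
        refine lintegral_mono fun p => ?_
        rw [← mul_assoc]
        exact mul_le_mul_left (hC τ h0 h1 p.1 p.2) _
    _ = C * ∫⁻ p : Phase d × Phase d, expDecay α p * polyWeight N p := lintegral_const_mul _ (by fun_prop)
    _ < ∞ := ENNReal.mul_lt_top ENNReal.coe_lt_top (hα α le_rfl)

theorem tsum_lattice_mul_normWeight_lt_top [DiscreteTopology Λ] [IsZLattice ℝ Λ] {K : Phase d → ℝ≥0∞} {N : ℕ}
    (hK : Measurable K) (hKmod : Moderate 1 K) (hKp : ∫⁻ x, K x * normWeight N x < ∞) (w : Phase d) :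
    ∑' l : Λ, K (l - w) * normWeight N (l : Phase d) < ∞ := by
  obtain ⟨C, hC⟩ := exists_tsum_lattice_le (volume : Measure (Phase d)) Λ (1 + N)
  have hp := isWeight_normWeight (V := Phase d) N
  have hpm := hp.measurable
  calc _ ≤ C * ∫⁻ x, K (x - w) * normWeight N x :=
        hC _ ((hKmod.comp_sub_const w).mul (moderate_normWeight N))
    _ ≤ C * ∫⁻ x, normWeight N w * (K (x - w) * normWeight N (x - w)) := by
        refine mul_le_mul_right (lintegral_mono fun x => ?_) _
        calc K (x - w) * normWeight N x ≤ K (x - w) * (normWeight N w * normWeight N (x - w)) :=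
              mul_le_mul_right (hp.le_mul_sub x w) _
          _ = _ := by ring
    _ = C * (normWeight N w * ∫⁻ x, K x * normWeight N x) := by
        rw [lintegral_const_mul _ (by fun_prop), lintegral_sub_right_eq_self (fun x => K x * normWeight N x) w]
    _ < ∞ := ENNReal.mul_lt_top ENNReal.coe_lt_top
        (ENNReal.mul_lt_top (lt_top_iff_ne_top.2 (hp.ne_top w)) hKp)

/-- A double lattice sum against a function of `l + k` is a single sum of correlations. -/
theorem exists_tsum_tsum_lattice_le [DiscreteTopology Λ] [IsZLattice ℝ Λ] :
    ∃ C : ℝ≥0, ∀ K : Phase d → ℝ≥0∞, Moderate 1 K → ∀ (h : Λ → ℝ≥0∞) (w z : Phase d),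
      ∑' l : Λ, ∑' k : Λ, K (l - w) * K (k - z) * h (l + k) ≤
        ∑' n : Λ, C * h n * ∫⁻ s, K s * K (n - (w + z) - s) := by
  obtain ⟨C, hC⟩ := exists_tsum_lattice_le (volume : Measure (Phase d)) Λ (1 + 1)
  refine ⟨C, fun K hK h w z => ?_⟩
  rw [ENNReal.tsum_comm]
  -- Substituting l = n - k at fixed k isolates the factor h(n). What remains is a lattice sum in k
  -- of a product of two moderate functions, comparable to an integral.
  have e : ∀ k : Λ, ∑' l : Λ, K (l - w) * K (k - z) * h (l + k) =
      ∑' n : Λ, K (n - k - w) * K (k - z) * h n := fun k => by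
    rw [← (Equiv.subRight k).tsum_eq]
    refine tsum_congr fun n => ?_
    simp only [Equiv.subRight_apply, sub_add_cancel, AddSubgroupClass.coe_sub]
  simp only [e]
  rw [ENNReal.tsum_comm]
  refine ENNReal.tsum_le_tsum fun n => ?_
  rw [ENNReal.tsum_mul_right, mul_comm, mul_comm (C : ℝ≥0∞), mul_assoc]
  gcongr
  have hmod : Moderate (1 + 1) fun t : Phase d => K (n - w - t) * K (t - z) :=
    (hK.comp_const_sub _).mul (hK.comp_sub_const z)
  calc ∑' k : Λ, K (n - k - w) * K (k - z) = ∑' k : Λ, K (n - w - k) * K (k - z) := by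
        refine tsum_congr fun k => ?_
        rw [sub_right_comm]
    _ ≤ C * ∫⁻ t, K (n - w - t) * K (t - z) := hC _ hmod
    _ = C * ∫⁻ s, K s * K (n - (w + z) - s) := by
        rw [← lintegral_add_right_eq_self (fun t => K (n - w - t) * K (t - z)) z]
        congr 2
        funext s
        rw [add_sub_cancel_right, mul_comm, show (n : Phase d) - w - (s + z) = n - (w + z) - s by abel]

/-- Lattice entries of φ control the Gaussian entries at all points of phase space: both Gaussians
are expanded in the frame, and the double sum collapses because the bound depends on l + k, again a
lattice point. The continuous converse is then applied to the Gaussian. -/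
theorem memAmalgam_of_latticeEntries [DiscreteTopology Λ] [IsZLattice ℝ Λ] (hv : IsAdmissible v)
    (hφ : MemM1 v φ) (hφ0 : φ ≠ 0) (hΛ : IsGaborFrame φ Λ) {h : Λ → ℝ} (hs : Summable fun l : Λ => h l * v l)
    (hb : ∀ l k : Λ, GaborEntryLE (1 / 2) σ φ k l (h (l + k))) :
    MemAmalgam (fun z => v (matB (1 / 2) z)) σ := by
  rw [memM1_iff] at hφ
  have h12 : (0 : ℝ) ≤ 1 / 2 := by norm_num
  have h12' : (1 / 2 : ℝ) ≤ 1 := by norm_num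
  have hφ1 : Integrable φ :=
    integrable_of_lintegral_gabor hφ.1 ((hv.isWeight.lintegral_le _).trans_lt hφ.2)
  -- The entry at l = k = 0 fixes a growth exponent N for σ and puts W_{1/2}(φ, φ) in the matching
  -- M¹; polynomial localization of φ itself follows.
  obtain ⟨N, hσN, hW⟩ : OpEntryDefined (1 / 2) σ φ φ := by
    have := (hb 0 0).1
    rwa [ZeroMemClass.coe_zero, tfShift_zero] at this
  obtain ⟨C, hC⟩ := hσN.enorm_le
  obtain ⟨b, hbne⟩ := exists_gaborNorm_ne_zero hφ0
  have hφN : ∫⁻ a, gaborNorm φ a * normWeight N a < ∞ :=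
    lintegral_gaborNorm_mul_normWeight_lt_top h12 h12' hφ1 hbne hW.2
  have hm := hv.isSubexpWeight_sumWeight N
  have hΦ := measurable_gaborNorm_Lp φ
  have hvm : Measurable fun z => ENNReal.ofReal (v z) := hv.isWeight.measurable
  have hφm : ∫⁻ z, gaborNorm φ z * sumWeight v N z < ∞ := by
    simp only [sumWeight_eq hv, mul_add]
    rw [lintegral_add_left (by fun_prop)]
    exact ENNReal.add_lt_top.2 ⟨hφ.2, hφN⟩
  obtain ⟨K, hK, hKmod, hKm, hexp⟩ := hΛ.exists_expansion hm hφm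
  have hKN : ∫⁻ x, K x * normWeight N x < ∞ :=
    (lintegral_mono fun x => mul_le_mul_right (normWeight_le_sumWeight hv N x) _).trans_lt hKm
  have hKv : ∫⁻ x, K x * ENNReal.ofReal (v x) < ∞ :=
    (lintegral_mono fun x => mul_le_mul_right (ofReal_le_sumWeight N x) _).trans_lt hKm
  obtain ⟨C', hC'⟩ := exists_tsum_tsum_lattice_le (Λ := Λ)
  set η : Λ → ℝ≥0∞ := fun n => ENNReal.ofReal (h n)
  set Q : Phase d → ℝ≥0∞ := fun x => ∫⁻ s, K s * K (x - s)
  have hQ : Measurable Q :=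
    Measurable.lintegral_prod_right' (f := fun p : Phase d × Phase d => K p.2 * K (p.1 - p.2)) (by fun_prop)
  -- A correlation of the lattice sequence with Q = K * K, so that its L¹_v norm is controlled by
  -- those of the sequence and of K.
  set H : Phase d → ℝ≥0∞ := fun u => ∑' n : Λ, C' * η n * Q (n - u) with hH
  have hHm : Measurable H := Measurable.tsum fun n => by fun_prop
  have hQv : ∫⁻ x, Q x * ENNReal.ofReal (v x) < ∞ :=
    (hv.isWeight.lintegral_conv_mul_le hK hK).trans_lt (ENNReal.mul_lt_top hKv hKv)
  have hHv : ∫⁻ u, H u * ENNReal.ofReal (v u) < ∞ := by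
    calc ∫⁻ u, H u * ENNReal.ofReal (v u) = ∑' n : Λ, ∫⁻ u, C' * η n * Q (n - u) * ENNReal.ofReal (v u) := by
          rw [← lintegral_tsum fun n => by fun_prop]
          simp only [hH, ENNReal.tsum_mul_right]
      _ ≤ ∑' n : Λ, (C' * (∫⁻ x, Q x * ENNReal.ofReal (v x))) * ENNReal.ofReal (h n * v n) := by
          refine ENNReal.tsum_le_tsum fun n => ?_
          calc _ ≤ ∫⁻ u, (C' * ENNReal.ofReal (h n * v n)) * (Q (n - u) * ENNReal.ofReal (v (n - u))) := by
                refine lintegral_mono fun u => ?_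
                calc C' * η n * Q (n - u) * ENNReal.ofReal (v u)
                    ≤ C' * η n * Q (n - u) * (ENNReal.ofReal (v n) * ENNReal.ofReal (v (n - u))) := by
                      gcongr
                      exact hv.isWeight.le_mul_sub' u n
                  _ = _ := by rw [ENNReal.ofReal_mul' (hv.nonneg _)]; ring
            _ = (C' * ENNReal.ofReal (h n * v n)) * ∫⁻ x, Q x * ENNReal.ofReal (v x) := by
                rw [lintegral_const_mul' _ _ (ENNReal.mul_ne_top ENNReal.coe_ne_top ENNReal.ofReal_ne_top),
                  lintegral_sub_left_eq_self (fun x => Q x * ENNReal.ofReal (v x)) (n : Phase d)]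
            _ = _ := by ring
      _ = (C' * (∫⁻ x, Q x * ENNReal.ofReal (v x))) * ∑' n : Λ, ENNReal.ofReal (h n * v n) := ENNReal.tsum_mul_left
      _ < ∞ := ENNReal.mul_lt_top (ENNReal.mul_lt_top ENNReal.coe_lt_top hQv) hs.tsum_ofReal_lt_top
  have hentry : ∀ w z, ‖opEntry (1 / 2) σ (tfShift z (gaussian (Conf d))) (tfShift w (gaussian (Conf d)))‖ₑ ≤
      H (w + z) := by
    intro w z
    obtain ⟨c, hc, hci, hce⟩ := hexp w
    obtain ⟨c', hc', hci', hce'⟩ := hexp z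
    set D : ℝ≥0∞ := C * 2 ^ N * ∫⁻ p : Phase d × Phase d,
      ‖stft (gaussian (Phase d)) (tauWigner (1 / 2) φ φ) p.1 p.2‖ₑ * polyWeight N p
    have hD : D < ∞ := ENNReal.mul_lt_top (ENNReal.mul_lt_top ENNReal.coe_lt_top
      (ENNReal.pow_lt_top ENNReal.ofNat_lt_top)) hW.2
    -- The exchange of σ with the series rests only on polynomial growth of V_Gσ against the
    -- polynomial decay in K; the assumed bounds on the entries are used afterwards.
    refine (enorm_bracket_le_tsum (ζ := fun l : Λ => (l : Phase d)) hφ1 hci hci' hce hce' ?_).trans ?_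
    · calc _ ≤ ∑' l : Λ, ∑' k : Λ, D * ((K (l - w) * normWeight N (l : Phase d)) *
            (K (k - z) * normWeight N (k : Phase d))) := by
            refine ENNReal.tsum_le_tsum fun l => ENNReal.tsum_le_tsum fun k => ?_
            calc _ ≤ K (l - w) * K (k - z) * (D * (normWeight N (l : Phase d) * normWeight N (k : Phase d))) :=
                  mul_le_mul' (mul_le_mul' (hc l) (hc' k)) (lintegral_enorm_mul_stft_tfShift_le hC _ _)
              _ = _ := by ring
        _ = D * ((∑' l : Λ, K (l - w) * normWeight N (l : Phase d)) *
              ∑' k : Λ, K (k - z) * normWeight N (k : Phase d)) := by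
            simp only [ENNReal.tsum_mul_left, ENNReal.tsum_mul_right]
        _ < ∞ := ENNReal.mul_lt_top hD (ENNReal.mul_lt_top
            (tsum_lattice_mul_normWeight_lt_top hK hKmod hKN w) (tsum_lattice_mul_normWeight_lt_top hK hKmod hKN z))
    · refine le_trans (ENNReal.tsum_le_tsum fun l => ENNReal.tsum_le_tsum fun k => ?_) (hC' K hKmod η w z)
      refine mul_le_mul' (mul_le_mul' (hc l) (hc' k)) ?_
      rw [← ofReal_norm]
      exact ENNReal.ofReal_le_ofReal (hb l k).2
  have hne : (1 / 2 : ℝ) ≠ 0 := by norm_num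
  have hne' : 1 - (1 / 2 : ℝ) ≠ 0 := by norm_num
  have hcomp : ∀ z : Phase d, v (matB (1 / 2) (matD (1 / 2) z)) = v z := fun z => by rw [matB_matD hne hne']
  have hcomp' : ∀ z : Phase d, v (matB (1 / 2) (matD (1 - 1 / 2) z)) = v z := fun z => by
    rw [matB_matD_one_sub, matU_half, neg_neg]
  have hg0 : ¬ (gaussian (Conf d) : Conf d → ℂ) =ᵐ[volume] 0 := fun hcon => by
    have h1 := integral_gaussian_mul_conj (V := Conf d)
    rw [integral_congr_ae (g := fun _ => 0) (by filter_upwards [hcon] with t ht; rw [ht]; simp),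
      integral_zero] at h1
    exact zero_ne_one h1
  have hg := lintegral_gaborNorm_gaussian_mul_lt_top hv
  -- B_{1/2} T_{1/2}(w,z) = w + z, so H∘B_{1/2} is the required function of T_{1/2}(w,z).
  refine lintegral_ampl_lt_top_of_opEntry_le (H := fun u => H (matB (1 / 2) u))
    (hv.isWeight_comp_matB hne hne') h12 h12' memLp_gaussian hg0 (by simpa only [hcomp] using hg)
    (by simpa only [hcomp'] using hg) (hHm.comp (matBE d hne hne').continuous.measurable).aemeasurable
    (lintegral_comp_continuousLinearEquiv_lt_top (matBE d hne hne') hHv)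
    (opEntryDefined_gaussian h12 h12' hσN) fun w z => ?_
  rw [matB_mapT hne hne', matU_half, sub_neg_eq_add]
  exact hentry w z

/-- T_{1/2}(l,k) = D_{1/2}(l + k), so the continuous majorant composed with D_{1/2} is sampled on
the lattice; being moderate, it has lattice sums bounded by integrals. -/
theorem exists_latticeEntries_of_memAmalgam [DiscreteTopology Λ] [IsZLattice ℝ Λ] (hv : IsAdmissible v)
    (hφ : MemM1 v φ) (hσ : MemAmalgam (fun z => v (matB (1 / 2) z)) σ) :
    ∃ h : Λ → ℝ, (Summable fun l : Λ => h l * v l) ∧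
      ∀ l k : Λ, GaborEntryLE (1 / 2) σ φ k l (h (l + k)) := by
  rw [memM1_iff] at hφ
  have hne : (1 / 2 : ℝ) ≠ 0 := by norm_num
  have hne' : 1 - (1 / 2 : ℝ) ≠ 0 := by norm_num
  have hcomp : ∀ z : Phase d, v (matB (1 / 2) (matD (1 / 2) z)) = v z := fun z => by rw [matB_matD hne hne']
  have hcomp' : ∀ z : Phase d, v (matB (1 / 2) (matD (1 - 1 / 2) z)) = v z := fun z => by
    rw [matB_matD_one_sub, matU_half, neg_neg]
  have hmB := hv.isWeight_comp_matB (d := d) hne hne'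
  obtain ⟨α, H, hα, hH, hHm, hreg, hb⟩ := exists_majorant_of_lintegral_ampl hmB (τ := 1 / 2) (by norm_num)
    (by norm_num) hφ.1 (by simpa only [hcomp, gaborNorm] using hφ.2) (by simpa only [hcomp', gaborNorm] using hφ.2) hσ
  have hfin := lt_top_of_moderate hmB hH hHm hreg
  have hm := hv.isSubexpWeight_sumWeight 0
  obtain ⟨C, hC⟩ := hm.envelope_le one_pos
  -- Submultiplicativity makes a weight moderate only up to a multiplicative constant in general,
  -- whereas the envelope satisfies the bound with constant one.
  have henv : Moderate 1 (weightEnvelope 1 (sumWeight v 0)) := fun x q => by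
    have h1 := hm.toIsWeight.envelope_le_mul zero_le_one (x + q) (-q)
    rw [add_neg_cancel_right, norm_neg] at h1
    exact h1.trans (mul_le_mul_left (min_le_left _ _) _)
  have hHmod : Moderate α fun x => H (matD (1 / 2) x) := fun x q => by
    dsimp only
    rw [← matDL_apply, map_add, matDL_apply, matDL_apply]
    refine (hreg _ _).trans (mul_le_mul_left (ENNReal.ofReal_le_ofReal (Real.exp_le_exp.2 ?_)) _)
    refine mul_le_mul_of_nonneg_left ?_ hα
    have e : matD (1 / 2) q = (1 / 2 : ℝ) • q := by
      rw [matD, ← pt_pos_freq ((1 / 2 : ℝ) • q), pos_smul, freq_smul]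
      norm_num
    rw [e, norm_smul, Real.norm_of_nonneg (by norm_num)]
    linarith [norm_nonneg q]
  obtain ⟨C', hC'⟩ := exists_tsum_lattice_le (volume : Measure (Phase d)) Λ (α + 1)
  have hHD : ∫⁻ x, H (matD (1 / 2) x) * ENNReal.ofReal (v x) < ∞ := by
    have h1 := lintegral_comp_continuousLinearEquiv_lt_top (matBE d hne hne').symm hHm
    refine lt_of_eq_of_lt (lintegral_congr fun x => ?_) h1
    have e : (matBE d hne hne').symm x = matD (1 / 2) x := rfl
    rw [e, hcomp]
  -- With exponent 0 the added polynomial is the constant 1 ≤ v, so no weight beyond v is required.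
  have hvle : ∀ x : Phase d, sumWeight v 0 x ≤ 2 * ENNReal.ofReal (v x) := fun x => by
    rw [sumWeight_eq hv, two_mul, normWeight, pow_zero, ENNReal.ofReal_one]
    gcongr
    exact hv.isWeight.one_le x
  have hsum : ∑' l : Λ, ENNReal.ofReal ((H (matD (1 / 2) (l : Phase d))).toReal * v l) < ∞ := by
    calc _ ≤ ∑' l : Λ, H (matD (1 / 2) (l : Phase d)) * weightEnvelope 1 (sumWeight v 0) (l : Phase d) := by
          refine ENNReal.tsum_le_tsum fun l => ?_
          rw [ENNReal.ofReal_mul ENNReal.toReal_nonneg, ENNReal.ofReal_toReal (hfin _).ne]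
          gcongr
          exact (ofReal_le_sumWeight 0 _).trans (le_weightEnvelope 1 _ _)
      _ ≤ C' * ∫⁻ x, H (matD (1 / 2) x) * weightEnvelope 1 (sumWeight v 0) x := hC' _ (hHmod.mul henv)
      _ ≤ C' * ∫⁻ x, (C * 2) * (H (matD (1 / 2) x) * ENNReal.ofReal (v x)) := by
          refine mul_le_mul_right (lintegral_mono fun x => ?_) _
          calc H (matD (1 / 2) x) * weightEnvelope 1 (sumWeight v 0) x
              ≤ H (matD (1 / 2) x) * (C * (2 * ENNReal.ofReal (v x))) :=
                mul_le_mul_right ((hC x).trans (mul_le_mul_right (hvle x) _)) _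
            _ = _ := by ring
      _ = C' * ((C * 2) * ∫⁻ x, H (matD (1 / 2) x) * ENNReal.ofReal (v x)) := by
          rw [lintegral_const_mul' _ _ (ENNReal.mul_ne_top ENNReal.coe_ne_top ENNReal.ofNat_ne_top)]
      _ < ∞ := ENNReal.mul_lt_top ENNReal.coe_lt_top
          (ENNReal.mul_lt_top (ENNReal.mul_lt_top ENNReal.coe_lt_top ENNReal.ofNat_lt_top) hHD)
  refine ⟨fun l => (H (matD (1 / 2) (l : Phase d))).toReal, ?_, fun l k => ⟨(hb l k).1, ?_⟩⟩
  · have h1 := ENNReal.summable_toReal hsum.ne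
    refine h1.congr fun l => ?_
    rw [ENNReal.toReal_ofReal (mul_nonneg ENNReal.toReal_nonneg (hv.nonneg _))]
  · have e : mapT (1 / 2) (l : Phase d) k = matD (1 / 2) ((l + k : Λ) : Phase d) := by
      rw [mapT_eq_add, show (1 - 1 / 2 : ℝ) = 1 / 2 by norm_num, ← matDL_apply, ← matDL_apply, ← map_add,
        matDL_apply]
      rfl
    dsimp only
    rw [← toReal_enorm, ← e]
    exact ENNReal.toReal_mono (hfin _).ne (hb l k).2

end LatticeEntries

end TauPDO

end

/-! ### Assembly of the three equivalences -/

theorem mainTheorem2 (d : ℕ) (v : TauPDO.Phase d → ℝ) (hv : TauPDO.IsAdmissible v)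
    (φ : Lp ℂ 2 (volume : Measure (TauPDO.Conf d))) (hφ : TauPDO.MemM1 v φ) (hφ0 : φ ≠ 0)
    (σ : 𝓢'(TauPDO.Phase d, ℂ)) :
    (∀ τ : ℝ, 0 < τ → τ < 1 → TauPDO.MemM1 (fun z => v (TauPDO.matU τ z)) φ →
      (TauPDO.MemAmalgam (fun z => v (TauPDO.matB τ z)) σ ↔
        ∃ H : TauPDO.Phase d → ℝ, TauPDO.MemL1 v H ∧
          ∀ w z : TauPDO.Phase d,
            TauPDO.GaborEntryLE τ σ φ z w (H (w - TauPDO.matU τ z)))) ∧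
    (∀ τ : ℝ, 0 ≤ τ → τ ≤ 1 → TauPDO.MemM1 (fun z => v (TauPDO.matD τ z)) φ →
      TauPDO.MemM1 (fun z => v (TauPDO.matD (1 - τ) z)) φ →
      (TauPDO.MemAmalgam v σ ↔
        ∃ H : TauPDO.Phase d → ℝ, TauPDO.MemL1 v H ∧
          ∀ w z : TauPDO.Phase d,
            TauPDO.GaborEntryLE τ σ φ z w (H (TauPDO.mapT τ w z)))) ∧
    (∀ (Λ : Submodule ℤ (TauPDO.Phase d)) [DiscreteTopology Λ] [IsZLattice ℝ Λ],
      TauPDO.IsGaborFrame φ Λ →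
      (TauPDO.MemAmalgam (fun z => v (TauPDO.matB (1 / 2) z)) σ ↔
        ∃ h : Λ → ℝ, (Summable fun l : Λ => h l * v l) ∧
          ∀ l m : Λ, TauPDO.GaborEntryLE (1 / 2) σ φ m l (h (l + m)))) := by
  have hφ0' : ¬ (φ : TauPDO.Conf d → ℂ) =ᵐ[volume] 0 := fun h => hφ0 ((Lp.eq_zero_iff_ae_eq_zero).2 h)
  refine ⟨fun τ h0 h1 hφ2 => TauPDO.memAmalgam_comp_matB_iff hv h0 h1 hφ0' hφ hφ2,
    fun τ h0 h1 hφ1 hφ2 => TauPDO.memAmalgam_iff_exists_gaborEntryLE hv.isWeight hv.continuous.measurable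
      h0 h1 hφ0' hφ1 hφ2, fun Λ _ _ hΛ => ⟨TauPDO.exists_latticeEntries_of_memAmalgam hv hφ, ?_⟩⟩
  rintro ⟨h, hs, hb⟩
  exact TauPDO.memAmalgam_of_latticeEntries hv hφ hφ0 hΛ hs hb
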